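/- **Lemma 2.** Let $0\le\alpha<\tfrac12$, $\beta\ge 1$, $r=\alpha+\beta-1>0$ and $k\ge\alpha+\beta$. Write $\Lambda=(-\Delta)^{1/2}$, i.e. $\widehat{\Lambda^s f}(\xi)=|\xi|^s\hat f(\xi)$, and put $\nu=1$ if $\alpha>0$ and $\nu=0$ if $\alpha=0$. Let $u_0,b_0\in H^k(\mathbb R^2;\mathbb R^2)$ with $\nabla\cdot u_0=\nabla\cdot b_0=0$. For $S>0$, a solution on $[0,S]$ means a pair of real vector fields $u\in C([0,S];H^k)\cap L^2(0,S;H^{k+\alpha})$, $b\in C([0,S];H^k)\cap L^2(0,S;H^{k+\beta})$ which, together with some pressure $p$, satisfies in the sense of distributions $$\begin{cases}u_t+u\cdot\nabla u=-\nabla p+b\cdot\nabla b-\nu\Lambda^{2\alpha}u,\\ b_t+u\cdot\nabla b=b\cdot\nabla u-\Lambda^{2\beta}b,\\ \nabla\cdot u=\nabla\cdot b=0,\\ u(\cdot,0)=u_0,\quad b(\cdot,0)=b_0\end{cases}$$ on $\mathbb R^2\times[0,S]$. Then for every $T>0$ there is a constant $C=C(u_0,b_0,T)$ (which may also depend on $\alpha,\beta,k$,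 but not on $S$ or on the solution) such that for every $0<S\le T$ and every solution $(u,b)$ on $[0,S]$ the current $j=\nabla^\perp\cdot b=-\partial_2b_1+\partial_1b_2$ satisfies, for all $t\in[0,S]$, $$\|\Lambda^r j(t)\|_{L^2}^2+\int_0^t\|\Lambda^{\beta+r}j(\tau)\|_{L^2}^2\,d\tau\le C(u_0,b_0,T).$$ In particular, $j(t)\in L^2$ and $\Lambda^rj(t)\in L^2$ for all $t\in[0,S]$, and $\Lambda^{\beta+r}j\in L^2$ for almost every time. -/

import Mathlib

open MeasureTheory FourierTransform TemperedDistribution LineDeriv Set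
open scoped SchwartzMap ENNReal

namespace GMHD

noncomputable section

/-- The plane `ℝ²` with its Euclidean norm and Lebesgue measure. -/
abbrev Plane := EuclideanSpace ℝ (Fin 2)

/-- Real-valued square integrable functions on the plane. -/
abbrev L2R := Lp ℝ 2 (volume : Measure Plane)

/-- Complex-valued square integrable functions on the plane. -/
abbrev L2C := Lp ℂ 2 (volume : Measure Plane)

/-- A square integrable real planar vector field, given by its two components. -/
abbrev VectorField := Fin 2 → L2R

/-- A real function in `L²` regarded as a complex-valued one. -/
def cplx (f : L2R) : L2C := Complex.ofRealCLM.compLp f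

/-- The tempered distribution given by a real function in `L²`. -/
def dist (f : L2R) : 𝓢'(Plane, ℂ) := (cplx f : 𝓢'(Plane, ℂ))

/-- The tempered distribution given by the pointwise product (a function in `L¹`) of two real
functions in `L²`. -/
def prodDist (f g : L2R) : 𝓢'(Plane, ℂ) :=
  ((Complex.ofRealCLM.compLp (f • g : Lp ℝ 1 (volume : Measure Plane)) :
    Lp ℂ 1 (volume : Measure Plane)) : 𝓢'(Plane, ℂ))

/-- The distributional partial derivative in the `i`-th coordinate direction. -/
def partialD (i : Fin 2) (f : 𝓢'(Plane, ℂ)) : 𝓢'(Plane, ℂ) :=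
  ∂_{(EuclideanSpace.single i (1 : ℝ) : Plane)} f

/-- The distributional divergence `∂₁ v₁ + ∂₂ v₂`. -/
def divergence (v : VectorField) : 𝓢'(Plane, ℂ) := ∑ i, partialD i (dist (v i))

/-- The scalar curl `∇^⊥ · v = -∂₂ v₁ + ∂₁ v₂` (components and directions are indexed by `0, 1`). -/
def curl (v : VectorField) : 𝓢'(Plane, ℂ) :=
  - partialD 1 (dist (v 0)) + partialD 0 (dist (v 1))

/-- The `i`-th component of `v · ∇ w`, written as `∑ⱼ ∂ⱼ (vⱼ wᵢ)`; the two agree for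
divergence free `v`. -/
def advect (v w : VectorField) (i : Fin 2) : 𝓢'(Plane, ℂ) :=
  ∑ j, partialD j (prodDist (v j) (w i))

/-- The function `|ξ|^s f̂(ξ)`. Mathlib's Fourier transform has the kernel `exp (-2πi x·ξ)`, so the
symbol of `(-Δ)^{1/2}` is `2π‖ξ‖` in its frequency variable. -/
def lambdaSymbol (s : ℝ) (f : L2C) (ξ : Plane) : ℂ :=
  (((2 * Real.pi * ‖ξ‖) ^ s : ℝ) : ℂ) * (𝓕 f : L2C) ξ

/-- `Λ^s f` lies in `L²`. -/
def LambdaMem (s : ℝ) (f : L2C) : Prop := MemLp (lambdaSymbol s f) 2 (volume : Measure Plane)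

open Classical in
/-- `Λ^s f`, where `Λ = (-Δ)^{1/2}`, for the `f` in `L²` with `Λ^s f` in `L²`
(and `0` for all other `f`). -/
def Lambda (s : ℝ) (f : L2C) : L2C :=
  if h : LambdaMem s f then 𝓕⁻ (h.toLp (lambdaSymbol s f) : L2C) else 0

/-- `f ∈ C([0, S]; H^s)`. -/
def ContSobolev (s S : ℝ) (f : ℝ → L2R) : Prop :=
  ∃ F : ℝ → L2C, ContinuousOn F (Icc 0 S) ∧
    ∀ t ∈ Icc 0 S, besselPotential Plane ℂ s (dist (f t)) = (F t : 𝓢'(Plane, ℂ))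

/-- `f ∈ L²(0, S; H^s)`. -/
def SqIntSobolev (s S : ℝ) (f : ℝ → L2R) : Prop :=
  ∃ F : ℝ → L2C, MemLp F 2 (volume.restrict (Icc 0 S)) ∧
    ∀ᵐ t ∂(volume.restrict (Icc 0 S)),
      besselPotential Plane ℂ s (dist (f t)) = (F t : 𝓢'(Plane, ℂ))

/-- `∂ₜ f = G` on `[0, S]` in the sense of tempered distributions in space, integrated in time. -/
def HasTimeDeriv (S : ℝ) (f G : ℝ → 𝓢'(Plane, ℂ)) : Prop :=
  ∀ φ : 𝓢(Plane, ℂ), IntervalIntegrable (fun τ ↦ G τ φ) volume 0 S ∧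
    ∀ t ∈ Icc 0 S, f t φ = f 0 φ + ∫ τ in (0 : ℝ)..t, G τ φ

/-- The viscosity: `1` if `α > 0`, and `0` if `α = 0`. The magnetic diffusivity is always `1`. -/
def viscosity (α : ℝ) : ℂ := if α = 0 then 0 else 1

/-- `(u, b)` with pressure `p` is a solution in `H^k` on `[0, S]` of the generalized
magnetohydrodynamic equations with initial data `(u₀, b₀)`:
`u, b ∈ C([0, S]; H^k)`, `u ∈ L²(0, S; H^{k+α})`, `b ∈ L²(0, S; H^{k+β})`, and
`∂ₜ u + u · ∇ u = -∇ p + b · ∇ b - ν Λ^{2α} u`, `∂ₜ b + u · ∇ b = b · ∇ u - Λ^{2β} b`,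
`∇ · u = ∇ · b = 0`. -/
structure IsSolution (α β k S : ℝ) (u₀ b₀ : VectorField) (u b : ℝ → VectorField)
    (p : ℝ → 𝓢'(Plane, ℂ)) : Prop where
  cont_u : ∀ i, ContSobolev k S (fun t ↦ u t i)
  cont_b : ∀ i, ContSobolev k S (fun t ↦ b t i)
  sqInt_u : ∀ i, SqIntSobolev (k + α) S (fun t ↦ u t i)
  sqInt_b : ∀ i, SqIntSobolev (k + β) S (fun t ↦ b t i)
  div_u : ∀ t ∈ Icc 0 S, divergence (u t) = 0
  div_b : ∀ t ∈ Icc 0 S, divergence (b t) = 0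
  init_u : u 0 = u₀
  init_b : b 0 = b₀
  eq_u : ∀ i, HasTimeDeriv S (fun t ↦ dist (u t i)) (fun t ↦
    - advect (u t) (u t) i - partialD i (p t) + advect (b t) (b t) i
      - viscosity α • (Lambda (2 * α) (cplx (u t i)) : 𝓢'(Plane, ℂ)))
  eq_b : ∀ i, HasTimeDeriv S (fun t ↦ dist (b t i)) (fun t ↦
    - advect (u t) (b t) i + advect (b t) (u t) i
      - (Lambda (2 * β) (cplx (b t i)) : 𝓢'(Plane, ℂ)))

end

end GMHD

namespace GMHD

noncomputable section

/-! The proof works in frequency space with the energies `en a V`, the squared homogeneous norms of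
order `a`. Taking the curl removes the pressure, and a divergence free field is determined by its
curl, so the energy balance at each level can be read off from the curl equations.

Three levels are combined. At level 0 all advection terms cancel. This bounds the `L²` norms and the
time integral of `‖Λ^β b‖²`, and, because `β ≥ 1`, also that of `‖∇b‖²` on a bounded time interval
(`Flow.energy_zero`).

At level 1 the transport of the vorticity contributes nothing. The other nonlinear terms symmetrize
into an integral of the type `∫ |∇u| |∇b|²`, which an estimate of Ladyzhenskaya type controls by
`‖∇u‖ (R ‖∇b‖² + R⁻¹ ‖Δb‖²)` for any scale `R`. With `R` proportional to `1 + ‖∇u‖` the second term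
is absorbed by the magnetic dissipation, and `(1 + ‖∇u‖²) ‖∇b‖²` remains
(`exists_nonlinear_grad_le`). Since `‖∇b‖²` is already integrable in time, Grönwall's inequality
bounds `∇u` and `∇b` in `L²` and the time integral of `‖Λ^(1+β) b‖²`. The time integral of `‖Λ^(1+α)
u‖²` is bounded as well: by viscosity if `α > 0`, by the bound on `∇u` if `α = 0`.

At level `α + β = 1 + r` the trilinear terms carry `2(α+β) + 1` derivatives. Of these, `α + 2β` stay
on the dissipated factor, and the other `1 + α` fall on `u` or on `b`; the hypothesis `α < 1/2`
leaves room for the second case (`exists_nonlinear_high_le`). What results is a linear Grönwall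
inequality with integrable coefficients. As `‖Λ^s j‖²` is a constant times `en (1 + s)` of `b`
(`lambda_current`), this is the claim; `Flow.exists_bound` assembles the constants.

The delicate point is regularity. When `k` is only slightly larger than 1, the level 1 transport
term of `u` need not converge absolutely, so the energy cannot simply be differentiated. The
vorticity is therefore mollified at scale `ε` and its square is replaced by a logarithmic truncation
with derivative of size `κ^(-1/2)`. The commutator of mollification and transport is of size `ε^δ`
in `L¹`; with `κ = ε^δ` the error vanishes in the limit and an energy inequality survives
(`vorticity_energy_le`). Every other balance follows from `energy_identity`, where absolute
convergence is available. -/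

/-- The Fourier transform of a real square integrable function. -/
def hat (f : L2R) : L2C := 𝓕 (cplx f)

/-! ### The Fourier transform on `L²` and its bilinear duality. -/

lemma integrable_mul_L2 (f g : L2C) : Integrable (fun x ↦ f x * g x) :=
  MemLp.integrable_mul (p := 2) (q := 2) (Lp.memLp f) (Lp.memLp g)

lemma coe_apply_eq (f : L2C) (φ : 𝓢(Plane, ℂ)) :
    (f : 𝓢'(Plane, ℂ)) φ = ∫ x, φ x * f x := by
  simp

lemma coe_fourier_apply (f : L2C) (φ : 𝓢(Plane, ℂ)) :
    (f : 𝓢'(Plane, ℂ)) (𝓕 φ) = ∫ ξ, φ ξ * (𝓕 f : L2C) ξ := by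
  rw [← TemperedDistribution.fourier_apply, Lp.fourier_toTemperedDistribution_eq, coe_apply_eq]

lemma continuous_integral_mul (f : L2C) : Continuous (fun g : L2C ↦ ∫ x, f x * g x) := by
  have h : (fun g : L2C ↦ ∫ x, f x * g x)
      = fun g ↦ (ContinuousLinearMap.mul ℂ ℂ).lpPairing volume 2 2 f g := by
    ext g; simp [ContinuousLinearMap.lpPairing_eq_integral]
  rw [h]; exact ContinuousLinearMap.continuous _

/-- The Fourier transform is symmetric for the bilinear pairing of `L²`. -/
lemma integral_fourier_mul (f g : L2C) :
    ∫ x, (𝓕 f : L2C) x * g x = ∫ x, f x * (𝓕 g : L2C) x := by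
  apply DenseRange.induction_on (p := fun g : L2C ↦
    ∫ x, (𝓕 f : L2C) x * g x = ∫ x, f x * (𝓕 g : L2C) x)
    (SchwartzMap.denseRange_toLpCLM (p := 2) (μ := (volume : Measure Plane))
      ENNReal.ofNat_ne_top) g
  · exact isClosed_eq (continuous_integral_mul _) ((continuous_integral_mul _).comp
      (Lp.fourierTransformₗᵢ Plane ℂ).continuous)
  · intro φ
    have h := coe_fourier_apply f φ
    rw [coe_apply_eq] at h
    have e1 : ∫ x, (𝓕 f : L2C) x * (SchwartzMap.toLpCLM ℝ ℂ 2 volume φ : L2C) x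
        = ∫ ξ, φ ξ * (𝓕 f : L2C) ξ := by
      apply integral_congr_ae
      filter_upwards [φ.coeFn_toLp 2 volume] with x hx
      rw [SchwartzMap.toLpCLM_apply, hx, mul_comm]
    have e2 : ∫ x, f x * (𝓕 (SchwartzMap.toLpCLM ℝ ℂ 2 volume φ : L2C) : L2C) x
        = ∫ x, (𝓕 φ : 𝓢(Plane, ℂ)) x * f x := by
      apply integral_congr_ae
      rw [SchwartzMap.toLpCLM_apply, SchwartzMap.toLp_fourier_eq]
      filter_upwards [(𝓕 φ : 𝓢(Plane, ℂ)).coeFn_toLp 2 volume] with x hx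
      rw [hx, mul_comm]
    rw [e1, e2, h]

/-- Functions with equal integrals against all Schwartz functions agree almost everywhere. -/
lemma ae_eq_of_integral_schwartz {f g : Plane → ℂ} (hf : LocallyIntegrable f)
    (hg : LocallyIntegrable g)
    (h : ∀ φ : 𝓢(Plane, ℂ), ∫ x, φ x * f x = ∫ x, φ x * g x) : f =ᵐ[volume] g := by
  apply ae_eq_of_integral_contDiff_smul_eq hf hg
  intro φ h1 h2
  have hg₁ : HasCompactSupport (Complex.ofRealCLM ∘ φ) := h2.comp_left rfl
  have hg₂ : ContDiff ℝ (⊤ : ℕ∞) (Complex.ofRealCLM ∘ φ) := by fun_prop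
  simpa using h (hg₁.toSchwartzMap hg₂)

lemma continuous_innerₗ : Continuous fun p : Plane × Plane ↦ innerₗ Plane p.1 p.2 := by
  simp only [innerₗ_apply_apply]; fun_prop

lemma continuous_fourierIntegral {f : Plane → ℂ} (h : Integrable f) : Continuous (𝓕 f) :=
  VectorFourier.fourierIntegral_continuous Real.continuous_fourierChar continuous_innerₗ h

lemma fourierInv_eq_fourier_neg (f : Plane → ℂ) (x : Plane) : 𝓕⁻ f x = 𝓕 f (-x) :=
  Real.fourierInv_eq_fourier_neg f x

/-- On `L¹ ∩ L²` the Fourier transform is given by the Fourier integral. -/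
lemma fourier_toLp_ae {f : Plane → ℂ} (h1 : Integrable f) (h2 : MemLp f 2) :
    (𝓕 (h2.toLp f) : L2C) =ᵐ[volume] 𝓕 f := by
  apply ae_eq_of_integral_schwartz
  · exact (Lp.memLp _).locallyIntegrable (by norm_num)
  · exact (continuous_fourierIntegral h1).locallyIntegrable
  intro φ
  rw [← coe_fourier_apply, coe_apply_eq]
  have := VectorFourier.integral_fourierIntegral_smul_eq_flip (μ := (volume : Measure Plane))
    (ν := volume) (L := innerₗ Plane) Real.continuous_fourierChar continuous_innerₗ φ.integrable h1
  simp only [smul_eq_mul] at this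
  rw [show (innerₗ Plane).flip = innerₗ Plane by ext x y; simp] at this
  refine Eq.trans ?_ this
  apply integral_congr_ae
  filter_upwards [h2.coeFn_toLp] with x hx
  rw [hx]; rfl

lemma coe_fourierInv_apply (f : L2C) (φ : 𝓢(Plane, ℂ)) :
    (f : 𝓢'(Plane, ℂ)) (𝓕⁻ φ) = ∫ ξ, φ ξ * (𝓕⁻ f : L2C) ξ := by
  rw [← TemperedDistribution.fourierInv_apply, Lp.fourierInv_toTemperedDistribution_eq,
    coe_apply_eq]

lemma fourierInv_toLp_ae {f : Plane → ℂ} (h1 : Integrable f) (h2 : MemLp f 2) :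
    (𝓕⁻ (h2.toLp f) : L2C) =ᵐ[volume] 𝓕⁻ f := by
  have hc : Continuous (𝓕⁻ f) := by
    have : 𝓕⁻ f = fun x ↦ 𝓕 f (-x) := funext (fourierInv_eq_fourier_neg f)
    rw [this]; exact (continuous_fourierIntegral h1).comp continuous_neg
  apply ae_eq_of_integral_schwartz
  · exact (Lp.memLp _).locallyIntegrable (by norm_num)
  · exact hc.locallyIntegrable
  intro φ
  rw [← coe_fourierInv_apply, coe_apply_eq]
  -- The inverse transform is the Fourier integral for the pairing `-innerₗ Plane`, so the duality
  -- used for the forward transform applies unchanged.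
  have := VectorFourier.integral_fourierIntegral_smul_eq_flip (μ := (volume : Measure Plane))
    (ν := volume) (L := -innerₗ Plane) Real.continuous_fourierChar
    continuous_innerₗ.neg φ.integrable h1
  simp only [smul_eq_mul] at this
  rw [show (-innerₗ Plane).flip = -innerₗ Plane by
    ext x y; simp [real_inner_comm y x]] at this
  refine Eq.trans ?_ this
  apply integral_congr_ae
  filter_upwards [h2.coeFn_toLp] with x hx
  rw [hx, SchwartzMap.fourierInv_coe]
  rfl

/-! ### Products and convolutions. -/

/-- The convolution of two functions, as a function defined everywhere. -/
def conv (f g : Plane → ℂ) (ξ : Plane) : ℂ := ∫ η, f η * g (ξ - η)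

lemma memLp_comp_sub_left {f : Plane → ℂ} (hf : MemLp f 2) (ξ : Plane) :
    MemLp (fun η ↦ f (ξ - η)) 2 :=
  hf.comp_measurePreserving (volume.measurePreserving_sub_left ξ)

lemma integrable_conv (f g : L2C) (ξ : Plane) : Integrable fun η ↦ f η * g (ξ - η) :=
  MemLp.integrable_mul (p := 2) (q := 2) (Lp.memLp f) (memLp_comp_sub_left (Lp.memLp g) ξ)

lemma integral_norm_mul_le {f g : Plane → ℂ} (hf : MemLp f 2) (hg : MemLp g 2) :
    ∫ x, ‖f x‖ * ‖g x‖ ≤ ‖hf.toLp f‖ * ‖hg.toLp g‖ := by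
  have := integral_mul_norm_le_Lp_mul_Lq (μ := (volume : Measure Plane)) (f := f) (g := g)
    (p := 2) (q := 2) Real.HolderConjugate.two_two (by simpa using hf) (by simpa using hg)
  refine this.trans (le_of_eq ?_)
  rw [Lp.norm_toLp, Lp.norm_toLp, hf.eLpNorm_eq_integral_rpow_norm (by norm_num) (by norm_num),
    hg.eLpNorm_eq_integral_rpow_norm (by norm_num) (by norm_num), ENNReal.toReal_ofReal,
    ENNReal.toReal_ofReal]
  · simp
  all_goals positivity

/-- Cauchy–Schwarz and translation invariance. Uniformity in `ξ` makes the convolution of two `L²`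
functions a bounded function defined everywhere, so quadratic terms have a pointwise meaning in
frequency without extra regularity. -/
lemma integral_norm_conv_le (f g : L2C) (ξ : Plane) :
    ∫ η, ‖f η‖ * ‖g (ξ - η)‖ ≤ ‖f‖ * ‖g‖ := by
  have hg := memLp_comp_sub_left (Lp.memLp g) ξ
  refine (integral_norm_mul_le (Lp.memLp f) hg).trans (le_of_eq ?_)
  rw [Lp.toLp_coeFn, Lp.norm_toLp]
  have := eLpNorm_comp_measurePreserving (p := 2) (Lp.aestronglyMeasurable g)
    (volume.measurePreserving_sub_left ξ)
  simp only [Function.comp_def] at this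
  rw [this, Lp.norm_def, Lp.norm_def]

lemma norm_conv_le (f g : L2C) (ξ : Plane) : ‖conv f g ξ‖ ≤ ‖f‖ * ‖g‖ := by
  refine (norm_integral_le_integral_norm _).trans ?_
  simpa only [norm_mul] using integral_norm_conv_le f g ξ

lemma stronglyMeasurable_conv_integrand (f g : L2C) :
    StronglyMeasurable fun p : Plane × Plane ↦ f p.2 * g (p.1 - p.2) :=
  ((Lp.stronglyMeasurable f).comp_measurable measurable_snd).mul
    ((Lp.stronglyMeasurable g).comp_measurable (measurable_fst.sub measurable_snd))

lemma stronglyMeasurable_conv (f g : L2C) : StronglyMeasurable (conv f g) :=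
  (stronglyMeasurable_conv_integrand f g).integral_prod_right'

/-- Since `compSubConstCLM` subtracts its argument, the parameter `-η` encodes `φ (· + η)`; this
fixes the sign of the character. -/
lemma fourier_comp_add (φ : 𝓢(Plane, ℂ)) (η x : Plane) :
    (𝓕 (SchwartzMap.compSubConstCLM ℂ (-η) φ) : 𝓢(Plane, ℂ)) x
      = Real.fourierChar (inner ℝ x η) • (𝓕 φ : 𝓢(Plane, ℂ)) x := by
  rw [SchwartzMap.fourier_coe, SchwartzMap.fourier_coe]
  have := VectorFourier.fourierIntegral_comp_add_right Real.fourierChar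
    (volume : Measure Plane) (innerₗ Plane) (φ : Plane → ℂ) η
  have := congrFun this x
  rw [innerₗ_apply_apply, real_inner_comm] at this
  refine Eq.trans ?_ this
  show VectorFourier.fourierIntegral _ _ _ _ _ = _
  congr 1
  ext y
  simp

/-- The Fourier transform turns products into convolutions. -/
lemma integral_mul_fourier (f g : L2C) (φ : 𝓢(Plane, ℂ)) :
    ∫ x, (𝓕 φ : 𝓢(Plane, ℂ)) x * (f x * g x)
      = ∫ ξ, φ ξ * conv (𝓕 f : L2C) (𝓕 g : L2C) ξ := by
  set F : L2C := 𝓕 f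
  set G : L2C := 𝓕 g
  set h : Plane → ℂ := fun x ↦ (𝓕 φ : 𝓢(Plane, ℂ)) x * g x
  have h1 : Integrable h :=
    MemLp.integrable_mul (p := 2) (q := 2) ((𝓕 φ).memLp 2 volume) (Lp.memLp g)
  have h2 : MemLp h 2 := (Lp.memLp g).mul' ((𝓕 φ).memLp_top volume)
  -- The Schwartz factor is grouped with `g`: the product `h` lies in `L¹ ∩ L²`, so duality can move
  -- the transform off `f` and `𝓕⁻ h` is a genuine integral.
  have e1 : ∫ x, (𝓕 φ : 𝓢(Plane, ℂ)) x * (f x * g x) = ∫ x, F x * 𝓕⁻ h x := by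
    have := integral_fourier_mul f (𝓕⁻ (h2.toLp h))
    rw [FourierTransform.fourier_fourierInv_eq] at this
    calc _ = ∫ x, f x * (h2.toLp h : L2C) x := by
            apply integral_congr_ae
            filter_upwards [h2.coeFn_toLp] with x hx
            rw [hx]; simp only [h]; ring
      _ = _ := this.symm
      _ = _ := by
            apply integral_congr_ae
            filter_upwards [fourierInv_toLp_ae h1 h2] with x hx
            rw [hx]
  -- The character in `𝓕⁻ h η` is absorbed into a translate of `φ`, and duality then acts on `g`
  -- alone.
  have e2 : ∀ η, 𝓕⁻ h η = ∫ ξ, φ ξ * G (ξ - η) := by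
    intro η
    have := coe_fourier_apply g (SchwartzMap.compSubConstCLM ℂ (-η) φ)
    rw [coe_apply_eq] at this
    calc 𝓕⁻ h η = ∫ x, (𝓕 (SchwartzMap.compSubConstCLM ℂ (-η) φ) : 𝓢(Plane, ℂ)) x * g x := by
          rw [Real.fourierInv_eq]
          congr 1; ext x
          rw [fourier_comp_add, smul_mul_assoc]
      _ = _ := this
      _ = ∫ ξ, φ (ξ + η) * G ((ξ + η) - η) := by simp [G]
      _ = _ := integral_add_right_eq_self (fun ξ ↦ φ ξ * G (ξ - η)) η
  rw [e1]
  simp only [e2, conv]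
  simp_rw [← integral_const_mul]
  have hI : Integrable (Function.uncurry fun ξ η ↦ φ ξ * (F η * G (ξ - η)))
      ((volume : Measure Plane).prod volume) := by
    have hm : AEStronglyMeasurable (Function.uncurry fun ξ η ↦ φ ξ * (F η * G (ξ - η)))
        ((volume : Measure Plane).prod volume) :=
      ((φ.continuous.stronglyMeasurable.comp_measurable measurable_fst).mul
        (stronglyMeasurable_conv_integrand F G)).aestronglyMeasurable
    rw [integrable_prod_iff hm]
    refine ⟨.of_forall fun ξ ↦ (integrable_conv F G ξ).const_mul (φ ξ), ?_⟩
    refine (φ.integrable.norm.mul_const (‖F‖ * ‖G‖)).mono'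
      hm.norm.integral_prod_right' (.of_forall fun ξ ↦ ?_)
    rw [Real.norm_of_nonneg (by positivity)]
    simp only [Function.uncurry_apply_pair, norm_mul]
    rw [integral_const_mul]
    exact mul_le_mul_of_nonneg_left (integral_norm_conv_le F G ξ) (norm_nonneg _)
  rw [integral_integral_swap hI]
  congr 1; ext η; congr 1; ext ξ; ring

/-! ### Bracket weights, and derivatives and Bessel potentials in frequency. -/

/-- The Japanese bracket `(1 + |ξ|²)^{s/2}`. -/
def jap (s : ℝ) (ξ : Plane) : ℝ := (1 + ‖ξ‖ ^ 2) ^ (s / 2)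

lemma jap_pos (s : ℝ) (ξ : Plane) : 0 < jap s ξ := by unfold jap; positivity

lemma jap_add (s t : ℝ) (ξ : Plane) : jap (s + t) ξ = jap s ξ * jap t ξ := by
  unfold jap; rw [← Real.rpow_add (by positivity)]; ring_nf

lemma jap_zero (ξ : Plane) : jap 0 ξ = 1 := by simp [jap]

lemma jap_mono {s t : ℝ} (h : s ≤ t) (ξ : Plane) : jap s ξ ≤ jap t ξ := by
  unfold jap
  exact Real.rpow_le_rpow_of_exponent_le (by nlinarith [sq_nonneg ‖ξ‖]) (by linarith)

lemma jap_two (ξ : Plane) : jap 2 ξ = 1 + ‖ξ‖ ^ 2 := by simp [jap]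

lemma jap_mul_neg (s : ℝ) (ξ : Plane) : jap s ξ * jap (-s) ξ = 1 := by
  rw [← jap_add, add_neg_cancel, jap_zero]

lemma continuous_jap (s : ℝ) : Continuous (jap s) := by
  unfold jap
  exact Continuous.rpow_const (by fun_prop) fun x ↦ Or.inl (by positivity)

lemma norm_rpow_le_jap {a s : ℝ} (ha : 0 ≤ a) (has : a ≤ s) (ξ : Plane) :
    ‖ξ‖ ^ a ≤ jap s ξ := by
  refine le_trans ?_ (jap_mono has ξ)
  unfold jap
  calc ‖ξ‖ ^ a = (‖ξ‖ ^ 2) ^ (a / 2) := by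
        rw [← Real.rpow_natCast, ← Real.rpow_mul (norm_nonneg _)]; congr 1; push_cast; ring
    _ ≤ _ := Real.rpow_le_rpow (by positivity) (by linarith) (by linarith)

/-- The symbol `2π|ξ|` of `(-Δ)^{1/2}`. -/
def lam (ξ : Plane) : ℝ := 2 * Real.pi * ‖ξ‖

lemma lam_nonneg (ξ : Plane) : 0 ≤ lam ξ := by unfold lam; positivity

lemma continuous_lam : Continuous lam := by unfold lam; fun_prop

lemma measurable_lam_rpow (s : ℝ) : Measurable fun ξ ↦ lam ξ ^ s :=
  continuous_lam.measurable.pow_const s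

lemma lam_rpow_le_jap {a s : ℝ} (ha : 0 ≤ a) (has : a ≤ s) (ξ : Plane) :
    lam ξ ^ a ≤ (2 * Real.pi) ^ a * jap s ξ := by
  unfold lam
  rw [Real.mul_rpow (by positivity) (norm_nonneg _)]
  exact mul_le_mul_of_nonneg_left (norm_rpow_le_jap ha has ξ) (by positivity)

/-- Multiplication of a Schwartz function by the `i`-th coordinate. -/
def mulX (i : Fin 2) (φ : 𝓢(Plane, ℂ)) : 𝓢(Plane, ℂ) :=
  SchwartzMap.smulLeftCLM ℂ (fun ξ : Plane ↦ ((inner ℝ ξ (EuclideanSpace.single i (1 : ℝ)) : ℝ) : ℂ)) φ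

lemma mulX_apply (i : Fin 2) (φ : 𝓢(Plane, ℂ)) (ξ : Plane) : mulX i φ ξ = (ξ i : ℂ) * φ ξ := by
  unfold mulX
  rw [SchwartzMap.smulLeftCLM_apply_apply (by fun_prop)]
  simp [EuclideanSpace.inner_single_right]

/-- Distributions are always tested on functions `𝓕 φ`. The sign from the definition of the weak
derivative cancels the sign from differentiating a Fourier transform. -/
lemma partialD_fourier (i : Fin 2) (T : 𝓢'(Plane, ℂ)) (φ : 𝓢(Plane, ℂ)) :
    partialD i T (𝓕 φ) = T (𝓕 ((2 * Real.pi * Complex.I) • mulX i φ)) := by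
  unfold partialD
  rw [TemperedDistribution.lineDerivOp_apply_apply, SchwartzMap.lineDerivOp_fourier_eq,
    ← FourierTransform.fourier_neg]
  congr 2
  ext ξ
  have h : (fun ξ : Plane ↦ inner ℝ ξ (EuclideanSpace.single i (1 : ℝ))).HasTemperateGrowth := by
    fun_prop
  simp only [neg_smul, neg_neg, smul_apply, mulX_apply, SchwartzMap.smulLeftCLM_apply_apply h]
  simp [EuclideanSpace.inner_single_right]

lemma dist_fourier (f : L2R) (φ : 𝓢(Plane, ℂ)) : dist f (𝓕 φ) = ∫ ξ, φ ξ * hat f ξ :=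
  coe_fourier_apply _ _

lemma cplx_ae (f : L2R) : cplx f =ᵐ[volume] fun x ↦ (f x : ℂ) :=
  Complex.ofRealCLM.coeFn_compLp f

lemma prodDist_fourier (f g : L2R) (φ : 𝓢(Plane, ℂ)) :
    prodDist f g (𝓕 φ) = ∫ ξ, φ ξ * conv (hat f) (hat g) ξ := by
  unfold hat
  rw [← integral_mul_fourier, prodDist, Lp.toTemperedDistribution_apply]
  apply integral_congr_ae
  filter_upwards [Complex.ofRealCLM.coeFn_compLp (f • g : Lp ℝ 1 (volume : Measure Plane)),
    Lp.coeFn_lpSMul (r := 1) f g, cplx_ae f, cplx_ae g] with x h1 h2 h3 h4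
  rw [h1, h2, h3, h4]
  simp

lemma schwartz_mul_L2_integrable (φ : 𝓢(Plane, ℂ)) (f : L2C) : Integrable fun ξ ↦ φ ξ * f ξ :=
  MemLp.integrable_mul (p := 2) (q := 2) (φ.memLp 2 volume) (Lp.memLp f)

lemma schwartz_mul_conv_integrable (φ : 𝓢(Plane, ℂ)) (f g : L2C) :
    Integrable fun ξ ↦ φ ξ * conv f g ξ :=
  φ.integrable.mul_bdd (c := ‖f‖ * ‖g‖) (stronglyMeasurable_conv f g).aestronglyMeasurable
    (.of_forall fun ξ ↦ norm_conv_le f g ξ)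

/-- The Fourier transform of a real function is conjugate symmetric. -/
lemma hat_neg (f : L2R) : ∀ᵐ ξ, hat f (-ξ) = (starRingEnd ℂ) (hat f ξ) := by
  have hmp : MemLp (fun ξ ↦ hat f (-ξ)) 2 :=
    (Lp.memLp (hat f)).comp_measurePreserving (Measure.measurePreserving_neg volume)
  have hcj : MemLp (fun ξ ↦ (starRingEnd ℂ) (hat f ξ)) 2 := (Lp.memLp (hat f)).star
  apply ae_eq_of_integral_schwartz (hmp.locallyIntegrable (by norm_num))
    (hcj.locallyIntegrable (by norm_num))
  intro φ
  -- Reflection and conjugation are moved to the test function. The transforms of `φn` and `φc` are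
  -- conjugate to each other, and `f` is real.
  set φn : 𝓢(Plane, ℂ) :=
    SchwartzMap.compCLMOfContinuousLinearEquiv ℂ (ContinuousLinearEquiv.neg ℝ) φ with hφn
  set φc : 𝓢(Plane, ℂ) := SchwartzMap.postcompCLM (Complex.conjCLE : ℂ →L[ℝ] ℂ) φ with hφc
  have hn : ∀ x, φn x = φ (-x) := fun x ↦ by simp [hφn]
  have hc : ∀ x, φc x = (starRingEnd ℂ) (φ x) := fun x ↦ by simp [hφc]
  have h1 := coe_fourier_apply (cplx f) φn
  have h2 := coe_fourier_apply (cplx f) φc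
  rw [coe_apply_eq] at h1 h2
  have e1 : ∫ x, φ x * hat f (-x) = ∫ x, φn x * hat f x := by
    rw [← integral_neg_eq_self (fun x ↦ φn x * hat f x)]
    simp [hn]
  have e2 : ∫ x, φ x * (starRingEnd ℂ) (hat f x) = (starRingEnd ℂ) (∫ x, φc x * hat f x) := by
    rw [← integral_conj]
    simp [hc]
  rw [e1, e2, hat, ← h1, ← h2, ← integral_conj]
  apply integral_congr_ae
  filter_upwards [cplx_ae f] with x hx
  rw [hx, map_mul, Complex.conj_ofReal]
  congr 1
  rw [SchwartzMap.fourier_coe, SchwartzMap.fourier_coe, Real.fourier_eq, Real.fourier_eq,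
    ← integral_conj, ← integral_neg_eq_self]
  congr 1
  ext y
  simp only [hn, hc, Circle.smul_def, smul_eq_mul, map_mul, neg_neg, Complex.conj_conj,
    inner_neg_left]
  rw [← Circle.coe_inv_eq_conj, ← AddChar.map_neg_eq_inv]
  simp

/-- The Bessel potential has the symbol `jap s` in the same frequency variable, with no factor `2π`.
All Sobolev hypotheses are used in this form. -/
lemma bessel_hat {s : ℝ} {f : L2R} {F : L2C}
    (h : besselPotential Plane ℂ s (dist f) = (F : 𝓢'(Plane, ℂ))) :
    (𝓕 F : L2C) =ᵐ[volume] fun ξ ↦ (jap s ξ : ℂ) * hat f ξ := by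
  have hl : LocallyIntegrable fun ξ ↦ (jap s ξ : ℂ) * hat f ξ := by
    have := ((Lp.memLp (hat f)).locallyIntegrable (by norm_num)).smul_continuous
      (Complex.continuous_ofReal.comp (continuous_jap s))
    simpa [smul_eq_mul, mul_comm] using this
  apply ae_eq_of_integral_schwartz ((Lp.memLp _).locallyIntegrable (by norm_num)) hl
  intro φ
  rw [← coe_fourier_apply, ← h, besselPotential,
    TemperedDistribution.fourierMultiplierCLM_apply_apply, FourierTransform.fourierInv_fourier_eq,
    dist_fourier]
  congr 1; ext ξ
  rw [SchwartzMap.smulLeftCLM_apply_apply (by fun_prop)]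
  simp only [jap, smul_eq_mul]
  ring

lemma div_hat {v : VectorField} (h : divergence v = 0) :
    ∀ᵐ ξ, (ξ 0 : ℂ) * hat (v 0) ξ + (ξ 1 : ℂ) * hat (v 1) ξ = 0 := by
  have hc (i : Fin 2) : Continuous fun ξ : Plane ↦ (ξ i : ℂ) := by fun_prop
  have hl (i : Fin 2) : LocallyIntegrable fun ξ ↦ (ξ i : ℂ) * hat (v i) ξ := by
    have := ((Lp.memLp (hat (v i))).locallyIntegrable (by norm_num)).smul_continuous (hc i)
    simpa [smul_eq_mul, mul_comm] using this
  apply ae_eq_of_integral_schwartz ((hl 0).add (hl 1)) (locallyIntegrable_zero)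
  intro φ
  have h1 : divergence v (𝓕 φ) = 0 := by rw [h]; rfl
  have hi (i : Fin 2) : Integrable fun ξ ↦ φ ξ * ((ξ i : ℂ) * hat (v i) ξ) := by
    refine (schwartz_mul_L2_integrable (mulX i φ) (hat (v i))).congr (.of_forall fun ξ ↦ ?_)
    simp only [mulX_apply]; ring
  have h2 (i : Fin 2) : partialD i (dist (v i)) (𝓕 φ)
      = (2 * Real.pi * Complex.I) * ∫ ξ, φ ξ * ((ξ i : ℂ) * hat (v i) ξ) := by
    rw [partialD_fourier, dist_fourier, ← integral_const_mul]
    congr 1; ext ξ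
    simp only [smul_apply, mulX_apply, smul_eq_mul]; ring
  have h3 : divergence v (𝓕 φ)
      = partialD 0 (dist (v 0)) (𝓕 φ) + partialD 1 (dist (v 1)) (𝓕 φ) := by
    simp [divergence]
  rw [h3, h2, h2, ← mul_add] at h1
  have h4 := (mul_eq_zero.mp h1).resolve_left (by simp [Real.pi_ne_zero])
  simp only [Pi.add_apply, mul_zero, integral_zero, mul_add]
  rw [integral_add (hi 0) (hi 1), h4]

/-! ### The equations in frequency and elimination of the pressure. -/

/-- The Fourier side of the scalar curl, without the factor `2πi`. -/
def curlHat (V : Fin 2 → Plane → ℂ) (ξ : Plane) : ℂ := ξ 0 * V 1 ξ - ξ 1 * V 0 ξ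

/-- The Fourier side of `advect`. -/
def advHat (V W : Fin 2 → L2C) (i : Fin 2) (ξ : Plane) : ℂ :=
  (2 * Real.pi * Complex.I) * ∑ j, (ξ j : ℂ) * conv (V j) (W i) ξ

/-- The Fourier side of the right-hand side of the velocity equation, without the pressure. -/
def rhsU (α : ℝ) (U B : Fin 2 → L2C) (i : Fin 2) (ξ : Plane) : ℂ :=
  - advHat U U i ξ + advHat B B i ξ - viscosity α * (((lam ξ ^ (2 * α) : ℝ) : ℂ) * U i ξ)

/-- The Fourier side of the right-hand side of the magnetic equation. -/
def rhsB (β : ℝ) (U B : Fin 2 → L2C) (i : Fin 2) (ξ : Plane) : ℂ :=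
  - advHat U B i ξ + advHat B U i ξ - ((lam ξ ^ (2 * β) : ℝ) : ℂ) * B i ξ

/-- The Fourier transform of a vector field. -/
def vhat (v : VectorField) (i : Fin 2) : L2C := hat (v i)

lemma memLp_lam_mul {a s : ℝ} (ha : 0 ≤ a) (has : a ≤ s) {f F : L2C}
    (h : F =ᵐ[volume] fun ξ ↦ (jap s ξ : ℂ) * f ξ) :
    MemLp (fun ξ ↦ ((lam ξ ^ a : ℝ) : ℂ) * f ξ) 2 := by
  refine (Lp.memLp F).of_le_mul (c := (2 * Real.pi) ^ a) ?_ ?_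
  · exact (Complex.measurable_ofReal.comp (measurable_lam_rpow a)).aestronglyMeasurable.mul
      (Lp.aestronglyMeasurable f)
  · filter_upwards [h] with ξ hξ
    rw [hξ, norm_mul, norm_mul, Complex.norm_real, Complex.norm_real,
      Real.norm_of_nonneg (by have := lam_nonneg ξ; positivity),
      Real.norm_of_nonneg (jap_pos s ξ).le, ← mul_assoc]
    exact mul_le_mul_of_nonneg_right (lam_rpow_le_jap ha has ξ) (norm_nonneg _)

lemma lambdaMem_of_jap {a s : ℝ} (ha : 0 ≤ a) (has : a ≤ s) {f F : L2C}
    (h : F =ᵐ[volume] fun ξ ↦ (jap s ξ : ℂ) * (𝓕 f : L2C) ξ) : LambdaMem a f :=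
  memLp_lam_mul ha has h

lemma lambda_fourier {s : ℝ} {f : L2C} (h : LambdaMem s f) (φ : 𝓢(Plane, ℂ)) :
    (Lambda s f : 𝓢'(Plane, ℂ)) (𝓕 φ) = ∫ ξ, φ ξ * (((lam ξ ^ s : ℝ) : ℂ) * (𝓕 f : L2C) ξ) := by
  rw [Lambda, dif_pos h, coe_fourier_apply, FourierTransform.fourier_fourierInv_eq]
  apply integral_congr_ae
  filter_upwards [MemLp.coeFn_toLp h] with ξ hξ
  rw [hξ]; rfl

lemma integrable_lambda {s : ℝ} {f : L2C} (h : LambdaMem s f) (φ : 𝓢(Plane, ℂ)) :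
    Integrable fun ξ ↦ φ ξ * (((lam ξ ^ s : ℝ) : ℂ) * (𝓕 f : L2C) ξ) :=
  MemLp.integrable_mul (p := 2) (q := 2) (φ.memLp 2 volume) h

lemma integrable_schwartz_coord_conv (φ : 𝓢(Plane, ℂ)) (f g : L2C) (j : Fin 2) :
    Integrable fun ξ ↦ φ ξ * ((ξ j : ℂ) * conv f g ξ) := by
  refine (schwartz_mul_conv_integrable (mulX j φ) f g).congr (.of_forall fun ξ ↦ ?_)
  simp only [mulX_apply]; ring

lemma integrable_schwartz_advHat (φ : 𝓢(Plane, ℂ)) (V W : Fin 2 → L2C) (i : Fin 2) :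
    Integrable fun ξ ↦ φ ξ * advHat V W i ξ := by
  refine (((integrable_schwartz_coord_conv φ (V 0) (W i) 0).add
    (integrable_schwartz_coord_conv φ (V 1) (W i) 1)).const_mul
      (2 * Real.pi * Complex.I)).congr (.of_forall fun ξ ↦ ?_)
  simp only [advHat, Fin.sum_univ_two, Pi.add_apply]; ring

lemma advect_fourier (v w : VectorField) (i : Fin 2) (φ : 𝓢(Plane, ℂ)) :
    advect v w i (𝓕 φ) = ∫ ξ, φ ξ * advHat (vhat v) (vhat w) i ξ := by
  have h1 : advect v w i (𝓕 φ) = partialD 0 (prodDist (v 0) (w i)) (𝓕 φ)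
      + partialD 1 (prodDist (v 1) (w i)) (𝓕 φ) := by simp [advect]
  have h2 (j : Fin 2) : partialD j (prodDist (v j) (w i)) (𝓕 φ) = (2 * Real.pi * Complex.I)
      * ∫ ξ, φ ξ * ((ξ j : ℂ) * conv (hat (v j)) (hat (w i)) ξ) := by
    rw [partialD_fourier, prodDist_fourier, ← integral_const_mul]
    congr 1; ext ξ
    simp only [smul_apply, mulX_apply, smul_eq_mul]; ring
  rw [h1, h2, h2, ← mul_add, ← integral_add (integrable_schwartz_coord_conv _ _ _ _)
    (integrable_schwartz_coord_conv _ _ _ _), ← integral_const_mul]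
  congr 1; ext ξ
  simp only [advHat, Fin.sum_univ_two, vhat]; ring

/-- The pressure stays an arbitrary distribution evaluated at one test function. Nothing about it
has to be known, since the curl cancels it. -/
lemma rhsU_fourier {α : ℝ} {u b : VectorField} (i : Fin 2) (q : 𝓢'(Plane, ℂ))
    (h : LambdaMem (2 * α) (cplx (u i))) (φ : 𝓢(Plane, ℂ)) :
    Integrable (fun ξ ↦ φ ξ * rhsU α (vhat u) (vhat b) i ξ) ∧
    (- advect u u i - partialD i q + advect b b i
      - viscosity α • (Lambda (2 * α) (cplx (u i)) : 𝓢'(Plane, ℂ))) (𝓕 φ)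
      = (∫ ξ, φ ξ * rhsU α (vhat u) (vhat b) i ξ)
        - q (𝓕 ((2 * Real.pi * Complex.I) • mulX i φ)) := by
  have i1 := integrable_schwartz_advHat φ (vhat u) (vhat u) i
  have i2 := integrable_schwartz_advHat φ (vhat b) (vhat b) i
  have i3 := (integrable_lambda h φ).const_mul (viscosity α)
  have key : (fun ξ ↦ φ ξ * rhsU α (vhat u) (vhat b) i ξ)
      = fun ξ ↦ -(φ ξ * advHat (vhat u) (vhat u) i ξ) + φ ξ * advHat (vhat b) (vhat b) i ξ
        - viscosity α * (φ ξ * (((lam ξ ^ (2 * α) : ℝ) : ℂ) * (𝓕 (cplx (u i)) : L2C) ξ)) := by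
    ext ξ; simp only [rhsU, vhat, hat]; ring
  have e : (- advect u u i - partialD i q + advect b b i
      - viscosity α • (Lambda (2 * α) (cplx (u i)) : 𝓢'(Plane, ℂ))) (𝓕 φ)
      = - (advect u u i (𝓕 φ)) - partialD i q (𝓕 φ) + advect b b i (𝓕 φ)
        - viscosity α * (Lambda (2 * α) (cplx (u i)) : 𝓢'(Plane, ℂ)) (𝓕 φ) := rfl
  rw [e, key, partialD_fourier, advect_fourier, advect_fourier, lambda_fourier h]
  have i1' : Integrable fun ξ ↦ -(φ ξ * advHat (vhat u) (vhat u) i ξ) := i1.neg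
  have i12 : Integrable fun ξ ↦ -(φ ξ * advHat (vhat u) (vhat u) i ξ)
      + φ ξ * advHat (vhat b) (vhat b) i ξ := i1'.add i2
  refine ⟨i12.sub i3, ?_⟩
  rw [integral_sub i12 i3, integral_add i1' i2, integral_neg, integral_const_mul]
  ring

lemma rhsB_fourier {β : ℝ} {u b : VectorField} (i : Fin 2)
    (h : LambdaMem (2 * β) (cplx (b i))) (φ : 𝓢(Plane, ℂ)) :
    Integrable (fun ξ ↦ φ ξ * rhsB β (vhat u) (vhat b) i ξ) ∧
    (- advect u b i + advect b u i
      - (Lambda (2 * β) (cplx (b i)) : 𝓢'(Plane, ℂ))) (𝓕 φ)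
      = (∫ ξ, φ ξ * rhsB β (vhat u) (vhat b) i ξ) := by
  have i1 := integrable_schwartz_advHat φ (vhat u) (vhat b) i
  have i2 := integrable_schwartz_advHat φ (vhat b) (vhat u) i
  have i3 := integrable_lambda h φ
  have key : (fun ξ ↦ φ ξ * rhsB β (vhat u) (vhat b) i ξ)
      = fun ξ ↦ -(φ ξ * advHat (vhat u) (vhat b) i ξ) + φ ξ * advHat (vhat b) (vhat u) i ξ
        - (φ ξ * (((lam ξ ^ (2 * β) : ℝ) : ℂ) * (𝓕 (cplx (b i)) : L2C) ξ)) := by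
    ext ξ; simp only [rhsB, vhat, hat]; ring
  have e : (- advect u b i + advect b u i
      - (Lambda (2 * β) (cplx (b i)) : 𝓢'(Plane, ℂ))) (𝓕 φ)
      = - (advect u b i (𝓕 φ)) + advect b u i (𝓕 φ)
        - (Lambda (2 * β) (cplx (b i)) : 𝓢'(Plane, ℂ)) (𝓕 φ) := rfl
  rw [e, key, advect_fourier, advect_fourier, lambda_fourier h]
  have i1' : Integrable fun ξ ↦ -(φ ξ * advHat (vhat u) (vhat b) i ξ) := i1.neg
  have i12 : Integrable fun ξ ↦ -(φ ξ * advHat (vhat u) (vhat b) i ξ)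
      + φ ξ * advHat (vhat b) (vhat u) i ξ := i1'.add i2
  refine ⟨i12.sub i3, ?_⟩
  rw [integral_sub i12 i3, integral_add i1' i2, integral_neg]

/-- The curl of `V` has the curl of `G` as its time derivative, tested against Schwartz functions on
the Fourier side. -/
def CurlEq (S : ℝ) (V : ℝ → Fin 2 → L2C) (G : ℝ → Fin 2 → Plane → ℂ) : Prop :=
  ∀ φ : 𝓢(Plane, ℂ), ∀ t ∈ Icc 0 S,
    ∫ ξ, φ ξ * curlHat (fun i ↦ V t i) ξ = (∫ ξ, φ ξ * curlHat (fun i ↦ V 0 i) ξ)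
      + ∫ τ in (0 : ℝ)..t, ∫ ξ, φ ξ * curlHat (G τ) ξ

lemma integral_curlHat {V : Fin 2 → Plane → ℂ} (φ : 𝓢(Plane, ℂ))
    (h0 : Integrable fun ξ ↦ mulX 1 φ ξ * V 0 ξ) (h1 : Integrable fun ξ ↦ mulX 0 φ ξ * V 1 ξ) :
    ∫ ξ, φ ξ * curlHat V ξ = (∫ ξ, mulX 0 φ ξ * V 1 ξ) - ∫ ξ, mulX 1 φ ξ * V 0 ξ := by
  rw [← integral_sub h1 h0]
  congr 1; ext ξ
  simp only [curlHat, mulX_apply]; ring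

/-- Testing two time-dependent distributions against a rotated gradient removes a gradient. -/
lemma curlEq_of_hasTimeDeriv {S : ℝ} {v : ℝ → VectorField} {R : ℝ → Fin 2 → 𝓢'(Plane, ℂ)}
    {G : ℝ → Fin 2 → Plane → ℂ} {q : ℝ → 𝓢'(Plane, ℂ)}
    (h : ∀ i, HasTimeDeriv S (fun t ↦ dist (v t i)) (fun t ↦ R t i))
    (hR : ∀ᵐ t ∂(volume.restrict (Icc 0 S)), ∀ i, ∀ φ : 𝓢(Plane, ℂ),
      Integrable (fun ξ ↦ φ ξ * G t i ξ) ∧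
      R t i (𝓕 φ) = (∫ ξ, φ ξ * G t i ξ) - q t (𝓕 ((2 * Real.pi * Complex.I) • mulX i φ))) :
    CurlEq S (fun t ↦ vhat (v t)) G := by
  intro φ t ht
  -- Commuting coordinates express that the curl of a gradient vanishes: `q` receives the same test
  -- function from both components and drops out of the difference.
  have hcomm : mulX 0 (mulX 1 φ) = mulX 1 (mulX 0 φ) := by
    ext ξ; simp only [mulX_apply]; ring
  have hV (s : ℝ) : ∫ ξ, φ ξ * curlHat (fun i ↦ vhat (v s) i) ξ
      = dist (v s 1) (𝓕 (mulX 0 φ)) - dist (v s 0) (𝓕 (mulX 1 φ)) := by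
    rw [dist_fourier, dist_fourier]
    exact integral_curlHat (V := fun i ↦ (vhat (v s) i : Plane → ℂ)) φ
      (schwartz_mul_L2_integrable (mulX 1 φ) (hat (v s 0)))
      (schwartz_mul_L2_integrable (mulX 0 φ) (hat (v s 1)))
  have hsub : Icc 0 t ⊆ Icc 0 S := Icc_subset_Icc_right ht.2
  have hii (i : Fin 2) (χ : 𝓢(Plane, ℂ)) :
      IntervalIntegrable (fun τ ↦ R τ i (𝓕 χ)) volume 0 t :=
    ((h i (𝓕 χ)).1).mono_set (by
      rw [uIcc_of_le ht.1, uIcc_of_le (ht.1.trans ht.2)]; exact hsub)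
  have e0 := (h 0 (𝓕 (mulX 1 φ))).2 t ht
  have e1 := (h 1 (𝓕 (mulX 0 φ))).2 t ht
  have key : ∫ τ in (0 : ℝ)..t, ∫ ξ, φ ξ * curlHat (G τ) ξ
      = (∫ τ in (0 : ℝ)..t, R τ 1 (𝓕 (mulX 0 φ))) - ∫ τ in (0 : ℝ)..t, R τ 0 (𝓕 (mulX 1 φ)) := by
    rw [← intervalIntegral.integral_sub (hii _ _) (hii _ _)]
    apply intervalIntegral.integral_congr_ae
    have := ae_imp_of_ae_restrict hR
    filter_upwards [this] with τ hτ hτt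
    rw [uIoc_of_le ht.1] at hτt
    have hτ' := hτ (hsub (Ioc_subset_Icc_self hτt))
    rw [integral_curlHat φ (hτ' 0 _).1 (hτ' 1 _).1, (hτ' 0 _).2, (hτ' 1 _).2, hcomm]
    ring
  rw [hV t, hV 0, key]
  simp only at e0 e1
  rw [e0, e1]
  ring

/-! ### Weighted curls as continuous curves in `L²`. -/

/-- Multiplication by a bounded function as an operator on `L²`. -/
def mulOp (m : Plane → ℂ) (hm : MemLp m ∞) : L2C →L[ℂ] L2C :=
  (ContinuousLinearMap.mul ℂ ℂ).holderL volume ∞ 2 2 (hm.toLp m)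

lemma mulOp_ae (m : Plane → ℂ) (hm : MemLp m ∞) (f : L2C) :
    mulOp m hm f =ᵐ[volume] fun ξ ↦ m ξ * f ξ := by
  unfold mulOp
  rw [ContinuousLinearMap.holderL_apply_apply]
  filter_upwards [(ContinuousLinearMap.mul ℂ ℂ).coeFn_holder (r := 2) (hm.toLp m) f,
    hm.coeFn_toLp] with ξ h1 h2
  rw [h1, h2]; rfl

lemma memLp_weight_conv {a : Plane → ℂ} (ha : MemLp a 2) (f g : L2C) :
    MemLp (fun ξ ↦ a ξ * conv f g ξ) 2 := by
  refine ha.of_le_mul (c := ‖f‖ * ‖g‖)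
    (ha.1.mul (stronglyMeasurable_conv f g).aestronglyMeasurable) (.of_forall fun ξ ↦ ?_)
  rw [norm_mul, mul_comm]
  exact mul_le_mul_of_nonneg_right (norm_conv_le f g ξ) (norm_nonneg _)

lemma conv_congr_left {f f' g : Plane → ℂ} (h : f =ᵐ[volume] f') : conv f g = conv f' g := by
  ext ξ
  apply integral_congr_ae
  filter_upwards [h] with η hη
  rw [hη]

lemma conv_congr_right {f g g' : Plane → ℂ} (h : g =ᵐ[volume] g') : conv f g = conv f g' := by
  ext ξ
  apply integral_congr_ae
  filter_upwards [(volume.measurePreserving_sub_left ξ).quasiMeasurePreserving.ae h] with η hη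
  rw [hη]

/-- The bilinear map `(f, g) ↦ a · (f ⋆ g)` on `L²`, for a square integrable weight `a`. -/
def weightConv (a : Plane → ℂ) (ha : MemLp a 2) : L2C →L[ℂ] L2C →L[ℂ] L2C :=
  LinearMap.mkContinuous₂ (LinearMap.mk₂ ℂ (fun f g ↦ (memLp_weight_conv ha f g).toLp)
    (fun f f' g ↦ by
      rw [← MemLp.toLp_add]
      apply MemLp.toLp_congr
      refine .of_forall fun ξ ↦ ?_
      simp only [Pi.add_apply]
      rw [conv_congr_left (Lp.coeFn_add f f'), ← mul_add]
      congr 1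
      rw [conv, conv, conv, ← integral_add (integrable_conv f g ξ) (integrable_conv f' g ξ)]
      congr 1; ext η; simp only [Pi.add_apply]; ring)
    (fun c f g ↦ by
      rw [← MemLp.toLp_const_smul]
      apply MemLp.toLp_congr
      refine .of_forall fun ξ ↦ ?_
      simp only [Pi.smul_apply, smul_eq_mul]
      rw [conv_congr_left (Lp.coeFn_smul c f), mul_left_comm]
      congr 1
      rw [conv, conv, ← integral_const_mul]
      congr 1; ext η; simp only [Pi.smul_apply, smul_eq_mul]; ring)
    (fun f g g' ↦ by
      rw [← MemLp.toLp_add]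
      apply MemLp.toLp_congr
      refine .of_forall fun ξ ↦ ?_
      simp only [Pi.add_apply]
      rw [conv_congr_right (Lp.coeFn_add g g'), ← mul_add]
      congr 1
      rw [conv, conv, conv, ← integral_add (integrable_conv f g ξ) (integrable_conv f g' ξ)]
      congr 1; ext η; simp only [Pi.add_apply]; ring)
    (fun c f g ↦ by
      rw [← MemLp.toLp_const_smul]
      apply MemLp.toLp_congr
      refine .of_forall fun ξ ↦ ?_
      simp only [Pi.smul_apply, smul_eq_mul]
      rw [conv_congr_right (Lp.coeFn_smul c g), mul_left_comm]
      congr 1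
      rw [conv, conv, ← integral_const_mul]
      congr 1; ext η; simp only [Pi.smul_apply, smul_eq_mul]; ring)) ‖ha.toLp a‖
    (fun f g ↦ by
      rw [LinearMap.mk₂_apply]
      have : ‖(memLp_weight_conv ha f g).toLp‖ ≤ (‖f‖ * ‖g‖) * ‖ha.toLp a‖ := by
        apply Lp.norm_le_mul_norm_of_ae_le_mul
        filter_upwards [(memLp_weight_conv ha f g).coeFn_toLp, ha.coeFn_toLp] with ξ h1 h2
        rw [h1, h2, norm_mul, mul_comm]
        exact mul_le_mul_of_nonneg_right (norm_conv_le f g ξ) (norm_nonneg _)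
      linarith)

lemma weightConv_ae (a : Plane → ℂ) (ha : MemLp a 2) (f g : L2C) :
    weightConv a ha f g =ᵐ[volume] fun ξ ↦ a ξ * conv f g ξ :=
  (memLp_weight_conv ha f g).coeFn_toLp

/-- The square decays like `|ξ|^(2s)`, which is integrable at infinity in the plane when `2s < -2`.
-/
lemma memLp_jap {s : ℝ} (hs : s < -1) : MemLp (jap s) 2 := by
  rw [memLp_two_iff_integrable_sq (continuous_jap s).aestronglyMeasurable]
  have := integrable_rpow_neg_one_add_norm_sq (E := Plane) (μ := volume) (r := -2 * s)
    (by simp; linarith)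
  refine this.congr (.of_forall fun ξ ↦ ?_)
  simp only [jap]
  rw [← Real.rpow_mul_natCast (by positivity)]
  congr 1; push_cast; ring

lemma norm_coord_le (ξ : Plane) (i : Fin 2) : ‖(ξ i : ℂ)‖ ≤ ‖ξ‖ := by
  rw [Complex.norm_real]; exact PiLp.norm_apply_le ξ i

lemma norm_le_jap (ξ : Plane) : ‖ξ‖ ≤ jap 1 ξ := by
  simpa using norm_rpow_le_jap (a := 1) zero_le_one le_rfl ξ

lemma jap_nonneg (s : ℝ) (ξ : Plane) : 0 ≤ jap s ξ := (jap_pos s ξ).le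

lemma continuous_coord (i : Fin 2) : Continuous fun ξ : Plane ↦ (ξ i : ℂ) := by fun_prop

lemma continuous_japC (s : ℝ) : Continuous fun ξ : Plane ↦ (jap s ξ : ℂ) :=
  Complex.continuous_ofReal.comp (continuous_jap s)

/-- The convolution is merely bounded, so the weight has to supply all the decay. One coordinate
comes from the divergence form of advection and one from the curl, hence `jap (2 - m)` must be
square integrable: `2 - m < -1`. -/
lemma exists_weighted_coord_conv {m : ℝ} (hm : 3 < m) {f g : ℝ → L2C} (hf : Continuous f)
    (hg : Continuous g) (p j : Fin 2) :
    ∃ γ : ℝ → L2C, Continuous γ ∧ ∀ t, γ t =ᵐ[volume] fun ξ ↦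
      (jap (-m) ξ : ℂ) * ((ξ p : ℂ) * ((ξ j : ℂ) * conv (f t) (g t) ξ)) := by
  have ha : MemLp (fun ξ : Plane ↦ (jap (-m) ξ : ℂ) * ((ξ p : ℂ) * (ξ j : ℂ))) 2 := by
    refine (memLp_jap (s := 2 - m) (by linarith)).of_le_mul (c := 1) ?_ (.of_forall fun ξ ↦ ?_)
    · exact ((continuous_japC _).mul
        ((continuous_coord p).mul (continuous_coord j))).aestronglyMeasurable
    · rw [norm_mul, norm_mul, one_mul, Complex.norm_real, Real.norm_of_nonneg (jap_nonneg _ _),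
        Real.norm_of_nonneg (jap_nonneg _ _), show (2 - m : ℝ) = -m + (1 + 1) by ring, jap_add,
        jap_add]
      have h1 := (norm_coord_le ξ p).trans (norm_le_jap ξ)
      have h2 := (norm_coord_le ξ j).trans (norm_le_jap ξ)
      have := jap_nonneg (-m) ξ
      have := jap_nonneg 1 ξ
      gcongr
  refine ⟨fun t ↦ weightConv _ ha (f t) (g t), ?_, fun t ↦ ?_⟩
  · exact ((weightConv _ ha).continuous.comp hf).clm_apply hg
  · filter_upwards [weightConv_ae _ ha (f t) (g t)] with ξ h
    rw [h]; ring

lemma exists_weighted_advHat {m : ℝ} (hm : 3 < m) {V W : ℝ → Fin 2 → L2C}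
    (hV : ∀ i, Continuous fun t ↦ V t i) (hW : ∀ i, Continuous fun t ↦ W t i) (p i : Fin 2) :
    ∃ γ : ℝ → L2C, Continuous γ ∧ ∀ t, γ t =ᵐ[volume] fun ξ ↦
      (jap (-m) ξ : ℂ) * ((ξ p : ℂ) * advHat (V t) (W t) i ξ) := by
  obtain ⟨γ0, h0, e0⟩ := exists_weighted_coord_conv hm (hV 0) (hW i) p 0
  obtain ⟨γ1, h1, e1⟩ := exists_weighted_coord_conv hm (hV 1) (hW i) p 1
  have hc : Continuous fun t ↦ γ0 t + γ1 t := h0.add h1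
  refine ⟨fun t ↦ (2 * Real.pi * Complex.I) • (γ0 t + γ1 t), (continuous_const_smul _).comp hc, fun t ↦ ?_⟩
  filter_upwards [e0 t, e1 t, Lp.coeFn_smul (2 * Real.pi * Complex.I) (γ0 t + γ1 t),
    Lp.coeFn_add (γ0 t) (γ1 t)] with ξ a0 a1 a2 a3
  rw [a2, Pi.smul_apply, a3, Pi.add_apply, a0, a1, advHat, Fin.sum_univ_two, smul_eq_mul]
  ring

lemma memLp_top_of_norm_le {m : Plane → ℂ} (hm : AEStronglyMeasurable m volume) {C : ℝ}
    (h : ∀ ξ, ‖m ξ‖ ≤ C) : MemLp m ∞ := memLp_top_of_bound hm C (.of_forall h)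

lemma exists_weighted_lam {m a : ℝ} (ha : 0 ≤ a) (hm : 1 + a ≤ m) {f : ℝ → L2C}
    (hf : Continuous f) (p : Fin 2) :
    ∃ γ : ℝ → L2C, Continuous γ ∧ ∀ t, γ t =ᵐ[volume] fun ξ ↦
      (jap (-m) ξ : ℂ) * ((ξ p : ℂ) * (((lam ξ ^ a : ℝ) : ℂ) * f t ξ)) := by
  have hb : MemLp (fun ξ : Plane ↦ (jap (-m) ξ : ℂ) * ((ξ p : ℂ) * ((lam ξ ^ a : ℝ) : ℂ))) ∞ := by
    refine memLp_top_of_norm_le (C := (2 * Real.pi) ^ a) ?_ fun ξ ↦ ?_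
    · exact (continuous_japC _).aestronglyMeasurable.mul
        ((continuous_coord p).aestronglyMeasurable.mul
        (Complex.measurable_ofReal.comp (measurable_lam_rpow a)).aestronglyMeasurable)
    · rw [norm_mul, norm_mul, Complex.norm_real, Complex.norm_real (lam ξ ^ a),
        Real.norm_of_nonneg (jap_nonneg _ _),
        Real.norm_of_nonneg (Real.rpow_nonneg (lam_nonneg _) _)]
      have h1 := (norm_coord_le ξ p).trans (norm_le_jap ξ)
      have h2 := lam_rpow_le_jap (a := a) (s := m - 1) ha (by linarith) ξ
      have h3 := jap_nonneg (-m) ξ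
      have h4 : (0 : ℝ) ≤ lam ξ ^ a := Real.rpow_nonneg (lam_nonneg _) _
      calc _ ≤ jap (-m) ξ * (jap 1 ξ * ((2 * Real.pi) ^ a * jap (m - 1) ξ)) := by
            gcongr
            exact jap_nonneg _ _
        _ = (2 * Real.pi) ^ a * (jap (-m + 1 + (m - 1)) ξ) := by rw [jap_add, jap_add]; ring
        _ = _ := by rw [show -m + 1 + (m - 1) = 0 by ring, jap_zero, mul_one]
  refine ⟨fun t ↦ mulOp _ hb (f t), (mulOp _ hb).continuous.comp hf, fun t ↦ ?_⟩
  filter_upwards [mulOp_ae _ hb (f t)] with ξ h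
  rw [h]; ring

/-- `γ` represents the weighted curls of the functions `G t`. -/
def CurlRep (m : ℝ) (G : ℝ → Fin 2 → Plane → ℂ) (γ : ℝ → L2C) : Prop :=
  Continuous γ ∧ ∀ t, γ t =ᵐ[volume] fun ξ ↦ (jap (-m) ξ : ℂ) * curlHat (G t) ξ

/-- A weight of large negative order turns the curls of the fields and of the right-hand sides into
continuous `L²`-valued curves, for which integrals and derivatives in time are elementary. -/
lemma exists_curlRep_self {m : ℝ} (hm : 1 ≤ m) {V : ℝ → Fin 2 → L2C}
    (hV : ∀ i, Continuous fun t ↦ V t i) : ∃ γ, CurlRep m (fun t i ↦ V t i) γ := by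
  obtain ⟨γ0, h0, e0⟩ := exists_weighted_lam (a := 0) (m := m) le_rfl (by linarith) (hV 1) 0
  obtain ⟨γ1, h1, e1⟩ := exists_weighted_lam (a := 0) (m := m) le_rfl (by linarith) (hV 0) 1
  refine ⟨fun t ↦ γ0 t - γ1 t, h0.sub h1, fun t ↦ ?_⟩
  filter_upwards [e0 t, e1 t, Lp.coeFn_sub (γ0 t) (γ1 t)] with ξ a0 a1 a3
  rw [a3, Pi.sub_apply, a0, a1, curlHat, Real.rpow_zero]
  push_cast; ring

lemma exists_curlRep_rhsU {m α : ℝ} (hα : 0 ≤ α) (hm : 3 < m) (hm' : 1 + 2 * α ≤ m)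
    {U B : ℝ → Fin 2 → L2C}
    (hU : ∀ i, Continuous fun t ↦ U t i) (hB : ∀ i, Continuous fun t ↦ B t i) :
    ∃ γ, CurlRep m (fun t ↦ rhsU α (U t) (B t)) γ := by
  choose γ1 h1 e1 using fun p i ↦ exists_weighted_advHat hm hU hU p i
  choose γ2 h2 e2 using fun p i ↦ exists_weighted_advHat hm hB hB p i
  choose γ3 h3 e3 using fun (p i : Fin 2) ↦
    exists_weighted_lam (a := 2 * α) (m := m) (by linarith) hm' (hU i) p
  have h3' (p i : Fin 2) : Continuous fun t ↦ viscosity α • γ3 p i t :=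
    (continuous_const_smul _).comp (h3 p i)
  have h4 (p i : Fin 2) : Continuous fun t ↦ γ2 p i t - γ1 p i t - viscosity α • γ3 p i t :=
    ((h2 p i).sub (h1 p i)).sub (h3' p i)
  refine ⟨fun t ↦ (γ2 0 1 t - γ1 0 1 t - viscosity α • γ3 0 1 t)
    - (γ2 1 0 t - γ1 1 0 t - viscosity α • γ3 1 0 t), (h4 0 1).sub (h4 1 0), fun t ↦ ?_⟩
  filter_upwards [e1 0 1 t, e1 1 0 t, e2 0 1 t, e2 1 0 t, e3 0 1 t, e3 1 0 t,
    Lp.coeFn_sub (γ2 0 1 t - γ1 0 1 t - viscosity α • γ3 0 1 t)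
      (γ2 1 0 t - γ1 1 0 t - viscosity α • γ3 1 0 t),
    Lp.coeFn_sub (γ2 0 1 t - γ1 0 1 t) (viscosity α • γ3 0 1 t),
    Lp.coeFn_sub (γ2 1 0 t - γ1 1 0 t) (viscosity α • γ3 1 0 t),
    Lp.coeFn_sub (γ2 0 1 t) (γ1 0 1 t), Lp.coeFn_sub (γ2 1 0 t) (γ1 1 0 t),
    Lp.coeFn_smul (viscosity α) (γ3 0 1 t), Lp.coeFn_smul (viscosity α) (γ3 1 0 t)]
    with ξ a1 a2 a3 a4 a5 a6 b1 b2 b3 b4 b5 b6 b7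
  rw [b1, Pi.sub_apply, b2, b3, Pi.sub_apply, Pi.sub_apply, b4, b5, Pi.sub_apply, Pi.sub_apply,
    b6, b7, Pi.smul_apply, Pi.smul_apply, a1, a2, a3, a4, a5, a6, curlHat, rhsU, rhsU,
    smul_eq_mul, smul_eq_mul]
  ring

lemma exists_curlRep_rhsB {m β : ℝ} (hβ : 0 ≤ β) (hm : 3 < m) (hm' : 1 + 2 * β ≤ m)
    {U B : ℝ → Fin 2 → L2C}
    (hU : ∀ i, Continuous fun t ↦ U t i) (hB : ∀ i, Continuous fun t ↦ B t i) :
    ∃ γ, CurlRep m (fun t ↦ rhsB β (U t) (B t)) γ := by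
  choose γ1 h1 e1 using fun p i ↦ exists_weighted_advHat hm hU hB p i
  choose γ2 h2 e2 using fun p i ↦ exists_weighted_advHat hm hB hU p i
  choose γ3 h3 e3 using fun (p i : Fin 2) ↦
    exists_weighted_lam (a := 2 * β) (m := m) (by linarith) hm' (hB i) p
  refine ⟨fun t ↦ (γ2 0 1 t - γ1 0 1 t - γ3 0 1 t) - (γ2 1 0 t - γ1 1 0 t - γ3 1 0 t),
    (((h2 0 1).sub (h1 0 1)).sub (h3 0 1)).sub
      (((h2 1 0).sub (h1 1 0)).sub (h3 1 0)), fun t ↦ ?_⟩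
  filter_upwards [e1 0 1 t, e1 1 0 t, e2 0 1 t, e2 1 0 t, e3 0 1 t, e3 1 0 t,
    Lp.coeFn_sub (γ2 0 1 t - γ1 0 1 t - γ3 0 1 t) (γ2 1 0 t - γ1 1 0 t - γ3 1 0 t),
    Lp.coeFn_sub (γ2 0 1 t - γ1 0 1 t) (γ3 0 1 t),
    Lp.coeFn_sub (γ2 1 0 t - γ1 1 0 t) (γ3 1 0 t),
    Lp.coeFn_sub (γ2 0 1 t) (γ1 0 1 t), Lp.coeFn_sub (γ2 1 0 t) (γ1 1 0 t)]
    with ξ a1 a2 a3 a4 a5 a6 b1 b2 b3 b4 b5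
  rw [b1, Pi.sub_apply, b2, b3, Pi.sub_apply, Pi.sub_apply, b4, b5, Pi.sub_apply, Pi.sub_apply,
    a1, a2, a3, a4, a5, a6, curlHat, rhsB, rhsB]
  ring

/-! ### Energy identities obtained from the curl equation. -/

/-- `|V|²` for a pair of functions. -/
def sq (V : Fin 2 → Plane → ℂ) (ξ : Plane) : ℝ := ‖V 0 ξ‖ ^ 2 + ‖V 1 ξ‖ ^ 2

/-- The real part of `∑ conj(Vᵢ) Gᵢ`. -/
def rdot (V G : Fin 2 → Plane → ℂ) (ξ : Plane) : ℝ :=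
  ((starRingEnd ℂ) (V 0 ξ) * G 0 ξ + (starRingEnd ℂ) (V 1 ξ) * G 1 ξ).re

lemma norm_plane_sq (ξ : Plane) : ‖ξ‖ ^ 2 = ξ 0 ^ 2 + ξ 1 ^ 2 := by
  rw [EuclideanSpace.norm_sq_eq]; simp

/-- A divergence free `V` is parallel to the rotation of `ξ`, and the curl is the component in that
direction times `‖ξ‖`. Hence only the curl of `G` enters its product with `V`, and the pressure-free
equation suffices for energy balances. -/
lemma conj_curlHat_mul_curlHat {V G : Fin 2 → Plane → ℂ} {ξ : Plane}
    (h : (ξ 0 : ℂ) * V 0 ξ + (ξ 1 : ℂ) * V 1 ξ = 0) :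
    (starRingEnd ℂ) (curlHat V ξ) * curlHat G ξ
      = ((‖ξ‖ ^ 2 : ℝ) : ℂ)
        * ((starRingEnd ℂ) (V 0 ξ) * G 0 ξ + (starRingEnd ℂ) (V 1 ξ) * G 1 ξ) := by
  have h' := congrArg (starRingEnd ℂ) h
  simp only [map_add, map_mul, Complex.conj_ofReal, map_zero] at h'
  rw [norm_plane_sq]
  simp only [curlHat, map_sub, map_mul, Complex.conj_ofReal]
  push_cast
  linear_combination (-(ξ 0 : ℂ) * G 0 ξ - (ξ 1 : ℂ) * G 1 ξ) * h'

/-- The weighted curl is a primitive in time of the weighted curl of the right-hand side. -/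
lemma curlRep_eq_integral {S m : ℝ} {V : ℝ → Fin 2 → L2C} {G : ℝ → Fin 2 → Plane → ℂ}
    {q γ : ℝ → L2C} (hE : CurlEq S V G) (hq : CurlRep m (fun t i ↦ V t i) q)
    (hγ : CurlRep m G γ) {t : ℝ} (ht : t ∈ Icc 0 S) : q t = q 0 + ∫ τ in (0 : ℝ)..t, γ τ := by
  have hpair (f : L2C) (φ : 𝓢(Plane, ℂ)) : ∫ ξ, φ ξ * f ξ
      = (ContinuousLinearMap.mul ℂ ℂ).lpPairing volume 2 2 (φ.toLp 2 volume) f := by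
    rw [ContinuousLinearMap.lpPairing_eq_integral]
    apply integral_congr_ae
    filter_upwards [φ.coeFn_toLp 2 volume] with x hx
    rw [hx]; rfl
  apply Lp.ext
  apply ae_eq_of_integral_schwartz ((Lp.memLp _).locallyIntegrable (by norm_num))
    ((Lp.memLp _).locallyIntegrable (by norm_num))
  intro φ
  have hjap : (fun ξ : Plane ↦ (jap (-m) ξ : ℂ)).HasTemperateGrowth := by
    unfold jap; fun_prop
  -- The weight is absorbed by the test function, to which `CurlEq` applies directly.
  set ψ : 𝓢(Plane, ℂ) := SchwartzMap.smulLeftCLM ℂ (fun ξ : Plane ↦ (jap (-m) ξ : ℂ)) φ with hψ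
  have hψ' : ∀ ξ, ψ ξ = (jap (-m) ξ : ℂ) * φ ξ := fun ξ ↦ by
    rw [hψ, SchwartzMap.smulLeftCLM_apply_apply hjap]; rfl
  have h1 (s : ℝ) : ∫ ξ, φ ξ * q s ξ = ∫ ξ, ψ ξ * curlHat (fun i ↦ V s i) ξ := by
    apply integral_congr_ae
    filter_upwards [hq.2 s] with ξ hξ
    rw [hξ, hψ']; ring
  have h2 (s : ℝ) : ∫ ξ, φ ξ * γ s ξ = ∫ ξ, ψ ξ * curlHat (G s) ξ := by
    apply integral_congr_ae
    filter_upwards [hγ.2 s] with ξ hξ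
    rw [hξ, hψ']; ring
  rw [h1, hE ψ t ht, ← h1]
  simp_rw [← h2]
  rw [hpair (q 0 + _), map_add, ← hpair,
    ← ContinuousLinearMap.intervalIntegral_comp_comm _ (hγ.1.intervalIntegrable 0 t)]
  simp_rw [hpair]

lemma integral_conj_mul_eq_inner (f g : L2C) :
    ∫ ξ, (starRingEnd ℂ) (f ξ) * g ξ = inner ℂ f g := by
  rw [L2.inner_def]
  simp [mul_comm]

/-- The energy identity for a bounded weight supported in an annulus. -/
lemma energy_trunc {S m : ℝ} {V : ℝ → Fin 2 → L2C} {G : ℝ → Fin 2 → Plane → ℂ}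
    {q γ : ℝ → L2C} (hE : CurlEq S V G) (hq : CurlRep m (fun t i ↦ V t i) q)
    (hγ : CurlRep m G γ)
    (hdiv : ∀ t, ∀ᵐ ξ, (ξ 0 : ℂ) * V t 0 ξ + (ξ 1 : ℂ) * V t 1 ξ = 0)
    {w : Plane → ℝ} (hw : Measurable w) {C c R : ℝ} (hc : 0 < c) (hwC : ∀ ξ, |w ξ| ≤ C)
    (hsupp : ∀ ξ, w ξ ≠ 0 → c ≤ ‖ξ‖ ∧ ‖ξ‖ ≤ R) :
    ∃ D : ℝ → ℝ, Continuous D ∧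
      (∀ t ∈ Icc 0 S, D t = ∫ ξ, w ξ * rdot (fun i ↦ V t i) (G t) ξ) ∧
      ∀ t ∈ Icc 0 S, ∫ ξ, w ξ * sq (fun i ↦ V t i) ξ
        = (∫ ξ, w ξ * sq (fun i ↦ V 0 i) ξ) + 2 * ∫ τ in (0 : ℝ)..t, D τ := by
  -- `μ` undoes the weight `jap (-m)` on both factors and the factor `‖ξ‖²` from
  -- `conj_curlHat_mul_curlHat`. It is bounded because `w` lives in an annulus.
  set μ : Plane → ℂ := fun ξ ↦ ((w ξ * (‖ξ‖ ^ 2)⁻¹ * (jap m ξ) ^ 2 : ℝ) : ℂ) with hμ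
  have hμm : MemLp μ ∞ := by
    refine memLp_top_of_norm_le (C := |C| * (c ^ 2)⁻¹ * ((1 + R ^ 2) ^ (|m| / 2)) ^ 2) ?_ fun ξ ↦ ?_
    · refine (Complex.measurable_ofReal.comp ?_).aestronglyMeasurable
      exact (hw.mul (by fun_prop)).mul ((continuous_jap m).measurable.pow_const 2)
    · by_cases h0 : w ξ = 0
      · simp only [hμ, h0, zero_mul, Complex.ofReal_zero, norm_zero]; positivity
      obtain ⟨h1, h2⟩ := hsupp ξ h0
      have hR : ‖ξ‖ ^ 2 ≤ R ^ 2 := by gcongr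
      have hj : jap m ξ ≤ (1 + R ^ 2) ^ (|m| / 2) :=
        (jap_mono (le_abs_self m) ξ).trans
          (Real.rpow_le_rpow (by positivity) (by linarith) (by positivity))
      have hj0 := jap_nonneg m ξ
      rw [hμ, Complex.norm_real, norm_mul, norm_mul, Real.norm_eq_abs,
        Real.norm_of_nonneg (by positivity : (0 : ℝ) ≤ (‖ξ‖ ^ 2)⁻¹),
        Real.norm_of_nonneg (by positivity : (0 : ℝ) ≤ jap m ξ ^ 2)]
      have hw' : |w ξ| ≤ |C| := (hwC ξ).trans (le_abs_self C)
      have hb : 0 ≤ |C| := abs_nonneg C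
      generalize |w ξ| = a at hw'
      generalize |C| = b at hw' hb
      gcongr
  set M := mulOp μ hμm
  -- `Q` agrees with `q` on `[0, S]` but is differentiable on the whole line, which avoids one-sided
  -- derivatives at the endpoints.
  set Q : ℝ → L2C := fun t ↦ q 0 + ∫ τ in (0 : ℝ)..t, γ τ with hQ
  have hQq : ∀ t ∈ Icc 0 S, q t = Q t := fun t ht ↦ curlRep_eq_integral hE hq hγ ht
  have hQd : ∀ t, HasDerivAt Q (γ t) t := fun t ↦
    ((intervalIntegral.integral_hasDerivAt_right (hγ.1.intervalIntegrable 0 t)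
      (hγ.1.stronglyMeasurableAtFilter _ _) hγ.1.continuousAt)).const_add _
  -- The multiplier is real, hence symmetric; the two terms of the product rule therefore have the
  -- same real part.
  have hsymm (f g : L2C) : inner ℂ (M f) g = inner ℂ f (M g) := by
    rw [← integral_conj_mul_eq_inner, ← integral_conj_mul_eq_inner]
    apply integral_congr_ae
    filter_upwards [mulOp_ae μ hμm f, mulOp_ae μ hμm g] with ξ h1 h2
    rw [h1, h2, map_mul, hμ, Complex.conj_ofReal]; ring
  have hQc : Continuous Q := continuous_iff_continuousAt.2 fun t ↦ (hQd t).continuousAt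
  have hMQ : Continuous fun t ↦ M (Q t) := M.continuous.comp hQc
  have hjj (ξ : Plane) : (jap m ξ : ℂ) * (jap (-m) ξ : ℂ) = 1 := by
    exact_mod_cast jap_mul_neg m ξ
  have hform (t : ℝ) (H : Fin 2 → Plane → ℂ) (g : L2C)
      (hg : g =ᵐ[volume] fun ξ ↦ (jap (-m) ξ : ℂ) * curlHat H ξ) :
      (inner ℂ (M (q t)) g).re = ∫ ξ, w ξ * rdot (fun i ↦ V t i) H ξ := by
    rw [← integral_conj_mul_eq_inner]
    have hi : Integrable fun ξ ↦ (starRingEnd ℂ) (M (q t) ξ) * g ξ :=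
      MemLp.integrable_mul (p := 2) (q := 2) (Lp.memLp (M (q t))).star (Lp.memLp g)
    rw [← RCLike.re_eq_complex_re, ← integral_re hi]
    apply integral_congr_ae
    filter_upwards [mulOp_ae μ hμm (q t), hq.2 t, hg, hdiv t] with ξ h1 h2 h3 h4
    rw [h1, h2, h3]
    by_cases h0 : w ξ = 0
    · simp [hμ, h0]
    have hξ : ‖ξ‖ ≠ 0 := (hc.trans_le (hsupp ξ h0).1).ne'
    have e1 := conj_curlHat_mul_curlHat (V := fun i ↦ (V t i : Plane → ℂ)) (G := H) h4
    have e2 : (starRingEnd ℂ) (μ ξ * ((jap (-m) ξ : ℂ) * curlHat (fun i ↦ V t i) ξ))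
        * ((jap (-m) ξ : ℂ) * curlHat H ξ)
        = (w ξ : ℂ) * ((starRingEnd ℂ) (V t 0 ξ) * H 0 ξ + (starRingEnd ℂ) (V t 1 ξ) * H 1 ξ) := by
      have hξ' : (‖ξ‖ : ℂ) ≠ 0 := by exact_mod_cast hξ
      calc _ = (w ξ : ℂ) * ((‖ξ‖ : ℂ) ^ 2)⁻¹ * ((jap m ξ : ℂ) * (jap (-m) ξ : ℂ)) ^ 2
            * ((starRingEnd ℂ) (curlHat (fun i ↦ V t i) ξ) * curlHat H ξ) := by
              simp only [hμ, map_mul, Complex.conj_ofReal]; push_cast; ring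
        _ = _ := by
              rw [hjj, e1]; push_cast; field_simp
    rw [e2]
    simp [rdot]
  have hself (t : ℝ) : ∫ ξ, w ξ * rdot (fun i ↦ V t i) (fun i ↦ V t i) ξ
      = ∫ ξ, w ξ * sq (fun i ↦ V t i) ξ := by
    congr 1; ext ξ; congr 1
    simp only [rdot, sq, Complex.add_re, Complex.conj_mul']
    norm_cast
  refine ⟨fun t ↦ (inner ℂ (M (Q t)) (γ t)).re,
    Complex.continuous_re.comp (hMQ.inner hγ.1), fun t ht ↦ ?_, fun t ht ↦ ?_⟩
  · show (inner ℂ (M (Q t)) (γ t)).re = _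
    rw [← hQq t ht, hform t (G t) (γ t) (hγ.2 t)]
  · have hd (s : ℝ) : HasDerivAt (fun t ↦ (inner ℂ (M (Q t)) (Q t)).re)
        (2 * (inner ℂ (M (Q s)) (γ s)).re) s := by
      have hMd : HasDerivAt (fun t ↦ M (Q t)) (M (γ s)) s :=
        (M.restrictScalars ℝ).hasFDerivAt.comp_hasDerivAt s (hQd s)
      have h1 := (hMd.inner ℂ (hQd s))
      have h2 := Complex.reCLM.hasFDerivAt.comp_hasDerivAt s h1
      refine h2.congr_deriv ?_
      simp only [Complex.reCLM_apply, Complex.add_re]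
      rw [hsymm (γ s), ← inner_conj_symm (γ s), Complex.conj_re]
      ring
    have hc2 : Continuous fun s ↦ 2 * (inner ℂ (M (Q s)) (γ s)).re :=
      continuous_const.mul (Complex.continuous_re.comp (hMQ.inner hγ.1))
    have := intervalIntegral.integral_eq_sub_of_hasDerivAt (a := 0) (b := t)
      (fun s _ ↦ hd s) (hc2.intervalIntegrable _ _)
    rw [intervalIntegral.integral_const_mul] at this
    have ht0 : (0 : ℝ) ∈ Icc 0 S := ⟨le_rfl, ht.1.trans ht.2⟩
    have f1 := hform t (fun i ↦ V t i) (q t) (hq.2 t)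
    have f0 := hform 0 (fun i ↦ V 0 i) (q 0) (hq.2 0)
    rw [hself, hQq t ht] at f1
    rw [hself, hQq 0 ht0] at f0
    rw [← f1, ← f0, this]
    ring

/-- The energy identity for a general weight. -/
theorem energy_identity {S m : ℝ} {V : ℝ → Fin 2 → L2C} {G : ℝ → Fin 2 → Plane → ℂ}
    {q γ : ℝ → L2C} (hE : CurlEq S V G) (hq : CurlRep m (fun t i ↦ V t i) q)
    (hγ : CurlRep m G γ)
    (hdiv : ∀ t, ∀ᵐ ξ, (ξ 0 : ℂ) * V t 0 ξ + (ξ 1 : ℂ) * V t 1 ξ = 0)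
    {w : Plane → ℝ} (hw : Measurable w) (hw0 : ∀ ξ, 0 ≤ w ξ)
    (hsq : ∀ t ∈ Icc 0 S, Integrable fun ξ ↦ w ξ * sq (fun i ↦ V t i) ξ)
    {D : ℝ → ℝ} (hD : IntegrableOn D (Icc 0 S))
    (hdom : ∀ᵐ τ ∂(volume.restrict (Icc 0 S)),
      Integrable (fun ξ ↦ w ξ * rdot (fun i ↦ V τ i) (G τ) ξ) ∧
      ∫ ξ, ‖w ξ * rdot (fun i ↦ V τ i) (G τ) ξ‖ ≤ D τ) :
    IntegrableOn (fun τ ↦ ∫ ξ, w ξ * rdot (fun i ↦ V τ i) (G τ) ξ) (Icc 0 S) ∧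
    ∀ t ∈ Icc 0 S, ∫ ξ, w ξ * sq (fun i ↦ V t i) ξ
        = (∫ ξ, w ξ * sq (fun i ↦ V 0 i) ξ)
          + 2 * ∫ τ in (0 : ℝ)..t, ∫ ξ, w ξ * rdot (fun i ↦ V τ i) (G τ) ξ := by
  -- Cutting off low frequencies, high frequencies and large values of `w` puts each truncated
  -- weight within reach of `energy_trunc`; dominated convergence in `ξ` and then in time removes
  -- the cutoff.
  set A : ℕ → Set Plane := fun n ↦ {ξ | ((n : ℝ) + 1)⁻¹ ≤ ‖ξ‖ ∧ ‖ξ‖ ≤ n ∧ w ξ ≤ n} with hA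
  have hAm (n : ℕ) : MeasurableSet (A n) :=
    (measurableSet_le measurable_const measurable_norm).inter
      ((measurableSet_le measurable_norm measurable_const).inter
        (measurableSet_le hw measurable_const))
  set wn : ℕ → Plane → ℝ := fun n ↦ (A n).indicator w with hwn
  have hwn_le (n : ℕ) (ξ : Plane) : |wn n ξ| ≤ w ξ := by
    by_cases h : ξ ∈ A n
    · simp [hwn, h, abs_of_nonneg (hw0 ξ)]
    · simp [hwn, h, hw0 ξ]
  have hlim (f : Plane → ℝ) (hf : Integrable fun ξ ↦ w ξ * f ξ) :
      Filter.Tendsto (fun n ↦ ∫ ξ, wn n ξ * f ξ) Filter.atTop (nhds (∫ ξ, w ξ * f ξ)) := by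
    have hmeas (n : ℕ) : (fun ξ ↦ wn n ξ * f ξ) = (A n).indicator (fun ξ ↦ w ξ * f ξ) := by
      ext ξ; by_cases h : ξ ∈ A n <;> simp [hwn, h]
    refine tendsto_integral_of_dominated_convergence (fun ξ ↦ ‖w ξ * f ξ‖) (fun n ↦ ?_)
      hf.norm (fun n ↦ .of_forall fun ξ ↦ ?_) ?_
    · rw [hmeas]; exact hf.aestronglyMeasurable.indicator (hAm n)
    · rw [norm_mul, norm_mul, Real.norm_eq_abs, Real.norm_of_nonneg (hw0 ξ)]
      exact mul_le_mul_of_nonneg_right (hwn_le n ξ) (norm_nonneg _)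
    -- The origin is the only point that the sets `A n` never reach.
    · have hne : ∀ᵐ ξ : Plane, ξ ≠ 0 := by simp [ae_iff]
      filter_upwards [hne] with ξ hξ
      apply tendsto_const_nhds.congr'
      have hpos : 0 < ‖ξ‖ := norm_pos_iff.2 hξ
      filter_upwards [Filter.eventually_ge_atTop ⌈‖ξ‖⁻¹⌉₊, Filter.eventually_ge_atTop ⌈‖ξ‖⌉₊,
        Filter.eventually_ge_atTop ⌈w ξ⌉₊] with n h1 h2 h3
      have h1' := (Nat.ceil_le.1 h1)
      have : ξ ∈ A n := by
        refine ⟨?_, Nat.ceil_le.1 h2, Nat.ceil_le.1 h3⟩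
        rw [inv_le_comm₀ (by positivity) hpos]
        linarith
      simp [hwn, this]
  have htr (n : ℕ) := energy_trunc hE hq hγ hdiv (w := wn n) (hw.indicator (hAm n)) (C := n)
    (c := ((n : ℝ) + 1)⁻¹) (R := n) (by positivity)
    (fun ξ ↦ by
      by_cases h : ξ ∈ A n
      · simpa [hwn, h, abs_of_nonneg (hw0 ξ)] using h.2.2
      · simp [hwn, h])
    (fun ξ h ↦ by
      have : ξ ∈ A n := by by_contra h'; simp [hwn, h'] at h
      exact ⟨this.1, this.2.1⟩)
  choose Dn hDc hDe hDi using htr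
  have hbound (n : ℕ) : ∀ᵐ τ ∂(volume.restrict (Icc 0 S)), ‖Dn n τ‖ ≤ D τ := by
    filter_upwards [hdom, ae_restrict_mem measurableSet_Icc] with τ h hτ
    rw [hDe n τ hτ]
    refine (norm_integral_le_integral_norm _).trans (le_trans ?_ h.2)
    refine integral_mono_of_nonneg (.of_forall fun ξ ↦ norm_nonneg _) h.1.norm
      (.of_forall fun ξ ↦ ?_)
    simp only [norm_mul, Real.norm_eq_abs, abs_of_nonneg (hw0 ξ)]
    exact mul_le_mul_of_nonneg_right (hwn_le n ξ) (abs_nonneg _)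
  have hptw : ∀ᵐ τ ∂(volume.restrict (Icc 0 S)), Filter.Tendsto (fun n ↦ Dn n τ) Filter.atTop
      (nhds (∫ ξ, w ξ * rdot (fun i ↦ V τ i) (G τ) ξ)) := by
    filter_upwards [hdom, ae_restrict_mem measurableSet_Icc] with τ h hτ
    simp_rw [hDe _ τ hτ]
    exact hlim _ h.1
  have hint : IntegrableOn (fun τ ↦ ∫ ξ, w ξ * rdot (fun i ↦ V τ i) (G τ) ξ) (Icc 0 S) := by
    refine Integrable.mono' hD
      (aestronglyMeasurable_of_tendsto_ae _ (fun n ↦ (hDc n).aestronglyMeasurable) hptw) ?_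
    filter_upwards [hdom] with τ h
    exact (norm_integral_le_integral_norm _).trans h.2
  refine ⟨hint, fun t ht ↦ ?_⟩
  have hsub : Ioc 0 t ⊆ Icc 0 S := fun x hx ↦ ⟨hx.1.le, hx.2.trans ht.2⟩
  have hle : (volume.restrict (Ioc 0 t)) ≤ (volume.restrict (Icc 0 S)) :=
    Measure.restrict_mono hsub le_rfl
  have L1 := hlim _ (hsq t ht)
  have L0 := hlim _ (hsq 0 ⟨le_rfl, ht.1.trans ht.2⟩)
  have L2 : Filter.Tendsto (fun n ↦ ∫ τ in (0 : ℝ)..t, Dn n τ) Filter.atTop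
      (nhds (∫ τ in (0 : ℝ)..t, ∫ ξ, w ξ * rdot (fun i ↦ V τ i) (G τ) ξ)) := by
    simp_rw [intervalIntegral.integral_of_le ht.1]
    exact tendsto_integral_of_dominated_convergence D (fun n ↦ (hDc n).aestronglyMeasurable)
      (hD.mono_set hsub) (fun n ↦ ae_mono hle (hbound n)) (ae_mono hle hptw)
  refine tendsto_nhds_unique L1 ((L0.add (L2.const_mul 2)).congr fun n ↦ ?_)
  exact (hDi n t ht).symm

/-! ### Trilinear convolution forms of nonnegative functions. -/

/-- The `L²` norm of a nonnegative function. -/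
def n2 (F : Plane → ℝ≥0∞) : ℝ≥0∞ := (∫⁻ ξ, F ξ ^ 2) ^ (1 / 2 : ℝ)

/-- The trilinear form `∫∫ F(ζ) G(η) H(ζ + η)`. -/
def tri (F G H : Plane → ℝ≥0∞) : ℝ≥0∞ := ∫⁻ ζ, ∫⁻ η, F ζ * G η * H (ζ + η)

lemma lintegral_mul_le_n2 {F G : Plane → ℝ≥0∞} (hF : Measurable F) (hG : Measurable G) :
    ∫⁻ ξ, F ξ * G ξ ≤ n2 F * n2 G := by
  have := ENNReal.lintegral_mul_le_Lp_mul_Lq (volume : Measure Plane) Real.HolderConjugate.two_two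
    hF.aemeasurable hG.aemeasurable
  simpa [n2] using this

lemma n2_sq (F : Plane → ℝ≥0∞) : n2 F ^ 2 = ∫⁻ ξ, F ξ ^ 2 := by
  unfold n2
  rw [← ENNReal.rpow_natCast, ← ENNReal.rpow_mul]; simp

lemma n2_mono {F G : Plane → ℝ≥0∞} (h : ∀ ξ, F ξ ≤ G ξ) : n2 F ≤ n2 G := by
  unfold n2
  gcongr with ξ
  exact h ξ

lemma n2_const_mul (c : ℝ≥0∞) {F : Plane → ℝ≥0∞} (hF : Measurable F) :
    n2 (fun ξ ↦ c * F ξ) = c * n2 F := by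
  unfold n2
  simp_rw [mul_pow]
  rw [lintegral_const_mul _ (hF.pow_const 2), ENNReal.mul_rpow_of_nonneg _ _ (by norm_num),
    ← ENNReal.rpow_natCast, ← ENNReal.rpow_mul]
  simp

lemma measurable_tri_inner {F G H : Plane → ℝ≥0∞} (hF : Measurable F) (hG : Measurable G)
    (hH : Measurable H) :
    Measurable (Function.uncurry fun ζ η ↦ F ζ * G η * H (ζ + η)) := by
  unfold Function.uncurry
  fun_prop

lemma tri_comm {F G H : Plane → ℝ≥0∞} (hF : Measurable F) (hG : Measurable G)
    (hH : Measurable H) : tri F G H = tri G F H := by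
  unfold tri
  rw [lintegral_lintegral_swap (measurable_tri_inner hF hG hH).aemeasurable]
  simp_rw [mul_comm (F _) (G _), add_comm]

lemma tri_eq {F G H : Plane → ℝ≥0∞} (hF : Measurable F) (hG : Measurable G)
    (hH : Measurable H) : tri F G H = ∫⁻ ξ, H ξ * ∫⁻ ζ, F ζ * G (ξ - ζ) := by
  unfold tri
  have h1 (ζ : Plane) : ∫⁻ η, F ζ * G η * H (ζ + η) = ∫⁻ ξ, F ζ * G (ξ - ζ) * H ξ := by
    rw [← lintegral_sub_right_eq_self _ ζ]
    simp
  simp_rw [h1]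
  rw [lintegral_lintegral_swap (by unfold Function.uncurry; fun_prop)]
  congr 1; ext ξ
  rw [← lintegral_const_mul _ (by fun_prop)]
  congr 1; ext ζ; ring

/-- Reflection exchanges the roles of the last two functions. -/
lemma tri_reflect {F G H : Plane → ℝ≥0∞} (hG : ∀ᵐ ξ, G (-ξ) = G ξ)
    (hH : ∀ᵐ ξ, H (-ξ) = H ξ) : tri F G H = tri F H G := by
  unfold tri
  congr 1; ext ζ
  have h1 : ∫⁻ η, F ζ * G η * H (ζ + η) = ∫⁻ η, F ζ * G (-ζ - η) * H (ζ + (-ζ - η)) :=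
    (lintegral_sub_left_eq_self _ (-ζ)).symm
  rw [h1]
  apply lintegral_congr_ae
  have hG' : ∀ᵐ η, G (-(ζ + η)) = G (ζ + η) :=
    (measurePreserving_add_left volume ζ).quasiMeasurePreserving.ae hG
  filter_upwards [hG', hH] with η h2 h3
  rw [show -ζ - η = -(ζ + η) by abel, h2, show ζ + -(ζ + η) = -η by abel, h3]
  ring

lemma tri_mono {F F' G G' H H' : Plane → ℝ≥0∞} (hF : ∀ ξ, F ξ ≤ F' ξ) (hG : ∀ ξ, G ξ ≤ G' ξ)
    (hH : ∀ ξ, H ξ ≤ H' ξ) : tri F G H ≤ tri F' G' H' := by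
  unfold tri
  gcongr
  exacts [hF _, hG _, hH _]

/-- A weighted Cauchy–Schwarz bound for the trilinear form. -/
lemma tri_le_of_weight {a b F G H : Plane → ℝ≥0∞} (ha : Measurable a) (hb : Measurable b)
    (hF : Measurable F) (hG : Measurable G) (hH : Measurable H) {K : ℝ≥0∞}
    (hK : ∀ ξ, ∫⁻ ζ, a ζ ^ 2 * b (ξ - ζ) ^ 2 ≤ K ^ 2) :
    tri (fun ξ ↦ a ξ * F ξ) (fun ξ ↦ b ξ * G ξ) H ≤ K * n2 F * n2 G * n2 H := by
  rw [tri_eq (F := fun ξ ↦ a ξ * F ξ) (G := fun ξ ↦ b ξ * G ξ) (ha.mul hF) (hb.mul hG) hH]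
  -- For fixed `ξ`, Cauchy–Schwarz separates the weights, controlled by `K`, from the functions,
  -- collected in `P`. By Tonelli the norm of `P` is exactly `n2 F * n2 G`.
  set P : Plane → ℝ≥0∞ := fun ξ ↦ (∫⁻ ζ, (F ζ * G (ξ - ζ)) ^ 2) ^ (1 / 2 : ℝ) with hP
  have hPm : Measurable P := by
    refine Measurable.pow_const ?_ _
    exact Measurable.lintegral_prod_right' (f := fun p : Plane × Plane ↦
      (F p.2 * G (p.1 - p.2)) ^ 2) (by fun_prop)
  have h1 (ξ : Plane) : ∫⁻ ζ, a ζ * F ζ * (b (ξ - ζ) * G (ξ - ζ)) ≤ K * P ξ := by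
    calc _ = ∫⁻ ζ, (a ζ * b (ξ - ζ)) * (F ζ * G (ξ - ζ)) := by
          congr 1; ext ζ; ring
      _ ≤ n2 (fun ζ ↦ a ζ * b (ξ - ζ)) * n2 (fun ζ ↦ F ζ * G (ξ - ζ)) :=
          lintegral_mul_le_n2 (by fun_prop) (by fun_prop)
      _ ≤ K * P ξ := by
          refine mul_le_mul' ?_ le_rfl
          unfold n2
          simp_rw [mul_pow]
          calc _ ≤ (K ^ 2) ^ (1 / 2 : ℝ) := by gcongr; exact hK ξ
            _ = K := by
              rw [← ENNReal.rpow_natCast, ← ENNReal.rpow_mul]; simp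
  have h2 : n2 P = n2 F * n2 G := by
    unfold n2
    have : ∀ ξ, P ξ ^ 2 = ∫⁻ ζ, (F ζ * G (ξ - ζ)) ^ 2 := fun ξ ↦ by
      simp only [hP]
      rw [← ENNReal.rpow_natCast, ← ENNReal.rpow_mul]; simp
    simp_rw [this]
    rw [lintegral_lintegral_swap (by unfold Function.uncurry; fun_prop),
      ← ENNReal.mul_rpow_of_nonneg _ _ (by norm_num)]
    congr 1
    simp_rw [mul_pow]
    have h3 (ζ : Plane) : ∫⁻ ξ, F ζ ^ 2 * G (ξ - ζ) ^ 2 = F ζ ^ 2 * ∫⁻ ξ, G ξ ^ 2 := by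
      rw [lintegral_const_mul _ (by fun_prop), lintegral_sub_right_eq_self (fun ξ ↦ G ξ ^ 2)]
    simp_rw [h3]
    rw [lintegral_mul_const _ (by fun_prop)]
  calc _ ≤ ∫⁻ ξ, H ξ * (K * P ξ) := by
        gcongr with ξ; exact h1 ξ
    _ = K * ∫⁻ ξ, H ξ * P ξ := by
        rw [← lintegral_const_mul _ (by fun_prop)]; congr 1; ext ξ; ring
    _ ≤ K * (n2 H * n2 P) := by gcongr; exact lintegral_mul_le_n2 hH hPm
    _ = _ := by rw [h2]; ring

lemma ennreal_sqrt_sq (x : ℝ≥0∞) : (x ^ (1 / 2 : ℝ)) ^ 2 = x := by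
  rw [← ENNReal.rpow_natCast, ← ENNReal.rpow_mul]; simp

/-- Young's inequality with one integrable factor. -/
lemma tri_le_young {F G H : Plane → ℝ≥0∞} (hF : Measurable F) (hG : Measurable G)
    (hH : Measurable H) : tri F G H ≤ (∫⁻ ξ, F ξ) * n2 G * n2 H := by
  -- Writing `F` as the square of `f`, one copy of `f` serves as the weight and the other as the
  -- `L²` function.
  set f : Plane → ℝ≥0∞ := fun ξ ↦ F ξ ^ (1 / 2 : ℝ) with hf
  have hfm : Measurable f := hF.pow_const _
  have hff : ∀ ξ, f ξ ^ 2 = F ξ := fun ξ ↦ ennreal_sqrt_sq _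
  have h := tri_le_of_weight (a := f) (b := fun _ ↦ 1) hfm measurable_const hfm hG hH
    (K := (∫⁻ ξ, F ξ) ^ (1 / 2 : ℝ)) (fun ξ ↦ by rw [ennreal_sqrt_sq]; simp [hff])
  simp only [← pow_two, hff, one_mul] at h
  refine h.trans (le_of_eq ?_)
  have : n2 f = (∫⁻ ξ, F ξ) ^ (1 / 2 : ℝ) := by unfold n2; simp_rw [hff]
  rw [this, ← pow_two, ennreal_sqrt_sq]

/-- Bracket powers as extended nonnegative weights. -/
def ejap (s : ℝ) (ξ : Plane) : ℝ≥0∞ := ENNReal.ofReal (jap s ξ)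

lemma measurable_ejap (s : ℝ) : Measurable (ejap s) :=
  (continuous_jap s).measurable.ennreal_ofReal

lemma ejap_add (s t : ℝ) (ξ : Plane) : ejap (s + t) ξ = ejap s ξ * ejap t ξ := by
  unfold ejap; rw [jap_add, ENNReal.ofReal_mul (jap_nonneg _ _)]

lemma ejap_zero (ξ : Plane) : ejap 0 ξ = 1 := by simp [ejap, jap_zero]

lemma ejap_neg_mul (s : ℝ) (ξ : Plane) : ejap (-s) ξ * ejap s ξ = 1 := by
  rw [← ejap_add, neg_add_cancel, ejap_zero]

lemma ejap_mono {s t : ℝ} (h : s ≤ t) (ξ : Plane) : ejap s ξ ≤ ejap t ξ :=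
  ENNReal.ofReal_le_ofReal (jap_mono h ξ)

lemma n2_ejap_lt_top {s : ℝ} (hs : s < -1) : n2 (ejap s) < ∞ := by
  have h := (memLp_jap hs).2
  rw [eLpNorm_lt_top_iff_lintegral_rpow_enorm_lt_top (by norm_num) (by norm_num)] at h
  unfold n2
  refine ENNReal.rpow_lt_top_of_nonneg (by norm_num) (ne_of_lt ?_)
  refine lt_of_le_of_lt (le_of_eq ?_) h
  congr 1; ext ξ
  rw [ejap, Real.enorm_eq_ofReal (jap_nonneg _ _)]
  norm_cast

/-- Integrability of the Fourier transform of a function in `H^s`, `s > 1`. -/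
lemma lintegral_le_ejap {s : ℝ} {F : Plane → ℝ≥0∞} (hF : Measurable F) :
    ∫⁻ ξ, F ξ ≤ n2 (ejap (-s)) * n2 (fun ξ ↦ ejap s ξ * F ξ) := by
  refine le_trans (le_of_eq ?_) (lintegral_mul_le_n2 (measurable_ejap _)
    ((measurable_ejap s).mul hF))
  congr 1; ext ξ
  rw [← mul_assoc, ejap_neg_mul, one_mul]

/-- Both negative powers are largest at the shorter of `ζ` and `ξ - ζ`, so the product is bounded by
the full power there. Summing over the two cases gives a bound that does not depend on `ξ`. -/
lemma ejap_weight_bound (a b : ℝ) (ha : 0 ≤ a) (hb : 0 ≤ b) (ξ : Plane) :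
    ∫⁻ ζ, ejap (-a) ζ ^ 2 * ejap (-b) (ξ - ζ) ^ 2 ≤ 2 * n2 (ejap (-(a + b))) ^ 2 := by
  have key (x y : Plane) : ejap (-a) x ^ 2 * ejap (-b) y ^ 2
      ≤ ejap (-(a + b)) x ^ 2 + ejap (-(a + b)) y ^ 2 := by
    rw [← mul_pow, neg_add, ejap_add, ejap_add]
    rcases le_total ‖x‖ ‖y‖ with h | h
    · have : ejap (-b) y ≤ ejap (-b) x := by
        apply ENNReal.ofReal_le_ofReal
        unfold jap
        apply Real.rpow_le_rpow_of_nonpos (by positivity) (by gcongr) (by linarith)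
      calc _ ≤ (ejap (-a) x * ejap (-b) x) ^ 2 := by gcongr
        _ ≤ _ := le_self_add
    · have : ejap (-a) x ≤ ejap (-a) y := by
        apply ENNReal.ofReal_le_ofReal
        unfold jap
        apply Real.rpow_le_rpow_of_nonpos (by positivity) (by gcongr) (by linarith)
      calc _ ≤ (ejap (-a) y * ejap (-b) y) ^ 2 := by gcongr
        _ ≤ _ := le_add_self
  have hm := measurable_ejap (-(a + b))
  calc _ ≤ ∫⁻ ζ, (ejap (-(a + b)) ζ ^ 2 + ejap (-(a + b)) (ξ - ζ) ^ 2) := by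
        gcongr with ζ; exact key _ _
    _ = _ := by
        rw [lintegral_add_left (by fun_prop),
          lintegral_sub_left_eq_self (fun ζ ↦ ejap (-(a + b)) ζ ^ 2) ξ, n2_sq, two_mul]

/-- The product estimate `H^a · H^b ⊂ L²`, `a + b > 1`. -/
lemma tri_le_ejap {a b : ℝ} (ha : 0 ≤ a) (hb : 0 ≤ b) {F G H : Plane → ℝ≥0∞}
    (hF : Measurable F) (hG : Measurable G) (hH : Measurable H) :
    tri F G H ≤ 2 * n2 (ejap (-(a + b))) * n2 (fun ξ ↦ ejap a ξ * F ξ)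
      * n2 (fun ξ ↦ ejap b ξ * G ξ) * n2 H := by
  have h := tri_le_of_weight (F := fun ξ ↦ ejap a ξ * F ξ) (G := fun ξ ↦ ejap b ξ * G ξ)
    (measurable_ejap (-a)) (measurable_ejap (-b)) ((measurable_ejap a).mul hF) ((measurable_ejap b).mul hG) hH
    (K := 2 * n2 (ejap (-(a + b)))) (fun ξ ↦ (ejap_weight_bound a b ha hb ξ).trans (by
      rw [mul_pow]; gcongr; norm_num))
  simp_rw [← mul_assoc, ejap_neg_mul, one_mul] at h
  simpa [mul_assoc] using h

lemma n2_comp_neg (F : Plane → ℝ≥0∞) : n2 (fun ξ ↦ F (-ξ)) = n2 F := by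
  unfold n2
  rw [lintegral_neg_eq_self (fun ξ ↦ F ξ ^ 2)]

/-- The substitution `ξ = ζ + η` makes `F` the output variable. With `tri_comm`, an estimate proved
for one slot transfers to the others. -/
lemma tri_rotate {F G H : Plane → ℝ≥0∞} (hF : Measurable F) (hG : Measurable G)
    (hH : Measurable H) : tri F G H = tri (fun ξ ↦ G (-ξ)) H F := by
  rw [tri_eq (F := fun ξ ↦ G (-ξ)) (by fun_prop) hH hF]
  unfold tri
  congr 1; ext ζ
  rw [← lintegral_const_mul _ (by fun_prop), ← lintegral_neg_eq_self]
  congr 1; ext η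
  rw [sub_eq_add_neg]; ring

lemma tri_le_young_right {F G H : Plane → ℝ≥0∞} (hF : Measurable F) (hG : Measurable G)
    (hH : Measurable H) : tri F G H ≤ (∫⁻ ξ, H ξ) * n2 F * n2 G := by
  rw [tri_rotate hF hG hH, tri_comm (by fun_prop) hH hF]
  refine (tri_le_young hH (by fun_prop) hF).trans (le_of_eq ?_)
  rw [n2_comp_neg]; ring

lemma tri_le_young_mid {F G H : Plane → ℝ≥0∞} (hF : Measurable F) (hG : Measurable G)
    (hH : Measurable H) : tri F G H ≤ (∫⁻ ξ, G ξ) * n2 F * n2 H := by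
  rw [tri_comm hF hG hH]
  exact tri_le_young hG hF hH

/-- Dilation by `R`: homogeneity contributes `R⁻⁴` and the area element `R²`. -/
lemma lintegral_scaled_bracket {R : ℝ} (hR : 0 < R) :
    ∫⁻ ξ : Plane, ENNReal.ofReal ((R ^ 2 + ‖ξ‖ ^ 2)⁻¹ ^ 2)
      = ENNReal.ofReal (R⁻¹ ^ 2) * n2 (ejap (-2)) ^ 2 := by
  rw [n2_sq]
  have hm : Measurable fun ξ ↦ ejap (-2) ξ ^ 2 := (measurable_ejap _).pow_const 2
  have h : ∫⁻ ξ, ejap (-2) (R⁻¹ • ξ) ^ 2 = ENNReal.ofReal (R ^ 2) * ∫⁻ ξ, ejap (-2) ξ ^ 2 := by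
    rw [← lintegral_map (f := fun ξ ↦ ejap (-2) ξ ^ 2) hm (measurable_const_smul R⁻¹),
      Measure.map_addHaar_smul volume (inv_ne_zero hR.ne'), lintegral_smul_measure, smul_eq_mul]
    congr 2
    rw [finrank_euclideanSpace_fin, abs_of_nonneg (by positivity), inv_pow, inv_inv]
  have e (ξ : Plane) : ENNReal.ofReal ((R ^ 2 + ‖ξ‖ ^ 2)⁻¹ ^ 2)
      = ENNReal.ofReal ((R ^ 4)⁻¹) * ejap (-2) (R⁻¹ • ξ) ^ 2 := by
    rw [ejap, ← ENNReal.ofReal_pow (jap_nonneg _ _), ← ENNReal.ofReal_mul (by positivity)]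
    congr 1
    have : jap (-2) (R⁻¹ • ξ) = (1 + ‖R⁻¹ • ξ‖ ^ 2)⁻¹ := by
      unfold jap; rw [show (-2 / 2 : ℝ) = -1 by norm_num, Real.rpow_neg_one]
    rw [this, norm_smul, Real.norm_of_nonneg (by positivity)]
    field_simp
  simp_rw [e]
  rw [lintegral_const_mul _ (show Measurable fun ξ : Plane ↦ ejap (-2) (R⁻¹ • ξ) ^ 2 from
      hm.comp (measurable_const_smul R⁻¹)), h, ← mul_assoc,
    ← ENNReal.ofReal_mul (by positivity)]
  congr 2
  field_simp

/-- A scale-invariant product estimate of Ladyzhenskaya type with a free scale `R`. -/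
lemma tri_le_ladyzhenskaya {F G H : Plane → ℝ≥0∞} (hF : Measurable F) (hG : Measurable G)
    (hH : Measurable H) {R : ℝ} (hR : 0 < R) :
    tri F G H ≤ n2 F * (ENNReal.ofReal R * volume (Metric.ball (0 : Plane) 1) ^ (1 / 2 : ℝ)
        * 2 * (n2 G * n2 H)
      + ENNReal.ofReal R⁻¹ * 2 * n2 (ejap (-2))
        * (n2 (fun ξ ↦ ‖ξ‖ₑ * G ξ) * n2 (fun ξ ↦ ‖ξ‖ₑ * H ξ))) := by
  -- `G` and `H` are split at frequency `R`. A low part has integral at most the square root of the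
  -- area of the ball times the `L²` norm, which yields the factor `R`.
  set A : Set Plane := Metric.closedBall 0 R with hA
  have hAm : MeasurableSet A := Metric.isClosed_closedBall.measurableSet
  have hlow {G : Plane → ℝ≥0∞} (hG : Measurable G) : ∫⁻ ξ, A.indicator G ξ
      ≤ ENNReal.ofReal R * volume (Metric.ball (0 : Plane) 1) ^ (1 / 2 : ℝ) * n2 G := by
    have h := lintegral_mul_le_n2 (F := A.indicator 1) (G := G) (measurable_one.indicator hAm) hG
    have e : n2 (A.indicator 1)
        = ENNReal.ofReal R * volume (Metric.ball (0 : Plane) 1) ^ (1 / 2 : ℝ) := by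
      have : ∀ ξ, A.indicator (1 : Plane → ℝ≥0∞) ξ ^ 2 = A.indicator 1 ξ := fun ξ ↦ by
        by_cases h : ξ ∈ A <;> simp [h]
      unfold n2
      simp_rw [this]
      rw [lintegral_indicator_one hAm, hA, Measure.addHaar_closedBall _ _ hR.le,
        ENNReal.mul_rpow_of_nonneg _ _ (by norm_num)]
      congr 1
      rw [finrank_euclideanSpace_fin, ENNReal.ofReal_pow hR.le, ← ENNReal.rpow_natCast,
        ← ENNReal.rpow_mul]
      simp
    rw [e] at h
    refine le_trans (le_of_eq ?_) h
    congr 1; ext ξ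
    by_cases h : ξ ∈ A <;> simp [h]
  have hsplit {G : Plane → ℝ≥0∞} (ξ : Plane) : G ξ = A.indicator G ξ + Aᶜ.indicator G ξ := by
    by_cases h : ξ ∈ A <;> simp [h]
  have hind {G : Plane → ℝ≥0∞} {B : Set Plane} (ξ : Plane) : B.indicator G ξ ≤ G ξ :=
    indicator_le_self _ _ _
  set G1 := A.indicator G
  set G2 := Aᶜ.indicator G
  set H1 := A.indicator H
  set H2 := Aᶜ.indicator H
  have hG1 : Measurable G1 := hG.indicator hAm
  have hG2 : Measurable G2 := hG.indicator hAm.compl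
  have hH1 : Measurable H1 := hH.indicator hAm
  have hH2 : Measurable H2 := hH.indicator hAm.compl
  -- In the first two terms one of `G`, `H` is low and Young's inequality suffices. In the third
  -- both are high and can pay with one derivative each.
  have hdec : tri F G H = tri F G1 H + tri F G2 H1 + tri F G2 H2 := by
    unfold tri
    have m1 : Measurable fun ζ ↦ ∫⁻ η, F ζ * G1 η * H (ζ + η) :=
      Measurable.lintegral_prod_right' (measurable_tri_inner hF hG1 hH)
    have m2 : Measurable fun ζ ↦ ∫⁻ η, F ζ * G2 η * H1 (ζ + η) :=
      Measurable.lintegral_prod_right' (measurable_tri_inner hF hG2 hH1)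
    have m12 : Measurable fun ζ ↦ (∫⁻ η, F ζ * G1 η * H (ζ + η))
        + ∫⁻ η, F ζ * G2 η * H1 (ζ + η) := m1.add m2
    rw [← lintegral_add_left m1, ← lintegral_add_left m12]
    congr 1; ext ζ
    rw [← lintegral_add_left (by fun_prop), ← lintegral_add_left (by fun_prop)]
    congr 1; ext η
    conv_lhs => rw [hsplit (G := G) η]
    rw [mul_add, add_mul, add_assoc, ← mul_add, ← hsplit (G := H)]
  have b1 : tri F G1 H ≤ n2 F * (ENNReal.ofReal R
      * volume (Metric.ball (0 : Plane) 1) ^ (1 / 2 : ℝ) * (n2 G * n2 H)) := by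
    refine (tri_le_young_mid hF hG1 hH).trans ?_
    calc _ ≤ (ENNReal.ofReal R * volume (Metric.ball (0 : Plane) 1) ^ (1 / 2 : ℝ) * n2 G)
          * n2 F * n2 H := by gcongr; exact hlow hG
      _ = _ := by ring
  have b2 : tri F G2 H1 ≤ n2 F * (ENNReal.ofReal R
      * volume (Metric.ball (0 : Plane) 1) ^ (1 / 2 : ℝ) * (n2 G * n2 H)) := by
    refine (tri_le_young_right hF hG2 hH1).trans ?_
    calc _ ≤ (ENNReal.ofReal R * volume (Metric.ball (0 : Plane) 1) ^ (1 / 2 : ℝ) * n2 H)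
          * n2 F * n2 G := by
            gcongr
            · exact hlow hH
            · exact n2_mono fun ξ ↦ hind ξ
      _ = _ := by ring
  -- `a² = 2 / (R² + |ξ|²)` is chosen so that `a |ξ| ≥ 1` outside the ball, while the convolution of
  -- `a²` with itself is bounded by a multiple of `R⁻²`.
  set a : Plane → ℝ≥0∞ := fun ξ ↦ ENNReal.ofReal (2 * (R ^ 2 + ‖ξ‖ ^ 2)⁻¹) ^ (1 / 2 : ℝ) with ha
  have ham : Measurable a := by
    refine Measurable.pow_const (Measurable.ennreal_ofReal ?_) _
    fun_prop
  have ha2 : ∀ ξ, a ξ ^ 2 = ENNReal.ofReal (2 * (R ^ 2 + ‖ξ‖ ^ 2)⁻¹) := fun ξ ↦ ennreal_sqrt_sq _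
  have hKa (ξ : Plane) : ∫⁻ ζ, a ζ ^ 2 * a (ξ - ζ) ^ 2
      ≤ (ENNReal.ofReal R⁻¹ * 2 * n2 (ejap (-2))) ^ 2 := by
    have key (x y : Plane) : a x ^ 2 * a y ^ 2
        ≤ 2 * ENNReal.ofReal ((R ^ 2 + ‖x‖ ^ 2)⁻¹ ^ 2)
          + 2 * ENNReal.ofReal ((R ^ 2 + ‖y‖ ^ 2)⁻¹ ^ 2) := by
      have h2 (z : ℝ) : 2 * ENNReal.ofReal z = ENNReal.ofReal (2 * z) := by
        rw [ENNReal.ofReal_mul zero_le_two, ENNReal.ofReal_ofNat]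
      rw [ha2, ha2, ← ENNReal.ofReal_mul (by positivity),
        h2, h2, ← ENNReal.ofReal_add (by positivity) (by positivity)]
      apply ENNReal.ofReal_le_ofReal
      nlinarith [sq_nonneg ((R ^ 2 + ‖x‖ ^ 2)⁻¹ - (R ^ 2 + ‖y‖ ^ 2)⁻¹)]
    have hmm : Measurable fun x : Plane ↦ ENNReal.ofReal ((R ^ 2 + ‖x‖ ^ 2)⁻¹ ^ 2) := by fun_prop
    calc _ ≤ ∫⁻ ζ : Plane, (2 * ENNReal.ofReal ((R ^ 2 + ‖ζ‖ ^ 2)⁻¹ ^ 2)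
          + 2 * ENNReal.ofReal ((R ^ 2 + ‖ξ - ζ‖ ^ 2)⁻¹ ^ 2)) := by
            gcongr with ζ; exact key _ _
      _ = (ENNReal.ofReal R⁻¹ * 2 * n2 (ejap (-2))) ^ 2 := by
          rw [lintegral_add_left (by fun_prop), lintegral_const_mul _ hmm,
            lintegral_const_mul _ (by fun_prop),
            lintegral_sub_left_eq_self
              (fun ζ : Plane ↦ ENNReal.ofReal ((R ^ 2 + ‖ζ‖ ^ 2)⁻¹ ^ 2)) ξ,
            lintegral_scaled_bracket hR, ENNReal.ofReal_pow (by positivity)]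
          ring
  have hale {G : Plane → ℝ≥0∞} (ξ : Plane) : Aᶜ.indicator G ξ ≤ a ξ * (‖ξ‖ₑ * G ξ) := by
    by_cases h : ξ ∈ A
    · simp [h]
    · have hξ : R < ‖ξ‖ := by simpa [hA] using h
      rw [indicator_of_mem (show ξ ∈ Aᶜ from h), ← mul_assoc]
      refine le_mul_of_one_le_left zero_le ?_
      have h1 : (1 : ℝ≥0∞) ≤ (a ξ * ‖ξ‖ₑ) ^ 2 := by
        rw [mul_pow, ha2, ← ofReal_norm, ← ENNReal.ofReal_pow (norm_nonneg _),
          ← ENNReal.ofReal_mul (by positivity), ← ENNReal.ofReal_one]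
        apply ENNReal.ofReal_le_ofReal
        rw [mul_assoc, ← div_eq_inv_mul, ← mul_div_assoc, le_div_iff₀ (by positivity)]
        nlinarith
      by_contra h2
      push Not at h2
      exact absurd h1 (not_le.2 (pow_lt_one₀ zero_le h2 two_ne_zero))
  have b3 : tri F G2 H2 ≤ n2 F * (ENNReal.ofReal R⁻¹ * 2 * n2 (ejap (-2))
      * (n2 (fun ξ ↦ ‖ξ‖ₑ * G ξ) * n2 (fun ξ ↦ ‖ξ‖ₑ * H ξ))) := by
    -- The rotation puts the two high-frequency factors into the weighted slots and leaves `F`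
    -- without a weight.
    rw [tri_rotate hF hG2 hH2]
    have hGn : Measurable fun ξ : Plane ↦ ‖ξ‖ₑ * G ξ := by fun_prop
    have := tri_le_of_weight (F := fun ξ ↦ ‖-ξ‖ₑ * G (-ξ)) (G := fun ξ ↦ ‖ξ‖ₑ * H ξ) ham ham
      (by fun_prop) (by fun_prop) hF hKa
    rw [n2_comp_neg (fun ξ ↦ ‖ξ‖ₑ * G ξ)] at this
    refine le_trans (tri_mono (fun ξ ↦ ?_) (fun ξ ↦ hale ξ) fun ξ ↦ le_rfl)
      (this.trans (le_of_eq (by ring)))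
    have := hale (G := G) (-ξ)
    simpa [ha] using this
  rw [hdec]
  calc _ ≤ _ := add_le_add (add_le_add b1 b2) b3
    _ = _ := by ring

/-! ### A logarithmic truncation of the square and its calculus on `L²`. -/

/-- The derivative of the truncated square `rtrunc`, up to a factor: `conj z / (1 + κ|z|²)`. -/
def rder (κ : ℝ) (z : ℂ) : ℂ := (((1 + κ * ‖z‖ ^ 2)⁻¹ : ℝ) : ℂ) * (starRingEnd ℂ) z

/-- A smooth, sublinearly growing substitute for `|z|²`. -/
def rtrunc (κ : ℝ) (z : ℂ) : ℝ := κ⁻¹ * Real.log (1 + κ * ‖z‖ ^ 2)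

lemma norm_rder {κ : ℝ} (hκ : 0 < κ) (z : ℂ) : ‖rder κ z‖ = (1 + κ * ‖z‖ ^ 2)⁻¹ * ‖z‖ := by
  rw [rder, norm_mul, Complex.norm_real, Real.norm_of_nonneg (by positivity), RCLike.norm_conj]

lemma norm_rder_le {κ : ℝ} (hκ : 0 < κ) (z : ℂ) : ‖rder κ z‖ ≤ ‖z‖ := by
  rw [norm_rder hκ]
  refine mul_le_of_le_one_left (norm_nonneg _) (inv_le_one_of_one_le₀ ?_)
  have : 0 ≤ κ * ‖z‖ ^ 2 := by positivity
  linarith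

/-- From `√κ |z| ≤ 1 + κ|z|²`. Boundedness of the derivative is the purpose of the truncation: it
can be paired with a commutator that is only in `L¹`. -/
lemma norm_rder_le_inv_sqrt {κ : ℝ} (hκ : 0 < κ) (z : ℂ) : ‖rder κ z‖ ≤ (Real.sqrt κ)⁻¹ := by
  have hs : 0 < Real.sqrt κ := Real.sqrt_pos.2 hκ
  have hs2 : Real.sqrt κ ^ 2 = κ := Real.sq_sqrt hκ.le
  rw [norm_rder hκ, inv_mul_le_iff₀ (by positivity), ← div_eq_mul_inv, le_div_iff₀ hs]
  nlinarith [sq_nonneg (Real.sqrt κ * ‖z‖ - 1), norm_nonneg z]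

/-- The difference factors explicitly, and `1 + κ|z||w| ≤ (1 + κ|z|²)(1 + κ|w|²)`. The Lipschitz
constant 1 does not depend on `κ`, which matters when `κ` tends to zero. -/
lemma norm_rder_sub_le {κ : ℝ} (hκ : 0 < κ) (z w : ℂ) : ‖rder κ z - rder κ w‖ ≤ ‖z - w‖ := by
  have h1 : 0 < 1 + κ * ‖z‖ ^ 2 := by positivity
  have h2 : 0 < 1 + κ * ‖w‖ ^ 2 := by positivity
  have key : rder κ z - rder κ w = (((1 + κ * ‖z‖ ^ 2)⁻¹ * (1 + κ * ‖w‖ ^ 2)⁻¹ : ℝ) : ℂ)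
      * ((starRingEnd ℂ) (z - w) - κ * (starRingEnd ℂ) z * (starRingEnd ℂ) w * (z - w)) := by
    have e1 : ((1 + κ * ‖z‖ ^ 2 : ℝ) : ℂ) ≠ 0 := by exact_mod_cast h1.ne'
    have e2 : ((1 + κ * ‖w‖ ^ 2 : ℝ) : ℂ) ≠ 0 := by exact_mod_cast h2.ne'
    have hz : ((‖z‖ : ℂ)) ^ 2 = z * (starRingEnd ℂ) z := by
      rw [Complex.mul_conj, Complex.normSq_eq_norm_sq]; push_cast; rfl
    have hw : ((‖w‖ : ℂ)) ^ 2 = w * (starRingEnd ℂ) w := by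
      rw [Complex.mul_conj, Complex.normSq_eq_norm_sq]; push_cast; rfl
    unfold rder
    push_cast at e1 e2 ⊢
    field_simp
    rw [hz, hw, map_sub]; ring
  rw [key, norm_mul, Complex.norm_real, Real.norm_of_nonneg (by positivity)]
  have h3 : ‖(starRingEnd ℂ) (z - w) - κ * (starRingEnd ℂ) z * (starRingEnd ℂ) w * (z - w)‖
      ≤ (1 + κ * ‖z‖ * ‖w‖) * ‖z - w‖ := by
    refine (norm_sub_le _ _).trans (le_of_eq ?_)
    simp only [norm_mul, RCLike.norm_conj, Complex.norm_real, Real.norm_of_nonneg hκ.le]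
    ring
  rw [← mul_inv]
  rw [inv_mul_le_iff₀ (by positivity)]
  refine h3.trans (mul_le_mul_of_nonneg_right ?_ (norm_nonneg _))
  have : 0 ≤ κ * ‖z‖ ^ 2 * (κ * ‖w‖ ^ 2) := by positivity
  nlinarith [mul_nonneg hκ.le (sq_nonneg (‖z‖ - ‖w‖)), mul_nonneg (mul_nonneg hκ.le (norm_nonneg z)) (norm_nonneg w)]

lemma lipschitzWith_rder {κ : ℝ} (hκ : 0 < κ) : LipschitzWith 1 (rder κ) :=
  LipschitzWith.of_dist_le_mul fun z w ↦ by
    simpa [dist_eq_norm] using norm_rder_sub_le hκ z w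

lemma rtrunc_nonneg {κ : ℝ} (hκ : 0 < κ) (z : ℂ) : 0 ≤ rtrunc κ z :=
  mul_nonneg (by positivity) (Real.log_nonneg (by
    have : 0 ≤ κ * ‖z‖ ^ 2 := by positivity
    linarith))

lemma rtrunc_le {κ : ℝ} (hκ : 0 < κ) (z : ℂ) : rtrunc κ z ≤ ‖z‖ ^ 2 := by
  have h := Real.log_le_sub_one_of_pos (show 0 < 1 + κ * ‖z‖ ^ 2 by positivity)
  rw [rtrunc, inv_mul_le_iff₀ hκ]; linarith

/-- This is `1 - 1/x ≤ log x`. Together with `rtrunc_le` it encloses the truncated square between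
two expressions that tend to `|z|²` with `κ`. -/
lemma re_rder_mul_le {κ : ℝ} (hκ : 0 < κ) (z : ℂ) : (rder κ z * z).re ≤ rtrunc κ z := by
  have h1 : 0 < 1 + κ * ‖z‖ ^ 2 := by positivity
  have h := Real.one_sub_inv_le_log_of_pos h1
  have e : (rder κ z * z).re = (1 + κ * ‖z‖ ^ 2)⁻¹ * ‖z‖ ^ 2 := by
    rw [rder, mul_assoc, mul_comm _ z, Complex.mul_conj, Complex.normSq_eq_norm_sq,
      ← Complex.ofReal_mul, Complex.ofReal_re]
  rw [e, rtrunc]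
  refine le_trans (le_of_eq ?_) (mul_le_mul_of_nonneg_left h (by positivity))
  field_simp
  ring

lemma hasFDerivAt_rtrunc {κ : ℝ} (hκ : 0 < κ) (z : ℂ) :
    HasFDerivAt (rtrunc κ) ((1 + κ * ‖z‖ ^ 2)⁻¹ • ((2 : ℝ) • innerSL ℝ z)) z := by
  have h0 : HasFDerivAt (fun x : ℂ ↦ ‖x‖ ^ 2) ((2 : ℝ) • innerSL ℝ z) z := by
    have := (hasStrictFDerivAt_norm_sq z).hasFDerivAt
    rwa [ofNat_smul_eq_nsmul ℝ 2] 
  have h1 : (1 + κ * ‖z‖ ^ 2) ≠ 0 := by positivity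
  have h2 := (((h0.const_mul κ).const_add 1).log h1).const_mul κ⁻¹
  refine h2.congr_fderiv ?_
  ext w
  simp
  field_simp

lemma fderiv_rtrunc_apply (κ : ℝ) (z w : ℂ) :
    ((1 + κ * ‖z‖ ^ 2)⁻¹ • ((2 : ℝ) • innerSL ℝ z)) w = 2 * (rder κ z * w).re := by
  have h : (rder κ z * w).re = (1 + κ * ‖z‖ ^ 2)⁻¹ * ((starRingEnd ℂ) z * w).re := by
    rw [rder, mul_assoc, Complex.re_ofReal_mul]
  rw [h]
  simp only [FunLike.coe_smul, Pi.smul_apply, innerSL_apply_apply, Complex.inner, smul_eq_mul]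
  rw [mul_comm w]; ring

/-- The mean value theorem along the segment from `z` to `z + w`, followed by the Lipschitz bound
for `rder`. -/
lemma abs_rtrunc_add_sub_le {κ : ℝ} (hκ : 0 < κ) (z w : ℂ) :
    |rtrunc κ (z + w) - rtrunc κ z - 2 * (rder κ z * w).re| ≤ 2 * ‖w‖ ^ 2 := by
  set g : ℝ → ℝ := fun s ↦ rtrunc κ (z + s * w) with hg
  have hd (s : ℝ) : HasDerivAt g (2 * (rder κ (z + s * w) * w).re) s := by
    have h1 : HasDerivAt (fun s : ℝ ↦ z + s * w) w s := by
      simpa using ((Complex.ofRealCLM.hasDerivAt (x := s)).mul_const w).const_add z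
    have h2 := (hasFDerivAt_rtrunc hκ (z + s * w)).comp_hasDerivAt s h1
    rwa [fderiv_rtrunc_apply κ] at h2
  obtain ⟨c, hc, hc'⟩ := exists_hasDerivAt_eq_slope g (fun s ↦ 2 * (rder κ (z + s * w) * w).re)
    zero_lt_one (fun s _ ↦ (hd s).continuousAt.continuousWithinAt) (fun s _ ↦ hd s)
  have e : rtrunc κ (z + w) - rtrunc κ z = 2 * (rder κ (z + c * w) * w).re := by
    rw [hc', hg]; simp
  rw [e, ← mul_sub, ← Complex.sub_re, ← sub_mul, abs_mul, abs_two]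
  refine mul_le_mul_of_nonneg_left ((Complex.abs_re_le_norm _).trans ?_) zero_le_two
  rw [norm_mul, pow_two]
  refine mul_le_mul_of_nonneg_right ((norm_rder_sub_le hκ _ _).trans ?_) (norm_nonneg _)
  rw [add_sub_cancel_left, norm_mul, Complex.norm_real, Real.norm_of_nonneg hc.1.le]
  exact mul_le_of_le_one_left (norm_nonneg _) hc.2.le

lemma rder_zero (κ : ℝ) : rder κ 0 = 0 := by simp [rder]

/-- The superposition operator of `rder` on `L²`. -/
def rderLp {κ : ℝ} (hκ : 0 < κ) (f : L2C) : L2C := (lipschitzWith_rder hκ).compLp (rder_zero κ) f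

lemma rderLp_ae {κ : ℝ} (hκ : 0 < κ) (f : L2C) : rderLp hκ f =ᵐ[volume] fun x ↦ rder κ (f x) :=
  LipschitzWith.coeFn_compLp _ _ f

lemma norm_rderLp_le {κ : ℝ} (hκ : 0 < κ) (f : L2C) : ‖rderLp hκ f‖ ≤ ‖f‖ := by
  simpa [rderLp] using LipschitzWith.norm_compLp_le (lipschitzWith_rder hκ) (rder_zero κ) f

lemma norm_rderLp_sub_le {κ : ℝ} (hκ : 0 < κ) (f g : L2C) : ‖rderLp hκ f - rderLp hκ g‖ ≤ ‖f - g‖ := by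
  simpa [rderLp] using LipschitzWith.norm_compLp_sub_le (lipschitzWith_rder hκ) (rder_zero κ) f g

lemma continuous_rderLp {κ : ℝ} (hκ : 0 < κ) : Continuous (rderLp hκ) :=
  LipschitzWith.continuous_compLp (lipschitzWith_rder hκ) (rder_zero κ)

lemma continuous_rtrunc {κ : ℝ} (hκ : 0 < κ) : Continuous (rtrunc κ) :=
  continuous_iff_continuousAt.2 fun z ↦ (hasFDerivAt_rtrunc hκ z).continuousAt

lemma integrable_norm_sq (f : L2C) : Integrable fun x ↦ ‖f x‖ ^ 2 := by
  have := (Lp.memLp f).integrable_norm_pow (p := 2) (by norm_num)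
  simpa using this

lemma integrable_rtrunc {κ : ℝ} (hκ : 0 < κ) (f : L2C) : Integrable fun x ↦ rtrunc κ (f x) := by
  refine (integrable_norm_sq f).mono'
    ((continuous_rtrunc hκ).comp_aestronglyMeasurable (Lp.aestronglyMeasurable f))
    (.of_forall fun x ↦ ?_)
  rw [Real.norm_of_nonneg (rtrunc_nonneg hκ _)]
  exact rtrunc_le hκ _

/-- The bilinear pairing `∫ f g` on `L²`. -/
def pairL : L2C →L[ℂ] L2C →L[ℂ] ℂ := (ContinuousLinearMap.mul ℂ ℂ).lpPairing volume 2 2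

lemma pairL_apply (f g : L2C) : pairL f g = ∫ x, f x * g x := by
  rw [pairL, ContinuousLinearMap.lpPairing_eq_integral]; rfl

lemma norm_pairL_le (f g : L2C) : ‖pairL f g‖ ≤ ‖f‖ * ‖g‖ := by
  rw [pairL_apply]
  refine (norm_integral_le_integral_norm _).trans ?_
  have := integral_norm_mul_le (Lp.memLp f) (Lp.memLp g)
  simpa [Lp.norm_def] using this

lemma norm_sq_eq_integral (w : L2C) : ‖w‖ ^ 2 = ∫ x, ‖w x‖ ^ 2 := by
  have h := integral_conj_mul_eq_inner w w
  have h2 := congrArg Complex.re h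
  rw [inner_self_eq_norm_sq_to_K] at h2
  have h3 : ∀ x, (starRingEnd ℂ) (w x) * w x = ((‖w x‖ ^ 2 : ℝ) : ℂ) := fun x ↦ by
    rw [mul_comm, Complex.mul_conj, Complex.normSq_eq_norm_sq]
  simp_rw [h3] at h2
  rw [integral_complex_ofReal, Complex.ofReal_re] at h2
  rw [h2]; norm_cast

/-- Dominated convergence in `L²`. -/
lemma tendsto_L2_of_dominated {f : ℕ → L2C} {g F : L2C}
    (hF : ∀ n, ∀ᵐ x, ‖f n x‖ ≤ ‖F x‖)
    (hlim : ∀ᵐ x, Filter.Tendsto (fun n ↦ f n x) Filter.atTop (nhds (g x))) :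
    Filter.Tendsto f Filter.atTop (nhds g) := by
  have hF' : ∀ᵐ x, ∀ n, ‖f n x‖ ≤ ‖F x‖ := ae_all_iff.2 hF
  have hg : ∀ᵐ x, ‖g x‖ ≤ ‖F x‖ := by
    filter_upwards [hF', hlim] with x h1 h2
    exact le_of_tendsto h2.norm (.of_forall h1)
  have key : Filter.Tendsto (fun n ↦ ∫ x, ‖(f n - g) x‖ ^ 2) Filter.atTop
      (nhds (∫ _ : Plane, (0 : ℝ))) := by
    refine tendsto_integral_of_dominated_convergence (fun x ↦ 4 * ‖F x‖ ^ 2)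
      (fun n ↦ (integrable_norm_sq (f n - g)).aestronglyMeasurable)
      ((integrable_norm_sq F).const_mul 4) (fun n ↦ ?_) ?_
    · filter_upwards [hF n, hg, Lp.coeFn_sub (f n) g] with x h1 h2 h3
      rw [h3, Pi.sub_apply, Real.norm_of_nonneg (by positivity)]
      have h4 := norm_sub_le (f n x) (g x)
      have h5 : ‖f n x - g x‖ ≤ 2 * ‖F x‖ := by linarith
      have := pow_le_pow_left₀ (norm_nonneg _) h5 2
      linarith [mul_pow 2 ‖F x‖ 2]
    · filter_upwards [hlim, ae_all_iff.2 fun n ↦ Lp.coeFn_sub (f n) g] with x h1 h3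
      simp_rw [h3, Pi.sub_apply]
      have := ((tendsto_sub_nhds_zero_iff.2 h1).norm).pow 2
      simpa using this
  rw [integral_zero] at key
  simp_rw [← norm_sq_eq_integral] at key
  rw [← tendsto_sub_nhds_zero_iff, tendsto_zero_iff_norm_tendsto_zero]
  have := key.sqrt
  simpa using this

/-- The pointwise Taylor remainder is at most `2|w|²`, so its integral is quadratic in the `L²` norm
of the increment. This is what makes the functional Fréchet differentiable. -/
lemma hasFDerivAt_integral_rtrunc {κ : ℝ} (hκ : 0 < κ) (f : L2C) :
    HasFDerivAt (fun g : L2C ↦ ∫ x, rtrunc κ (g x))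
      ((2 : ℝ) • Complex.reCLM.comp ((pairL (rderLp hκ f)).restrictScalars ℝ)) f := by
  have hb (w : L2C) : |(∫ x, rtrunc κ ((f + w) x)) - (∫ x, rtrunc κ (f x))
      - 2 * (pairL (rderLp hκ f) w).re| ≤ 2 * ‖w‖ ^ 2 := by
    have i1 := integrable_rtrunc hκ (f + w)
    have i2 := integrable_rtrunc hκ f
    have i3 : Integrable fun x ↦ 2 * (rderLp hκ f x * w x).re :=
      (integrable_mul_L2 (rderLp hκ f) w).re.const_mul 2
    have i12 : Integrable fun x ↦ rtrunc κ ((f + w) x) - rtrunc κ (f x) := i1.sub i2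
    have e3 : 2 * (pairL (rderLp hκ f) w).re = ∫ x, 2 * (rderLp hκ f x * w x).re := by
      rw [integral_const_mul, pairL_apply]
      congr 1
      exact (integral_re (integrable_mul_L2 (rderLp hκ f) w)).symm
    rw [e3, ← integral_sub i1 i2, ← integral_sub i12 i3]
    rw [norm_sq_eq_integral, ← integral_const_mul]
    refine (norm_integral_le_integral_norm (_ : Plane → ℝ)).trans ?_
    refine integral_mono_ae (i12.sub i3).norm ((integrable_norm_sq w).const_mul 2) ?_
    filter_upwards [Lp.coeFn_add f w, rderLp_ae hκ f] with x h1 h2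
    rw [h1, h2]
    exact abs_rtrunc_add_sub_le hκ (f x) (w x)
  rw [hasFDerivAt_iff_isLittleO_nhds_zero]
  have hO : (fun w : L2C ↦ (∫ x, rtrunc κ ((f + w) x)) - (∫ x, rtrunc κ (f x))
      - ((2 : ℝ) • Complex.reCLM.comp ((pairL (rderLp hκ f)).restrictScalars ℝ)) w)
      =O[nhds 0] fun w : L2C ↦ ‖w‖ ^ 2 := by
    refine Asymptotics.IsBigO.of_bound 2 (.of_forall fun w ↦ ?_)
    have := hb w
    simpa using this
  refine hO.trans_isLittleO ?_
  exact Asymptotics.isLittleO_norm_pow_id one_lt_two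

/-- The chain rule for the truncated square along a differentiable curve in `L²`. -/
lemma integral_rtrunc_eq {κ S : ℝ} (hκ : 0 < κ) {f h : ℝ → L2C} (hh : Continuous h)
    (hf : ∀ t ∈ Icc 0 S, f t = f 0 + ∫ τ in (0 : ℝ)..t, h τ) {t : ℝ} (ht : t ∈ Icc 0 S) :
    ∫ x, rtrunc κ (f t x) = (∫ x, rtrunc κ (f 0 x))
      + 2 * ∫ τ in (0 : ℝ)..t, (pairL (rderLp hκ (f τ)) (h τ)).re := by
  set F : ℝ → L2C := fun t ↦ f 0 + ∫ τ in (0 : ℝ)..t, h τ with hF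
  have hFd (s : ℝ) : HasDerivAt F (h s) s :=
    (intervalIntegral.integral_hasDerivAt_right (hh.intervalIntegrable _ _)
      (hh.stronglyMeasurableAtFilter _ _) hh.continuousAt).const_add _
  have hE (s : ℝ) : HasDerivAt (fun s ↦ ∫ x, rtrunc κ (F s x))
      (2 * (pairL (rderLp hκ (F s)) (h s)).re) s :=
    (hasFDerivAt_integral_rtrunc hκ (F s)).comp_hasDerivAt s (hFd s)
  have hFc : Continuous F := continuous_iff_continuousAt.2 fun s ↦ (hFd s).continuousAt
  have hc : Continuous fun s ↦ 2 * (pairL (rderLp hκ (F s)) (h s)).re :=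
    continuous_const.mul (Complex.continuous_re.comp
      ((pairL.continuous.comp ((continuous_rderLp hκ).comp hFc)).clm_apply hh))
  have key := intervalIntegral.integral_eq_sub_of_hasDerivAt (a := 0) (b := t)
    (fun s _ ↦ hE s) (hc.intervalIntegrable _ _)
  have hF0 : F 0 = f 0 := by simp [hF]
  have hsub : ∀ s ∈ uIcc 0 t, F s = f s := fun s hs ↦ by
    rw [uIcc_of_le ht.1] at hs
    exact (hf s ⟨hs.1, hs.2.trans ht.2⟩).symm
  rw [hF0, hsub t right_mem_uIcc, intervalIntegral.integral_const_mul] at key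
  have e : ∫ τ in (0 : ℝ)..t, (pairL (rderLp hκ (F τ)) (h τ)).re
      = ∫ τ in (0 : ℝ)..t, (pairL (rderLp hκ (f τ)) (h τ)).re :=
    intervalIntegral.integral_congr fun s hs ↦ by simp only [hsub s hs]
  rw [e] at key
  linarith

/-- Convergence of the truncated derivative to the conjugate. -/
lemma tendsto_rderLp {κ : ℕ → ℝ} (hκ : ∀ n, 0 < κ n) (hκ0 : Filter.Tendsto κ Filter.atTop (nhds 0))
    {f : ℕ → L2C} {g : L2C} (hf : Filter.Tendsto f Filter.atTop (nhds g)) :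
    Filter.Tendsto (fun n ↦ rderLp (hκ n) (f n)) Filter.atTop (nhds (star g)) := by
  have h1 : Filter.Tendsto (fun n ↦ rderLp (hκ n) g) Filter.atTop (nhds (star g)) := by
    refine tendsto_L2_of_dominated (F := g) (fun n ↦ ?_) ?_
    · filter_upwards [rderLp_ae (hκ n) g] with x hx
      rw [hx]; exact norm_rder_le (hκ n) _
    · filter_upwards [ae_all_iff.2 fun n ↦ rderLp_ae (hκ n) g, Lp.coeFn_star g] with x hx h2
      simp_rw [hx]
      rw [h2]
      have h3 : Filter.Tendsto (fun n ↦ (1 + κ n * ‖g x‖ ^ 2)⁻¹) Filter.atTop (nhds 1) := by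
        have := ((hκ0.mul_const (‖g x‖ ^ 2)).const_add 1).inv₀ (by simp)
        simpa using this
      have h4 := ((Complex.continuous_ofReal.tendsto _).comp h3).mul_const ((starRingEnd ℂ) (g x))
      simpa [rder] using h4
  -- The Lipschitz bound, uniform in `κ`, reduces the moving argument `f n` to the fixed one `g`.
  have h2 : Filter.Tendsto (fun n ↦ rderLp (hκ n) (f n) - rderLp (hκ n) g) Filter.atTop
      (nhds 0) := by
    refine squeeze_zero_norm (fun n ↦ norm_rderLp_sub_le (hκ n) (f n) g) ?_
    have := (tendsto_sub_nhds_zero_iff.2 hf).norm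
    simpa using this
  simpa using h2.add h1

/-! ### Translations and mollifiers. -/

/-- Modulation of a Schwartz function by a character. -/
def modS (x : Plane) (φ : 𝓢(Plane, ℂ)) : 𝓢(Plane, ℂ) :=
  𝓕⁻ (SchwartzMap.compSubConstCLM ℂ x (𝓕 φ : 𝓢(Plane, ℂ)))

lemma fourier_modS (x : Plane) (φ : 𝓢(Plane, ℂ)) (y : Plane) :
    (𝓕 (modS x φ) : 𝓢(Plane, ℂ)) y = (𝓕 φ : 𝓢(Plane, ℂ)) (y - x) := by
  rw [modS, FourierTransform.fourier_fourierInv_eq, SchwartzMap.compSubConstCLM_apply]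

lemma fourierInv_schwartz_apply (φ : 𝓢(Plane, ℂ)) (x : Plane) :
    (𝓕⁻ φ : 𝓢(Plane, ℂ)) x = (𝓕 φ : 𝓢(Plane, ℂ)) (-x) := by
  rw [SchwartzMap.fourierInv_coe, SchwartzMap.fourier_coe]
  exact fourierInv_eq_fourier_neg _ x

lemma modS_apply (x : Plane) (φ : 𝓢(Plane, ℂ)) (ξ : Plane) :
    modS x φ ξ = Real.fourierChar (inner ℝ ξ x) • φ ξ := by
  have h := fourier_comp_add (𝓕 φ : 𝓢(Plane, ℂ)) (-x) (-ξ)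
  rw [neg_neg, inner_neg_neg] at h
  rw [modS, fourierInv_schwartz_apply, h, ← fourierInv_schwartz_apply,
    FourierTransform.fourierInv_fourier_eq]

lemma n2_eq_norm (f : L2C) : n2 (fun ξ ↦ ‖f ξ‖ₑ) = ENNReal.ofReal ‖f‖ := by
  rw [Lp.norm_def, ENNReal.ofReal_toReal (Lp.eLpNorm_ne_top f),
    eLpNorm_eq_lintegral_rpow_enorm_toReal (by norm_num) (by norm_num)]
  simp [n2]

lemma n2_congr {F G : Plane → ℝ≥0∞} (h : F =ᵐ[volume] G) : n2 F = n2 G := by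
  unfold n2
  congr 1
  apply lintegral_congr_ae
  filter_upwards [h] with ξ hξ
  rw [hξ]

/-- Translation on `L²`. -/
def translate (z : Plane) (f : L2C) : L2C :=
  Lp.compMeasurePreserving (fun x ↦ x + z) (measurePreserving_add_right volume z) f

lemma translate_ae (z : Plane) (f : L2C) : translate z f =ᵐ[volume] fun x ↦ f (x + z) :=
  Lp.coeFn_compMeasurePreserving f (measurePreserving_add_right volume z)

lemma fourier_translate (z : Plane) (f : L2C) :
    (𝓕 (translate z f) : L2C) =ᵐ[volume]
      fun ξ ↦ Real.fourierChar (inner ℝ ξ z) • (𝓕 f : L2C) ξ := by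
  have hc : Continuous fun ξ : Plane ↦ ((Real.fourierChar (inner ℝ ξ z) : Circle) : ℂ) := by
    fun_prop
  have hl : LocallyIntegrable fun ξ ↦ Real.fourierChar (inner ℝ ξ z) • (𝓕 f : L2C) ξ := by
    have h := ((Lp.memLp (𝓕 f : L2C)).locallyIntegrable (by norm_num)).smul_continuous hc
    refine h.congr (.of_forall fun ξ ↦ ?_)
    simp [Circle.smul_def, mul_comm]
  apply ae_eq_of_integral_schwartz ((Lp.memLp _).locallyIntegrable (by norm_num)) hl
  intro φ
  calc ∫ ξ, φ ξ * (𝓕 (translate z f) : L2C) ξ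
      = ∫ x, (𝓕 φ : 𝓢(Plane, ℂ)) x * f (x + z) := by
        rw [← coe_fourier_apply, coe_apply_eq]
        apply integral_congr_ae
        filter_upwards [translate_ae z f] with x hx
        rw [hx]
    _ = ∫ x, (𝓕 (modS z φ) : 𝓢(Plane, ℂ)) (x + z) * f (x + z) := by
        congr 1; ext x
        rw [fourier_modS, add_sub_cancel_right]
    _ = ∫ x, (𝓕 (modS z φ) : 𝓢(Plane, ℂ)) x * f x :=
        integral_add_right_eq_self (fun x ↦ (𝓕 (modS z φ) : 𝓢(Plane, ℂ)) x * f x) z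
    _ = ∫ ξ, modS z φ ξ * (𝓕 f : L2C) ξ := by rw [← coe_fourier_apply, coe_apply_eq]
    _ = _ := by
        congr 1; ext ξ
        rw [modS_apply]; simp [Circle.smul_def]; ring

/-- An interpolation between the trivial bound 2 and the Lipschitz bound `2π|x|`, used according to
whether `|x|` is at least or at most 1. -/
lemma norm_fourierChar_sub_one_le {a : ℝ} (ha : 0 ≤ a) (ha1 : a ≤ 1) (x : ℝ) :
    ‖((Real.fourierChar x : Circle) : ℂ) - 1‖ ≤ 4 * Real.pi * |x| ^ a := by
  have hpi := Real.pi_gt_three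
  have h1 : ‖((Real.fourierChar x : Circle) : ℂ) - 1‖ ≤ 2 := by
    refine (norm_sub_le _ _).trans ?_
    rw [Circle.norm_coe, norm_one]; norm_num
  have h2 : ‖((Real.fourierChar x : Circle) : ℂ) - 1‖ ≤ 2 * Real.pi * |x| := by
    rw [Real.fourierChar_apply]
    have := Real.norm_exp_I_mul_ofReal_sub_one_le (x := 2 * Real.pi * x)
    rw [mul_comm Complex.I] at this
    refine this.trans (le_of_eq ?_)
    rw [Real.norm_eq_abs, abs_mul, abs_of_pos (by positivity)]
  rcases le_total |x| 1 with h | h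
  · refine h2.trans ?_
    have : |x| ≤ |x| ^ a := by
      conv_lhs => rw [← Real.rpow_one |x|]
      rcases (abs_nonneg x).eq_or_lt with h0 | h0
      · rw [← h0, Real.zero_rpow one_ne_zero]; positivity
      · exact Real.rpow_le_rpow_of_exponent_ge h0 h ha1
    nlinarith [abs_nonneg x]
  · refine h1.trans ?_
    have := Real.one_le_rpow h ha
    nlinarith

/-- Translation differences in `L²` are controlled by a fractional derivative. -/
lemma n2_translate_sub_le {a : ℝ} (ha : 0 ≤ a) (ha1 : a ≤ 1) (z : Plane) (f : L2C) :
    n2 (fun x ↦ ‖f (x + z) - f x‖ₑ)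
      ≤ ENNReal.ofReal (4 * Real.pi * ‖z‖ ^ a)
        * n2 (fun ξ ↦ ENNReal.ofReal (‖ξ‖ ^ a) * ‖(𝓕 f : L2C) ξ‖ₑ) := by
  have h1 : n2 (fun x ↦ ‖f (x + z) - f x‖ₑ) = n2 (fun x ↦ ‖(translate z f - f) x‖ₑ) := by
    apply n2_congr
    filter_upwards [Lp.coeFn_sub (translate z f) f, translate_ae z f] with x h1 h2
    rw [h1, Pi.sub_apply, h2]
  have h2 : n2 (fun x ↦ ‖(translate z f - f) x‖ₑ)
      = n2 (fun ξ ↦ ‖(𝓕 (translate z f - f) : L2C) ξ‖ₑ) := by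
    rw [n2_eq_norm, n2_eq_norm, Lp.norm_fourier_eq]
  have hm : Measurable fun ξ : Plane ↦ ENNReal.ofReal (‖ξ‖ ^ a) * ‖(𝓕 f : L2C) ξ‖ₑ :=
    (measurable_norm.pow_const a).ennreal_ofReal.mul
      (Lp.stronglyMeasurable (𝓕 f : L2C)).enorm
  rw [h1, h2, ← n2_const_mul _ hm]
  have h3 : (fun ξ ↦ ‖(𝓕 (translate z f - f) : L2C) ξ‖ₑ) =ᵐ[volume]
      fun ξ ↦ ‖(((Real.fourierChar (inner ℝ ξ z) : Circle) : ℂ) - 1) * (𝓕 f : L2C) ξ‖ₑ := by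
    have hs : (𝓕 (translate z f - f) : L2C) = 𝓕 (translate z f) - 𝓕 f :=
      map_sub (FourierTransform.fourierCLE ℂ L2C) _ _
    rw [hs]
    filter_upwards [Lp.coeFn_sub (𝓕 (translate z f) : L2C) (𝓕 f : L2C), fourier_translate z f]
      with ξ h1 h2
    rw [h1, Pi.sub_apply, h2, Circle.smul_def, smul_eq_mul]
    congr 1; ring
  rw [n2_congr h3]
  refine n2_mono fun ξ ↦ ?_
  rw [enorm_mul, ← mul_assoc, ← ENNReal.ofReal_mul (by positivity)]
  gcongr
  rw [← ofReal_norm]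
  refine ENNReal.ofReal_le_ofReal ((norm_fourierChar_sub_one_le ha ha1 _).trans ?_)
  rw [mul_assoc (4 * Real.pi), ← Real.mul_rpow (norm_nonneg _) (norm_nonneg _), mul_comm ‖z‖]
  gcongr
  exact abs_real_inner_le_norm ξ z

/-- A smooth compactly supported cutoff in frequency. -/
def cutoff : 𝓢(Plane, ℂ) :=
  HasCompactSupport.toSchwartzMap (f := fun ξ ↦ (((⟨1, 2, one_pos, one_lt_two⟩ :
    ContDiffBump (0 : Plane)) ξ : ℝ) : ℂ))
    ((ContDiffBump.hasCompactSupport _).comp_left (g := fun x : ℝ ↦ (x : ℂ)) rfl)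
    (Complex.ofRealCLM.contDiff.comp (ContDiffBump.contDiff _))

lemma cutoff_zero : cutoff 0 = 1 := by
  show (((⟨1, 2, one_pos, one_lt_two⟩ : ContDiffBump (0 : Plane)) 0 : ℝ) : ℂ) = 1
  rw [ContDiffBump.one_of_mem_closedBall _ (by simp)]; simp

lemma norm_cutoff_le (ξ : Plane) : ‖cutoff ξ‖ ≤ 1 := by
  show ‖(((⟨1, 2, one_pos, one_lt_two⟩ : ContDiffBump (0 : Plane)) ξ : ℝ) : ℂ)‖ ≤ 1
  rw [Complex.norm_real, Real.norm_of_nonneg (ContDiffBump.nonneg _)]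
  exact ContDiffBump.le_one _

/-- The cutoff at frequency scale `1 / ε`. -/
def cutoffAt (ε : ℝ) (hε : 0 < ε) : 𝓢(Plane, ℂ) :=
  SchwartzMap.compCLMOfContinuousLinearEquiv ℂ
    (ContinuousLinearEquiv.smulLeft (R₁ := ℝ) (M₁ := Plane) (Units.mk0 ε hε.ne')) cutoff

lemma cutoffAt_apply {ε : ℝ} (hε : 0 < ε) (ξ : Plane) : cutoffAt ε hε ξ = cutoff (ε • ξ) := rfl

/-- The `j`-th derivative of the mollifying kernel. -/
def kern (φ : 𝓢(Plane, ℂ)) (j : Fin 2) : 𝓢(Plane, ℂ) :=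
  𝓕 ((2 * Real.pi * Complex.I) • mulX j φ)

/-- Two of the three powers of `ε⁻¹` come from the dimension and one from the derivative. -/
lemma kern_cutoffAt {ε : ℝ} (hε : 0 < ε) (j : Fin 2) (z : Plane) :
    kern (cutoffAt ε hε) j z = ((ε⁻¹ ^ 3 : ℝ) : ℂ) * kern cutoff j (ε⁻¹ • z) := by
  simp only [kern, SchwartzMap.fourier_coe, Real.fourier_eq]
  have h := Measure.integral_comp_smul (volume : Measure Plane)
    (fun v ↦ Real.fourierChar (-inner ℝ v (ε⁻¹ • z)) •
      ((2 * Real.pi * Complex.I) • mulX j cutoff) v) ε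
  rw [finrank_euclideanSpace_fin, abs_of_nonneg (by positivity), Complex.real_smul] at h
  have e : ((ε⁻¹ ^ 3 : ℝ) : ℂ) = ((ε⁻¹ : ℝ) : ℂ) * (((ε ^ 2)⁻¹ : ℝ) : ℂ) := by
    push_cast; field_simp
  rw [e, mul_assoc (((ε⁻¹ : ℝ) : ℂ)), ← h, ← integral_const_mul]
  congr 1; ext v
  have hi : inner ℝ (ε • v) (ε⁻¹ • z) = inner ℝ v z := by
    rw [real_inner_smul_left, real_inner_smul_right]; field_simp
  have hε' : (ε : ℂ) ≠ 0 := by exact_mod_cast hε.ne'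
  simp only [hi, smul_apply, mulX_apply, cutoffAt_apply, Circle.smul_def,
    smul_eq_mul, PiLp.smul_apply]
  push_cast
  field_simp

lemma integrable_rpow_mul_schwartz {s : ℝ} (hs : 0 ≤ s) (hs2 : s ≤ 2) (φ : 𝓢(Plane, ℂ)) :
    Integrable fun z ↦ ‖φ z‖ * ‖z‖ ^ s := by
  have h0 := φ.integrable_pow_mul volume 0
  have h2 := φ.integrable_pow_mul volume 2
  refine (h0.add h2).mono' ?_ (.of_forall fun z ↦ ?_)
  · exact (φ.continuous.norm.mul (continuous_norm.rpow_const fun _ ↦ Or.inr hs)).aestronglyMeasurable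
  · rw [Real.norm_of_nonneg (by positivity)]
    simp only [Pi.add_apply, pow_zero, one_mul]
    have : ‖z‖ ^ s ≤ 1 + ‖z‖ ^ 2 := by
      have := norm_rpow_le_jap hs hs2 z
      rwa [jap_two] at this
    nlinarith [norm_nonneg (φ z)]

/-- Scaling gives `ε^(-3)` from the kernel, `ε²` from the area and `ε^(1+δ)` from the weight. One
order of the moment pays for the derivative in the kernel; the surplus `δ` makes the commutator
vanish as `ε` tends to zero. -/
lemma exists_kern_moment {δ : ℝ} (hδ : 0 ≤ δ) (hδ1 : δ ≤ 1) :
    ∃ C : ℝ, 0 ≤ C ∧ ∀ (ε : ℝ) (hε : 0 < ε) (j : Fin 2),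
      ∫⁻ z, ‖kern (cutoffAt ε hε) j z‖ₑ * ENNReal.ofReal (‖z‖ ^ (1 + δ))
        ≤ ENNReal.ofReal (C * ε ^ δ) := by
  set I : Fin 2 → ℝ := fun j ↦ ∫ z, ‖kern cutoff j z‖ * ‖z‖ ^ (1 + δ) with hI
  have hI0 (j) : 0 ≤ I j := integral_nonneg fun z ↦ by positivity
  refine ⟨I 0 + I 1, add_nonneg (hI0 0) (hI0 1), fun ε hε j ↦ ?_⟩
  have e1 : ∫⁻ z, ‖kern (cutoffAt ε hε) j z‖ₑ * ENNReal.ofReal (‖z‖ ^ (1 + δ))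
      = ENNReal.ofReal (∫ z, ‖kern (cutoffAt ε hε) j z‖ * ‖z‖ ^ (1 + δ)) := by
    rw [ofReal_integral_eq_lintegral_ofReal
      (integrable_rpow_mul_schwartz (by linarith) (by linarith) _)
      (.of_forall fun z ↦ by positivity)]
    congr 1; ext z
    rw [ENNReal.ofReal_mul (norm_nonneg _), ofReal_norm]
  rw [e1]
  apply ENNReal.ofReal_le_ofReal
  have h := Measure.integral_comp_smul (volume : Measure Plane)
    (fun z ↦ ‖kern cutoff j z‖ * ‖z‖ ^ (1 + δ)) ε⁻¹
  rw [finrank_euclideanSpace_fin, abs_of_nonneg (by positivity), smul_eq_mul] at h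
  have e2 : ∫ z, ‖kern (cutoffAt ε hε) j z‖ * ‖z‖ ^ (1 + δ)
      = (ε⁻¹ ^ 3 * ε ^ (1 + δ)) * ∫ z, ‖kern cutoff j (ε⁻¹ • z)‖ * ‖ε⁻¹ • z‖ ^ (1 + δ) := by
    rw [← integral_const_mul]
    congr 1; ext z
    have : ‖z‖ = ε * ‖ε⁻¹ • z‖ := by
      rw [norm_smul, norm_inv, Real.norm_of_nonneg hε.le]; field_simp
    rw [kern_cutoffAt, norm_mul, Complex.norm_real, Real.norm_of_nonneg (by positivity), this,
      Real.mul_rpow hε.le (norm_nonneg _)]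
    ring
  rw [e2, h]
  have e3 : ε⁻¹ ^ 3 * ε ^ (1 + δ) * ((ε⁻¹ ^ 2)⁻¹ * I j) = I j * ε ^ δ := by
    rw [Real.rpow_add hε, Real.rpow_one]; field_simp
  rw [e3]
  refine mul_le_mul_of_nonneg_right ?_ (by positivity)
  fin_cases j
  · simpa using hI0 1
  · simpa using hI0 0

/-- The symbol of `∂ⱼ` applied to a Schwartz function in frequency. -/
def diffS (j : Fin 2) (φ : 𝓢(Plane, ℂ)) : 𝓢(Plane, ℂ) := (2 * Real.pi * Complex.I) • mulX j φ

lemma diffS_apply (j : Fin 2) (φ : 𝓢(Plane, ℂ)) (ξ : Plane) :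
    diffS j φ ξ = 2 * Real.pi * Complex.I * ((ξ j : ℂ) * φ ξ) := by
  simp only [diffS, smul_apply, mulX_apply, smul_eq_mul]

/-- The Fourier multiplier with Schwartz symbol `φ`, as a function. -/
def moll (φ : 𝓢(Plane, ℂ)) (θ : L2C) (x : Plane) : ℂ := ∫ ξ, modS x φ ξ * (𝓕 θ : L2C) ξ

lemma moll_eq_integral (φ : 𝓢(Plane, ℂ)) (θ : L2C) (x : Plane) :
    moll φ θ x = ∫ z, (𝓕 φ : 𝓢(Plane, ℂ)) z * θ (x + z) := by
  rw [moll, ← coe_fourier_apply, coe_apply_eq]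
  simp_rw [fourier_modS]
  rw [← integral_add_right_eq_self _ x]
  simp [add_comm]

lemma moll_eq_fourierInv (φ : 𝓢(Plane, ℂ)) (θ : L2C) :
    moll φ θ = 𝓕⁻ (fun ξ ↦ φ ξ * (𝓕 θ : L2C) ξ) := by
  ext x
  rw [Real.fourierInv_eq, moll]
  congr 1; ext ξ
  rw [modS_apply, smul_mul_assoc]

lemma memLp_schwartz_mul (φ : 𝓢(Plane, ℂ)) (f : L2C) : MemLp (fun ξ ↦ φ ξ * f ξ) 2 :=
  (Lp.memLp f).mul' (φ.memLp_top volume)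

lemma moll_ae {φ : 𝓢(Plane, ℂ)} {θ f : L2C}
    (h : (𝓕 f : L2C) =ᵐ[volume] fun ξ ↦ φ ξ * (𝓕 θ : L2C) ξ) : f =ᵐ[volume] moll φ θ := by
  have h1 := fourierInv_toLp_ae (schwartz_mul_L2_integrable φ (𝓕 θ)) (memLp_schwartz_mul φ (𝓕 θ))
  have h2 : (memLp_schwartz_mul φ (𝓕 θ)).toLp _ = (𝓕 f : L2C) := by
    apply Lp.ext
    exact (MemLp.coeFn_toLp _).trans h.symm
  rw [h2, FourierTransform.fourierInv_fourier_eq] at h1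
  rw [moll_eq_fourierInv]
  exact h1

lemma memLp_moll (φ : 𝓢(Plane, ℂ)) (θ : L2C) : MemLp (moll φ θ) 2 := by
  have h := moll_ae (φ := φ) (θ := θ) (f := 𝓕⁻ ((memLp_schwartz_mul φ (𝓕 θ)).toLp _))
    (by rw [FourierTransform.fourier_fourierInv_eq]; exact MemLp.coeFn_toLp _)
  exact (memLp_congr_ae h).1 (Lp.memLp _)

lemma hasFDerivAt_moll (φ : 𝓢(Plane, ℂ)) (θ : L2C) (x : Plane) :
    HasFDerivAt (moll φ θ)
      (∑ j, (EuclideanSpace.proj j : Plane →L[ℝ] ℝ).smulRight (moll (diffS j φ) θ x)) x := by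
  set g : Plane → ℂ := fun ξ ↦ φ ξ * (𝓕 θ : L2C) ξ with hg
  have i1 : Integrable g := schwartz_mul_L2_integrable φ (𝓕 θ)
  have i2 : Integrable fun ξ ↦ ‖ξ‖ * ‖g ξ‖ := by
    have h0 := (schwartz_mul_L2_integrable (mulX 0 φ) (𝓕 θ)).norm
    have h1 := (schwartz_mul_L2_integrable (mulX 1 φ) (𝓕 θ)).norm
    refine (h0.add h1).mono' (continuous_norm.aestronglyMeasurable.mul
      i1.aestronglyMeasurable.norm) (.of_forall fun ξ ↦ ?_)
    rw [Real.norm_of_nonneg (by positivity)]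
    simp only [Pi.add_apply, mulX_apply, norm_mul, Complex.norm_real, Real.norm_eq_abs, hg]
    have : ‖ξ‖ ≤ |ξ 0| + |ξ 1| := by
      refine abs_le_of_sq_le_sq' ?_ (by positivity) |>.2
      rw [norm_plane_sq]
      nlinarith [abs_nonneg (ξ 0), abs_nonneg (ξ 1), sq_abs (ξ 0), sq_abs (ξ 1),
        mul_nonneg (abs_nonneg (ξ 0)) (abs_nonneg (ξ 1))]
    calc ‖ξ‖ * (‖φ ξ‖ * ‖(𝓕 θ : L2C) ξ‖)
        ≤ (|ξ 0| + |ξ 1|) * (‖φ ξ‖ * ‖(𝓕 θ : L2C) ξ‖) := by gcongr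
      _ = _ := by ring
  have i3 : Integrable (VectorFourier.fourierSMulRight (innerSL ℝ) g) := by
    refine (i2.const_mul (2 * Real.pi)).mono' i1.aestronglyMeasurable.fourierSMulRight
      (.of_forall fun ξ ↦ ?_)
    rw [VectorFourier.norm_fourierSMulRight, innerSL_apply_norm]
    exact le_of_eq (by ring)
  have e : moll φ θ = fun x ↦ 𝓕 g (-x) := by
    rw [moll_eq_fourierInv]; ext x; exact fourierInv_eq_fourier_neg _ x
  rw [e]
  have h := (Real.hasFDerivAt_fourier i1 i2 (-x)).comp x (hasFDerivAt_id x).neg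
  refine h.congr_fderiv ?_
  ext w
  have hs : (𝓕 (VectorFourier.fourierSMulRight (innerSL ℝ) g) (-x)) (-w)
      = ∑ j, w j • moll (diffS j φ) θ x := by
    rw [Real.fourier_continuousLinearMap_apply i3, ← fourierInv_eq_fourier_neg, Real.fourierInv_eq]
    have e2 (j : Fin 2) : w j • moll (diffS j φ) θ x
        = ∫ ξ, w j • (modS x (diffS j φ) ξ * (𝓕 θ : L2C) ξ) := by
      rw [moll, integral_smul]
    simp_rw [e2]
    rw [← integral_finsetSum]
    · congr 1; ext ξ
      have hw : innerSL ℝ ξ (-w) = -(w 0 * ξ 0 + w 1 * ξ 1) := by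
        change inner ℝ ξ (-w) = _
        simp [EuclideanSpace.inner_eq_star_dotProduct, dotProduct, Fin.sum_univ_two]
      rw [VectorFourier.fourierSMulRight_apply, hw]
      simp only [Fin.sum_univ_two, modS_apply, diffS_apply,
        EuclideanSpace.inner_eq_star_dotProduct, hg, Circle.smul_def, smul_eq_mul,
        Complex.real_smul, dotProduct, Pi.star_apply, star_trivial]
      push_cast
      ring
    · intro j _
      exact (schwartz_mul_L2_integrable (modS x (diffS j φ)) (𝓕 θ)).smul (w j)
  simpa using hs

/-! ### Mollified transport and its commutator. -/

/-- Integration by parts against a divergence free field. -/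
lemma integral_divFree_eq_zero {u : VectorField}
    (hdiv : ∀ᵐ ξ, (ξ 0 : ℂ) * hat (u 0) ξ + (ξ 1 : ℂ) * hat (u 1) ξ = 0)
    {ψ : Plane → ℂ} (hψ : Integrable ψ) (hψ2 : MemLp ψ 2) (hd : Differentiable ℝ ψ)
    (hd1 : Integrable (fderiv ℝ ψ))
    (hd2 : ∀ j : Fin 2, MemLp (fun x ↦ fderiv ℝ ψ x (EuclideanSpace.single j 1)) 2) :
    ∑ j : Fin 2, ∫ x, cplx (u j) x * fderiv ℝ ψ x (EuclideanSpace.single j 1) = 0 := by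
  -- The field is only square integrable, so the integration by parts is Parseval's identity: the
  -- gradient becomes `2πiξP`, which is orthogonal to the transform of `u`.
  set P : L2C := 𝓕 (hψ2.toLp ψ)
  have hconj (j : Fin 2) : ∀ᵐ x, (starRingEnd ℂ) (cplx (u j) x) = cplx (u j) x := by
    filter_upwards [cplx_ae (u j)] with x hx
    rw [hx, Complex.conj_ofReal]
  have key (j : Fin 2) : ∫ x, cplx (u j) x * fderiv ℝ ψ x (EuclideanSpace.single j 1)
      = ∫ ξ, (starRingEnd ℂ) (hat (u j) ξ) * (2 * Real.pi * Complex.I * (ξ j : ℂ) * P ξ) ∧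
      Integrable fun ξ ↦ (starRingEnd ℂ) (hat (u j) ξ)
        * (2 * Real.pi * Complex.I * (ξ j : ℂ) * P ξ) := by
    have hdj1 : Integrable fun x ↦ fderiv ℝ ψ x (EuclideanSpace.single j 1) :=
      hd1.apply_continuousLinearMap _
    set D : L2C := (hd2 j).toLp _
    have hF : (𝓕 D : L2C) =ᵐ[volume] fun ξ ↦ 2 * Real.pi * Complex.I * (ξ j : ℂ) * P ξ := by
      filter_upwards [fourier_toLp_ae hdj1 (hd2 j), fourier_toLp_ae hψ hψ2] with ξ h1 h2
      rw [h1, h2, ← Real.fourier_continuousLinearMap_apply hd1, Real.fourier_fderiv hψ hd hd1,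
        VectorFourier.fourierSMulRight_apply]
      have hi : innerSL ℝ ξ (EuclideanSpace.single j (1 : ℝ)) = ξ j := by
        change inner ℝ ξ (EuclideanSpace.single j (1 : ℝ)) = _
        simp [EuclideanSpace.inner_single_right]
      simp [hi, mul_assoc]
    have e1 : ∫ x, cplx (u j) x * fderiv ℝ ψ x (EuclideanSpace.single j 1)
        = ∫ x, (starRingEnd ℂ) (cplx (u j) x) * D x := by
      apply integral_congr_ae
      filter_upwards [hconj j, (hd2 j).coeFn_toLp] with x h1 h2
      rw [h1, h2]
    have e2 : ∀ᵐ ξ, (starRingEnd ℂ) (hat (u j) ξ) * (𝓕 D : L2C) ξ = (starRingEnd ℂ) (hat (u j) ξ)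
        * (2 * Real.pi * Complex.I * (ξ j : ℂ) * P ξ) := by
      filter_upwards [hF] with ξ h
      rw [h]
    refine ⟨?_, ?_⟩
    · rw [e1, integral_conj_mul_eq_inner, ← Lp.inner_fourier_eq, ← integral_conj_mul_eq_inner]
      exact integral_congr_ae e2
    · refine Integrable.congr ?_ e2
      exact MemLp.integrable_mul (p := 2) (q := 2) (Lp.memLp (hat (u j))).star (Lp.memLp _)
  rw [Fin.sum_univ_two, (key 0).1, (key 1).1, ← integral_add (key 0).2 (key 1).2]
  rw [← integral_zero Plane ℂ]
  apply integral_congr_ae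
  filter_upwards [hdiv] with ξ h
  have h' := congrArg (starRingEnd ℂ) h
  simp only [map_add, map_mul, Complex.conj_ofReal, map_zero] at h'
  linear_combination (2 * Real.pi * Complex.I * P ξ) * h'

/-- The remainder of the mollified transport term. -/
def commut (φ : 𝓢(Plane, ℂ)) (v : Fin 2 → L2C) (θ : L2C) (x : Plane) : ℂ :=
  ∑ j, ∫ z, kern φ j z * ((v j (x + z) - v j x) * (θ (x + z) - θ x))

lemma integral_kern (φ : 𝓢(Plane, ℂ)) (j : Fin 2) : ∫ z, kern φ j z = 0 := by
  have h : (𝓕⁻ (kern φ j) : 𝓢(Plane, ℂ)) 0 = ∫ z, kern φ j z := by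
    rw [SchwartzMap.fourierInv_coe, Real.fourierInv_eq]
    simp
  rw [← h, kern, FourierTransform.fourierInv_fourier_eq]
  simp [mulX_apply]

lemma memLp_comp_add (f : L2C) (x : Plane) : MemLp (fun z ↦ f (x + z)) 2 :=
  (Lp.memLp f).comp_measurePreserving (measurePreserving_add_left volume x)

lemma integrable_schwartz_mul_comp_add (φ : 𝓢(Plane, ℂ)) (f : L2C) (x : Plane) :
    Integrable fun z ↦ φ z * f (x + z) :=
  MemLp.integrable_mul (p := 2) (q := 2) (φ.memLp 2 volume) (memLp_comp_add f x)

lemma integrable_schwartz_mul_comp_add_mul (φ : 𝓢(Plane, ℂ)) (f g : L2C) (x : Plane) :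
    Integrable fun z ↦ φ z * (f (x + z) * g (x + z)) :=
  MemLp.integrable_mul (p := ∞) (q := 1) (φ.memLp_top volume)
    (memLp_one_iff_integrable.2 (MemLp.integrable_mul (p := 2) (q := 2) (memLp_comp_add f x)
      (memLp_comp_add g x)))

/-- Splitting the mollified product into transport of the mollified function and a commutator. -/
lemma integral_kern_mul_eq {u : VectorField}
    (hdiv : ∀ᵐ ξ, (ξ 0 : ℂ) * hat (u 0) ξ + (ξ 1 : ℂ) * hat (u 1) ξ = 0)
    (φ : 𝓢(Plane, ℂ)) (θ : L2C) (x : Plane) :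
    ∑ j, ∫ z, kern φ j z * (cplx (u j) (x + z) * θ (x + z))
      = (∑ j, cplx (u j) x * moll (diffS j φ) θ x) + commut φ (fun j ↦ cplx (u j)) θ x := by
  -- This sum is the divergence of the mollified field, hence zero.
  have hdiv0 : ∑ j, ∫ z, kern φ j z * cplx (u j) (x + z) = 0 := by
    have h (j : Fin 2) : ∫ z, kern φ j z * cplx (u j) (x + z)
        = ∫ ξ, modS x (diffS j φ) ξ * hat (u j) ξ :=
      (moll_eq_integral (diffS j φ) (cplx (u j)) x).symm
    rw [Fin.sum_univ_two, h, h, ← integral_add (schwartz_mul_L2_integrable _ _)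
      (schwartz_mul_L2_integrable _ _), ← integral_zero Plane ℂ]
    apply integral_congr_ae
    filter_upwards [hdiv] with ξ hξ
    simp only [modS_apply, diffS_apply, Circle.smul_def, smul_eq_mul]
    linear_combination (((Real.fourierChar (inner ℝ ξ x) : Circle) : ℂ)
      * (2 * Real.pi * Complex.I) * φ ξ) * hξ
  -- Expanding the product of differences gives four terms. The one without shifts vanishes because
  -- `kern` has mean zero, and the one with `θ x` disappears after summing over `j` by `hdiv0`.
  have hR (j : Fin 2) : ∫ z, kern φ j z * ((cplx (u j) (x + z) - cplx (u j) x)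
        * (θ (x + z) - θ x))
      = (∫ z, kern φ j z * (cplx (u j) (x + z) * θ (x + z)))
        - cplx (u j) x * moll (diffS j φ) θ x
        - θ x * ∫ z, kern φ j z * cplx (u j) (x + z) := by
    have i1 := integrable_schwartz_mul_comp_add_mul (kern φ j) (cplx (u j)) θ x
    have i2 := (integrable_schwartz_mul_comp_add (kern φ j) θ x).const_mul (cplx (u j) x)
    have i3 := (integrable_schwartz_mul_comp_add (kern φ j) (cplx (u j)) x).const_mul (θ x)
    have i4 : Integrable fun z ↦ cplx (u j) x * θ x * kern φ j z :=
      (kern φ j).integrable.const_mul (cplx (u j) x * θ x)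
    have i12 : Integrable fun z ↦ kern φ j z * (cplx (u j) (x + z) * θ (x + z))
        - cplx (u j) x * (kern φ j z * θ (x + z)) := i1.sub i2
    have i123 : Integrable fun z ↦ kern φ j z * (cplx (u j) (x + z) * θ (x + z))
        - cplx (u j) x * (kern φ j z * θ (x + z))
        - θ x * (kern φ j z * cplx (u j) (x + z)) := i12.sub i3
    rw [moll_eq_integral, ← integral_const_mul, ← integral_const_mul]
    change _ = (∫ z, kern φ j z * (cplx (u j) (x + z) * θ (x + z)))
        - (∫ z, cplx (u j) x * (kern φ j z * θ (x + z))) - _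
    have h4 : ∫ z, cplx (u j) x * θ x * kern φ j z = 0 := by
      rw [integral_const_mul, integral_kern, mul_zero]
    rw [← integral_sub i1 i2, ← integral_sub i12 i3]
    conv_rhs => rw [← add_zero (integral _ _), ← h4, ← integral_add i123 i4]
    congr 1; ext z; ring
  rw [commut, Fin.sum_univ_two, Fin.sum_univ_two, Fin.sum_univ_two, hR, hR]
  rw [Fin.sum_univ_two] at hdiv0
  linear_combination θ x * hdiv0

lemma measurable_enorm_L2 (f : L2C) : Measurable fun ξ ↦ ‖f ξ‖ₑ :=
  (Lp.stronglyMeasurable f).measurable.enorm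

/-- The commutator estimate in `L¹`. -/
lemma lintegral_commut_le {δ : ℝ} (hδ : 0 ≤ δ) (hδ1 : δ ≤ 1) (φ : 𝓢(Plane, ℂ))
    (v : Fin 2 → L2C) (θ : L2C) :
    ∫⁻ x, ‖commut φ v θ x‖ₑ ≤ ∑ j, (∫⁻ z, ‖kern φ j z‖ₑ * ENNReal.ofReal (‖z‖ ^ (1 + δ)))
      * (ENNReal.ofReal (4 * Real.pi) ^ 2
        * n2 (fun ξ ↦ ‖ξ‖ₑ * ‖(𝓕 (v j) : L2C) ξ‖ₑ)
        * n2 (fun ξ ↦ ENNReal.ofReal (‖ξ‖ ^ δ) * ‖(𝓕 θ : L2C) ξ‖ₑ)) := by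
  have hvm (j : Fin 2) : Measurable (v j) := (Lp.stronglyMeasurable (v j)).measurable
  have hθm : Measurable θ := (Lp.stronglyMeasurable θ).measurable
  have hm (j : Fin 2) : Measurable (Function.uncurry fun x z : Plane ↦ ‖kern φ j z‖ₑ
      * (‖v j (x + z) - v j x‖ₑ * ‖θ (x + z) - θ x‖ₑ)) := by
    have hk : Measurable fun z ↦ kern φ j z := (kern φ j).continuous.measurable
    unfold Function.uncurry
    fun_prop
  calc ∫⁻ x, ‖commut φ v θ x‖ₑ
      ≤ ∫⁻ x, ∑ j, ∫⁻ z, ‖kern φ j z‖ₑ * (‖v j (x + z) - v j x‖ₑ * ‖θ (x + z) - θ x‖ₑ) := by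
        gcongr with x
        refine (enorm_sum_le _ _).trans (Finset.sum_le_sum fun j _ ↦ ?_)
        refine (enorm_integral_le_lintegral_enorm _).trans (le_of_eq ?_)
        simp_rw [enorm_mul]
    _ = ∑ j, ∫⁻ x, ∫⁻ z, ‖kern φ j z‖ₑ * (‖v j (x + z) - v j x‖ₑ * ‖θ (x + z) - θ x‖ₑ) :=
        lintegral_finsetSum _ fun j _ ↦ (hm j).lintegral_prod_right'
    _ = ∑ j, ∫⁻ z, ‖kern φ j z‖ₑ * ∫⁻ x, ‖v j (x + z) - v j x‖ₑ * ‖θ (x + z) - θ x‖ₑ := by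
        refine Finset.sum_congr rfl fun j _ ↦ ?_
        rw [lintegral_lintegral_swap (hm j).aemeasurable]
        congr 1; ext z
        rw [lintegral_const_mul _ (by fun_prop)]
    _ ≤ ∑ j, ∫⁻ z, ‖kern φ j z‖ₑ * ENNReal.ofReal (‖z‖ ^ (1 + δ))
          * (ENNReal.ofReal (4 * Real.pi) ^ 2
            * n2 (fun ξ ↦ ‖ξ‖ₑ * ‖(𝓕 (v j) : L2C) ξ‖ₑ)
            * n2 (fun ξ ↦ ENNReal.ofReal (‖ξ‖ ^ δ) * ‖(𝓕 θ : L2C) ξ‖ₑ)) := by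
        refine Finset.sum_le_sum fun j _ ↦ lintegral_mono fun z ↦ ?_
        rw [mul_assoc]
        refine mul_le_mul_right ?_ _
        -- Cauchy–Schwarz in `x` at fixed `z`: the increment of `v` costs a full derivative and that
        -- of `θ` a derivative of order `δ`, which produces the weight `|z|^(1+δ)`.
        refine (lintegral_mul_le_n2 (by fun_prop) (by fun_prop)).trans ?_
        refine (mul_le_mul' (n2_translate_sub_le zero_le_one le_rfl z (v j))
          (n2_translate_sub_le hδ hδ1 z θ)).trans (le_of_eq ?_)
        have e1 : (fun ξ : Plane ↦ ENNReal.ofReal (‖ξ‖ ^ (1 : ℝ)) * ‖(𝓕 (v j) : L2C) ξ‖ₑ)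
            = fun ξ ↦ ‖ξ‖ₑ * ‖(𝓕 (v j) : L2C) ξ‖ₑ := by
          ext ξ; rw [Real.rpow_one, ofReal_norm]
        rw [e1, ENNReal.ofReal_mul (p := 4 * Real.pi) (by positivity),
          ENNReal.ofReal_mul (p := 4 * Real.pi) (by positivity),
          Real.rpow_add_of_nonneg (norm_nonneg z) zero_le_one hδ,
          ENNReal.ofReal_mul (p := ‖z‖ ^ (1 : ℝ)) (by positivity)]
        ring
    _ = _ := by
        refine Finset.sum_congr rfl fun j _ ↦ ?_
        have hk : Measurable fun z ↦ kern φ j z := (kern φ j).continuous.measurable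
        rw [lintegral_mul_const _ (by fun_prop)]

lemma continuous_moll (φ : 𝓢(Plane, ℂ)) (θ : L2C) : Continuous (moll φ θ) :=
  continuous_iff_continuousAt.2 fun x ↦ (hasFDerivAt_moll φ θ x).continuousAt

lemma norm_moll_le (φ : 𝓢(Plane, ℂ)) (θ : L2C) (x : Plane) :
    ‖moll φ θ x‖ ≤ ∫ ξ, ‖φ ξ * (𝓕 θ : L2C) ξ‖ := by
  refine (norm_integral_le_integral_norm _).trans (le_of_eq ?_)
  congr 1; ext ξ
  rw [modS_apply, smul_mul_assoc, Circle.norm_smul]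

lemma continuous_rder {κ : ℝ} (hκ : 0 < κ) : Continuous (rder κ) :=
  (lipschitzWith_rder hκ).continuous

lemma integrable_mul_moll (f : L2C) (φ : 𝓢(Plane, ℂ)) (θ : L2C) :
    Integrable fun x ↦ f x * moll φ θ x :=
  MemLp.integrable_mul (p := 2) (q := 2) (Lp.memLp f) (memLp_moll φ θ)

/-- The transport term drops out of the truncated energy. -/
lemma re_integral_rder_transport {u : VectorField}
    (hdiv : ∀ᵐ ξ, (ξ 0 : ℂ) * hat (u 0) ξ + (ξ 1 : ℂ) * hat (u 1) ξ = 0)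
    {κ : ℝ} (hκ : 0 < κ) (φ : 𝓢(Plane, ℂ)) (θ : L2C) :
    Integrable (fun x ↦ rder κ (moll φ θ x) * ∑ j, cplx (u j) x * moll (diffS j φ) θ x) ∧
    (∫ x, rder κ (moll φ θ x) * ∑ j, cplx (u j) x * moll (diffS j φ) θ x).re = 0 := by
  set m := moll φ θ with hm
  set mj : Fin 2 → Plane → ℂ := fun j ↦ moll (diffS j φ) θ with hmj
  have hmc : Continuous m := continuous_moll φ θ
  have hrc : Continuous fun x ↦ rder κ (m x) := (continuous_rder hκ).comp hmc
  have hmjc (j) : Continuous (mj j) := continuous_moll _ θ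
  have hint (j : Fin 2) : Integrable fun x ↦ rder κ (m x) * (cplx (u j) x * mj j x) :=
    (integrable_mul_moll _ _ _).bdd_mul (c := (Real.sqrt κ)⁻¹) hrc.aestronglyMeasurable
      (.of_forall fun x ↦ norm_rder_le_inv_sqrt hκ _)
  have hI : Integrable (fun x ↦ rder κ (m x) * ∑ j, cplx (u j) x * mj j x) := by
    simp_rw [Finset.mul_sum]
    exact integrable_finsetSum _ fun j _ ↦ hint j
  refine ⟨hI, ?_⟩
  -- By the chain rule twice the real part of `rder` times the derivative of `moll φ θ` is the
  -- derivative of `ψ`. The transport term is thus half of `∫ u · ∇ψ`, which vanishes for divergence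
  -- free `u`.
  set ψ : Plane → ℂ := fun x ↦ (rtrunc κ (m x) : ℂ) with hψdef
  have hD (x : Plane) : HasFDerivAt ψ (Complex.ofRealCLM.comp
      (((1 + κ * ‖m x‖ ^ 2)⁻¹ • ((2 : ℝ) • innerSL ℝ (m x))).comp
        (∑ j, (EuclideanSpace.proj j : Plane →L[ℝ] ℝ).smulRight (mj j x)))) x :=
    (Complex.ofRealCLM.hasFDerivAt).comp x
      ((hasFDerivAt_rtrunc hκ (m x)).comp x (hasFDerivAt_moll φ θ x))
  have happ (x w : Plane) : fderiv ℝ ψ x w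
      = ((2 * (rder κ (m x) * ∑ j, w j • mj j x).re : ℝ) : ℂ) := by
    rw [(hD x).fderiv]
    rw [ContinuousLinearMap.comp_apply, ContinuousLinearMap.comp_apply,
      fderiv_rtrunc_apply κ (m x)]
    simp
  have hsingle (j : Fin 2) (x : Plane) : fderiv ℝ ψ x (EuclideanSpace.single j 1)
      = ((2 * (rder κ (m x) * mj j x).re : ℝ) : ℂ) := by
    rw [happ]
    fin_cases j <;> simp
  have hψ0 (x) : ‖ψ x‖ = rtrunc κ (m x) := by
    rw [hψdef, Complex.norm_real, Real.norm_of_nonneg (rtrunc_nonneg hκ _)]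
  have hψc : Continuous ψ :=
    Complex.continuous_ofReal.comp ((continuous_rtrunc hκ).comp hmc)
  have hψ1 : Integrable ψ := by
    have h2 := (memLp_moll φ θ).integrable_norm_pow (p := 2) (by norm_num)
    refine h2.mono' hψc.aestronglyMeasurable (.of_forall fun x ↦ ?_)
    rw [hψ0]; exact rtrunc_le hκ _
  have hψ2 : MemLp ψ 2 := by
    refine (memLp_moll φ θ).of_le_mul (c := ∫ ξ, ‖φ ξ * (𝓕 θ : L2C) ξ‖)
      hψc.aestronglyMeasurable (.of_forall fun x ↦ ?_)
    rw [hψ0]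
    refine (rtrunc_le hκ _).trans ?_
    rw [pow_two]
    exact mul_le_mul_of_nonneg_right (norm_moll_le φ θ x) (norm_nonneg _)
  have hd1 : Integrable (fderiv ℝ ψ) := by
    have hb (j : Fin 2) : Integrable fun x ↦ ‖m x‖ * ‖mj j x‖ :=
      MemLp.integrable_mul (p := 2) (q := 2) (memLp_moll φ θ).norm (memLp_moll _ θ).norm
    refine (((hb 0).add (hb 1)).const_mul 2).mono'
      (measurable_fderiv ℝ ψ).aestronglyMeasurable (.of_forall fun x ↦ ?_)
    refine ContinuousLinearMap.opNorm_le_bound _ (by simp only [Pi.add_apply]; positivity)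
      fun w ↦ ?_
    rw [happ, Complex.norm_real, Real.norm_eq_abs, abs_mul, abs_two, Pi.add_apply]
    have h1 : |(rder κ (m x) * ∑ j, w j • mj j x).re| ≤ ‖m x‖ * (‖w‖ * (‖mj 0 x‖ + ‖mj 1 x‖)) := by
      refine (Complex.abs_re_le_norm _).trans ?_
      rw [norm_mul]
      refine mul_le_mul (norm_rder_le hκ _) ?_ (norm_nonneg _) (norm_nonneg _)
      refine (norm_sum_le _ _).trans ?_
      rw [Fin.sum_univ_two, norm_smul, norm_smul, mul_add]
      have h0 := norm_coord_le w 0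
      have h1 := norm_coord_le w 1
      rw [Complex.norm_real] at h0 h1
      gcongr
    linarith
  have hd2 (j : Fin 2) : MemLp (fun x ↦ fderiv ℝ ψ x (EuclideanSpace.single j 1)) 2 := by
    refine (memLp_moll (diffS j φ) θ).of_le_mul (c := 2 * (Real.sqrt κ)⁻¹) ?_
      (.of_forall fun x ↦ ?_)
    · exact (hd1.apply_continuousLinearMap _).aestronglyMeasurable
    · rw [hsingle, Complex.norm_real, Real.norm_eq_abs, abs_mul, abs_two, mul_assoc]
      refine mul_le_mul_of_nonneg_left ((Complex.abs_re_le_norm _).trans ?_) zero_le_two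
      rw [norm_mul]
      exact mul_le_mul_of_nonneg_right (norm_rder_le_inv_sqrt hκ _) (norm_nonneg _)
  have key := integral_divFree_eq_zero hdiv hψ1 hψ2 (fun x ↦ (hD x).differentiableAt) hd1 hd2
  have hi (j : Fin 2) : Integrable fun x ↦ cplx (u j) x
      * fderiv ℝ ψ x (EuclideanSpace.single j 1) :=
    MemLp.integrable_mul (p := 2) (q := 2) (Lp.memLp _) (hd2 j)
  rw [← integral_finsetSum _ fun j _ ↦ hi j] at key
  have e : ∫ x, ∑ j : Fin 2, cplx (u j) x * fderiv ℝ ψ x (EuclideanSpace.single j 1)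
      = ∫ x, ((2 * (rder κ (m x) * ∑ j, cplx (u j) x * mj j x).re : ℝ) : ℂ) := by
    apply integral_congr_ae
    filter_upwards [cplx_ae (u 0), cplx_ae (u 1)] with x h0 h1
    simp only [Fin.sum_univ_two, hsingle, h0, h1]
    have : (rder κ (m x) * ((u 0 x : ℂ) * mj 0 x + (u 1 x : ℂ) * mj 1 x)).re
        = u 0 x * (rder κ (m x) * mj 0 x).re + u 1 x * (rder κ (m x) * mj 1 x).re := by
      rw [← Complex.re_ofReal_mul, ← Complex.re_ofReal_mul, ← Complex.add_re]
      congr 1; ring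
    rw [this]; push_cast; ring
  rw [e, integral_complex_ofReal, Complex.ofReal_eq_zero, integral_const_mul] at key
  have h3 := integral_re hI
  simp only [RCLike.re_to_complex] at h3
  rw [← h3]
  linarith

lemma norm_conv_memLp_top (f g : L2C) : MemLp (conv f g) ∞ :=
  memLp_top_of_norm_le (stronglyMeasurable_conv f g).aestronglyMeasurable (C := ‖f‖ * ‖g‖)
    (fun ξ ↦ norm_conv_le f g ξ)

/-- A mollified divergence `∑ ∂ⱼ (vⱼ θ)` as an integral in physical space. -/
lemma moll_divergence_ae {φ : 𝓢(Plane, ℂ)} {v : Fin 2 → L2C} {θ a : L2C}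
    (h : (𝓕 a : L2C) =ᵐ[volume] fun ξ ↦ φ ξ * (2 * Real.pi * Complex.I
      * ∑ j, (ξ j : ℂ) * conv (𝓕 (v j) : L2C) (𝓕 θ : L2C) ξ)) :
    a =ᵐ[volume] fun x ↦ ∑ j, ∫ z, kern φ j z * (v j (x + z) * θ (x + z)) := by
  set g : Plane → ℂ := fun ξ ↦ ∑ j, diffS j φ ξ * conv (𝓕 (v j) : L2C) (𝓕 θ : L2C) ξ with hg
  have hgj1 (χ : 𝓢(Plane, ℂ)) (j : Fin 2) :
      Integrable fun ξ ↦ χ ξ * conv (𝓕 (v j) : L2C) (𝓕 θ : L2C) ξ :=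
    schwartz_mul_conv_integrable _ _ _
  have hg1 : Integrable g := integrable_finsetSum _ fun j _ ↦ hgj1 _ j
  have hg2 : MemLp g 2 := memLp_finsetSum _ fun j _ ↦
    (norm_conv_memLp_top (𝓕 (v j)) (𝓕 θ)).mul' ((diffS j φ).memLp 2 volume)
  have h2 : hg2.toLp g = (𝓕 a : L2C) := by
    apply Lp.ext
    filter_upwards [hg2.coeFn_toLp, h] with ξ h1 h2
    rw [h1, h2, hg]
    simp only [Fin.sum_univ_two, diffS_apply]
    ring
  have h3 := fourierInv_toLp_ae hg1 hg2
  rw [h2, FourierTransform.fourierInv_fourier_eq] at h3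
  refine h3.trans (.of_forall fun x ↦ ?_)
  rw [Real.fourierInv_eq]
  have e (j : Fin 2) : ∫ z, kern φ j z * (v j (x + z) * θ (x + z))
      = ∫ ξ, modS x (diffS j φ) ξ * conv (𝓕 (v j) : L2C) (𝓕 θ : L2C) ξ := by
    rw [← integral_mul_fourier, ← integral_add_right_eq_self
      (fun y ↦ (𝓕 (modS x (diffS j φ)) : 𝓢(Plane, ℂ)) y * (v j y * θ y)) x]
    congr 1; ext z
    rw [fourier_modS, add_sub_cancel_right, add_comm z x]
    rfl
  simp_rw [e]
  rw [← integral_finsetSum _ fun j _ ↦ hgj1 _ j]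
  congr 1; ext ξ
  rw [hg, Finset.smul_sum]
  refine Finset.sum_congr rfl fun j _ ↦ ?_
  rw [modS_apply, smul_mul_assoc]

/-- The truncated energy is almost conserved by mollified transport. -/
theorem exists_abs_re_pairL_transport_le {δ : ℝ} (hδ : 0 ≤ δ) (hδ1 : δ ≤ 1) :
    ∃ C : ℝ, 0 ≤ C ∧ ∀ (u : VectorField) (θ f a : L2C) (ε κ M N : ℝ) (hε : 0 < ε) (hκ : 0 < κ),
      (∀ᵐ ξ, (ξ 0 : ℂ) * hat (u 0) ξ + (ξ 1 : ℂ) * hat (u 1) ξ = 0) →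
      ((𝓕 f : L2C) =ᵐ[volume] fun ξ ↦ cutoffAt ε hε ξ * (𝓕 θ : L2C) ξ) →
      ((𝓕 a : L2C) =ᵐ[volume] fun ξ ↦ cutoffAt ε hε ξ * (2 * Real.pi * Complex.I
        * ∑ j, (ξ j : ℂ) * conv (hat (u j)) (𝓕 θ : L2C) ξ)) →
      0 ≤ M → 0 ≤ N →
      (∀ j, n2 (fun ξ ↦ ‖ξ‖ₑ * ‖hat (u j) ξ‖ₑ) ≤ ENNReal.ofReal M) →
      n2 (fun ξ ↦ ENNReal.ofReal (‖ξ‖ ^ δ) * ‖(𝓕 θ : L2C) ξ‖ₑ) ≤ ENNReal.ofReal N →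
      |(pairL (rderLp hκ f) a).re| ≤ C * ε ^ δ * (Real.sqrt κ)⁻¹ * M * N := by
  obtain ⟨C, hC, hmom⟩ := exists_kern_moment hδ hδ1
  refine ⟨2 * C * (4 * Real.pi) ^ 2, by positivity, ?_⟩
  intro u θ f a ε κ M N hε hκ hdiv hf ha hM hN hu hθ
  set φ := cutoffAt ε hε
  set R := commut φ (fun j ↦ cplx (u j)) θ with hR
  set p : Plane → ℂ := fun x ↦ ∑ j, cplx (u j) x * moll (diffS j φ) θ x with hp
  have hf' := moll_ae hf
  have ha' : a =ᵐ[volume] fun x ↦ p x + R x :=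
    (moll_divergence_ae (v := fun j ↦ cplx (u j)) ha).trans
      (.of_forall fun x ↦ integral_kern_mul_eq hdiv φ θ x)
  have hRb : ∫⁻ x, ‖R x‖ₑ ≤ ENNReal.ofReal (2 * C * (4 * Real.pi) ^ 2 * ε ^ δ * M * N) := by
    refine (lintegral_commut_le hδ hδ1 φ _ θ).trans ?_
    calc _ ≤ ∑ j : Fin 2, ENNReal.ofReal (C * ε ^ δ) * (ENNReal.ofReal (4 * Real.pi) ^ 2
          * ENNReal.ofReal M * ENNReal.ofReal N) := by
          refine Finset.sum_le_sum fun j _ ↦ ?_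
          gcongr
          · exact hmom ε hε j
          · exact hu j
      _ = ENNReal.ofReal (2 * C * (4 * Real.pi) ^ 2 * ε ^ δ * M * N) := by
          rw [← ENNReal.ofReal_pow (by positivity), ← ENNReal.ofReal_mul (by positivity),
            ← ENNReal.ofReal_mul (by positivity), ← ENNReal.ofReal_mul (by positivity),
            Fin.sum_univ_two, ← ENNReal.ofReal_add (by positivity) (by positivity)]
          congr 1; ring
  have hpi : Integrable p := integrable_finsetSum _ fun j _ ↦ integrable_mul_moll _ _ _
  have hRm : AEStronglyMeasurable R volume := by
    refine ((Lp.aestronglyMeasurable a).sub hpi.aestronglyMeasurable).congr ?_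
    filter_upwards [ha'] with x hx
    simp [hx]
  have hRi : Integrable R := ⟨hRm, hRb.trans_lt ENNReal.ofReal_lt_top⟩
  have hRn : ∫ x, ‖R x‖ ≤ 2 * C * (4 * Real.pi) ^ 2 * ε ^ δ * M * N := by
    rw [integral_norm_eq_lintegral_enorm hRm]
    exact ENNReal.toReal_le_of_le_ofReal (by positivity) hRb
  obtain ⟨i1, e1⟩ := re_integral_rder_transport hdiv hκ φ θ
  have hrc : Continuous fun x ↦ rder κ (moll φ θ x) :=
    (continuous_rder hκ).comp (continuous_moll φ θ)
  have i2 : Integrable fun x ↦ rder κ (moll φ θ x) * R x :=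
    hRi.bdd_mul (c := (Real.sqrt κ)⁻¹) hrc.aestronglyMeasurable
      (.of_forall fun x ↦ norm_rder_le_inv_sqrt hκ _)
  have e2 : pairL (rderLp hκ f) a = (∫ x, rder κ (moll φ θ x) * p x)
      + ∫ x, rder κ (moll φ θ x) * R x := by
    rw [pairL_apply, ← integral_add i1 i2]
    apply integral_congr_ae
    filter_upwards [rderLp_ae hκ f, hf', ha'] with x h1 h2 h3
    rw [h1, h2, h3]; ring
  -- Transport of the mollified function has dropped out; the bounded `rder` is left against the
  -- integrable commutator.
  rw [e2, Complex.add_re, e1, zero_add]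
  refine (Complex.abs_re_le_norm _).trans ((norm_integral_le_integral_norm _).trans ?_)
  calc ∫ x, ‖rder κ (moll φ θ x) * R x‖ ≤ ∫ x, (Real.sqrt κ)⁻¹ * ‖R x‖ := by
        refine integral_mono i2.norm (hRi.norm.const_mul _) fun x ↦ ?_
        simp only [norm_mul]
        exact mul_le_mul_of_nonneg_right (norm_rder_le_inv_sqrt hκ _) (norm_nonneg _)
    _ = (Real.sqrt κ)⁻¹ * ∫ x, ‖R x‖ := integral_const_mul _ _
    _ ≤ (Real.sqrt κ)⁻¹ * (2 * C * (4 * Real.pi) ^ 2 * ε ^ δ * M * N) := by gcongr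
    _ = _ := by ring

/-! ### The vorticity equation and its energy inequality. -/

lemma n2_add_le {F G : Plane → ℝ≥0∞} (hF : Measurable F) (hG : Measurable G) :
    n2 (fun ξ ↦ F ξ + G ξ) ≤ n2 F + n2 G := by
  have h := ENNReal.lintegral_Lp_add_le (μ := (volume : Measure Plane)) (p := 2) hF.aemeasurable
    hG.aemeasurable (by norm_num)
  simpa [n2] using h

/-- The algebra behind the absence of vortex stretching in two dimensions: the expression is
symmetrized under exchange of the frequencies `η` and `ξ - η` of two divergence free fields. -/
lemma curl_div_antisymm {ξ0 ξ1 η0 η1 A0 A1 B0 B1 : ℂ} (hA : η0 * A0 + η1 * A1 = 0)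
    (hB : (ξ0 - η0) * B0 + (ξ1 - η1) * B1 = 0) :
    (ξ0 * A0 + ξ1 * A1) * (η0 * B1 - η1 * B0)
      + (ξ0 * B0 + ξ1 * B1) * ((ξ0 - η0) * A1 - (ξ1 - η1) * A0) = 0 := by
  linear_combination (ξ0 * B1 - ξ1 * B0) * hA + (ξ0 * A1 - ξ1 * A0) * hB

/-- The curl of `div (u ⊗ u)` is the divergence of `u` times its curl. -/
lemma curlHat_advHat {U : Fin 2 → L2C} {Ω : L2C}
    (hdiv : ∀ᵐ ξ, (ξ 0 : ℂ) * U 0 ξ + (ξ 1 : ℂ) * U 1 ξ = 0)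
    (hU : ∀ i l : Fin 2, MemLp (fun ξ ↦ (ξ i : ℂ) * U l ξ) 2)
    (hΩ : Ω =ᵐ[volume] curlHat fun i ↦ U i) (ξ : Plane) :
    curlHat (advHat U U) ξ = 2 * Real.pi * Complex.I * ∑ j, (ξ j : ℂ) * conv (U j) Ω ξ := by
  have i0 (j l : Fin 2) : Integrable fun η ↦ U j η * U l (ξ - η) := integrable_conv _ _ _
  have i1 (j i l : Fin 2) : Integrable fun η ↦ U j η * (((ξ - η) i : ℝ) * U l (ξ - η)) :=
    MemLp.integrable_mul (p := 2) (q := 2) (Lp.memLp (U j))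
      ((hU i l).comp_measurePreserving (Measure.measurePreserving_sub_left volume ξ))
  have hdivL : ∀ᵐ η, (((ξ - η) 0 : ℝ) : ℂ) * U 0 (ξ - η) + (((ξ - η) 1 : ℝ) : ℂ) * U 1 (ξ - η) = 0 :=
    (Measure.measurePreserving_sub_left volume ξ).quasiMeasurePreserving.ae hdiv
  have hΩL : ∀ᵐ η, Ω (ξ - η) = curlHat (fun i ↦ U i) (ξ - η) :=
    (Measure.measurePreserving_sub_left volume ξ).quasiMeasurePreserving.ae hΩ
  -- `D` is the integrand of the curl of `div (u ⊗ u)` minus that of `div (u ω)`. It changes sign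
  -- under `η ↦ ξ - η`, so its integral is zero.
  set D : Plane → ℂ := fun η ↦ ((ξ 0 : ℂ) * U 0 η + (ξ 1 : ℂ) * U 1 η)
    * ((η 0 : ℂ) * U 1 (ξ - η) - (η 1 : ℂ) * U 0 (ξ - η)) with hD
  have hDsymm : ∫ η, D η = 0 := by
    have h1 : ∫ η, D (ξ - η) = ∫ η, D η := integral_sub_left_eq_self D volume ξ
    have h2 : ∀ᵐ η, D (ξ - η) = - D η := by
      filter_upwards [hdiv, hdivL] with η a b
      simp only [PiLp.sub_apply, Complex.ofReal_sub] at b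
      have := curl_div_antisymm a b
      simp only [hD, sub_sub_cancel, PiLp.sub_apply, Complex.ofReal_sub]
      linear_combination this
    rw [integral_congr_ae h2, integral_neg] at h1
    have : (2 : ℂ) * ∫ η, D η = 0 := by linear_combination -h1
    simpa using this
  have hc (j l : Fin 2) : conv (U j) (U l) ξ = ∫ η, U j η * U l (ξ - η) := rfl
  have e1 : curlHat (advHat U U) ξ = 2 * Real.pi * Complex.I
      * ∫ η, ((ξ 0 : ℂ) * U 0 η + (ξ 1 : ℂ) * U 1 η)
        * ((ξ 0 : ℂ) * U 1 (ξ - η) - (ξ 1 : ℂ) * U 0 (ξ - η)) := by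
    have : (fun η ↦ ((ξ 0 : ℂ) * U 0 η + (ξ 1 : ℂ) * U 1 η)
        * ((ξ 0 : ℂ) * U 1 (ξ - η) - (ξ 1 : ℂ) * U 0 (ξ - η)))
        = fun η ↦ ((ξ 0 : ℂ) * ξ 0 * (U 0 η * U 1 (ξ - η)) + (ξ 0 : ℂ) * ξ 1 * (U 1 η * U 1 (ξ - η)))
          - ((ξ 1 : ℂ) * ξ 0 * (U 0 η * U 0 (ξ - η)) + (ξ 1 : ℂ) * ξ 1 * (U 1 η * U 0 (ξ - η))) := by
      ext η; ring
    rw [this, integral_sub, integral_add, integral_add]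
    · simp only [integral_const_mul, curlHat, advHat, Fin.sum_univ_two, hc]; ring
    · exact (i0 _ _).const_mul _
    · exact (i0 _ _).const_mul _
    · exact (i0 _ _).const_mul _
    · exact (i0 _ _).const_mul _
    · exact ((i0 0 1).const_mul _).add ((i0 1 1).const_mul _)
    · exact ((i0 0 0).const_mul _).add ((i0 1 0).const_mul _)
  have iR : Integrable fun η ↦ ((ξ 0 : ℂ) * U 0 η + (ξ 1 : ℂ) * U 1 η)
      * ((((ξ - η) 0 : ℝ) : ℂ) * U 1 (ξ - η) - (((ξ - η) 1 : ℝ) : ℂ) * U 0 (ξ - η)) := by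
    refine ((((i1 0 0 1).const_mul (ξ 0 : ℂ)).sub ((i1 0 1 0).const_mul (ξ 0 : ℂ))).add
      (((i1 1 0 1).const_mul (ξ 1 : ℂ)).sub ((i1 1 1 0).const_mul (ξ 1 : ℂ)))).congr
      (.of_forall fun η ↦ ?_)
    simp only [Pi.add_apply, Pi.sub_apply]; ring
  have iL : Integrable fun η ↦ ((ξ 0 : ℂ) * U 0 η + (ξ 1 : ℂ) * U 1 η)
        * ((ξ 0 : ℂ) * U 1 (ξ - η) - (ξ 1 : ℂ) * U 0 (ξ - η)) := by
    refine ((((i0 0 1).const_mul ((ξ 0 : ℂ) * ξ 0)).add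
      ((i0 1 1).const_mul ((ξ 0 : ℂ) * ξ 1))).sub
      (((i0 0 0).const_mul ((ξ 1 : ℂ) * ξ 0)).add
      ((i0 1 0).const_mul ((ξ 1 : ℂ) * ξ 1)))).congr (.of_forall fun η ↦ ?_)
    simp only [Pi.add_apply, Pi.sub_apply]; ring
  have iD : Integrable D := by
    refine (iL.sub iR).congr (.of_forall fun η ↦ ?_)
    simp only [Pi.sub_apply, hD, PiLp.sub_apply, Complex.ofReal_sub]; ring
  have e2 : ∑ j, (ξ j : ℂ) * conv (U j) Ω ξ = ∫ η, ((ξ 0 : ℂ) * U 0 η + (ξ 1 : ℂ) * U 1 η)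
      * ((((ξ - η) 0 : ℝ) : ℂ) * U 1 (ξ - η) - (((ξ - η) 1 : ℝ) : ℂ) * U 0 (ξ - η)) := by
    simp only [Fin.sum_univ_two, conv]
    rw [← integral_const_mul, ← integral_const_mul, ← integral_add
      ((integrable_conv (U 0) Ω ξ).const_mul _) ((integrable_conv (U 1) Ω ξ).const_mul _)]
    apply integral_congr_ae
    filter_upwards [hΩL] with η h
    rw [h, curlHat]; ring
  rw [e1, e2]
  congr 1
  rw [← sub_eq_zero, ← integral_sub iL iR, ← hDsymm]
  congr 1; ext η
  simp only [hD, PiLp.sub_apply, Complex.ofReal_sub]; ring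

/-- Multiplication by a Schwartz function on `L²`. -/
def mulS (χ : 𝓢(Plane, ℂ)) : L2C →L[ℂ] L2C := mulOp χ (χ.memLp_top volume)

lemma mulS_ae (χ : 𝓢(Plane, ℂ)) (f : L2C) : mulS χ f =ᵐ[volume] fun ξ ↦ χ ξ * f ξ :=
  mulOp_ae _ _ f

lemma exists_schwartz_jap_mul (m : ℝ) (φ : 𝓢(Plane, ℂ)) :
    ∃ χ : 𝓢(Plane, ℂ), ∀ ξ, χ ξ = (jap m ξ : ℂ) * φ ξ := by
  have hjap : (fun ξ : Plane ↦ (jap m ξ : ℂ)).HasTemperateGrowth := by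
    unfold jap; fun_prop
  exact ⟨SchwartzMap.smulLeftCLM ℂ (fun ξ : Plane ↦ (jap m ξ : ℂ)) φ, fun ξ ↦ by
    rw [SchwartzMap.smulLeftCLM_apply_apply hjap]; rfl⟩

/-- The inverse Fourier transform on `L²` as a continuous linear map. -/
def invF : L2C →L[ℂ] L2C := ((FourierTransform.fourierCLE ℂ L2C).symm : L2C →L[ℂ] L2C)

lemma invF_apply (f : L2C) : invF f = 𝓕⁻ f := rfl

lemma fourier_invF (f : L2C) : (𝓕 (invF f) : L2C) = f := FourierTransform.fourier_fourierInv_eq f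

lemma norm_invF (f : L2C) : ‖invF f‖ = ‖f‖ := by
  conv_rhs => rw [← fourier_invF f, Lp.norm_fourier_eq]

lemma norm_le_of_ae_le {f g : L2C} (h : ∀ᵐ ξ, ‖f ξ‖ ≤ ‖g ξ‖) : ‖f‖ ≤ ‖g‖ :=
  Lp.norm_le_norm_of_ae_le h

lemma norm_mulS_cutoffAt_le {ε : ℝ} (hε : 0 < ε) (f : L2C) : ‖mulS (cutoffAt ε hε) f‖ ≤ ‖f‖ := by
  apply norm_le_of_ae_le
  filter_upwards [mulS_ae (cutoffAt ε hε) f] with ξ h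
  rw [h, norm_mul]
  exact mul_le_of_le_one_left (norm_nonneg _) (norm_cutoff_le _)

lemma tendsto_mulS_cutoffAt {ε : ℕ → ℝ} (hε : ∀ n, 0 < ε n)
    (hε0 : Filter.Tendsto ε Filter.atTop (nhds 0)) (f : L2C) :
    Filter.Tendsto (fun n ↦ mulS (cutoffAt (ε n) (hε n)) f) Filter.atTop (nhds f) := by
  refine tendsto_L2_of_dominated (F := f) (fun n ↦ ?_) ?_
  · filter_upwards [mulS_ae (cutoffAt (ε n) (hε n)) f] with ξ h
    rw [h, norm_mul]
    exact mul_le_of_le_one_left (norm_nonneg _) (norm_cutoff_le _)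
  · filter_upwards [ae_all_iff.2 fun n ↦ mulS_ae (cutoffAt (ε n) (hε n)) f] with ξ h
    simp_rw [h, cutoffAt_apply]
    have h1 : Filter.Tendsto (fun n ↦ ε n • ξ) Filter.atTop (nhds 0) := by
      simpa using hε0.smul_const ξ
    have h2 := ((cutoff.continuous.tendsto 0).comp h1).mul_const (f ξ)
    simpa [cutoff_zero] using h2

lemma norm_curlHat_sq {V : Fin 2 → Plane → ℂ} {ξ : Plane}
    (h : (ξ 0 : ℂ) * V 0 ξ + (ξ 1 : ℂ) * V 1 ξ = 0) :
    ‖curlHat V ξ‖ ^ 2 = ‖ξ‖ ^ 2 * sq V ξ := by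
  have h1 := congrArg Complex.re (conj_curlHat_mul_curlHat (G := V) h)
  rw [mul_comm, Complex.mul_conj, Complex.normSq_eq_norm_sq, Complex.ofReal_re,
    Complex.re_ofReal_mul] at h1
  rw [h1, sq]
  congr 1
  rw [mul_comm, Complex.mul_conj, mul_comm, Complex.mul_conj, Complex.normSq_eq_norm_sq,
    Complex.normSq_eq_norm_sq, ← Complex.ofReal_add, Complex.ofReal_re]

lemma re_pairL_star (f g : L2C) : (pairL (star f) g).re = (inner ℂ f g : ℂ).re := by
  rw [pairL_apply, ← integral_conj_mul_eq_inner]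
  congr 1
  apply integral_congr_ae
  filter_upwards [Lp.coeFn_star f] with x h
  rw [h]; rfl

lemma memLp_of_n2_le {f : Plane → ℂ} (hf : AEStronglyMeasurable f volume) {F : Plane → ℝ≥0∞}
    (h : ∀ᵐ ξ, ‖f ξ‖ₑ ≤ F ξ) (hF : n2 F < ∞) : MemLp f 2 := by
  refine ⟨hf, ?_⟩
  rw [eLpNorm_eq_lintegral_rpow_enorm_toReal (by norm_num) (by norm_num)]
  refine lt_of_le_of_lt ?_ hF
  simp only [ENNReal.toReal_ofNat, n2, ENNReal.rpow_ofNat]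
  gcongr ?_ ^ _
  refine lintegral_mono_ae ?_
  filter_upwards [h] with ξ hξ
  gcongr

lemma enorm_coord_le (ξ : Plane) (i : Fin 2) : ‖(ξ i : ℂ)‖ₑ ≤ ‖ξ‖ₑ := by
  rw [← ofReal_norm, ← ofReal_norm]
  exact ENNReal.ofReal_le_ofReal (norm_coord_le ξ i)

lemma enorm_le_ejap (ξ : Plane) : ‖ξ‖ₑ ≤ ejap 1 ξ := by
  rw [← ofReal_norm]; exact ENNReal.ofReal_le_ofReal (norm_le_jap ξ)

lemma ofReal_rpow_le_ejap {a s : ℝ} (ha : 0 ≤ a) (has : a ≤ s) (ξ : Plane) :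
    ENNReal.ofReal (‖ξ‖ ^ a) ≤ ejap s ξ :=
  ENNReal.ofReal_le_ofReal (norm_rpow_le_jap ha has ξ)

lemma tendsto_clm_apply₂ {E F : Type*} [NormedAddCommGroup E] [NormedSpace ℂ E]
    [NormedAddCommGroup F] [NormedSpace ℂ F] (B : E →L[ℂ] F →L[ℂ] ℂ) {f : ℕ → E} {g : ℕ → F}
    {x : E} {y : F} (hf : Filter.Tendsto f Filter.atTop (nhds x))
    (hg : Filter.Tendsto g Filter.atTop (nhds y)) :
    Filter.Tendsto (fun n ↦ B (f n) (g n)) Filter.atTop (nhds (B x y)) :=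
  (B.continuous₂.tendsto (x, y)).comp (hf.prodMk_nhds hg)

lemma tendsto_pairL {f g : ℕ → L2C} {F G : L2C} (hf : Filter.Tendsto f Filter.atTop (nhds F))
    (hg : Filter.Tendsto g Filter.atTop (nhds G)) :
    Filter.Tendsto (fun n ↦ pairL (f n) (g n)) Filter.atTop (nhds (pairL F G)) :=
  tendsto_clm_apply₂ pairL hf hg

/-- Applied with `a = δ` it gives the fractional regularity of the vorticity that the commutator
estimate consumes; with `a = 0` it gives the plain `L²` bound. -/
lemma n2_curl_le {a δ M : ℝ} (ha : 0 ≤ a) (haδ : a ≤ δ) {V : Fin 2 → L2C} {Ω : L2C}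
    (h0 : n2 (fun ξ ↦ ejap (1 + δ) ξ * ‖V 0 ξ‖ₑ) ≤ ENNReal.ofReal M)
    (h1 : n2 (fun ξ ↦ ejap (1 + δ) ξ * ‖V 1 ξ‖ₑ) ≤ ENNReal.ofReal M) (hM0 : 0 ≤ M)
    (hΩ : Ω =ᵐ[volume] curlHat fun i ↦ V i) :
    n2 (fun ξ ↦ ENNReal.ofReal (‖ξ‖ ^ a) * ‖Ω ξ‖ₑ) ≤ ENNReal.ofReal (2 * M) := by
  have hm (j) : Measurable fun ξ ↦ ejap (1 + δ) ξ * ‖V j ξ‖ₑ :=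
    (measurable_ejap _).mul (measurable_enorm_L2 _)
  calc _ = n2 (fun ξ ↦ ENNReal.ofReal (‖ξ‖ ^ a) * ‖curlHat (fun i ↦ V i) ξ‖ₑ) := by
        apply n2_congr
        filter_upwards [hΩ] with ξ h
        rw [h]
    _ ≤ n2 (fun ξ ↦ ejap (1 + δ) ξ * ‖V 1 ξ‖ₑ + ejap (1 + δ) ξ * ‖V 0 ξ‖ₑ) := by
        refine n2_mono fun ξ ↦ ?_
        have h1 : ‖curlHat (fun i ↦ V i) ξ‖ₑ ≤ ‖ξ‖ₑ * ‖V 1 ξ‖ₑ + ‖ξ‖ₑ * ‖V 0 ξ‖ₑ := by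
          refine (enorm_sub_le).trans ?_
          rw [enorm_mul, enorm_mul]
          gcongr <;> exact enorm_coord_le _ _
        have h2 : ENNReal.ofReal (‖ξ‖ ^ a) * ‖ξ‖ₑ ≤ ejap (1 + δ) ξ := by
          rw [add_comm, ejap_add]
          exact mul_le_mul' (ofReal_rpow_le_ejap ha haδ ξ) (enorm_le_ejap ξ)
        calc _ ≤ ENNReal.ofReal (‖ξ‖ ^ a) * (‖ξ‖ₑ * ‖V 1 ξ‖ₑ + ‖ξ‖ₑ * ‖V 0 ξ‖ₑ) := by
              gcongr
          _ = (ENNReal.ofReal (‖ξ‖ ^ a) * ‖ξ‖ₑ) * ‖V 1 ξ‖ₑ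
              + (ENNReal.ofReal (‖ξ‖ ^ a) * ‖ξ‖ₑ) * ‖V 0 ξ‖ₑ := by ring
          _ ≤ _ := by gcongr
    _ ≤ n2 (fun ξ ↦ ejap (1 + δ) ξ * ‖V 1 ξ‖ₑ) + n2 (fun ξ ↦ ejap (1 + δ) ξ * ‖V 0 ξ‖ₑ) :=
        n2_add_le (hm 1) (hm 0)
    _ ≤ ENNReal.ofReal M + ENNReal.ofReal M := add_le_add h1 h0
    _ = _ := by rw [← ENNReal.ofReal_add hM0 hM0]; congr 1; ring

set_option maxHeartbeats 1600000 in
/-- The energy inequality for the vorticity, in which transport does not appear. -/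
theorem vorticity_energy_le {S m δ : ℝ} (hδ : 0 < δ) (hδ1 : δ ≤ 1) {u : ℝ → VectorField}
    {G' : ℝ → Fin 2 → Plane → ℂ} {q γ : ℝ → L2C}
    (hE : CurlEq S (fun t ↦ vhat (u t))
      (fun t i ξ ↦ - advHat (vhat (u t)) (vhat (u t)) i ξ + G' t i ξ))
    (hq : CurlRep m (fun t i ↦ vhat (u t) i) q)
    (hγ : CurlRep m (fun t i ξ ↦ - advHat (vhat (u t)) (vhat (u t)) i ξ + G' t i ξ) γ)
    (hdiv : ∀ t, ∀ᵐ ξ, (ξ 0 : ℂ) * vhat (u t) 0 ξ + (ξ 1 : ℂ) * vhat (u t) 1 ξ = 0)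
    {M : ℝ} (hM0 : 0 ≤ M)
    (hM : ∀ t j, n2 (fun ξ ↦ ejap (1 + δ) ξ * ‖vhat (u t) j ξ‖ₑ) ≤ ENNReal.ofReal M)
    {g : ℝ → L2C} (hg : ∀ᵐ τ ∂(volume.restrict (Icc 0 S)), g τ =ᵐ[volume] curlHat (G' τ))
    {D : ℝ → ℝ} (hD : IntegrableOn D (Icc 0 S))
    (hgD : ∀ᵐ τ ∂(volume.restrict (Icc 0 S)), ‖g τ‖ ≤ D τ) :
    IntegrableOn (fun τ ↦ ∫ ξ, ‖ξ‖ ^ 2 * rdot (fun i ↦ vhat (u τ) i) (G' τ) ξ) (Icc 0 S) ∧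
    ∀ t ∈ Icc 0 S, ∫ ξ, ‖ξ‖ ^ 2 * sq (fun i ↦ vhat (u t) i) ξ
      ≤ (∫ ξ, ‖ξ‖ ^ 2 * sq (fun i ↦ vhat (u 0) i) ξ)
        + 2 * ∫ τ in (0 : ℝ)..t, ∫ ξ, ‖ξ‖ ^ 2 * rdot (fun i ↦ vhat (u τ) i) (G' τ) ξ := by
  set U : ℝ → Fin 2 → L2C := fun t ↦ vhat (u t) with hUdef
  have hUm (t j) : Measurable fun ξ ↦ ‖U t j ξ‖ₑ := measurable_enorm_L2 _
  have hM1 (t j) : n2 (fun ξ ↦ ‖ξ‖ₑ * ‖U t j ξ‖ₑ) ≤ ENNReal.ofReal M := by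
    refine le_trans (n2_mono fun ξ ↦ ?_) (hM t j)
    gcongr
    exact (enorm_le_ejap ξ).trans (ejap_mono (by linarith) ξ)
  have hcoord (t : ℝ) (i l : Fin 2) : MemLp (fun ξ ↦ (ξ i : ℂ) * U t l ξ) 2 := by
    refine memLp_of_n2_le ((continuous_coord i).aestronglyMeasurable.mul
      (Lp.aestronglyMeasurable _)) (F := fun ξ ↦ ‖ξ‖ₑ * ‖U t l ξ‖ₑ) (.of_forall fun ξ ↦ ?_)
      ((hM1 t l).trans_lt ENNReal.ofReal_lt_top)
    rw [enorm_mul]; gcongr; exact enorm_coord_le ξ i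
  have hcurl (t : ℝ) : MemLp (curlHat fun i ↦ U t i) 2 := (hcoord t 0 1).sub (hcoord t 1 0)
  set Ω : ℝ → L2C := fun t ↦ (hcurl t).toLp _ with hΩdef
  have hΩ (t) : Ω t =ᵐ[volume] curlHat fun i ↦ U t i := (hcurl t).coeFn_toLp
  set θ : ℝ → L2C := fun t ↦ invF (Ω t) with hθdef
  have hθF (t) : (𝓕 (θ t) : L2C) = Ω t := fourier_invF _
  have hN (t) : n2 (fun ξ ↦ ENNReal.ofReal (‖ξ‖ ^ δ) * ‖(𝓕 (θ t) : L2C) ξ‖ₑ)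
      ≤ ENNReal.ofReal (2 * M) := by
    rw [hθF]
    exact n2_curl_le hδ.le le_rfl (hM t 0) (hM t 1) hM0 (hΩ t)
  have hΩn (t) : ‖Ω t‖ ≤ 2 * M := by
    have h := n2_curl_le le_rfl hδ.le (hM t 0) (hM t 1) hM0 (hΩ t)
    simp only [Real.rpow_zero, ENNReal.ofReal_one, one_mul, n2_eq_norm] at h
    exact (ENNReal.ofReal_le_ofReal_iff (by positivity)).1 h
  have hΩsq (t) : ‖Ω t‖ ^ 2 = ∫ ξ, ‖ξ‖ ^ 2 * sq (fun i ↦ U t i) ξ := by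
    rw [norm_sq_eq_integral]
    apply integral_congr_ae
    filter_upwards [hΩ t, hdiv t] with ξ h1 h2
    rw [h1, norm_curlHat_sq h2]
  obtain ⟨C, hC, htr⟩ := exists_abs_re_pairL_transport_le hδ.le hδ1
  set ε : ℕ → ℝ := fun n ↦ 1 / ((n : ℝ) + 1) with hεdef
  have hε (n) : 0 < ε n := by positivity
  have hε0 : Filter.Tendsto ε Filter.atTop (nhds 0) := tendsto_one_div_add_atTop_nhds_zero_nat
  have hε1 (n) : ε n ≤ 1 := by
    rw [hεdef]; simp only; rw [div_le_one (by positivity)]; linarith [n.cast_nonneg (α := ℝ)]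
  -- With this coupling the commutator error `ε^δ κ^(-1/2)` equals `κ^(1/2)`, so it vanishes while
  -- the truncation is removed.
  set κ : ℕ → ℝ := fun n ↦ ε n ^ δ with hκdef
  have hκ (n) : 0 < κ n := Real.rpow_pos_of_pos (hε n) δ
  have hκ0 : Filter.Tendsto κ Filter.atTop (nhds 0) := by
    have := hε0.rpow_const (p := δ) (Or.inr hδ.le)
    rwa [Real.zero_rpow hδ.ne'] at this
  have herr (n) : C * ε n ^ δ * (Real.sqrt (κ n))⁻¹ * M * (2 * M)
      = 2 * C * M ^ 2 * Real.sqrt (κ n) := by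
    have h1 : ε n ^ δ = Real.sqrt (κ n) * Real.sqrt (κ n) := (Real.mul_self_sqrt (hκ n).le).symm
    have h2 : Real.sqrt (κ n) ≠ 0 := (Real.sqrt_pos.2 (hκ n)).ne'
    rw [h1]; field_simp
  -- `χ n` cancels the weight of `CurlRep` and mollifies at once: applied to `q` and `γ` it gives
  -- the mollified vorticity and its time derivative.
  choose χ hχ using fun n ↦ exists_schwartz_jap_mul m (cutoffAt (ε n) (hε n))
  set f : ℕ → ℝ → L2C := fun n t ↦ invF (mulS (χ n) (q t)) with hfdef
  set h : ℕ → ℝ → L2C := fun n t ↦ invF (mulS (χ n) (γ t)) with hhdef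
  have hhc (n) : Continuous (h n) := invF.continuous.comp ((mulS (χ n)).continuous.comp hγ.1)
  have hfeq (n t) : f n t = invF (mulS (cutoffAt (ε n) (hε n)) (Ω t)) := by
    rw [hfdef]; simp only
    congr 1
    apply Lp.ext
    filter_upwards [mulS_ae (χ n) (q t), mulS_ae (cutoffAt (ε n) (hε n)) (Ω t), hq.2 t, hΩ t]
      with ξ h1 h2 h3 h4
    rw [h1, h2, h3, h4, hχ]
    have := jap_mul_neg m ξ
    have : (jap m ξ : ℂ) * (jap (-m) ξ : ℂ) = 1 := by exact_mod_cast this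
    linear_combination (cutoffAt (ε n) (hε n) ξ * curlHat (fun i ↦ U t i) ξ) * this
  have hfn (n t) : ‖f n t‖ ≤ ‖Ω t‖ := by
    rw [hfeq, norm_invF]; exact norm_mulS_cutoffAt_le _ _
  have hft (t) : Filter.Tendsto (fun n ↦ f n t) Filter.atTop (nhds (θ t)) := by
    simp_rw [hfeq]
    exact (invF.continuous.tendsto _).comp (tendsto_mulS_cutoffAt hε hε0 (Ω t))
  have hfint (n) : ∀ t ∈ Icc 0 S, f n t = f n 0 + ∫ τ in (0 : ℝ)..t, h n τ := by
    intro t ht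
    have h1 := curlRep_eq_integral hE hq hγ ht
    rw [hfdef]; simp only
    rw [h1, map_add, map_add]
    congr 1
    exact ((invF.comp (mulS (χ n))).intervalIntegral_comp_comm
      (hγ.1.intervalIntegrable 0 t)).symm
  have hchain (n : ℕ) {t : ℝ} (ht : t ∈ Icc 0 S) :=
    integral_rtrunc_eq (hκ n) (hhc n) (hfint n) ht
  set Dn : ℕ → ℝ → ℝ := fun n τ ↦ (pairL (rderLp (hκ n) (f n τ)) (h n τ)).re with hDn
  set gn : ℕ → ℝ → L2C := fun n τ ↦ invF (mulS (cutoffAt (ε n) (hε n)) (g τ)) with hgn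
  -- By `curlHat_advHat`, `gn - h` is precisely the mollified divergence of `u` times vorticity, so
  -- the almost conservation estimate bounds its pairing.
  have hsplit : ∀ᵐ τ ∂(volume.restrict (Icc 0 S)), ∀ n,
      |Dn n τ - (pairL (rderLp (hκ n) (f n τ)) (gn n τ)).re|
        ≤ 2 * C * M ^ 2 * Real.sqrt (κ n) := by
    filter_upwards [hg] with τ hgτ n
    have ht := htr (u τ) (θ τ) (f n τ) (gn n τ - h n τ) (ε n) (κ n) M (2 * M) (hε n) (hκ n)
      (hdiv τ) ?_ ?_ hM0 (by positivity) (hM1 τ) (hN τ)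
    · rw [herr] at ht
      rw [hDn]; simp only
      rw [map_sub, Complex.sub_re, abs_sub_comm] at ht
      exact ht
    · rw [hfeq, fourier_invF, hθF]
      exact mulS_ae _ _
    · have hs : (𝓕 (gn n τ - h n τ) : L2C)
          = mulS (cutoffAt (ε n) (hε n)) (g τ) - mulS (χ n) (γ τ) := by
        rw [hgn, hhdef]; simp only
        rw [← map_sub, fourier_invF]
      rw [hs, hθF]
      filter_upwards [Lp.coeFn_sub (mulS (cutoffAt (ε n) (hε n)) (g τ)) (mulS (χ n) (γ τ)),
        mulS_ae (cutoffAt (ε n) (hε n)) (g τ), mulS_ae (χ n) (γ τ), hγ.2 τ, hgτ] with ξ a1 a2 a3 a4 a5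
      have h5 := curlHat_advHat (hdiv τ) (hcoord τ) (hΩ τ) ξ
      have h6 : curlHat (fun i ξ ↦ - advHat (U τ) (U τ) i ξ + G' τ i ξ) ξ
          = - curlHat (advHat (U τ) (U τ)) ξ + curlHat (G' τ) ξ := by
        simp only [curlHat]; ring
      have h7 : (jap m ξ : ℂ) * (jap (-m) ξ : ℂ) = 1 := by exact_mod_cast jap_mul_neg m ξ
      rw [a1, Pi.sub_apply, a2, a3, a4, a5, hχ, h6]
      change _ = cutoffAt (ε n) (hε n) ξ * (2 * Real.pi * Complex.I
        * ∑ j, (ξ j : ℂ) * conv (U τ j) (Ω τ) ξ)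
      rw [← h5]
      linear_combination (-cutoffAt (ε n) (hε n) ξ * (- curlHat (advHat (U τ) (U τ)) ξ
        + curlHat (G' τ) ξ)) * h7
  have hsqrt0 : Filter.Tendsto (fun n ↦ 2 * C * M ^ 2 * Real.sqrt (κ n)) Filter.atTop (nhds 0) := by
    have := (hκ0.sqrt).const_mul (2 * C * M ^ 2)
    simpa using this
  have hr (t) := tendsto_rderLp hκ hκ0 (hft t)
  have hlimD : ∀ᵐ τ ∂(volume.restrict (Icc 0 S)), Filter.Tendsto (fun n ↦ Dn n τ) Filter.atTop
      (nhds (∫ ξ, ‖ξ‖ ^ 2 * rdot (fun i ↦ U τ i) (G' τ) ξ)) := by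
    filter_upwards [hsplit, hg] with τ h1 h2
    have t1 : Filter.Tendsto (fun n ↦ Dn n τ - (pairL (rderLp (hκ n) (f n τ)) (gn n τ)).re)
        Filter.atTop (nhds 0) := squeeze_zero_norm h1 hsqrt0
    have t2 : Filter.Tendsto (fun n ↦ gn n τ) Filter.atTop (nhds (invF (g τ))) :=
      (invF.continuous.tendsto _).comp (tendsto_mulS_cutoffAt hε hε0 (g τ))
    have t3 : Filter.Tendsto (fun n ↦ (pairL (rderLp (hκ n) (f n τ)) (gn n τ)).re)
        Filter.atTop (nhds (pairL (star (θ τ)) (invF (g τ))).re) :=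
      (Complex.continuous_re.tendsto _).comp
        (tendsto_pairL (hr τ) t2)
    have e : (pairL (star (θ τ)) (invF (g τ))).re
        = ∫ ξ, ‖ξ‖ ^ 2 * rdot (fun i ↦ U τ i) (G' τ) ξ := by
      rw [re_pairL_star, ← Lp.inner_fourier_eq, fourier_invF, fourier_invF, ← integral_conj_mul_eq_inner]
      have hi : Integrable fun ξ ↦ (starRingEnd ℂ) (Ω τ ξ) * g τ ξ :=
        MemLp.integrable_mul (p := 2) (q := 2) (Lp.memLp (Ω τ)).star (Lp.memLp _)
      have h3 := integral_re hi
      simp only [RCLike.re_to_complex] at h3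
      rw [← h3]
      apply integral_congr_ae
      filter_upwards [hΩ τ, h2, hdiv τ] with ξ b1 b2 b3
      rw [b1, b2, conj_curlHat_mul_curlHat b3, Complex.re_ofReal_mul, rdot]
    have := t1.add t3
    rw [e] at this
    simpa using this
  have hbd (n : ℕ) : ∀ᵐ τ ∂(volume.restrict (Icc 0 S)),
      ‖Dn n τ‖ ≤ 2 * C * M ^ 2 + 2 * M * D τ := by
    filter_upwards [hsplit, hgD] with τ h1 h2
    have h3 := h1 n
    have h4 : |(pairL (rderLp (hκ n) (f n τ)) (gn n τ)).re| ≤ 2 * M * D τ := by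
      refine (Complex.abs_re_le_norm _).trans ((norm_pairL_le _ _).trans ?_)
      refine mul_le_mul ((norm_rderLp_le _ _).trans ((hfn n τ).trans (hΩn τ))) ?_
        (norm_nonneg _) (by positivity)
      rw [hgn]; simp only
      rw [norm_invF]
      exact (norm_mulS_cutoffAt_le _ _).trans h2
    have h5 : Real.sqrt (κ n) ≤ 1 := Real.sqrt_le_one.2
      (Real.rpow_le_one (hε n).le (hε1 n) hδ.le)
    have h6 : 2 * C * M ^ 2 * Real.sqrt (κ n) ≤ 2 * C * M ^ 2 :=
      mul_le_of_le_one_right (by positivity) h5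
    rw [Real.norm_eq_abs]
    have h7 := abs_sub_abs_le_abs_sub (Dn n τ) (pairL (rderLp (hκ n) (f n τ)) (gn n τ)).re
    linarith
  have hfc (n) : Continuous fun t ↦ f n t :=
    invF.continuous.comp ((mulS (χ n)).continuous.comp hq.1)
  have hDc (n) : Continuous (Dn n) := Complex.continuous_re.comp
    ((pairL.continuous.comp ((continuous_rderLp (hκ n)).comp (hfc n))).clm_apply (hhc n))
  have hdomI : IntegrableOn (fun τ ↦ 2 * C * M ^ 2 + 2 * M * D τ) (Icc 0 S) :=
    (integrableOn_const (by simp)).add (hD.const_mul _)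
  refine ⟨?_, fun t ht ↦ ?_⟩
  · refine Integrable.mono' hdomI
      (aestronglyMeasurable_of_tendsto_ae _ (fun n ↦ (hDc n).aestronglyMeasurable) hlimD) ?_
    filter_upwards [hlimD, ae_all_iff.2 hbd] with τ h1 h2
    exact le_of_tendsto h1.norm (.of_forall h2)
  have hsub : Ioc 0 t ⊆ Icc 0 S := fun x hx ↦ ⟨hx.1.le, hx.2.trans ht.2⟩
  have hle : (volume.restrict (Ioc 0 t)) ≤ (volume.restrict (Icc 0 S)) :=
    Measure.restrict_mono hsub le_rfl
  have L2 : Filter.Tendsto (fun n ↦ ∫ τ in (0 : ℝ)..t, Dn n τ) Filter.atTop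
      (nhds (∫ τ in (0 : ℝ)..t, ∫ ξ, ‖ξ‖ ^ 2 * rdot (fun i ↦ U τ i) (G' τ) ξ)) := by
    simp_rw [intervalIntegral.integral_of_le ht.1]
    exact tendsto_integral_of_dominated_convergence _ (fun n ↦ (hDc n).aestronglyMeasurable)
      (hdomI.mono_set hsub) (fun n ↦ ae_mono hle (hbd n)) (ae_mono hle hlimD)
  have L1 : Filter.Tendsto (fun n ↦ (pairL (rderLp (hκ n) (f n t)) (f n t)).re) Filter.atTop
      (nhds (∫ ξ, ‖ξ‖ ^ 2 * sq (fun i ↦ U t i) ξ)) := by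
    have h1 := (Complex.continuous_re.tendsto _).comp
        (tendsto_pairL (hr t) (hft t))
    have e : (pairL (star (θ t)) (θ t)).re = ∫ ξ, ‖ξ‖ ^ 2 * sq (fun i ↦ U t i) ξ := by
      rw [re_pairL_star, ← hΩsq, inner_self_eq_norm_sq_to_K, hθdef]
      simp only [norm_invF]
      norm_cast
    rw [e] at h1
    exact h1
  -- Equality is lost here: the truncated energy at time `t` is bounded below through
  -- `re_rder_mul_le`, and the one at time 0 above by the full energy. An inequality is enough for
  -- the a priori bound.
  refine le_of_tendsto_of_tendsto' L1 (tendsto_const_nhds.add (L2.const_mul 2)) fun n ↦ ?_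
  have a1 : (pairL (rderLp (hκ n) (f n t)) (f n t)).re ≤ ∫ x, rtrunc (κ n) (f n t x) := by
    have hi := integrable_mul_L2 (rderLp (hκ n) (f n t)) (f n t)
    rw [pairL_apply]
    have h3 := integral_re hi
    simp only [RCLike.re_to_complex] at h3
    rw [← h3]
    refine integral_mono_ae hi.re (integrable_rtrunc (hκ n) _) ?_
    filter_upwards [rderLp_ae (hκ n) (f n t)] with x hx
    rw [hx]; exact re_rder_mul_le (hκ n) _
  have a2 : ∫ x, rtrunc (κ n) (f n 0 x) ≤ ∫ ξ, ‖ξ‖ ^ 2 * sq (fun i ↦ U 0 i) ξ := by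
    rw [← hΩsq]
    refine le_trans ?_ (pow_le_pow_left₀ (norm_nonneg _) (hfn n 0) 2)
    rw [norm_sq_eq_integral]
    exact integral_mono (integrable_rtrunc (hκ n) _) (integrable_norm_sq _)
      fun x ↦ rtrunc_le (hκ n) _
  have a3 := hchain n ht
  linarith

/-! ### The advection form and its symmetrization. -/

/-- The Euclidean length of a pair of functions. -/
def mag (V : Fin 2 → L2C) (ξ : Plane) : ℝ≥0∞ := ENNReal.ofReal (Real.sqrt (sq (fun i ↦ V i) ξ))

lemma sq_nonneg' (V : Fin 2 → Plane → ℂ) (ξ : Plane) : 0 ≤ sq V ξ := by unfold sq; positivity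

lemma measurable_L2 (f : L2C) : Measurable f := (Lp.stronglyMeasurable f).measurable

lemma measurable_sq (V : Fin 2 → L2C) : Measurable (sq fun i ↦ V i) := by
  have h0 := measurable_L2 (V 0)
  have h1 := measurable_L2 (V 1)
  unfold sq
  fun_prop

lemma measurable_mag (V : Fin 2 → L2C) : Measurable (mag V) :=
  (measurable_sq V).sqrt.ennreal_ofReal

lemma norm_le_sqrt_sq (V : Fin 2 → Plane → ℂ) (i : Fin 2) (ξ : Plane) :
    ‖V i ξ‖ ≤ Real.sqrt (sq V ξ) := by
  apply Real.le_sqrt_of_sq_le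
  unfold sq
  fin_cases i
  · simp
  · simp

lemma enorm_le_mag (V : Fin 2 → L2C) (i : Fin 2) (ξ : Plane) : ‖V i ξ‖ₑ ≤ mag V ξ := by
  rw [← ofReal_norm]
  exact ENNReal.ofReal_le_ofReal (norm_le_sqrt_sq (fun i ↦ V i) i ξ)

lemma mag_le (V : Fin 2 → L2C) (ξ : Plane) : mag V ξ ≤ ‖V 0 ξ‖ₑ + ‖V 1 ξ‖ₑ := by
  rw [mag, ← ofReal_norm, ← ofReal_norm, ← ENNReal.ofReal_add (norm_nonneg _) (norm_nonneg _)]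
  apply ENNReal.ofReal_le_ofReal
  apply Real.sqrt_le_iff.2 ⟨by positivity, ?_⟩
  unfold sq
  nlinarith [mul_nonneg (norm_nonneg (V 0 ξ)) (norm_nonneg (V 1 ξ))]

/-- The kernel of the trilinear form `∫ w Re (conj Z · advHat V W)`. -/
def triKer (w : Plane → ℝ) (V W Z : Fin 2 → L2C) (ξ ζ : Plane) : ℂ :=
  (w ξ : ℂ) * (2 * Real.pi * Complex.I * ((ξ 0 : ℂ) * V 0 ζ + (ξ 1 : ℂ) * V 1 ζ)
    * (W 0 (ξ - ζ) * (starRingEnd ℂ) (Z 0 ξ) + W 1 (ξ - ζ) * (starRingEnd ℂ) (Z 1 ξ)))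

lemma enorm_coord_dot_le (ξ ζ : Plane) (V : Fin 2 → L2C) :
    ‖(ξ 0 : ℂ) * V 0 ζ + (ξ 1 : ℂ) * V 1 ζ‖ₑ ≤ 2 * (‖ξ‖ₑ * mag V ζ) := by
  refine (enorm_add_le _ _).trans ?_
  rw [enorm_mul, enorm_mul, two_mul]
  gcongr <;> first | exact enorm_coord_le _ _ | exact enorm_le_mag _ _ _

lemma enorm_dot_le {a0 a1 b0 b1 : ℂ} {A B : ℝ≥0∞} (h0 : ‖a0‖ₑ ≤ A) (h1 : ‖a1‖ₑ ≤ A)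
    (h2 : ‖b0‖ₑ ≤ B) (h3 : ‖b1‖ₑ ≤ B) : ‖a0 * b0 + a1 * b1‖ₑ ≤ 2 * (A * B) := by
  refine (enorm_add_le _ _).trans ?_
  rw [enorm_mul, enorm_mul, two_mul]
  gcongr

lemma enorm_two_pi_I : ‖(2 * Real.pi * Complex.I : ℂ)‖ₑ = ENNReal.ofReal (2 * Real.pi) := by
  rw [← ofReal_norm]
  congr 1
  simp [abs_of_pos Real.pi_pos]

lemma enorm_conj (z : ℂ) : ‖(starRingEnd ℂ) z‖ₑ = ‖z‖ₑ := by
  rw [← ofReal_norm, ← ofReal_norm, RCLike.norm_conj]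

lemma enorm_triKer_le {w : Plane → ℝ} (hw : ∀ ξ, 0 ≤ w ξ) (V W Z : Fin 2 → L2C) (ξ ζ : Plane) :
    ‖triKer w V W Z ξ ζ‖ₑ ≤ ENNReal.ofReal (8 * Real.pi)
      * (mag V ζ * mag W (ξ - ζ) * (ENNReal.ofReal (w ξ) * ‖ξ‖ₑ * mag Z ξ)) := by
  rw [triKer, enorm_mul, enorm_mul, enorm_mul, enorm_two_pi_I]
  have h1 : ‖(w ξ : ℂ)‖ₑ = ENNReal.ofReal (w ξ) := by
    rw [← ofReal_norm, Complex.norm_real, Real.norm_of_nonneg (hw ξ)]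
  have h2 := enorm_coord_dot_le ξ ζ V
  have h3 : ‖W 0 (ξ - ζ) * (starRingEnd ℂ) (Z 0 ξ) + W 1 (ξ - ζ) * (starRingEnd ℂ) (Z 1 ξ)‖ₑ
      ≤ 2 * (mag W (ξ - ζ) * mag Z ξ) := by
    apply enorm_dot_le (enorm_le_mag W 0 _) (enorm_le_mag W 1 _)
    · rw [enorm_conj]; exact enorm_le_mag Z 0 _
    · rw [enorm_conj]; exact enorm_le_mag Z 1 _
  have h4 : ENNReal.ofReal (8 * Real.pi) = ENNReal.ofReal (2 * Real.pi) * 4 := by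
    rw [show (4 : ℝ≥0∞) = ENNReal.ofReal 4 by simp, ← ENNReal.ofReal_mul (by positivity)]
    congr 1; ring
  rw [h1, h4]
  calc _ ≤ ENNReal.ofReal (w ξ) * (ENNReal.ofReal (2 * Real.pi) * (2 * (‖ξ‖ₑ * mag V ζ))
        * (2 * (mag W (ξ - ζ) * mag Z ξ))) := by gcongr
    _ = _ := by ring

lemma measurable_triKer {w : Plane → ℝ} (hw : Measurable w) (V W Z : Fin 2 → L2C) :
    Measurable (Function.uncurry fun ξ ζ ↦ triKer w V W Z ξ ζ) := by
  have hV (i) := measurable_L2 (V i)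
  have hW (i) := measurable_L2 (W i)
  have hZ (i) := measurable_L2 (Z i)
  have hc (i : Fin 2) : Measurable fun p : Plane × Plane ↦ (p.1 i : ℂ) :=
    ((continuous_coord i).comp continuous_fst).measurable
  have hconj : Measurable (starRingEnd ℂ) := Complex.continuous_conj.measurable
  have hZ' (i) : Measurable fun p : Plane × Plane ↦ (starRingEnd ℂ) (Z i p.1) :=
    hconj.comp ((hZ i).comp measurable_fst)
  unfold triKer Function.uncurry
  have h1 := hc 0
  have h2 := hc 1
  have h3 := hZ' 0
  have h4 := hZ' 1
  have h5 := hV 0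
  have h6 := hV 1
  have h7 := hW 0
  have h8 := hW 1
  fun_prop

/-- The weight of the third slot in the trilinear form. -/
def advWeight (w : Plane → ℝ) (Z : Fin 2 → L2C) (ξ : Plane) : ℝ≥0∞ :=
  ENNReal.ofReal (w ξ) * ‖ξ‖ₑ * mag Z ξ

lemma measurable_advWeight {w : Plane → ℝ} (hw : Measurable w) (Z : Fin 2 → L2C) :
    Measurable (advWeight w Z) := by
  have := measurable_mag Z
  unfold advWeight
  fun_prop

lemma lintegral_triKer_le {w : Plane → ℝ} (hw : Measurable w) (hw0 : ∀ ξ, 0 ≤ w ξ)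
    (V W Z : Fin 2 → L2C) :
    ∫⁻ ξ, ∫⁻ ζ, ‖triKer w V W Z ξ ζ‖ₑ
      ≤ ENNReal.ofReal (8 * Real.pi) * tri (mag V) (mag W) (advWeight w Z) := by
  have hV := measurable_mag V
  have hW := measurable_mag W
  have hZ := measurable_advWeight hw Z
  rw [tri_eq hV hW hZ, ← lintegral_const_mul _ (by
    refine hZ.mul (Measurable.lintegral_prod_right' (f := fun p : Plane × Plane ↦
      mag V p.2 * mag W (p.1 - p.2)) (by fun_prop)))]
  refine lintegral_mono fun ξ ↦ ?_
  rw [← lintegral_const_mul _ (by fun_prop), ← lintegral_const_mul _ (by fun_prop)]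
  refine lintegral_mono fun ζ ↦ (enorm_triKer_le hw0 V W Z ξ ζ).trans (le_of_eq ?_)
  rw [advWeight]; ring

lemma integrable_triKer {w : Plane → ℝ} (hw : Measurable w) (hw0 : ∀ ξ, 0 ≤ w ξ)
    {V W Z : Fin 2 → L2C} (hfin : tri (mag V) (mag W) (advWeight w Z) < ∞) :
    Integrable (Function.uncurry fun ξ ζ ↦ triKer w V W Z ξ ζ)
      ((volume : Measure Plane).prod volume) := by
  have hm := measurable_triKer hw V W Z
  refine ⟨hm.aestronglyMeasurable, ?_⟩
  rw [HasFiniteIntegral, lintegral_prod _ hm.enorm.aemeasurable]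
  exact (lintegral_triKer_le hw hw0 V W Z).trans_lt (ENNReal.mul_lt_top ENNReal.ofReal_lt_top hfin)

lemma rdot_advHat_eq (w : Plane → ℝ) (V W Z : Fin 2 → L2C) (ξ : Plane) :
    w ξ * rdot (fun i ↦ Z i) (advHat V W) ξ = (∫ ζ, triKer w V W Z ξ ζ).re := by
  have i0 (j l : Fin 2) : Integrable fun ζ ↦ V j ζ * W l (ξ - ζ) := integrable_conv _ _ _
  have hc (j l : Fin 2) : conv (V j) (W l) ξ = ∫ ζ, V j ζ * W l (ξ - ζ) := rfl
  set c : Fin 2 → Fin 2 → ℂ := fun j l ↦ (w ξ : ℂ) * (2 * Real.pi * Complex.I) * (ξ j : ℂ)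
    * (starRingEnd ℂ) (Z l ξ) with hcdef
  have e : (fun ζ ↦ triKer w V W Z ξ ζ) = fun ζ ↦ ∑ j, ∑ l, c j l * (V j ζ * W l (ξ - ζ)) := by
    ext ζ
    simp only [Fin.sum_univ_two, triKer, hcdef]; ring
  rw [e, integral_finsetSum _ fun j _ ↦ integrable_finsetSum _ fun l _ ↦ (i0 j l).const_mul _]
  simp_rw [integral_finsetSum Finset.univ fun l _ ↦ (i0 _ l).const_mul (c _ l), integral_const_mul,
    ← hc]
  rw [rdot, ← Complex.re_ofReal_mul]
  congr 1
  simp only [Fin.sum_univ_two, hcdef, advHat]; ring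

/-- Absolute bound for the weighted advection form. -/
lemma advForm_le {w : Plane → ℝ} (hw : Measurable w) (hw0 : ∀ ξ, 0 ≤ w ξ)
    {V W Z : Fin 2 → L2C} (hfin : tri (mag V) (mag W) (advWeight w Z) < ∞) :
    Integrable (fun ξ ↦ w ξ * rdot (fun i ↦ Z i) (advHat V W) ξ) ∧
    ∫⁻ ξ, ‖w ξ * rdot (fun i ↦ Z i) (advHat V W) ξ‖ₑ
      ≤ ENNReal.ofReal (8 * Real.pi) * tri (mag V) (mag W) (advWeight w Z) := by
  have hI := integrable_triKer hw hw0 hfin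
  simp_rw [rdot_advHat_eq]
  refine ⟨hI.integral_prod_left.re, ?_⟩
  refine le_trans (lintegral_mono fun ξ ↦ ?_) (lintegral_triKer_le hw hw0 V W Z)
  refine le_trans ?_ (enorm_integral_le_lintegral_enorm _)
  rw [← ofReal_norm, ← ofReal_norm]
  exact ENNReal.ofReal_le_ofReal (Complex.abs_re_le_norm _)

/-- Conjugate symmetry of a pair of functions. -/
def IsRealHat (V : Fin 2 → L2C) : Prop :=
  ∀ i, ∀ᵐ ξ, V i (-ξ) = (starRingEnd ℂ) (V i ξ)

/-- The divergence free condition on the Fourier side. -/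
def IsDivFree (V : Fin 2 → L2C) : Prop :=
  ∀ᵐ ξ, (ξ 0 : ℂ) * V 0 ξ + (ξ 1 : ℂ) * V 1 ξ = 0

/-- The symmetric kernel of the trilinear form. -/
def symKer (V W Z : Fin 2 → L2C) (ζ η : Plane) : ℂ :=
  2 * Real.pi * Complex.I * ((η 0 : ℂ) * V 0 ζ + (η 1 : ℂ) * V 1 ζ)
    * (W 0 η * Z 0 (-(ζ + η)) + W 1 η * Z 1 (-(ζ + η)))

/-- Since `ζ · V(ζ) = 0`, the derivative `ξ = ζ + η` falling on the product may be replaced by `η`;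
reality of `Z` turns the conjugate into a value at the reflected frequency. -/
lemma triKer_add_eq {w : Plane → ℝ} {V W Z : Fin 2 → L2C} (hV : IsDivFree V)
    (hZ : IsRealHat Z) :
    ∀ᵐ ζ, ∀ᵐ η, triKer w V W Z (ζ + η) ζ = (w (ζ + η) : ℂ) * symKer V W Z ζ η := by
  filter_upwards [hV] with ζ hζ
  have h (i : Fin 2) : ∀ᵐ η, Z i (-(ζ + η)) = (starRingEnd ℂ) (Z i (ζ + η)) :=
    (measurePreserving_add_left volume ζ).quasiMeasurePreserving.ae (hZ i)
  filter_upwards [h 0, h 1] with η h0 h1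
  rw [triKer, symKer, h0, h1, add_sub_cancel_left]
  simp only [PiLp.add_apply, Complex.ofReal_add]
  linear_combination ((w (ζ + η) : ℂ) * (2 * Real.pi * Complex.I)
    * (W 0 η * (starRingEnd ℂ) (Z 0 (ζ + η)) + W 1 η * (starRingEnd ℂ) (Z 1 (ζ + η)))) * hζ

/-- The map `η ↦ -ζ - η` exchanges the frequencies of `W` and `Z` and, as `ζ · V(ζ) = 0`, reverses
the sign of `η · V(ζ)`. This is the antisymmetry of transport by a divergence free field. -/
lemma symKer_reflect {V W Z : Fin 2 → L2C} {ζ : Plane}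
    (hζ : (ζ 0 : ℂ) * V 0 ζ + (ζ 1 : ℂ) * V 1 ζ = 0) (η : Plane) :
    symKer V Z W ζ (-ζ - η) = - symKer V W Z ζ η := by
  have e1 : -(ζ + (-ζ - η)) = η := by abel
  have e2 : -ζ - η = -(ζ + η) := by abel
  rw [symKer, symKer, e1, e2]
  simp only [PiLp.neg_apply, PiLp.add_apply, Complex.ofReal_add, Complex.ofReal_neg]
  linear_combination (-(2 * Real.pi * Complex.I)
    * (W 0 η * Z 0 (-(ζ + η)) + W 1 η * Z 1 (-(ζ + η)))) * hζ

/-- Fubini, then the shift `ξ = ζ + η`. Finiteness of the trilinear form is what allows the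
exchange. -/
lemma advForm_eq {w : Plane → ℝ} (hw : Measurable w) (hw0 : ∀ ξ, 0 ≤ w ξ)
    {V W Z : Fin 2 → L2C} (hfin : tri (mag V) (mag W) (advWeight w Z) < ∞)
    (hV : IsDivFree V) (hZ : IsRealHat Z) :
    ∫ ξ, w ξ * rdot (fun i ↦ Z i) (advHat V W) ξ
        = (∫ ζ, ∫ η, (w (ζ + η) : ℂ) * symKer V W Z ζ η).re ∧
      (∀ᵐ ζ, Integrable fun η ↦ (w (ζ + η) : ℂ) * symKer V W Z ζ η) ∧
      Integrable fun ζ ↦ ∫ η, (w (ζ + η) : ℂ) * symKer V W Z ζ η := by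
  have hI := integrable_triKer hw hw0 hfin
  have hae := triKer_add_eq (w := w) (W := W) hV hZ
  have hshift (ζ : Plane) : ∫ ξ, triKer w V W Z ξ ζ = ∫ η, triKer w V W Z (ζ + η) ζ :=
    (integral_add_left_eq_self (fun ξ ↦ triKer w V W Z ξ ζ) ζ).symm
  have hA : (fun ζ ↦ ∫ ξ, triKer w V W Z ξ ζ) =ᵐ[volume]
      fun ζ ↦ ∫ η, (w (ζ + η) : ℂ) * symKer V W Z ζ η := by
    filter_upwards [hae] with ζ h
    rw [hshift]; exact integral_congr_ae h
  refine ⟨?_, ?_, ?_⟩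
  · simp_rw [rdot_advHat_eq]
    have h1 := integral_re hI.integral_prod_left
    simp only [RCLike.re_to_complex, Function.uncurry_apply_pair] at h1
    rw [h1, integral_integral_swap hI, integral_congr_ae hA]
  · filter_upwards [hae, hI.prod_left_ae] with ζ h1 h2
    exact (h2.comp_add_left ζ).congr h1
  · exact hI.integral_prod_right.congr hA

/-- Symmetrization of the weighted advection form. -/
lemma advForm_add {w : Plane → ℝ} (hw : Measurable w) (hw0 : ∀ ξ, 0 ≤ w ξ)
    (heven : ∀ ξ, w (-ξ) = w ξ) {V W Z : Fin 2 → L2C}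
    (h1 : tri (mag V) (mag W) (advWeight w Z) < ∞)
    (h2 : tri (mag V) (mag Z) (advWeight w W) < ∞)
    (hV : IsDivFree V) (hW : IsRealHat W) (hZ : IsRealHat Z) :
    (∫ ξ, w ξ * rdot (fun i ↦ Z i) (advHat V W) ξ)
      + ∫ ξ, w ξ * rdot (fun i ↦ W i) (advHat V Z) ξ
      = (∫ ζ, ∫ η, ((w (ζ + η) - w η : ℝ) : ℂ) * symKer V W Z ζ η).re := by
  obtain ⟨e1, a1, b1⟩ := advForm_eq hw hw0 h1 hV hZ
  obtain ⟨e2, a2, b2⟩ := advForm_eq hw hw0 h2 hV hW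
  rw [e1, e2, ← Complex.add_re, ← integral_add b1 b2]
  congr 1
  apply integral_congr_ae
  filter_upwards [a1, a2, hV] with ζ i1 i2 hζ
  have hr (η : Plane) : (w (ζ + (-ζ - η)) : ℂ) * symKer V Z W ζ (-ζ - η)
      = -((w η : ℂ) * symKer V W Z ζ η) := by
    rw [symKer_reflect hζ, show ζ + (-ζ - η) = -η by abel, heven]; ring
  have i3 : Integrable fun η ↦ (w η : ℂ) * symKer V W Z ζ η := by
    have := (i2.comp_sub_left (-ζ)).neg
    refine this.congr (.of_forall fun η ↦ ?_)
    simp only [Pi.neg_apply]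
    rw [hr, neg_neg]
  have h3 : ∫ η, (w (ζ + η) : ℂ) * symKer V Z W ζ η = - ∫ η, (w η : ℂ) * symKer V W Z ζ η := by
    rw [← integral_sub_left_eq_self _ volume (-ζ), ← integral_neg]
    exact integral_congr_ae (.of_forall hr)
  rw [h3, ← sub_eq_add_neg, ← integral_sub i1 i3]
  congr 1; ext η
  push_cast; ring

/-- Without a weight the advection form is antisymmetric. -/
lemma advForm_antisymm {V W Z : Fin 2 → L2C}
    (h1 : tri (mag V) (mag W) (advWeight (fun _ ↦ 1) Z) < ∞)
    (h2 : tri (mag V) (mag Z) (advWeight (fun _ ↦ 1) W) < ∞)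
    (hV : IsDivFree V) (hW : IsRealHat W) (hZ : IsRealHat Z) :
    (∫ ξ, 1 * rdot (fun i ↦ Z i) (advHat V W) ξ)
      + ∫ ξ, 1 * rdot (fun i ↦ W i) (advHat V Z) ξ = 0 := by
  rw [advForm_add (w := fun _ ↦ 1) measurable_const (fun _ ↦ zero_le_one) (fun _ ↦ rfl)
    h1 h2 hV hW hZ]
  simp

/-- With the weight `‖ξ‖²` the symmetrized advection form gains one derivative on each factor. -/
lemma abs_advForm_add_le {V W Z : Fin 2 → L2C}
    (h1 : tri (mag V) (mag W) (advWeight (fun ξ ↦ ‖ξ‖ ^ 2) Z) < ∞)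
    (h2 : tri (mag V) (mag Z) (advWeight (fun ξ ↦ ‖ξ‖ ^ 2) W) < ∞)
    (hV : IsDivFree V) (hW : IsRealHat W) (hZ : IsRealHat Z) :
    ENNReal.ofReal |(∫ ξ, ‖ξ‖ ^ 2 * rdot (fun i ↦ Z i) (advHat V W) ξ)
      + ∫ ξ, ‖ξ‖ ^ 2 * rdot (fun i ↦ W i) (advHat V Z) ξ|
      ≤ ENNReal.ofReal (16 * Real.pi) * tri (fun ξ ↦ ‖ξ‖ₑ * mag V ξ) (fun ξ ↦ ‖ξ‖ₑ * mag W ξ)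
        (fun ξ ↦ ‖ξ‖ₑ * mag Z ξ) := by
  rw [advForm_add (w := fun ξ ↦ ‖ξ‖ ^ 2) (by fun_prop) (fun _ ↦ by positivity)
    (fun ξ ↦ by simp) h1 h2 hV hW hZ]
  have hmV := measurable_mag V
  have hmW := measurable_mag W
  have hmZ := measurable_mag Z
  have hnorm (z : ℂ) : ENNReal.ofReal |z.re| ≤ ‖z‖ₑ := by
    rw [← ofReal_norm]; exact ENNReal.ofReal_le_ofReal (Complex.abs_re_le_norm z)
  refine (hnorm _).trans ((enorm_integral_le_lintegral_enorm _).trans ?_)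
  have hmm : Measurable fun ζ ↦ ∫⁻ η, ‖ζ‖ₑ * mag V ζ * (‖η‖ₑ * mag W η)
      * (‖ζ + η‖ₑ * mag Z (ζ + η)) :=
    Measurable.lintegral_prod_right' (measurable_tri_inner (F := fun ξ ↦ ‖ξ‖ₑ * mag V ξ)
      (G := fun ξ ↦ ‖ξ‖ₑ * mag W ξ) (H := fun ξ ↦ ‖ξ‖ₑ * mag Z ξ)
      (by fun_prop) (by fun_prop) (by fun_prop))
  rw [tri, ← lintegral_const_mul _ hmm]
  refine lintegral_mono_ae ?_
  filter_upwards [hV] with ζ hζ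
  refine (enorm_integral_le_lintegral_enorm _).trans ?_
  rw [← lintegral_const_mul _ (by fun_prop)]
  have hZ' (i : Fin 2) : ∀ᵐ η, Z i (-(ζ + η)) = (starRingEnd ℂ) (Z i (ζ + η)) :=
    (measurePreserving_add_left volume ζ).quasiMeasurePreserving.ae (hZ i)
  refine lintegral_mono_ae ?_
  filter_upwards [hZ' 0, hZ' 1] with η z0 z1
  -- The divergence condition allows `d` to be bounded with `|η|` or with `|ζ + η|`. The weight
  -- difference is at most `|ζ| (|ζ + η| + |η|)`; in each summand the missing derivative is taken
  -- from `d`, so every factor ends up with exactly one.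
  set d : ℂ := (η 0 : ℂ) * V 0 ζ + (η 1 : ℂ) * V 1 ζ with hd
  have hd' : d = (((ζ + η) 0 : ℝ) : ℂ) * V 0 ζ + (((ζ + η) 1 : ℝ) : ℂ) * V 1 ζ := by
    simp only [hd, PiLp.add_apply, Complex.ofReal_add]
    linear_combination -hζ
  have hd1 : ‖d‖ₑ ≤ 2 * (‖η‖ₑ * mag V ζ) := enorm_coord_dot_le η ζ V
  have hd2 : ‖d‖ₑ ≤ 2 * (‖ζ + η‖ₑ * mag V ζ) := by
    rw [hd']; exact enorm_coord_dot_le (ζ + η) ζ V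
  have hw : ‖((‖ζ + η‖ ^ 2 - ‖η‖ ^ 2 : ℝ) : ℂ)‖ₑ ≤ ‖ζ‖ₑ * (‖ζ + η‖ₑ + ‖η‖ₑ) := by
    simp only [← ofReal_norm]
    rw [← ENNReal.ofReal_add (norm_nonneg _) (norm_nonneg _), ← ENNReal.ofReal_mul (norm_nonneg _)]
    apply ENNReal.ofReal_le_ofReal
    rw [Complex.norm_real, Real.norm_eq_abs, sq_sub_sq, abs_mul, mul_comm,
      abs_of_nonneg (by positivity : 0 ≤ ‖ζ + η‖ + ‖η‖)]
    gcongr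
    have := abs_norm_sub_norm_le (ζ + η) η
    rwa [add_sub_cancel_right] at this
  have hWZ : ‖W 0 η * Z 0 (-(ζ + η)) + W 1 η * Z 1 (-(ζ + η))‖ₑ
      ≤ 2 * (mag W η * mag Z (ζ + η)) := by
    apply enorm_dot_le (enorm_le_mag W 0 _) (enorm_le_mag W 1 _)
    · rw [z0, enorm_conj]; exact enorm_le_mag Z 0 _
    · rw [z1, enorm_conj]; exact enorm_le_mag Z 1 _
  have hkey : ‖((‖ζ + η‖ ^ 2 - ‖η‖ ^ 2 : ℝ) : ℂ)‖ₑ * ‖d‖ₑ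
      ≤ 4 * (‖ζ‖ₑ * mag V ζ * ‖η‖ₑ * ‖ζ + η‖ₑ) := by
    calc _ ≤ ‖ζ‖ₑ * (‖ζ + η‖ₑ + ‖η‖ₑ) * ‖d‖ₑ := by gcongr
      _ = ‖ζ‖ₑ * (‖ζ + η‖ₑ * ‖d‖ₑ + ‖η‖ₑ * ‖d‖ₑ) := by ring
      _ ≤ ‖ζ‖ₑ * (‖ζ + η‖ₑ * (2 * (‖η‖ₑ * mag V ζ)) + ‖η‖ₑ * (2 * (‖ζ + η‖ₑ * mag V ζ))) := by
          gcongr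
      _ = _ := by ring
  have h16 : ENNReal.ofReal (16 * Real.pi) = ENNReal.ofReal (2 * Real.pi) * 8 := by
    rw [show (8 : ℝ≥0∞) = ENNReal.ofReal 8 by simp, ← ENNReal.ofReal_mul (by positivity)]
    congr 1; ring
  rw [symKer, enorm_mul, enorm_mul, enorm_mul, enorm_two_pi_I, ← hd, h16]
  calc _ = ENNReal.ofReal (2 * Real.pi) * (‖((‖ζ + η‖ ^ 2 - ‖η‖ ^ 2 : ℝ) : ℂ)‖ₑ * ‖d‖ₑ)
        * ‖W 0 η * Z 0 (-(ζ + η)) + W 1 η * Z 1 (-(ζ + η))‖ₑ := by ring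
    _ ≤ ENNReal.ofReal (2 * Real.pi) * (4 * (‖ζ‖ₑ * mag V ζ * ‖η‖ₑ * ‖ζ + η‖ₑ))
        * (2 * (mag W η * mag Z (ζ + η))) := by gcongr
    _ = _ := by ring

/-! ### Sobolev norms and product estimates. -/

/-- The inhomogeneous Sobolev norm on the Fourier side. -/
def hn (s : ℝ) (V : Fin 2 → L2C) : ℝ≥0∞ := n2 fun ξ ↦ ejap s ξ * mag V ξ

/-- The homogeneous Sobolev norm on the Fourier side. -/
def dn (a : ℝ) (V : Fin 2 → L2C) : ℝ≥0∞ := n2 fun ξ ↦ ENNReal.ofReal (‖ξ‖ ^ a) * mag V ξ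

/-- The square of the homogeneous Sobolev norm, as a real integral. -/
def en (a : ℝ) (V : Fin 2 → L2C) : ℝ := ∫ ξ, ‖ξ‖ ^ (2 * a) * sq (fun i ↦ V i) ξ

lemma measurable_norm_rpow (a : ℝ) : Measurable fun ξ : Plane ↦ ‖ξ‖ ^ a := by fun_prop

lemma dn_le_hn {a s : ℝ} (ha : 0 ≤ a) (has : a ≤ s) (V : Fin 2 → L2C) : dn a V ≤ hn s V :=
  n2_mono fun ξ ↦ mul_le_mul' (ofReal_rpow_le_ejap ha has ξ) le_rfl

lemma hn_mono {s t : ℝ} (h : s ≤ t) (V : Fin 2 → L2C) : hn s V ≤ hn t V :=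
  n2_mono fun ξ ↦ mul_le_mul' (ejap_mono h ξ) le_rfl

lemma norm_rpow_two_mul (a : ℝ) (ξ : Plane) : ‖ξ‖ ^ (2 * a) = (‖ξ‖ ^ a) ^ 2 := by
  rw [mul_comm, Real.rpow_mul (norm_nonneg _), Real.rpow_two]

lemma mag_sq (V : Fin 2 → L2C) (ξ : Plane) : mag V ξ ^ 2 = ENNReal.ofReal (sq (fun i ↦ V i) ξ) := by
  rw [mag, ← ENNReal.ofReal_pow (Real.sqrt_nonneg _), Real.sq_sqrt (sq_nonneg' _ _)]

lemma dn_sq (a : ℝ) (V : Fin 2 → L2C) :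
    dn a V ^ 2 = ∫⁻ ξ, ENNReal.ofReal (‖ξ‖ ^ (2 * a) * sq (fun i ↦ V i) ξ) := by
  rw [dn, n2_sq]
  congr 1; ext ξ
  rw [mul_pow, mag_sq, ← ENNReal.ofReal_pow (by positivity), ← ENNReal.ofReal_mul (by positivity),
    norm_rpow_two_mul]

lemma weighted_sq_nonneg (a : ℝ) (V : Fin 2 → L2C) (ξ : Plane) :
    0 ≤ ‖ξ‖ ^ (2 * a) * sq (fun i ↦ V i) ξ :=
  mul_nonneg (by positivity) (sq_nonneg' _ _)

lemma measurable_weighted_sq (a : ℝ) (V : Fin 2 → L2C) :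
    Measurable fun ξ ↦ ‖ξ‖ ^ (2 * a) * sq (fun i ↦ V i) ξ :=
  (measurable_norm_rpow _).mul (measurable_sq V)

lemma en_nonneg (a : ℝ) (V : Fin 2 → L2C) : 0 ≤ en a V :=
  integral_nonneg fun ξ ↦ weighted_sq_nonneg a V ξ

lemma integrable_en {a : ℝ} {V : Fin 2 → L2C} (h : dn a V < ∞) :
    Integrable fun ξ ↦ ‖ξ‖ ^ (2 * a) * sq (fun i ↦ V i) ξ := by
  refine ⟨(measurable_weighted_sq a V).aestronglyMeasurable, ?_⟩
  rw [hasFiniteIntegral_iff_ofReal (.of_forall (weighted_sq_nonneg a V)), ← dn_sq]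
  exact ENNReal.pow_lt_top h

lemma ofReal_en {a : ℝ} {V : Fin 2 → L2C} (h : dn a V < ∞) :
    ENNReal.ofReal (en a V) = dn a V ^ 2 := by
  rw [en, ofReal_integral_eq_lintegral_ofReal (integrable_en h)
    (.of_forall (weighted_sq_nonneg a V)), dn_sq]

lemma dn_eq {a : ℝ} {V : Fin 2 → L2C} (h : dn a V < ∞) :
    dn a V = ENNReal.ofReal (Real.sqrt (en a V)) := by
  have h1 : dn a V ^ 2 = ENNReal.ofReal (Real.sqrt (en a V)) ^ 2 := by
    rw [← ofReal_en h, ← ENNReal.ofReal_pow (Real.sqrt_nonneg _), Real.sq_sqrt (en_nonneg _ _)]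
  exact (ENNReal.pow_right_strictMono two_ne_zero).injective h1

lemma rpow_le_add_rpow {x a b c : ℝ} (hx : 0 ≤ x) (ha : 0 ≤ a) (hab : a ≤ b) (hbc : b ≤ c) :
    x ^ b ≤ x ^ a + x ^ c := by
  rcases le_total x 1 with h | h
  · have := Real.rpow_le_rpow_of_exponent_ge_of_imp hx h hab (fun _ h0 ↦ le_antisymm (h0 ▸ hab) ha)
    linarith [Real.rpow_nonneg hx c]
  · linarith [Real.rpow_le_rpow_of_exponent_le h hbc, Real.rpow_nonneg hx a]

/-- A crude form of interpolation. It is how `β ≥ 1` enters: first derivatives are controlled by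
orders `0` and `β`, second ones by `1` and `1 + β`. -/
lemma en_le_add {a b c : ℝ} (ha : 0 ≤ a) (hab : a ≤ b) (hbc : b ≤ c) {V : Fin 2 → L2C}
    (h1 : dn a V < ∞) (h2 : dn c V < ∞) : en b V ≤ en a V + en c V := by
  rw [en, en, en, ← integral_add (integrable_en h1) (integrable_en h2)]
  refine integral_mono_of_nonneg (.of_forall (weighted_sq_nonneg b V))
    ((integrable_en h1).add (integrable_en h2)) (.of_forall fun ξ ↦ ?_)
  simp only
  rw [← add_mul]
  gcongr
  · exact sq_nonneg' _ _
  · exact rpow_le_add_rpow (norm_nonneg _) (by linarith) (by linarith) (by linarith)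

lemma jap_sq_le {s : ℝ} (hs : 0 ≤ s) (ξ : Plane) :
    jap s ξ ^ 2 ≤ 2 ^ s * (1 + ‖ξ‖ ^ (2 * s)) := by
  have h0 : jap s ξ ^ 2 = (1 + ‖ξ‖ ^ 2) ^ s := by
    rw [jap, ← Real.rpow_two, ← Real.rpow_mul (by positivity)]; congr 1; ring
  have h1 : ‖ξ‖ ^ (2 * s) = (‖ξ‖ ^ 2) ^ s := by
    rw [Real.rpow_mul (norm_nonneg _), Real.rpow_two]
  rw [h0, h1]
  have h2 : 1 + ‖ξ‖ ^ 2 ≤ 2 * max 1 (‖ξ‖ ^ 2) := by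
    linarith [le_max_left 1 (‖ξ‖ ^ 2), le_max_right 1 (‖ξ‖ ^ 2)]
  refine (Real.rpow_le_rpow (by positivity) h2 hs).trans ?_
  rw [Real.mul_rpow (by norm_num) (by positivity)]
  gcongr
  rcases le_total 1 (‖ξ‖ ^ 2) with h | h
  · rw [max_eq_right h]; linarith
  · rw [max_eq_left h, Real.one_rpow]; linarith [Real.rpow_nonneg (sq_nonneg ‖ξ‖) s]

lemma hn_sq_le {s : ℝ} (hs : 0 ≤ s) {V : Fin 2 → L2C} (h0 : dn 0 V < ∞) (h1 : dn s V < ∞) :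
    hn s V ^ 2 ≤ ENNReal.ofReal (2 ^ s * (en 0 V + en s V)) := by
  rw [ENNReal.ofReal_mul (by positivity), ENNReal.ofReal_add (en_nonneg _ _) (en_nonneg _ _),
    ofReal_en h0, ofReal_en h1, dn_sq, dn_sq,
    ← lintegral_add_left (measurable_weighted_sq 0 V).ennreal_ofReal,
    ← lintegral_const_mul' _ _ ENNReal.ofReal_ne_top, hn, n2_sq]
  refine lintegral_mono fun ξ ↦ ?_
  simp only
  rw [mul_pow, mag_sq, ejap, ← ENNReal.ofReal_pow (jap_nonneg _ _),
    ← ENNReal.ofReal_mul (by positivity),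
    ← ENNReal.ofReal_add (weighted_sq_nonneg _ _ _) (weighted_sq_nonneg _ _ _),
    ← ENNReal.ofReal_mul (by positivity)]
  apply ENNReal.ofReal_le_ofReal
  rw [← add_mul, ← mul_assoc, mul_zero, Real.rpow_zero]
  exact mul_le_mul_of_nonneg_right (jap_sq_le hs ξ) (sq_nonneg' _ _)

lemma hn_le {s : ℝ} (hs : 0 ≤ s) {V : Fin 2 → L2C} (h0 : dn 0 V < ∞) (h1 : dn s V < ∞) :
    hn s V ≤ ENNReal.ofReal (Real.sqrt (2 ^ s * (en 0 V + en s V))) := by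
  have hnn : 0 ≤ 2 ^ s * (en 0 V + en s V) :=
    mul_nonneg (by positivity) (add_nonneg (en_nonneg _ _) (en_nonneg _ _))
  refine (ENNReal.pow_right_strictMono two_ne_zero).le_iff_le.1 ?_
  rw [← ENNReal.ofReal_pow (Real.sqrt_nonneg _), Real.sq_sqrt hnn]
  exact hn_sq_le hs h0 h1

lemma ejap_add_le {s : ℝ} (hs : 0 ≤ s) (ζ η : Plane) :
    ejap s (ζ + η) ≤ ENNReal.ofReal (2 ^ s) * (ejap s ζ + ejap s η) := by
  unfold ejap
  rw [← ENNReal.ofReal_add (jap_nonneg _ _) (jap_nonneg _ _), ← ENNReal.ofReal_mul (by positivity)]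
  apply ENNReal.ofReal_le_ofReal
  have key (x y : Plane) (h : ‖x‖ ≤ ‖y‖) : jap s (x + y) ≤ 2 ^ s * jap s y := by
    have h1 : 1 + ‖x + y‖ ^ 2 ≤ 2 ^ 2 * (1 + ‖y‖ ^ 2) := by
      have := norm_add_le x y
      nlinarith [norm_nonneg (x + y), norm_nonneg x, norm_nonneg y]
    have h2 : (2 : ℝ) ^ s = (2 ^ 2) ^ (s / 2) := by
      rw [← Real.rpow_natCast, ← Real.rpow_mul (by norm_num)]; congr 1; push_cast; ring
    rw [jap, jap, h2, ← Real.mul_rpow (by norm_num) (by positivity)]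
    exact Real.rpow_le_rpow (by positivity) h1 (by linarith)
  have hp : (0 : ℝ) < 2 ^ s := by positivity
  rcases le_total ‖ζ‖ ‖η‖ with h | h
  · nlinarith [key ζ η h, mul_nonneg hp.le (jap_nonneg s ζ)]
  · have := key η ζ h
    rw [add_comm] at this
    nlinarith [mul_nonneg hp.le (jap_nonneg s η)]

/-- If the weight `p` is quasi-subadditive, it can be moved from the third factor to the others. -/
lemma tri_le_move {p F G H : Plane → ℝ≥0∞} (hp : Measurable p) (hF : Measurable F)
    (hG : Measurable G) (hH : Measurable H) {c : ℝ≥0∞}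
    (h : ∀ ζ η, p (ζ + η) ≤ c * (p ζ + p η)) :
    tri F G (fun ξ ↦ p ξ * H ξ)
      ≤ c * (tri (fun ξ ↦ p ξ * F ξ) G H + tri F (fun ξ ↦ p ξ * G ξ) H) := by
  have hm : Measurable fun ζ ↦ ∫⁻ η, p ζ * F ζ * G η * H (ζ + η) :=
    Measurable.lintegral_prod_right' (measurable_tri_inner (F := fun ζ ↦ p ζ * F ζ)
      (by fun_prop) hG hH)
  have hm' : Measurable fun ζ ↦ ∫⁻ η, F ζ * (p η * G η) * H (ζ + η) :=
    Measurable.lintegral_prod_right' (measurable_tri_inner (G := fun ζ ↦ p ζ * G ζ) hF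
      (by fun_prop) hH)
  unfold tri
  rw [← lintegral_add_left hm, ← lintegral_const_mul _ (by fun_prop)]
  refine lintegral_mono fun ζ ↦ ?_
  simp only
  rw [← lintegral_add_left (by fun_prop), ← lintegral_const_mul _ (by fun_prop)]
  refine lintegral_mono fun η ↦ ?_
  calc F ζ * G η * (p (ζ + η) * H (ζ + η))
      ≤ F ζ * G η * (c * (p ζ + p η) * H (ζ + η)) := by gcongr; exact h ζ η
    _ = _ := by ring

lemma lintegral_mag_le (s : ℝ) (V : Fin 2 → L2C) : ∫⁻ ξ, mag V ξ ≤ n2 (ejap (-s)) * hn s V :=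
  lintegral_le_ejap (measurable_mag V)

/-- The constant of the algebra estimate. -/
def algConst (k s : ℝ) : ℝ≥0∞ := ENNReal.ofReal (2 ^ s) * n2 (ejap (-k))

lemma algConst_lt_top {k s : ℝ} (hk : 1 < k) : algConst k s < ∞ :=
  ENNReal.mul_lt_top ENNReal.ofReal_lt_top (n2_ejap_lt_top (by linarith))

/-- The weighted trilinear form is controlled by Sobolev norms. -/
lemma tri_advWeight_le {k s t a : ℝ} (hs : 0 ≤ s) (ha : 0 ≤ a) (hst : 2 * a + 1 ≤ s + t)
    (V W Z : Fin 2 → L2C) :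
    tri (mag V) (mag W) (advWeight (fun ξ ↦ ‖ξ‖ ^ (2 * a)) Z)
      ≤ algConst k s * (hn k V * hn s W + hn k W * hn s V) * hn t Z := by
  have hV := measurable_mag V
  have hW := measurable_mag W
  have hZ := measurable_mag Z
  have hes := measurable_ejap s
  have het := measurable_ejap t
  -- Of the `2a + 1` derivatives in the third slot, `t` remain on `Z` and `s` are distributed over
  -- `V` and `W`.
  have h1 (ξ : Plane) : advWeight (fun ξ ↦ ‖ξ‖ ^ (2 * a)) Z ξ ≤ ejap s ξ * (ejap t ξ * mag Z ξ) := by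
    rw [advWeight, ← mul_assoc, ← ejap_add]
    gcongr
    have h2 : ENNReal.ofReal (‖ξ‖ ^ (2 * a)) * ‖ξ‖ₑ = ENNReal.ofReal (‖ξ‖ ^ (2 * a + 1)) := by
      rw [← ofReal_norm, ← ENNReal.ofReal_mul (by positivity),
        Real.rpow_add_one' (norm_nonneg _) (by positivity)]
    rw [h2]
    exact ofReal_rpow_le_ejap (by positivity) hst ξ
  refine (tri_mono (fun _ ↦ le_rfl) (fun _ ↦ le_rfl) h1).trans ?_
  refine (tri_le_move (p := ejap s) hes hV hW (H := fun ξ ↦ ejap t ξ * mag Z ξ) (by fun_prop)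
    (ejap_add_le hs)).trans ?_
  have i1 := tri_le_young_mid (F := fun ξ ↦ ejap s ξ * mag V ξ) (G := mag W)
    (H := fun ξ ↦ ejap t ξ * mag Z ξ) (by fun_prop) hW (by fun_prop)
  have i2 := tri_le_young (F := mag V) (G := fun ξ ↦ ejap s ξ * mag W ξ)
    (H := fun ξ ↦ ejap t ξ * mag Z ξ) hV (by fun_prop) (by fun_prop)
  calc _ ≤ ENNReal.ofReal (2 ^ s) * ((∫⁻ ξ, mag W ξ) * hn s V * hn t Z
        + (∫⁻ ξ, mag V ξ) * hn s W * hn t Z) := by gcongr; exacts [i1, i2]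
    _ ≤ ENNReal.ofReal (2 ^ s) * ((n2 (ejap (-k)) * hn k W) * hn s V * hn t Z
        + (n2 (ejap (-k)) * hn k V) * hn s W * hn t Z) := by
      gcongr <;> exact lintegral_mag_le k _
    _ = _ := by rw [algConst]; ring

/-! ### The forms of the right-hand sides, and their absolute bounds. -/

/-- The advection form with the weight `‖ξ‖^(2a)`. -/
def advF (a : ℝ) (V W Z : Fin 2 → L2C) : ℝ :=
  ∫ ξ, ‖ξ‖ ^ (2 * a) * rdot (fun i ↦ Z i) (advHat V W) ξ

/-- A combination of two advection terms and a dissipative term. -/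
def mixG (c₁ c₂ ν b : ℝ) (V₁ W₁ V₂ W₂ Z : Fin 2 → L2C) (i : Fin 2) (ξ : Plane) : ℂ :=
  c₁ * advHat V₁ W₁ i ξ + c₂ * advHat V₂ W₂ i ξ - ν * (((lam ξ ^ (2 * b) : ℝ) : ℂ) * Z i ξ)

lemma rdot_mixG (c₁ c₂ ν b : ℝ) (V₁ W₁ V₂ W₂ Z : Fin 2 → L2C) (ξ : Plane) :
    rdot (fun i ↦ Z i) (mixG c₁ c₂ ν b V₁ W₁ V₂ W₂ Z) ξ
      = c₁ * rdot (fun i ↦ Z i) (advHat V₁ W₁) ξ + c₂ * rdot (fun i ↦ Z i) (advHat V₂ W₂) ξ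
        - ν * (lam ξ ^ (2 * b) * sq (fun i ↦ Z i) ξ) := by
  simp only [rdot, mixG, sq, ← Complex.normSq_eq_norm_sq, Complex.normSq_apply, Complex.add_re,
    Complex.sub_re, Complex.mul_re, Complex.conj_re, Complex.conj_im, Complex.ofReal_re,
    Complex.ofReal_im, Complex.sub_im, Complex.add_im, Complex.mul_im]
  ring

lemma weight_mul_lam {a b : ℝ} (ha : 0 ≤ a) (hb : 0 ≤ b) (x : ℝ) (ξ : Plane) :
    ‖ξ‖ ^ (2 * a) * (lam ξ ^ (2 * b) * x) = (2 * Real.pi) ^ (2 * b) * (‖ξ‖ ^ (2 * (a + b)) * x) := by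
  rw [lam, Real.mul_rpow (by positivity) (norm_nonneg _), mul_add 2 a b,
    Real.rpow_add_of_nonneg (norm_nonneg _) (by positivity) (by positivity)]
  ring

/-- The value of the form feeds the nonlinear estimates; the bound on the integral of its absolute
value provides the domination required in `energy_identity`. -/
lemma form_mixG {a b : ℝ} (ha : 0 ≤ a) (hb : 0 ≤ b) (c₁ c₂ ν : ℝ) {V₁ W₁ V₂ W₂ Z : Fin 2 → L2C}
    (h₁ : tri (mag V₁) (mag W₁) (advWeight (fun ξ ↦ ‖ξ‖ ^ (2 * a)) Z) < ∞)
    (h₂ : tri (mag V₂) (mag W₂) (advWeight (fun ξ ↦ ‖ξ‖ ^ (2 * a)) Z) < ∞)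
    (hZ : dn (a + b) Z < ∞) :
    Integrable (fun ξ ↦ ‖ξ‖ ^ (2 * a) * rdot (fun i ↦ Z i) (mixG c₁ c₂ ν b V₁ W₁ V₂ W₂ Z) ξ) ∧
    ∫ ξ, ‖ξ‖ ^ (2 * a) * rdot (fun i ↦ Z i) (mixG c₁ c₂ ν b V₁ W₁ V₂ W₂ Z) ξ
      = c₁ * advF a V₁ W₁ Z + c₂ * advF a V₂ W₂ Z - ν * ((2 * Real.pi) ^ (2 * b) * en (a + b) Z) ∧
    ∫⁻ ξ, ‖‖ξ‖ ^ (2 * a) * rdot (fun i ↦ Z i) (mixG c₁ c₂ ν b V₁ W₁ V₂ W₂ Z) ξ‖ₑ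
      ≤ ‖c₁‖ₑ * (ENNReal.ofReal (8 * Real.pi)
          * tri (mag V₁) (mag W₁) (advWeight (fun ξ ↦ ‖ξ‖ ^ (2 * a)) Z))
        + ‖c₂‖ₑ * (ENNReal.ofReal (8 * Real.pi)
          * tri (mag V₂) (mag W₂) (advWeight (fun ξ ↦ ‖ξ‖ ^ (2 * a)) Z))
        + ‖ν‖ₑ * (ENNReal.ofReal ((2 * Real.pi) ^ (2 * b)) * dn (a + b) Z ^ 2) := by
  obtain ⟨i₁, l₁⟩ := advForm_le (measurable_norm_rpow (2 * a)) (fun ξ ↦ by positivity) h₁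
  obtain ⟨i₂, l₂⟩ := advForm_le (measurable_norm_rpow (2 * a)) (fun ξ ↦ by positivity) h₂
  have i₃ := (integrable_en hZ).const_mul ((2 * Real.pi) ^ (2 * b))
  have heq (ξ : Plane) :
      ‖ξ‖ ^ (2 * a) * rdot (fun i ↦ Z i) (mixG c₁ c₂ ν b V₁ W₁ V₂ W₂ Z) ξ
        = c₁ * (‖ξ‖ ^ (2 * a) * rdot (fun i ↦ Z i) (advHat V₁ W₁) ξ)
          + c₂ * (‖ξ‖ ^ (2 * a) * rdot (fun i ↦ Z i) (advHat V₂ W₂) ξ)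
          - ν * ((2 * Real.pi) ^ (2 * b) * (‖ξ‖ ^ (2 * (a + b)) * sq (fun i ↦ Z i) ξ)) := by
    rw [rdot_mixG, ← weight_mul_lam ha hb]; ring
  have j₁ := i₁.const_mul c₁
  have j₂ := i₂.const_mul c₂
  have j₃ := i₃.const_mul ν
  have j₁₂ : Integrable fun ξ ↦ c₁ * (‖ξ‖ ^ (2 * a) * rdot (fun i ↦ Z i) (advHat V₁ W₁) ξ)
      + c₂ * (‖ξ‖ ^ (2 * a) * rdot (fun i ↦ Z i) (advHat V₂ W₂) ξ) := j₁.add j₂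
  simp_rw [heq]
  refine ⟨j₁₂.sub j₃, ?_, ?_⟩
  · rw [integral_sub j₁₂ j₃, integral_add j₁ j₂]
    simp only [integral_const_mul]
    rfl
  · have hm₁ : AEMeasurable fun ξ ↦ ‖c₁ * (‖ξ‖ ^ (2 * a) * rdot (fun i ↦ Z i) (advHat V₁ W₁) ξ)‖ₑ :=
      j₁.1.enorm
    have hm₂ : AEMeasurable fun ξ ↦ ‖c₂ * (‖ξ‖ ^ (2 * a) * rdot (fun i ↦ Z i) (advHat V₂ W₂) ξ)‖ₑ :=
      j₂.1.enorm
    have hm₁₂ : AEMeasurable fun ξ ↦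
        ‖c₁ * (‖ξ‖ ^ (2 * a) * rdot (fun i ↦ Z i) (advHat V₁ W₁) ξ)‖ₑ
        + ‖c₂ * (‖ξ‖ ^ (2 * a) * rdot (fun i ↦ Z i) (advHat V₂ W₂) ξ)‖ₑ := hm₁.add hm₂
    calc _ ≤ ∫⁻ ξ, (‖c₁ * (‖ξ‖ ^ (2 * a) * rdot (fun i ↦ Z i) (advHat V₁ W₁) ξ)‖ₑ
          + ‖c₂ * (‖ξ‖ ^ (2 * a) * rdot (fun i ↦ Z i) (advHat V₂ W₂) ξ)‖ₑ
          + ‖ν * ((2 * Real.pi) ^ (2 * b) * (‖ξ‖ ^ (2 * (a + b)) * sq (fun i ↦ Z i) ξ))‖ₑ) := by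
          refine lintegral_mono fun ξ ↦ ?_
          exact enorm_sub_le.trans (add_le_add (enorm_add_le _ _) le_rfl)
      _ ≤ _ := by
          rw [lintegral_add_left' hm₁₂, lintegral_add_left' hm₁]
          simp only [enorm_mul]
          refine add_le_add (add_le_add ?_ ?_) ?_
          · rw [lintegral_const_mul' _ _ enorm_ne_top]
            simp only [enorm_mul] at l₁
            gcongr
          · rw [lintegral_const_mul' _ _ enorm_ne_top]
            simp only [enorm_mul] at l₂
            gcongr
          · rw [lintegral_const_mul' _ _ enorm_ne_top, lintegral_const_mul' _ _ enorm_ne_top, dn_sq]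
            refine le_of_eq ?_
            congr 2
            · rw [Real.enorm_eq_ofReal (by positivity)]
            · congr 1; ext ξ
              rw [← enorm_mul, Real.enorm_eq_ofReal (weighted_sq_nonneg _ _ _)]

lemma integral_norm_le_of_lintegral {f : Plane → ℝ} (hf : AEStronglyMeasurable f volume) {C : ℝ}
    (hC : 0 ≤ C) (h : ∫⁻ ξ, ‖f ξ‖ₑ ≤ ENNReal.ofReal C) : ∫ ξ, ‖f ξ‖ ≤ C := by
  rw [integral_norm_eq_lintegral_enorm hf]
  exact ENNReal.toReal_le_of_le_ofReal hC h

/-- Young's inequality for the convolution of nonnegative functions. -/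
lemma n2_econv_le {F G : Plane → ℝ≥0∞} (hF : Measurable F) (hG : Measurable G) :
    n2 (fun ξ ↦ ∫⁻ ζ, F ζ * G (ξ - ζ)) ≤ (∫⁻ ζ, F ζ) * n2 G := by
  have hcs (ξ : Plane) : (∫⁻ ζ, F ζ * G (ξ - ζ)) ^ 2
      ≤ (∫⁻ ζ, F ζ) * ∫⁻ ζ, F ζ * G (ξ - ζ) ^ 2 := by
    have h := lintegral_mul_le_n2 (F := fun ζ ↦ F ζ ^ (1 / 2 : ℝ))
      (G := fun ζ ↦ F ζ ^ (1 / 2 : ℝ) * G (ξ - ζ)) (by fun_prop) (by fun_prop)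
    have h2 := pow_le_pow_left' h 2
    simp only [← mul_assoc, ← pow_two, ennreal_sqrt_sq] at h2
    rw [mul_pow, n2_sq, n2_sq] at h2
    simpa only [mul_pow, ennreal_sqrt_sq] using h2
  refine (ENNReal.pow_right_strictMono two_ne_zero).le_iff_le.1 ?_
  have hm : Measurable fun ξ ↦ ∫⁻ ζ, F ζ * G (ξ - ζ) ^ 2 :=
    Measurable.lintegral_prod_right' (f := fun p : Plane × Plane ↦ F p.2 * G (p.1 - p.2) ^ 2)
      (by fun_prop)
  rw [n2_sq, mul_pow, n2_sq]
  refine (lintegral_mono hcs).trans (le_of_eq ?_)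
  rw [lintegral_const_mul _ hm, lintegral_lintegral_swap (by unfold Function.uncurry; fun_prop), pow_two,
    mul_assoc]
  congr 1
  rw [← lintegral_mul_const _ hF]
  congr 1; ext ζ
  rw [lintegral_const_mul _ (by fun_prop), lintegral_sub_right_eq_self (fun ξ ↦ G ξ ^ 2) ζ]

lemma econv_comm (F G : Plane → ℝ≥0∞) (ξ : Plane) :
    ∫⁻ ζ, F ζ * G (ξ - ζ) = ∫⁻ ζ, G ζ * F (ξ - ζ) := by
  rw [← lintegral_sub_left_eq_self _ ξ]
  simp [mul_comm]

/-- The weight at `ξ` is split between the two frequencies; the factor without the weight is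
integrable because it lies in `H^k`, and Young's inequality applies. -/
lemma n2_ejap_econv_le {k s : ℝ} (hs : 0 ≤ s) (V W : Fin 2 → L2C) :
    n2 (fun ξ ↦ ejap s ξ * ∫⁻ ζ, mag V ζ * mag W (ξ - ζ))
      ≤ algConst k s * (hn k V * hn s W + hn k W * hn s V) := by
  have hV := measurable_mag V
  have hW := measurable_mag W
  have hes := measurable_ejap s
  set P : Plane → ℝ≥0∞ := fun ξ ↦ ∫⁻ ζ, mag V ζ * (ejap s (ξ - ζ) * mag W (ξ - ζ)) with hP
  set Q : Plane → ℝ≥0∞ := fun ξ ↦ ∫⁻ ζ, mag W ζ * (ejap s (ξ - ζ) * mag V (ξ - ζ)) with hQ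
  have hPm : Measurable P := Measurable.lintegral_prod_right'
    (f := fun p : Plane × Plane ↦ mag V p.2 * (ejap s (p.1 - p.2) * mag W (p.1 - p.2))) (by fun_prop)
  have hQm : Measurable Q := Measurable.lintegral_prod_right'
    (f := fun p : Plane × Plane ↦ mag W p.2 * (ejap s (p.1 - p.2) * mag V (p.1 - p.2))) (by fun_prop)
  have hpt (ξ : Plane) : ejap s ξ * ∫⁻ ζ, mag V ζ * mag W (ξ - ζ)
      ≤ ENNReal.ofReal (2 ^ s) * (P ξ + Q ξ) := by
    have hQ' : Q ξ = ∫⁻ ζ, ejap s ζ * mag V ζ * mag W (ξ - ζ) :=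
      econv_comm (mag W) (fun ζ ↦ ejap s ζ * mag V ζ) ξ
    rw [hQ', hP, ← lintegral_add_left (by fun_prop), ← lintegral_const_mul _ (by fun_prop),
      ← lintegral_const_mul _ (by fun_prop)]
    refine lintegral_mono fun ζ ↦ ?_
    have h := ejap_add_le hs ζ (ξ - ζ)
    rw [add_sub_cancel] at h
    calc _ ≤ ENNReal.ofReal (2 ^ s) * (ejap s ζ + ejap s (ξ - ζ)) * (mag V ζ * mag W (ξ - ζ)) := by
          gcongr
      _ = _ := by ring
  refine (n2_mono hpt).trans ?_
  rw [n2_const_mul _ (by fun_prop)]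
  have h1 := n2_econv_le (G := fun ξ ↦ ejap s ξ * mag W ξ) hV (by fun_prop)
  have h2 := n2_econv_le (G := fun ξ ↦ ejap s ξ * mag V ξ) hW (by fun_prop)
  calc _ ≤ ENNReal.ofReal (2 ^ s) * (n2 P + n2 Q) := by gcongr; exact n2_add_le hPm hQm
    _ ≤ ENNReal.ofReal (2 ^ s) * ((∫⁻ ξ, mag V ξ) * hn s W + (∫⁻ ξ, mag W ξ) * hn s V) := by
        gcongr; exacts [h1, h2]
    _ ≤ ENNReal.ofReal (2 ^ s) * (n2 (ejap (-k)) * hn k V * hn s W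
        + n2 (ejap (-k)) * hn k W * hn s V) := by gcongr <;> exact lintegral_mag_le k _
    _ = _ := by rw [algConst]; ring

lemma enorm_conv_le (V W : Fin 2 → L2C) (i j : Fin 2) (ξ : Plane) :
    ‖conv (V j) (W i) ξ‖ₑ ≤ ∫⁻ ζ, mag V ζ * mag W (ξ - ζ) := by
  refine (enorm_integral_le_lintegral_enorm _).trans (lintegral_mono fun ζ ↦ ?_)
  rw [enorm_mul]
  exact mul_le_mul' (enorm_le_mag V j ζ) (enorm_le_mag W i _)

lemma enorm_advHat_le (V W : Fin 2 → L2C) (i : Fin 2) (ξ : Plane) :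
    ‖advHat V W i ξ‖ₑ ≤ ENNReal.ofReal (4 * Real.pi) * (‖ξ‖ₑ * ∫⁻ ζ, mag V ζ * mag W (ξ - ζ)) := by
  have h4 : ENNReal.ofReal (4 * Real.pi) = ENNReal.ofReal (2 * Real.pi) * 2 := by
    rw [show (2 : ℝ≥0∞) = ENNReal.ofReal 2 by simp, ← ENNReal.ofReal_mul (by positivity)]
    congr 1; ring
  rw [advHat, enorm_mul, enorm_two_pi_I, Fin.sum_univ_two, h4, mul_assoc]
  gcongr
  refine (enorm_add_le _ _).trans ?_
  rw [enorm_mul, enorm_mul, two_mul]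
  gcongr <;> first | exact enorm_coord_le _ _ | exact enorm_conv_le _ _ _ _ _

lemma enorm_curlHat_le (G : Fin 2 → Plane → ℂ) (ξ : Plane) :
    ‖curlHat G ξ‖ₑ ≤ ‖ξ‖ₑ * (‖G 1 ξ‖ₑ + ‖G 0 ξ‖ₑ) := by
  rw [curlHat, mul_add]
  refine enorm_sub_le.trans ?_
  rw [enorm_mul, enorm_mul]
  gcongr <;> exact enorm_coord_le _ _

lemma measurable_advHat (V W : Fin 2 → L2C) (i : Fin 2) : Measurable (advHat V W i) := by
  have h (j : Fin 2) := (stronglyMeasurable_conv (V j) (W i)).measurable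
  have h0 := h 0
  have h1 := h 1
  unfold advHat
  simp only [Fin.sum_univ_two]
  fun_prop

lemma measurable_mixG (c₁ c₂ ν b : ℝ) (V₁ W₁ V₂ W₂ Z : Fin 2 → L2C) (i : Fin 2) :
    Measurable (mixG c₁ c₂ ν b V₁ W₁ V₂ W₂ Z i) := by
  have h1 := measurable_advHat V₁ W₁ i
  have h2 := measurable_advHat V₂ W₂ i
  have h3 := measurable_lam_rpow (2 * b)
  have h4 := measurable_L2 (Z i)
  unfold mixG
  fun_prop

/-- The vorticity source of the velocity equation is square integrable. -/
lemma exists_curl_source {α k s : ℝ} (hα : 0 ≤ α) (hk : 1 < k) (hs : 2 ≤ s) (hkα : 1 + α ≤ k) :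
    ∃ c : ℝ, 0 ≤ c ∧ ∀ (ν : ℝ), |ν| ≤ 1 → ∀ (U B : Fin 2 → L2C) (M N N' : ℝ), 0 ≤ M → 0 ≤ N →
      0 ≤ N' → hn k B ≤ ENNReal.ofReal M → hn s B ≤ ENNReal.ofReal N →
      hn (k + α) U ≤ ENNReal.ofReal N' →
      ∃ g : L2C, g =ᵐ[volume] curlHat (mixG 1 0 ν α B B B B U) ∧ ‖g‖ ≤ c * (M * N + N') := by
  set K : ℝ := (algConst k 2).toReal with hK
  have hKK : algConst k 2 = ENNReal.ofReal K := (ENNReal.ofReal_toReal (algConst_lt_top hk).ne).symm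
  have hK0 : 0 ≤ K := ENNReal.toReal_nonneg
  set L : ℝ := (2 * Real.pi) ^ (2 * α) with hL
  have hL0 : 0 ≤ L := by positivity
  refine ⟨16 * Real.pi * K + 2 * L, by positivity, ?_⟩
  intro ν hν U B M N N' hM hN hN' hBM hBN hUN
  set E : Plane → ℝ≥0∞ := fun ξ ↦ ∫⁻ ζ, mag B ζ * mag B (ξ - ζ) with hE
  have hmB := measurable_mag B
  have hmU := measurable_mag U
  have hEm : Measurable E := Measurable.lintegral_prod_right'
    (f := fun p : Plane × Plane ↦ mag B p.2 * mag B (p.1 - p.2)) (by fun_prop)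
  have he2 := measurable_ejap 2
  have hek := measurable_ejap (k + α)
  set F : Plane → ℝ≥0∞ := fun ξ ↦ ENNReal.ofReal (8 * Real.pi) * (ejap 2 ξ * E ξ)
    + ENNReal.ofReal (2 * L) * (ejap (k + α) ξ * mag U ξ) with hF
  have hG (i : Fin 2) (ξ : Plane) : ‖mixG 1 0 ν α B B B B U i ξ‖ₑ
      ≤ ENNReal.ofReal (4 * Real.pi) * (‖ξ‖ₑ * E ξ)
        + ENNReal.ofReal (lam ξ ^ (2 * α)) * mag U ξ := by
    rw [mixG]
    simp only [Complex.ofReal_one, one_mul, Complex.ofReal_zero, zero_mul, add_zero]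
    refine enorm_sub_le.trans (add_le_add (enorm_advHat_le B B i ξ) ?_)
    rw [enorm_mul, enorm_mul]
    have h1 : ‖(ν : ℂ)‖ₑ ≤ 1 := by
      rw [← ofReal_norm, Complex.norm_real, Real.norm_eq_abs]
      exact (ENNReal.ofReal_le_ofReal hν).trans (by simp)
    have h2 : ‖((lam ξ ^ (2 * α) : ℝ) : ℂ)‖ₑ = ENNReal.ofReal (lam ξ ^ (2 * α)) := by
      rw [← ofReal_norm, Complex.norm_real, Real.norm_eq_abs,
        abs_of_nonneg (Real.rpow_nonneg (lam_nonneg ξ) _)]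
    rw [h2]
    calc _ ≤ 1 * (ENNReal.ofReal (lam ξ ^ (2 * α)) * mag U ξ) := by
          gcongr; exact enorm_le_mag U i ξ
      _ = _ := one_mul _
  have hpt (ξ : Plane) : ‖curlHat (mixG 1 0 ν α B B B B U) ξ‖ₑ ≤ F ξ := by
    have h8 : ENNReal.ofReal (8 * Real.pi) = 2 * ENNReal.ofReal (4 * Real.pi) := by
      rw [show (2 : ℝ≥0∞) = ENNReal.ofReal 2 by simp, ← ENNReal.ofReal_mul (by positivity)]
      congr 1; ring
    have h2L : ENNReal.ofReal (2 * L) = 2 * ENNReal.ofReal L := by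
      rw [ENNReal.ofReal_mul (by norm_num)]; simp
    have hsq : ‖ξ‖ₑ * ‖ξ‖ₑ ≤ ejap 2 ξ := by
      rw [show (2 : ℝ) = 1 + 1 by norm_num, ejap_add]
      exact mul_le_mul' (enorm_le_ejap ξ) (enorm_le_ejap ξ)
    have hlam : ‖ξ‖ₑ * ENNReal.ofReal (lam ξ ^ (2 * α)) ≤ ENNReal.ofReal L * ejap (k + α) ξ := by
      rw [← ofReal_norm, ← ENNReal.ofReal_mul (norm_nonneg _), ejap, ← ENNReal.ofReal_mul hL0]
      apply ENNReal.ofReal_le_ofReal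
      have h := norm_rpow_le_jap (a := 1 + 2 * α) (s := k + α) (by positivity) (by linarith) ξ
      rw [Real.rpow_add_of_nonneg (norm_nonneg _) (by norm_num) (by positivity), Real.rpow_one] at h
      rw [lam, Real.mul_rpow (by positivity) (norm_nonneg _)]
      calc _ = L * (‖ξ‖ * ‖ξ‖ ^ (2 * α)) := by rw [hL]; ring
        _ ≤ _ := by gcongr
    refine (enorm_curlHat_le _ ξ).trans ?_
    calc _ ≤ ‖ξ‖ₑ * ((ENNReal.ofReal (4 * Real.pi) * (‖ξ‖ₑ * E ξ)
          + ENNReal.ofReal (lam ξ ^ (2 * α)) * mag U ξ) +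
          (ENNReal.ofReal (4 * Real.pi) * (‖ξ‖ₑ * E ξ)
          + ENNReal.ofReal (lam ξ ^ (2 * α)) * mag U ξ)) := by gcongr <;> exact hG _ ξ
      _ = 2 * ENNReal.ofReal (4 * Real.pi) * (‖ξ‖ₑ * ‖ξ‖ₑ * E ξ)
          + 2 * (‖ξ‖ₑ * ENNReal.ofReal (lam ξ ^ (2 * α)) * mag U ξ) := by ring
      _ ≤ 2 * ENNReal.ofReal (4 * Real.pi) * (ejap 2 ξ * E ξ)
          + 2 * (ENNReal.ofReal L * ejap (k + α) ξ * mag U ξ) := by gcongr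
      _ = F ξ := by rw [hF, h8, h2L]; ring
  have hFn : n2 F ≤ ENNReal.ofReal ((16 * Real.pi * K + 2 * L) * (M * N + N')) := by
    calc n2 F ≤ ENNReal.ofReal (8 * Real.pi) * n2 (fun ξ ↦ ejap 2 ξ * E ξ)
          + ENNReal.ofReal (2 * L) * hn (k + α) U := by
          rw [hn, ← n2_const_mul _ (by fun_prop), ← n2_const_mul _ (by fun_prop)]
          exact n2_add_le (by fun_prop) (by fun_prop)
      _ ≤ ENNReal.ofReal (8 * Real.pi) * (ENNReal.ofReal K * (ENNReal.ofReal M * ENNReal.ofReal N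
            + ENNReal.ofReal M * ENNReal.ofReal N)) + ENNReal.ofReal (2 * L) * ENNReal.ofReal N' := by
          have h := n2_ejap_econv_le (k := k) (s := 2) (by norm_num) B B
          have h2 : hn 2 B ≤ ENNReal.ofReal N := (hn_mono hs B).trans hBN
          rw [hKK] at h
          gcongr
          exact h.trans (by gcongr)
      _ = ENNReal.ofReal (8 * Real.pi * (K * (M * N + M * N)) + 2 * L * N') := by
          rw [← ENNReal.ofReal_mul hM, ← ENNReal.ofReal_add (by positivity) (by positivity),
            ← ENNReal.ofReal_mul hK0, ← ENNReal.ofReal_mul (by positivity),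
            ← ENNReal.ofReal_mul (by positivity), ← ENNReal.ofReal_add (by positivity) (by positivity)]
      _ ≤ _ := by
          apply ENNReal.ofReal_le_ofReal
          have : 0 ≤ 16 * Real.pi * K * N' := by positivity
          have : 0 ≤ 2 * L * (M * N) := by positivity
          linarith
  have hmeas : Measurable (curlHat (mixG 1 0 ν α B B B B U)) := by
    have h0 := measurable_mixG 1 0 ν α B B B B U 0
    have h1 := measurable_mixG 1 0 ν α B B B B U 1
    unfold curlHat
    fun_prop
  have hmem := memLp_of_n2_le hmeas.aestronglyMeasurable (.of_forall hpt)
    (hFn.trans_lt ENNReal.ofReal_lt_top)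
  refine ⟨hmem.toLp _, hmem.coeFn_toLp, ?_⟩
  have h := n2_eq_norm (hmem.toLp _)
  rw [n2_congr (G := fun ξ ↦ ‖curlHat (mixG 1 0 ν α B B B B U) ξ‖ₑ)
    (by filter_upwards [hmem.coeFn_toLp] with ξ hξ; rw [hξ])] at h
  exact (ENNReal.ofReal_le_ofReal_iff (by positivity)).1 (h ▸ (n2_mono hpt).trans hFn)

lemma tri_advWeight_lt_top {k s t a : ℝ} (hk : 1 < k) (hs : 0 ≤ s) (ha : 0 ≤ a)
    (hst : 2 * a + 1 ≤ s + t) {V W Z : Fin 2 → L2C} (hV : hn k V < ∞) (hW : hn k W < ∞)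
    (hV' : hn s V < ∞) (hW' : hn s W < ∞) (hZ : hn t Z < ∞) :
    tri (mag V) (mag W) (advWeight (fun ξ ↦ ‖ξ‖ ^ (2 * a)) Z) < ∞ :=
  (tri_advWeight_le (k := k) hs ha hst V W Z).trans_lt
    (ENNReal.mul_lt_top (ENNReal.mul_lt_top (algConst_lt_top hk)
      (ENNReal.add_lt_top.2 ⟨ENNReal.mul_lt_top hV hW', ENNReal.mul_lt_top hW hV'⟩)) hZ)

/-- The point is the shape `M² N + N²`: with `M` bounding the `H^k` norms and `N` the `H^t` norm at
a given time, it is integrable in time as soon as `N` is square integrable. -/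
lemma form_dom {k t a b : ℝ} (hk : 1 < k) (ha : 0 ≤ a) (hb : 0 ≤ b) (hat : 2 * a + 1 ≤ k + t)
    (hab : a + b ≤ t) :
    ∃ c : ℝ, 0 ≤ c ∧ ∀ (c₁ c₂ ν : ℝ) (V₁ W₁ V₂ W₂ Z : Fin 2 → L2C) (M N : ℝ), |c₁| ≤ 1 → |c₂| ≤ 1 →
      |ν| ≤ 1 → 0 ≤ M → 0 ≤ N →
      hn k V₁ ≤ ENNReal.ofReal M → hn k W₁ ≤ ENNReal.ofReal M → hn k V₂ ≤ ENNReal.ofReal M →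
      hn k W₂ ≤ ENNReal.ofReal M → hn t Z ≤ ENNReal.ofReal N →
      Integrable (fun ξ ↦ ‖ξ‖ ^ (2 * a) * rdot (fun i ↦ Z i) (mixG c₁ c₂ ν b V₁ W₁ V₂ W₂ Z) ξ) ∧
      ∫ ξ, ‖ξ‖ ^ (2 * a) * rdot (fun i ↦ Z i) (mixG c₁ c₂ ν b V₁ W₁ V₂ W₂ Z) ξ
        = c₁ * advF a V₁ W₁ Z + c₂ * advF a V₂ W₂ Z - ν * ((2 * Real.pi) ^ (2 * b) * en (a + b) Z) ∧
      ∫ ξ, ‖‖ξ‖ ^ (2 * a) * rdot (fun i ↦ Z i) (mixG c₁ c₂ ν b V₁ W₁ V₂ W₂ Z) ξ‖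
        ≤ c * (M ^ 2 * N + N ^ 2) := by
  set K : ℝ := (algConst k k).toReal with hK
  have hKK : algConst k k = ENNReal.ofReal K := (ENNReal.ofReal_toReal (algConst_lt_top hk).ne).symm
  have hK0 : 0 ≤ K := ENNReal.toReal_nonneg
  set L : ℝ := (2 * Real.pi) ^ (2 * b) with hL
  have hL0 : 0 ≤ L := by positivity
  refine ⟨32 * Real.pi * K + L, by positivity, ?_⟩
  intro c₁ c₂ ν V₁ W₁ V₂ W₂ Z M N hc₁ hc₂ hν hM hN h1 h2 h3 h4 hZ
  have hb' (V W : Fin 2 → L2C) (hV : hn k V ≤ ENNReal.ofReal M) (hW : hn k W ≤ ENNReal.ofReal M) :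
      tri (mag V) (mag W) (advWeight (fun ξ ↦ ‖ξ‖ ^ (2 * a)) Z)
        ≤ ENNReal.ofReal (2 * K * M ^ 2 * N) := by
    refine (tri_advWeight_le (k := k) (s := k) (t := t) (by linarith) ha hat V W Z).trans ?_
    calc _ ≤ ENNReal.ofReal K * (ENNReal.ofReal M * ENNReal.ofReal M
          + ENNReal.ofReal M * ENNReal.ofReal M) * ENNReal.ofReal N := by rw [hKK]; gcongr
      _ = _ := by
        rw [← ENNReal.ofReal_mul hM, ← ENNReal.ofReal_add (by positivity) (by positivity),
          ← ENNReal.ofReal_mul hK0, ← ENNReal.ofReal_mul (by positivity)]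
        congr 1; ring
  have hd : dn (a + b) Z ≤ ENNReal.ofReal N := (dn_le_hn (by positivity) hab Z).trans hZ
  obtain ⟨hi, he, hl⟩ := form_mixG ha hb c₁ c₂ ν ((hb' V₁ W₁ h1 h2).trans_lt ENNReal.ofReal_lt_top)
    ((hb' V₂ W₂ h3 h4).trans_lt ENNReal.ofReal_lt_top) (hd.trans_lt ENNReal.ofReal_lt_top)
  refine ⟨hi, he, integral_norm_le_of_lintegral hi.1 (by positivity) (hl.trans ?_)⟩
  have hone {x : ℝ} (hx : |x| ≤ 1) : ‖x‖ₑ ≤ 1 := by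
    rw [← ofReal_norm, Real.norm_eq_abs]
    exact (ENNReal.ofReal_le_ofReal hx).trans (by simp)
  have e1 := hone hc₁
  have e2 := hone hc₂
  have e3 := hone hν
  have t1 := hb' V₁ W₁ h1 h2
  have t2 := hb' V₂ W₂ h3 h4
  calc _ ≤ 1 * (ENNReal.ofReal (8 * Real.pi) * ENNReal.ofReal (2 * K * M ^ 2 * N))
        + 1 * (ENNReal.ofReal (8 * Real.pi) * ENNReal.ofReal (2 * K * M ^ 2 * N))
        + 1 * (ENNReal.ofReal L * ENNReal.ofReal N ^ 2) := by gcongr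
    _ = ENNReal.ofReal (8 * Real.pi * (2 * K * M ^ 2 * N) + 8 * Real.pi * (2 * K * M ^ 2 * N)
        + L * N ^ 2) := by
        rw [one_mul, one_mul, ← ENNReal.ofReal_mul (by positivity), ← ENNReal.ofReal_pow hN,
          ← ENNReal.ofReal_mul (by positivity), ← ENNReal.ofReal_add (by positivity) (by positivity),
          ← ENNReal.ofReal_add (by positivity) (by positivity)]
    _ ≤ _ := by
        apply ENNReal.ofReal_le_ofReal
        have : 0 ≤ 32 * Real.pi * K * N ^ 2 := by positivity
        have : 0 ≤ L * (M ^ 2 * N) := by positivity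
        linarith

/-! ### Estimates of the nonlinear terms. -/

lemma weight_zero : (fun ξ : Plane ↦ ‖ξ‖ ^ (2 * (0 : ℝ))) = fun _ ↦ 1 := by
  ext ξ; simp

lemma weight_one : (fun ξ : Plane ↦ ‖ξ‖ ^ (2 * (1 : ℝ))) = fun ξ ↦ ‖ξ‖ ^ 2 := by
  ext ξ; rw [mul_one, Real.rpow_two]

lemma advF_zero_antisymm {V W Z : Fin 2 → L2C}
    (h1 : tri (mag V) (mag W) (advWeight (fun ξ ↦ ‖ξ‖ ^ (2 * (0 : ℝ))) Z) < ∞)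
    (h2 : tri (mag V) (mag Z) (advWeight (fun ξ ↦ ‖ξ‖ ^ (2 * (0 : ℝ))) W) < ∞)
    (hV : IsDivFree V) (hW : IsRealHat W) (hZ : IsRealHat Z) :
    advF 0 V W Z + advF 0 V Z W = 0 := by
  rw [weight_zero] at h1 h2
  have h := advForm_antisymm h1 h2 hV hW hZ
  simpa [advF] using h

lemma mag_neg_ae {V : Fin 2 → L2C} (hV : IsRealHat V) : ∀ᵐ ξ, mag V (-ξ) = mag V ξ := by
  filter_upwards [hV 0, hV 1] with ξ h0 h1
  simp only [mag, sq, h0, h1, RCLike.norm_conj]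

lemma abs_advF_one_le {V W Z : Fin 2 → L2C}
    (h1 : tri (mag V) (mag W) (advWeight (fun ξ ↦ ‖ξ‖ ^ (2 * (1 : ℝ))) Z) < ∞)
    (h2 : tri (mag V) (mag Z) (advWeight (fun ξ ↦ ‖ξ‖ ^ (2 * (1 : ℝ))) W) < ∞)
    (hV : IsDivFree V) (hW : IsRealHat W) (hZ : IsRealHat Z) :
    ENNReal.ofReal |advF 1 V W Z + advF 1 V Z W| ≤ ENNReal.ofReal (16 * Real.pi) *
      tri (fun ξ ↦ ‖ξ‖ₑ * mag V ξ) (fun ξ ↦ ‖ξ‖ₑ * mag W ξ) (fun ξ ↦ ‖ξ‖ₑ * mag Z ξ) := by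
  rw [weight_one] at h1 h2
  have h := abs_advForm_add_le h1 h2 hV hW hZ
  simpa [advF, mul_one, Real.rpow_two] using h

lemma n2_enorm_mul_mag (V : Fin 2 → L2C) : n2 (fun ξ ↦ ‖ξ‖ₑ * mag V ξ) = dn 1 V := by
  simp_rw [dn, Real.rpow_one, ofReal_norm]

lemma n2_enorm_mul_enorm_mul_mag (V : Fin 2 → L2C) :
    n2 (fun ξ ↦ ‖ξ‖ₑ * (‖ξ‖ₑ * mag V ξ)) = dn 2 V := by
  simp_rw [dn, Real.rpow_two, ENNReal.ofReal_pow (norm_nonneg _), ofReal_norm, pow_two, mul_assoc]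

/-- The gradient estimate of the nonlinear terms. -/
lemma exists_nonlinear_grad_le : ∃ K : ℝ, 0 ≤ K ∧ ∀ (β k : ℝ), 1 ≤ β → 1 < k → β ≤ k →
    ∀ U B : Fin 2 → L2C,
    hn k U < ∞ → hn (k + β) B < ∞ → IsDivFree U → IsDivFree B → IsRealHat U → IsRealHat B →
    2 * |advF 1 B B U + advF 1 B U B - advF 1 U B B|
      ≤ en (1 + β) B + K * (1 + en 1 U) * en 1 B := by
  set ω : ℝ := (volume (Metric.ball (0 : Plane) 1) ^ (1 / 2 : ℝ)).toReal with hω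
  have hω' : volume (Metric.ball (0 : Plane) 1) ^ (1 / 2 : ℝ) = ENNReal.ofReal ω :=
    (ENNReal.ofReal_toReal (ENNReal.rpow_ne_top_of_nonneg (by norm_num)
      measure_ball_lt_top.ne)).symm
  set κ : ℝ := (n2 (ejap (-2))).toReal with hκ
  have hκ' : n2 (ejap (-2)) = ENNReal.ofReal κ :=
    (ENNReal.ofReal_toReal (n2_ejap_lt_top (by norm_num)).ne).symm
  have hω0 : 0 ≤ ω := ENNReal.toReal_nonneg
  have hκ0 : 0 ≤ κ := ENNReal.toReal_nonneg
  have hpi := Real.pi_pos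
  -- `96πκ` is the coefficient with which the second-derivative term will appear; the added 1 keeps
  -- `Q` positive.
  set Q : ℝ := 96 * Real.pi * κ + 1 with hQ
  have hQ0 : 0 < Q := by positivity
  refine ⟨192 * Real.pi * ω * Q + 1, by positivity, ?_⟩
  intro β k hβ hk hβk U B hU hB hdU hdB hrU hrB
  have hBk : hn k B < ∞ := (hn_mono (by linarith) B).trans_lt hB
  set T := tri (fun ξ ↦ ‖ξ‖ₑ * mag U ξ) (fun ξ ↦ ‖ξ‖ₑ * mag B ξ) (fun ξ ↦ ‖ξ‖ₑ * mag B ξ) with hT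
  have hmU := measurable_mag U
  have hmB := measurable_mag B
  have f1 : tri (mag B) (mag B) (advWeight (fun ξ ↦ ‖ξ‖ ^ (2 * (1 : ℝ))) U) < ∞ :=
    tri_advWeight_lt_top (s := k + β) (t := k) hk (by linarith) zero_le_one (by linarith) hBk hBk hB hB hU
  have f2 : tri (mag B) (mag U) (advWeight (fun ξ ↦ ‖ξ‖ ^ (2 * (1 : ℝ))) B) < ∞ :=
    tri_advWeight_lt_top (s := k) (t := k + β) hk (by linarith) zero_le_one (by linarith) hBk hU hBk hU hB
  have f3 : tri (mag U) (mag B) (advWeight (fun ξ ↦ ‖ξ‖ ^ (2 * (1 : ℝ))) B) < ∞ :=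
    tri_advWeight_lt_top (s := k) (t := k + β) hk (by linarith) zero_le_one (by linarith) hU hBk hU hBk hB
  have g1 := abs_advF_one_le f1 f2 hdB hrB hrU
  have g2 := abs_advF_one_le f3 f3 hdU hrB hrB
  have hevenB : ∀ᵐ ξ : Plane, ‖-ξ‖ₑ * mag B (-ξ) = ‖ξ‖ₑ * mag B ξ := by
    filter_upwards [mag_neg_ae hrB] with ξ h; rw [enorm_neg, h]
  have hevenU : ∀ᵐ ξ : Plane, ‖-ξ‖ₑ * mag U (-ξ) = ‖ξ‖ₑ * mag U ξ := by
    filter_upwards [mag_neg_ae hrU] with ξ h; rw [enorm_neg, h]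
  -- The Lorentz and stretching terms together are brought to the same trilinear form `T` as the
  -- transport term, with `u` in the first slot.
  rw [tri_reflect (G := fun ξ ↦ ‖ξ‖ₑ * mag B ξ) (H := fun ξ ↦ ‖ξ‖ₑ * mag U ξ) hevenB hevenU,
    tri_comm (by fun_prop) (by fun_prop) (by fun_prop), ← hT] at g1
  set x := Real.sqrt (en 1 U) with hx
  set y := Real.sqrt (en 1 B) with hy
  set z := Real.sqrt (en 2 B) with hz
  have hx0 : 0 ≤ x := Real.sqrt_nonneg _
  have hy0 : 0 ≤ y := Real.sqrt_nonneg _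
  have hz0 : 0 ≤ z := Real.sqrt_nonneg _
  -- The scale grows with `‖∇u‖`, so that the second-derivative term gets a coefficient at most 1
  -- whatever the size of `∇u`.
  have hR : 0 < Q * (1 + x) := by positivity
  have d1 : dn 1 B < ∞ := (dn_le_hn (by norm_num) (by linarith) B).trans_lt hB
  have d2 : dn 2 B < ∞ := (dn_le_hn (by norm_num) (by linarith) B).trans_lt hB
  have d3 : dn 1 U < ∞ := (dn_le_hn (by norm_num) (by linarith) U).trans_lt hU
  have d4 : dn (1 + β) B < ∞ := (dn_le_hn (by linarith) (by linarith) B).trans_lt hB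
  have hTle : T ≤ ENNReal.ofReal (x * (2 * ω * (Q * (1 + x)) * y ^ 2
      + 2 * κ * (Q * (1 + x))⁻¹ * z ^ 2)) := by
    refine (tri_le_ladyzhenskaya (by fun_prop) (by fun_prop) (by fun_prop) hR).trans (le_of_eq ?_)
    rw [n2_enorm_mul_mag, n2_enorm_mul_mag, n2_enorm_mul_enorm_mul_mag, dn_eq d1, dn_eq d2, dn_eq d3,
      hω', hκ', show (2 : ℝ≥0∞) = ENNReal.ofReal 2 by simp]
    have hRi : 0 ≤ (Q * (1 + x))⁻¹ := by positivity
    rw [← hx, ← hy, ← hz, ← ENNReal.ofReal_mul hR.le, ← ENNReal.ofReal_mul (by positivity),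
      ← ENNReal.ofReal_mul hy0, ← ENNReal.ofReal_mul (by positivity),
      ← ENNReal.ofReal_mul (by positivity), ← ENNReal.ofReal_mul (by positivity),
      ← ENNReal.ofReal_mul hz0, ← ENNReal.ofReal_mul (by positivity),
      ← ENNReal.ofReal_add (by positivity) (by positivity), ← ENNReal.ofReal_mul hx0]
    congr 1; ring
  set t := x * (2 * ω * (Q * (1 + x)) * y ^ 2 + 2 * κ * (Q * (1 + x))⁻¹ * z ^ 2) with ht
  have ht0 : 0 ≤ t := by positivity
  have toReal {A : ℝ} (h : ENNReal.ofReal |A| ≤ ENNReal.ofReal (16 * Real.pi) * T) :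
      |A| ≤ 16 * Real.pi * t := by
    have := h.trans (mul_le_mul' le_rfl hTle)
    rw [← ENNReal.ofReal_mul (by positivity)] at this
    exact (ENNReal.ofReal_le_ofReal_iff (by positivity)).1 this
  have r1 := toReal g1
  have r2 := toReal g2
  have hxx : x ^ 2 = en 1 U := Real.sq_sqrt (en_nonneg _ _)
  have hyy : y ^ 2 = en 1 B := Real.sq_sqrt (en_nonneg _ _)
  have hzz : z ^ 2 = en 2 B := Real.sq_sqrt (en_nonneg _ _)
  -- Second derivatives are absorbed by the dissipation of order `1 + β`; the remainder `en 1 B`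
  -- accounts for the `+ 1` in the constant.
  have hint : en 2 B ≤ en 1 B + en (1 + β) B :=
    en_le_add (by norm_num) (by norm_num) (by linarith) d1 d4
  -- The constant is `48π = 2 (16π + 8π)`: symmetrizing the transport term counts it twice, which
  -- halves its bound.
  have habs : 2 * |advF 1 B B U + advF 1 B U B - advF 1 U B B| ≤ 48 * Real.pi * t := by
    rw [← two_mul, abs_mul, abs_two] at r2
    have := abs_sub (advF 1 B B U + advF 1 B U B) (advF 1 U B B)
    linarith
  have hsecond : 48 * Real.pi * (x * (2 * κ * (Q * (1 + x))⁻¹ * z ^ 2)) ≤ z ^ 2 := by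
    have : 48 * Real.pi * (x * (2 * κ * (Q * (1 + x))⁻¹ * z ^ 2))
        = (96 * Real.pi * κ * x) / (Q * (1 + x)) * z ^ 2 := by
      rw [div_eq_mul_inv]; ring
    rw [this]
    have h1 : (96 * Real.pi * κ * x) / (Q * (1 + x)) ≤ 1 := by
      rw [div_le_one hR, hQ]
      have : 0 ≤ 96 * Real.pi * κ := by positivity
      nlinarith
    nlinarith [sq_nonneg z]
  have hfirst : 48 * Real.pi * (x * (2 * ω * (Q * (1 + x)) * y ^ 2))
      ≤ 192 * Real.pi * ω * Q * (1 + x ^ 2) * y ^ 2 := by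
    have h1 : x * (1 + x) ≤ 2 * (1 + x ^ 2) := by nlinarith [sq_nonneg (x - 1)]
    calc _ = 96 * Real.pi * ω * Q * y ^ 2 * (x * (1 + x)) := by ring
      _ ≤ 96 * Real.pi * ω * Q * y ^ 2 * (2 * (1 + x ^ 2)) := by gcongr
      _ = _ := by ring
  have hfin : 48 * Real.pi * t ≤ 192 * Real.pi * ω * Q * (1 + x ^ 2) * y ^ 2 + z ^ 2 := by
    rw [ht, mul_add, mul_add]; linarith
  rw [hxx, hyy, hzz] at hfin
  have := mul_nonneg (en_nonneg 1 U) (en_nonneg 1 B)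
  calc _ ≤ _ := habs
    _ ≤ _ := hfin
    _ ≤ _ := by linarith

lemma ofReal_norm_rpow_add_le {q : ℝ} (hq : 0 ≤ q) (ζ η : Plane) :
    ENNReal.ofReal (‖ζ + η‖ ^ q)
      ≤ ENNReal.ofReal (2 ^ q) * (ENNReal.ofReal (‖ζ‖ ^ q) + ENNReal.ofReal (‖η‖ ^ q)) := by
  rw [← ENNReal.ofReal_add (by positivity) (by positivity), ← ENNReal.ofReal_mul (by positivity)]
  apply ENNReal.ofReal_le_ofReal
  have key (x y : Plane) (h : ‖x‖ ≤ ‖y‖) : ‖x + y‖ ^ q ≤ 2 ^ q * ‖y‖ ^ q := by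
    rw [← Real.mul_rpow (by norm_num) (norm_nonneg _)]
    exact Real.rpow_le_rpow (norm_nonneg _) (by linarith [norm_add_le x y]) hq
  have hp : (0 : ℝ) < 2 ^ q := by positivity
  rcases le_total ‖ζ‖ ‖η‖ with h | h
  · nlinarith [key ζ η h, mul_nonneg hp.le (Real.rpow_nonneg (norm_nonneg ζ) q)]
  · have := key η ζ h
    rw [add_comm] at this
    nlinarith [mul_nonneg hp.le (Real.rpow_nonneg (norm_nonneg η) q)]

/-- The higher order estimate of the nonlinear terms of the magnetic equation. -/
lemma exists_nonlinear_high_le {α β k : ℝ} (hα0 : 0 ≤ α) (hα : α < 1 / 2) (hβ : 1 ≤ β)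
    (hr : 1 < α + β) (hk : α + β ≤ k) : ∃ K : ℝ, 0 ≤ K ∧ ∀ U B : Fin 2 → L2C,
    hn k U < ∞ → hn (k + β) B < ∞ →
    2 * |advF (α + β) B U B - advF (α + β) U B B| ≤ en (α + β + β) B
      + K * (en (1 + α) U * (en 0 B + en (α + β) B)
        + (en 0 U + en 1 U) * (en 0 B + en (1 + β) B)) := by
  have hpi := Real.pi_pos
  set a := α + β with ha
  set κa : ℝ := (n2 (ejap (-a))).toReal with hκa
  have hκa' : n2 (ejap (-a)) = ENNReal.ofReal κa :=
    (ENNReal.ofReal_toReal (n2_ejap_lt_top (by linarith)).ne).symm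
  set κ : ℝ := (n2 (ejap (-(1 + 1 / 2)))).toReal with hκ
  have hκ' : n2 (ejap (-(1 + 1 / 2))) = ENNReal.ofReal κ :=
    (ENNReal.ofReal_toReal (n2_ejap_lt_top (by norm_num)).ne).symm
  have hκa0 : 0 ≤ κa := ENNReal.toReal_nonneg
  have hκ0 : 0 ≤ κ := ENNReal.toReal_nonneg
  set c : ℝ := 16 * Real.pi * 2 ^ (1 + α) with hc
  have hc0 : 0 ≤ c := by positivity
  refine ⟨2 * (c * κa) ^ 2 * 2 ^ a + 2 * (c * (2 * κ)) ^ 2 * (2 ^ (1 : ℝ) * 2 ^ (1 + β)),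
    by positivity, ?_⟩
  intro U B hU hB
  have hBk : hn k B < ∞ := (hn_mono (by linarith) B).trans_lt hB
  have hmU := measurable_mag U
  have hmB := measurable_mag B
  have dU (s : ℝ) (h0 : 0 ≤ s) (h1 : s ≤ k) : dn s U < ∞ := (dn_le_hn h0 h1 U).trans_lt hU
  have dB (s : ℝ) (h0 : 0 ≤ s) (h1 : s ≤ k + β) : dn s B < ∞ := (dn_le_hn h0 h1 B).trans_lt hB
  set p : Plane → ℝ≥0∞ := fun ξ ↦ ENNReal.ofReal (‖ξ‖ ^ (1 + α)) with hp
  have hpm : Measurable p := (measurable_norm_rpow _).ennreal_ofReal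
  set H : Plane → ℝ≥0∞ := fun ξ ↦ ENNReal.ofReal (‖ξ‖ ^ (a + β)) * mag B ξ with hH
  have hHm : Measurable H := (measurable_norm_rpow _).ennreal_ofReal.mul hmB
  -- The count is `2(α+β) + 1 = (1 + α) + (α + 2β)`: the second part, kept in `H`, is exactly the
  -- order of the dissipation.
  have hpH : advWeight (fun ξ ↦ ‖ξ‖ ^ (2 * a)) B = fun ξ ↦ p ξ * H ξ := by
    ext ξ
    rw [advWeight, hH, hp, ← mul_assoc, ← ofReal_norm, ← ENNReal.ofReal_mul (by positivity),
      ← ENNReal.ofReal_mul (by positivity), ← Real.rpow_add_of_nonneg (norm_nonneg _) (by linarith)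
      (by linarith), ← Real.rpow_add_one' (norm_nonneg _) (by linarith)]
    congr 3; rw [ha]; ring
  set A1 := Real.sqrt (2 ^ a * (en 0 B + en a B)) with hA1
  set A2 := Real.sqrt (en (1 + α) U) with hA2
  set A3 := Real.sqrt (2 ^ (1 : ℝ) * (en 0 U + en 1 U)) with hA3
  set A4 := Real.sqrt (2 ^ (1 + β) * (en 0 B + en (1 + β) B)) with hA4
  set h := Real.sqrt (en (a + β) B) with hh
  have p1 : 0 ≤ A1 := Real.sqrt_nonneg _
  have p2 : 0 ≤ A2 := Real.sqrt_nonneg _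
  have p3 : 0 ≤ A3 := Real.sqrt_nonneg _
  have p4 : 0 ≤ A4 := Real.sqrt_nonneg _
  have p5 : 0 ≤ h := Real.sqrt_nonneg _
  have b1 : hn a B ≤ ENNReal.ofReal A1 :=
    hn_le (by linarith) (dB 0 le_rfl (by linarith)) (dB a (by linarith) (by linarith))
  have b2 : dn (1 + α) U = ENNReal.ofReal A2 := dn_eq (dU _ (by linarith) (by linarith))
  have b3 : hn 1 U ≤ ENNReal.ofReal A3 :=
    hn_le (by norm_num) (dU 0 le_rfl (by linarith)) (dU 1 (by norm_num) (by linarith))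
  have b4 : hn (1 + β) B ≤ ENNReal.ofReal A4 :=
    hn_le (by linarith) (dB 0 le_rfl (by linarith)) (dB _ (by linarith) (by linarith))
  have b5 : n2 H = ENNReal.ofReal h := dn_eq (dB (a + β) (by linarith) (by linarith))
  -- All `1 + α` derivatives on `u`: the transform of `b` is then taken in `L¹`, which its `H^(α+β)`
  -- norm controls because `α + β > 1`.
  have t1 : tri (fun ξ ↦ p ξ * mag U ξ) (mag B) H ≤ ENNReal.ofReal (κa * A1 * A2 * h) := by
    refine (tri_le_young_mid (by fun_prop) hmB hHm).trans ?_
    calc _ ≤ (n2 (ejap (-a)) * hn a B) * dn (1 + α) U * n2 H := by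
          gcongr
          · exact lintegral_mag_le a B
          · exact le_rfl
      _ ≤ ENNReal.ofReal κa * ENNReal.ofReal A1 * ENNReal.ofReal A2 * ENNReal.ofReal h := by
          rw [hκa', b2, b5]; gcongr
      _ = _ := by
          rw [← ENNReal.ofReal_mul hκa0, ← ENNReal.ofReal_mul (by positivity),
            ← ENNReal.ofReal_mul (by positivity)]
  -- All `1 + α` derivatives on `b`: `u` is used in `H¹` and the differentiated `b` in `H^(1/2)`.
  -- The latter needs `1/2 + 1 + α ≤ 1 + β`, which is where `α < 1/2` enters.
  have t2 : tri (mag U) (fun ξ ↦ p ξ * mag B ξ) H ≤ ENNReal.ofReal (2 * κ * A3 * A4 * h) := by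
    refine (tri_le_ejap (a := 1) (b := 1 / 2) (by norm_num) (by norm_num) hmU (by fun_prop)
      hHm).trans ?_
    have h4 : n2 (fun ξ ↦ ejap (1 / 2) ξ * (p ξ * mag B ξ)) ≤ hn (1 + β) B := by
      refine n2_mono fun ξ ↦ ?_
      rw [← mul_assoc]
      gcongr
      calc ejap (1 / 2) ξ * p ξ ≤ ejap (1 / 2) ξ * ejap (1 + α) ξ := by
            gcongr; exact ofReal_rpow_le_ejap (by linarith) le_rfl ξ
        _ = ejap (1 / 2 + (1 + α)) ξ := (ejap_add _ _ _).symm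
        _ ≤ _ := ejap_mono (by linarith) ξ
    calc _ ≤ ENNReal.ofReal 2 * ENNReal.ofReal κ * ENNReal.ofReal A3 * ENNReal.ofReal A4
          * ENNReal.ofReal h := by
          rw [hκ', b5]
          gcongr
          · simp
          · exact b3
          · exact h4.trans b4
      _ = _ := by
          rw [← ENNReal.ofReal_mul (by norm_num), ← ENNReal.ofReal_mul (by positivity),
            ← ENNReal.ofReal_mul (by positivity), ← ENNReal.ofReal_mul (by positivity)]
  have hT : tri (mag U) (mag B) (advWeight (fun ξ ↦ ‖ξ‖ ^ (2 * a)) B)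
      ≤ ENNReal.ofReal (2 ^ (1 + α) * (κa * A1 * A2 * h + 2 * κ * A3 * A4 * h)) := by
    rw [hpH]
    refine (tri_le_move hpm hmU hmB hHm (ofReal_norm_rpow_add_le (by linarith))).trans ?_
    rw [ENNReal.ofReal_mul (by positivity), ENNReal.ofReal_add (by positivity) (by positivity)]
    gcongr
  have hT' : tri (mag B) (mag U) (advWeight (fun ξ ↦ ‖ξ‖ ^ (2 * a)) B)
      = tri (mag U) (mag B) (advWeight (fun ξ ↦ ‖ξ‖ ^ (2 * a)) B) :=
    tri_comm hmB hmU (measurable_advWeight (measurable_norm_rpow _) B)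
  have bound {V W : Fin 2 → L2C}
      (hVW : tri (mag V) (mag W) (advWeight (fun ξ ↦ ‖ξ‖ ^ (2 * a)) B)
        ≤ ENNReal.ofReal (2 ^ (1 + α) * (κa * A1 * A2 * h + 2 * κ * A3 * A4 * h))) :
      |advF a V W B| ≤ 8 * Real.pi * (2 ^ (1 + α) * (κa * A1 * A2 * h + 2 * κ * A3 * A4 * h)) := by
    obtain ⟨i, l⟩ := advForm_le (measurable_norm_rpow (2 * a)) (fun ξ ↦ by positivity)
      (hVW.trans_lt ENNReal.ofReal_lt_top)
    rw [← Real.norm_eq_abs, advF]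
    refine (norm_integral_le_integral_norm _).trans
      (integral_norm_le_of_lintegral i.1 (by positivity) (l.trans ?_))
    rw [ENNReal.ofReal_mul (by positivity : 0 ≤ 8 * Real.pi)]
    gcongr
  have B1 := bound hT
  have B2 := bound (hT'.le.trans hT)
  have habs := abs_sub (advF a B U B) (advF a U B B)
  set P := c * κa * (A1 * A2) with hP
  set R := c * (2 * κ) * (A3 * A4) with hR
  have hsum : |advF a B U B - advF a U B B| ≤ h * (P + R) := by
    calc _ ≤ _ := habs
      _ ≤ _ := add_le_add B2 B1
      _ = _ := by rw [hP, hR, hc]; ring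
  -- Young's inequality; `h²` is half of what the dissipation provides at least, so one copy remains
  -- on the left of the final estimate.
  have hsq : 2 * (h * (P + R)) ≤ h ^ 2 + (2 * P ^ 2 + 2 * R ^ 2) := by
    nlinarith [sq_nonneg (h - (P + R)), sq_nonneg (P - R)]
  have q1 : A1 ^ 2 = 2 ^ a * (en 0 B + en a B) := Real.sq_sqrt
    (mul_nonneg (by positivity) (add_nonneg (en_nonneg _ _) (en_nonneg _ _)))
  have q2 : A2 ^ 2 = en (1 + α) U := Real.sq_sqrt (en_nonneg _ _)
  have q3 : A3 ^ 2 = 2 ^ (1 : ℝ) * (en 0 U + en 1 U) := Real.sq_sqrt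
    (mul_nonneg (by positivity) (add_nonneg (en_nonneg _ _) (en_nonneg _ _)))
  have q4 : A4 ^ 2 = 2 ^ (1 + β) * (en 0 B + en (1 + β) B) := Real.sq_sqrt
    (mul_nonneg (by positivity) (add_nonneg (en_nonneg _ _) (en_nonneg _ _)))
  have q5 : h ^ 2 = en (a + β) B := Real.sq_sqrt (en_nonneg _ _)
  have hP2 : P ^ 2 = (c * κa) ^ 2 * 2 ^ a * (en (1 + α) U * (en 0 B + en a B)) := by
    rw [hP, mul_pow, mul_pow A1, q1, q2]; ring
  have hR2 : R ^ 2 = (c * (2 * κ)) ^ 2 * (2 ^ (1 : ℝ) * 2 ^ (1 + β))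
      * ((en 0 U + en 1 U) * (en 0 B + en (1 + β) B)) := by
    rw [hR, mul_pow, mul_pow A3, q3, q4]; ring
  have n1 : 0 ≤ en (1 + α) U * (en 0 B + en a B) :=
    mul_nonneg (en_nonneg _ _) (add_nonneg (en_nonneg _ _) (en_nonneg _ _))
  have n2' : 0 ≤ (en 0 U + en 1 U) * (en 0 B + en (1 + β) B) :=
    mul_nonneg (add_nonneg (en_nonneg _ _) (en_nonneg _ _))
      (add_nonneg (en_nonneg _ _) (en_nonneg _ _))
  set X := en (1 + α) U * (en 0 B + en a B)
  set Y := (en 0 U + en 1 U) * (en 0 B + en (1 + β) B)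
  have m1 : 0 ≤ 2 * (c * κa) ^ 2 * 2 ^ a * Y := by positivity
  have m2 : 0 ≤ 2 * (c * (2 * κ)) ^ 2 * (2 ^ (1 : ℝ) * 2 ^ (1 + β)) * X := by positivity
  rw [hP2, hR2, q5] at hsq
  linarith

/-! ### Flows: solutions in frequency, and their dependence on time. -/

lemma exists_mulOp_rpow {a s : ℝ} (ha : 0 ≤ a) (has : a ≤ s) :
    ∃ T : L2C →L[ℂ] L2C, ∀ f F : L2C, F =ᵐ[volume] (fun ξ ↦ (jap s ξ : ℂ) * f ξ) →
      T F =ᵐ[volume] fun ξ ↦ ((‖ξ‖ ^ a : ℝ) : ℂ) * f ξ := by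
  set m : Plane → ℂ := fun ξ ↦ ((‖ξ‖ ^ a * jap (-s) ξ : ℝ) : ℂ) with hm
  have hmeas : Measurable m := by
    have := (continuous_jap (-s)).measurable
    fun_prop
  have hb (ξ : Plane) : ‖m ξ‖ ≤ 1 := by
    rw [hm, Complex.norm_real, Real.norm_eq_abs,
      abs_of_nonneg (mul_nonneg (by positivity) (jap_nonneg _ _)), ← jap_mul_neg s ξ]
    exact mul_le_mul_of_nonneg_right (norm_rpow_le_jap ha has ξ) (jap_nonneg _ _)
  refine ⟨mulOp m (memLp_top_of_norm_le hmeas.aestronglyMeasurable hb), fun f F h ↦ ?_⟩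
  filter_upwards [mulOp_ae m (memLp_top_of_norm_le hmeas.aestronglyMeasurable hb) F, h] with ξ h1 h2
  have h3 : (jap s ξ : ℂ) * jap (-s) ξ = 1 := by exact_mod_cast jap_mul_neg s ξ
  rw [h1, h2, hm]
  push_cast
  linear_combination ((‖ξ‖ ^ a : ℝ) : ℂ) * f ξ * h3

/-- The weight `|ξ|^a` is `jap s` times a multiplier bounded by one, so `en a` is a continuous
function of the `H^s` data. Continuity and integrability in time are inherited from the
Sobolev-valued curves. -/
lemma exists_en_eq {a s : ℝ} (ha : 0 ≤ a) (has : a ≤ s) :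
    ∃ T : L2C →L[ℂ] L2C, ∀ (V F : Fin 2 → L2C),
      (∀ i, F i =ᵐ[volume] fun ξ ↦ (jap s ξ : ℂ) * V i ξ) →
      en a V = ‖T (F 0)‖ ^ 2 + ‖T (F 1)‖ ^ 2 := by
  obtain ⟨T, hT⟩ := exists_mulOp_rpow ha has
  refine ⟨T, fun V F h ↦ ?_⟩
  rw [norm_sq_eq_integral, norm_sq_eq_integral, ← integral_add (integrable_norm_sq _)
    (integrable_norm_sq _), en]
  apply integral_congr_ae
  filter_upwards [hT _ _ (h 0), hT _ _ (h 1)] with ξ h0 h1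
  rw [h0, h1, norm_mul, norm_mul, Complex.norm_real, Real.norm_eq_abs, abs_of_nonneg (by positivity),
    norm_rpow_two_mul, sq]
  ring

lemma hn_le_norm {s : ℝ} {V F : Fin 2 → L2C}
    (h : ∀ i, F i =ᵐ[volume] fun ξ ↦ (jap s ξ : ℂ) * V i ξ) :
    hn s V ≤ ENNReal.ofReal (‖F 0‖ + ‖F 1‖) := by
  have hi (i : Fin 2) : n2 (fun ξ ↦ ejap s ξ * ‖V i ξ‖ₑ) = ENNReal.ofReal ‖F i‖ := by
    rw [← n2_eq_norm]
    apply n2_congr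
    filter_upwards [h i] with ξ hξ
    rw [hξ, enorm_mul, ejap, ← ofReal_norm (jap s ξ : ℂ), Complex.norm_real, Real.norm_eq_abs,
      abs_of_nonneg (jap_nonneg _ _)]
  have he := measurable_ejap s
  have hm (i : Fin 2) : Measurable fun ξ ↦ ‖V i ξ‖ₑ := (measurable_L2 (V i)).enorm
  have h0 := hm 0
  have h1 := hm 1
  rw [ENNReal.ofReal_add (norm_nonneg _) (norm_nonneg _), ← hi 0, ← hi 1]
  refine le_trans (n2_mono fun ξ ↦ ?_) (n2_add_le (by fun_prop) (by fun_prop))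
  rw [← mul_add]
  gcongr
  exact mag_le V ξ

lemma n2_ejap_coord_le (s : ℝ) (V : Fin 2 → L2C) (j : Fin 2) :
    n2 (fun ξ ↦ ejap s ξ * ‖V j ξ‖ₑ) ≤ hn s V :=
  n2_mono fun ξ ↦ mul_le_mul' le_rfl (enorm_le_mag V j ξ)

/-- A real form of the viscosity. -/
def nu (α : ℝ) : ℝ := if α = 0 then 0 else 1

lemma viscosity_eq (α : ℝ) : viscosity α = (nu α : ℂ) := by
  unfold viscosity nu; split_ifs <;> simp

lemma nu_nonneg (α : ℝ) : 0 ≤ nu α := by unfold nu; split_ifs <;> simp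

lemma abs_nu_le (α : ℝ) : |nu α| ≤ 1 := by unfold nu; split_ifs <;> simp

lemma rhsU_eq (α : ℝ) (U B : Fin 2 → L2C) : rhsU α U B = mixG (-1) 1 (nu α) α U U B B U := by
  ext i ξ; rw [rhsU, mixG, viscosity_eq]; push_cast; ring

lemma rhsU_eq_add (α : ℝ) (U B : Fin 2 → L2C) :
    rhsU α U B = fun i ξ ↦ - advHat U U i ξ + mixG 1 0 (nu α) α B B B B U i ξ := by
  ext i ξ; rw [rhsU, mixG, viscosity_eq]; push_cast; ring

lemma rhsB_eq (β : ℝ) (U B : Fin 2 → L2C) : rhsB β U B = mixG (-1) 1 1 β U B B U B := by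
  ext i ξ; rw [rhsB, mixG]; push_cast; ring

/-- A solution on `[0, S]` on the Fourier side, extended to all times so that it is bounded and
continuous in time. -/
structure Flow (α β k S : ℝ) (u b : ℝ → VectorField) : Prop where
  contU : ∀ i, ∃ F : ℝ → L2C, Continuous F ∧
    ∀ t, F t =ᵐ[volume] fun ξ ↦ (jap k ξ : ℂ) * vhat (u t) i ξ
  contB : ∀ i, ∃ F : ℝ → L2C, Continuous F ∧
    ∀ t, F t =ᵐ[volume] fun ξ ↦ (jap k ξ : ℂ) * vhat (b t) i ξ
  bdd : ∃ M : ℝ, 0 ≤ M ∧ ∀ t, hn k (vhat (u t)) ≤ ENNReal.ofReal M ∧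
    hn k (vhat (b t)) ≤ ENNReal.ofReal M
  sqU : ∀ i, ∃ F : ℝ → L2C, MemLp F 2 (volume.restrict (Icc 0 S)) ∧
    ∀ᵐ t ∂(volume.restrict (Icc 0 S)), F t =ᵐ[volume] fun ξ ↦ (jap (k + α) ξ : ℂ) * vhat (u t) i ξ
  sqB : ∀ i, ∃ F : ℝ → L2C, MemLp F 2 (volume.restrict (Icc 0 S)) ∧
    ∀ᵐ t ∂(volume.restrict (Icc 0 S)), F t =ᵐ[volume] fun ξ ↦ (jap (k + β) ξ : ℂ) * vhat (b t) i ξ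
  divU : ∀ t, IsDivFree (vhat (u t))
  divB : ∀ t, IsDivFree (vhat (b t))
  eqU : CurlEq S (fun t ↦ vhat (u t)) (fun t ↦ rhsU α (vhat (u t)) (vhat (b t)))
  eqB : CurlEq S (fun t ↦ vhat (b t)) (fun t ↦ rhsB β (vhat (u t)) (vhat (b t)))

lemma isRealHat_vhat (v : VectorField) : IsRealHat (vhat v) := fun i ↦ hat_neg (v i)

lemma continuous_vhat {k : ℝ} (hk : 0 ≤ k) {v : ℝ → VectorField} {i : Fin 2}
    (h : ∃ F : ℝ → L2C, Continuous F ∧ ∀ t, F t =ᵐ[volume] fun ξ ↦ (jap k ξ : ℂ) * vhat (v t) i ξ) :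
    Continuous fun t ↦ vhat (v t) i := by
  obtain ⟨F, hF, hFe⟩ := h
  obtain ⟨T, hT⟩ := exists_mulOp_rpow le_rfl hk
  have : (fun t ↦ vhat (v t) i) = fun t ↦ T (F t) := by
    ext1 t
    apply Lp.ext
    filter_upwards [hT _ _ (hFe t)] with ξ hξ
    rw [hξ]; simp
  rw [this]
  exact T.continuous.comp hF

lemma continuous_en {a k : ℝ} (ha : 0 ≤ a) (hak : a ≤ k) {v : ℝ → VectorField}
    (h : ∀ i, ∃ F : ℝ → L2C, Continuous F ∧
      ∀ t, F t =ᵐ[volume] fun ξ ↦ (jap k ξ : ℂ) * vhat (v t) i ξ) :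
    Continuous fun t ↦ en a (vhat (v t)) := by
  choose F hF hFe using h
  obtain ⟨T, hT⟩ := exists_en_eq ha hak
  simp_rw [fun t ↦ hT (vhat (v t)) (fun i ↦ F i t) (fun i ↦ hFe i t)]
  exact ((T.continuous.comp (hF 0)).norm.pow 2).add ((T.continuous.comp (hF 1)).norm.pow 2)

lemma integrableOn_en {a s S : ℝ} (ha : 0 ≤ a) (has : a ≤ s) {v : ℝ → VectorField}
    (h : ∀ i, ∃ F : ℝ → L2C, MemLp F 2 (volume.restrict (Icc 0 S)) ∧
      ∀ᵐ t ∂(volume.restrict (Icc 0 S)), F t =ᵐ[volume] fun ξ ↦ (jap s ξ : ℂ) * vhat (v t) i ξ) :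
    IntegrableOn (fun t ↦ en a (vhat (v t))) (Icc 0 S) := by
  choose F hF hFe using h
  obtain ⟨T, hT⟩ := exists_en_eq ha has
  have h1 (i : Fin 2) : Integrable (fun t ↦ ‖T (F i t)‖ ^ 2) (volume.restrict (Icc 0 S)) :=
    (T.comp_memLp' (hF i)).integrable_norm_pow two_ne_zero
  refine ((h1 0).add (h1 1)).congr ?_
  filter_upwards [hFe 0, hFe 1] with t e0 e1
  exact (hT (vhat (v t)) (fun i ↦ F i t) (fun i ↦ by fin_cases i; exacts [e0, e1])).symm

/-- The bound is real valued and both integrable and square integrable in time, ready to be inserted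
into the dominating functions of the energy balances. -/
lemma exists_hn_bound {s S : ℝ} {v : ℝ → VectorField}
    (h : ∀ i, ∃ F : ℝ → L2C, MemLp F 2 (volume.restrict (Icc 0 S)) ∧
      ∀ᵐ t ∂(volume.restrict (Icc 0 S)), F t =ᵐ[volume] fun ξ ↦ (jap s ξ : ℂ) * vhat (v t) i ξ) :
    ∃ N : ℝ → ℝ, (∀ t, 0 ≤ N t) ∧ IntegrableOn N (Icc 0 S) ∧
      IntegrableOn (fun t ↦ N t ^ 2) (Icc 0 S) ∧
      ∀ᵐ t ∂(volume.restrict (Icc 0 S)), hn s (vhat (v t)) ≤ ENNReal.ofReal (N t) := by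
  choose F hF hFe using h
  have hN : MemLp (fun t ↦ ‖F 0 t‖ + ‖F 1 t‖) 2 (volume.restrict (Icc 0 S)) :=
    (hF 0).norm.add (hF 1).norm
  refine ⟨fun t ↦ ‖F 0 t‖ + ‖F 1 t‖, fun t ↦ by positivity, hN.integrable (by norm_num),
    hN.integrable_sq, ?_⟩
  filter_upwards [hFe 0, hFe 1] with t e0 e1
  exact hn_le_norm (F := fun i ↦ F i t) (fun i ↦ by fin_cases i; exacts [e0, e1])

lemma intervalIntegrable_of_Icc {f : ℝ → ℝ} {S t : ℝ} (hf : IntegrableOn f (Icc 0 S))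
    (ht : t ∈ Icc 0 S) : IntervalIntegrable f volume 0 t :=
  (intervalIntegrable_iff_integrableOn_Icc_of_le ht.1).2 (hf.mono_set (Icc_subset_Icc_right ht.2))

lemma intervalIntegral_mono_Icc {f g : ℝ → ℝ} {S t : ℝ} (hf : IntegrableOn f (Icc 0 S))
    (hg : IntegrableOn g (Icc 0 S)) (h : ∀ᵐ τ ∂(volume.restrict (Icc 0 S)), f τ ≤ g τ)
    (ht : t ∈ Icc 0 S) : ∫ τ in (0 : ℝ)..t, f τ ≤ ∫ τ in (0 : ℝ)..t, g τ :=
  intervalIntegral.integral_mono_ae_restrict ht.1 (intervalIntegrable_of_Icc hf ht)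
    (intervalIntegrable_of_Icc hg ht) (ae_restrict_of_ae_restrict_of_subset
      (Icc_subset_Icc_right ht.2) h)

/-- Grönwall's inequality in integral form. -/
lemma gronwall_integral {y a : ℝ → ℝ} (hy : Continuous y) (ha : Continuous a) (ha0 : ∀ t, 0 ≤ a t)
    {A S : ℝ} (h : ∀ t ∈ Icc 0 S, y t ≤ A + ∫ τ in (0 : ℝ)..t, a τ * y τ) {t : ℝ}
    (ht : t ∈ Icc 0 S) : y t ≤ A * Real.exp (∫ τ in (0 : ℝ)..t, a τ) := by
  set Φ : ℝ → ℝ := fun t ↦ A + ∫ τ in (0 : ℝ)..t, a τ * y τ with hΦ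
  set I : ℝ → ℝ := fun t ↦ ∫ τ in (0 : ℝ)..t, a τ with hI
  have hΦ' (t : ℝ) : HasDerivAt Φ (a t * y t) t :=
    ((ha.mul hy).integral_hasStrictDerivAt 0 t).hasDerivAt.const_add A
  have hI' (t : ℝ) : HasDerivAt I (a t) t := (ha.integral_hasStrictDerivAt 0 t).hasDerivAt
  have hg (t : ℝ) : HasDerivAt (fun t ↦ Φ t * Real.exp (-I t))
      (a t * y t * Real.exp (-I t) + Φ t * (Real.exp (-I t) * -a t)) t :=
    (hΦ' t).mul (hI' t).neg.exp
  -- The integrating factor: `Φ` is differentiable and `Φ' = a y ≤ a Φ`, although `y` itself is only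
  -- continuous.
  have hanti : AntitoneOn (fun t ↦ Φ t * Real.exp (-I t)) (Icc 0 S) := by
    refine antitoneOn_of_deriv_nonpos (convex_Icc 0 S)
      (fun t _ ↦ (hg t).continuousAt.continuousWithinAt)
      (fun t _ ↦ (hg t).differentiableAt.differentiableWithinAt) fun t ht ↦ ?_
    rw [(hg t).deriv]
    have h1 := h t (interior_subset ht)
    have : a t * y t * Real.exp (-I t) + Φ t * (Real.exp (-I t) * -a t)
        = - (a t * Real.exp (-I t) * (Φ t - y t)) := by ring
    rw [this, neg_nonpos]
    exact mul_nonneg (mul_nonneg (ha0 t) (Real.exp_nonneg _)) (sub_nonneg.2 h1)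
  have h0 : (0 : ℝ) ∈ Icc 0 S := ⟨le_rfl, ht.1.trans ht.2⟩
  have h1 := hanti h0 ht ht.1
  simp only [hΦ, hI, intervalIntegral.integral_same, neg_zero, Real.exp_zero, mul_one, add_zero] at h1
  refine (h t ht).trans ?_
  rw [Real.exp_neg, ← div_eq_mul_inv, div_le_iff₀ (Real.exp_pos _)] at h1
  exact h1

/-! ### Energy balances of a flow at the three levels. -/

namespace Flow

lemma contU' {α β k S : ℝ} (hk : 1 < k) {u b : ℝ → VectorField} (hF : Flow α β k S u b) (i : Fin 2) :
    Continuous fun t ↦ vhat (u t) i := continuous_vhat (by linarith) (hF.contU i)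

lemma contB' {α β k S : ℝ} (hk : 1 < k) {u b : ℝ → VectorField} (hF : Flow α β k S u b) (i : Fin 2) :
    Continuous fun t ↦ vhat (b t) i := continuous_vhat (by linarith) (hF.contB i)

/-- The `β` additional derivatives of `b`, square integrable in time, make every term absolutely
convergent: `2a + 1 ≤ k + (k + β)` holds for each `a ≤ k`. No mollification is needed. -/
lemma energyB {α β k S a : ℝ} (hβ : 1 ≤ β) (hk : 1 < k) (ha : 0 ≤ a) (hak : a ≤ k)
    {u b : ℝ → VectorField} (hF : Flow α β k S u b) :
    ∃ f : ℝ → ℝ, IntegrableOn f (Icc 0 S) ∧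
      (∀ᵐ τ ∂(volume.restrict (Icc 0 S)), f τ = - advF a (vhat (u τ)) (vhat (b τ)) (vhat (b τ))
        + advF a (vhat (b τ)) (vhat (u τ)) (vhat (b τ))
        - (2 * Real.pi) ^ (2 * β) * en (a + β) (vhat (b τ))) ∧
      ∀ t ∈ Icc 0 S, en a (vhat (b t)) = en a (vhat (b 0)) + 2 * ∫ τ in (0 : ℝ)..t, f τ := by
  obtain ⟨M, hM0, hM⟩ := hF.bdd
  obtain ⟨N, hN0, hN1, hN2, hN⟩ := exists_hn_bound hF.sqB
  obtain ⟨c, hc0, hc⟩ := form_dom (k := k) (t := k + β) (a := a) (b := β) hk ha (by linarith)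
    (by linarith) (by linarith)
  -- Any order above 3 (for advection) and at least `1 + 2β` (for dissipation) would serve.
  set m : ℝ := 4 + 2 * β with hm
  obtain ⟨q, hq⟩ := exists_curlRep_self (m := m) (by linarith) (fun i ↦ hF.contB' hk i)
  obtain ⟨γ, hγ⟩ := exists_curlRep_rhsB (m := m) (β := β) (by linarith) (by linarith) (by linarith)
    (fun i ↦ hF.contU' hk i) (fun i ↦ hF.contB' hk i)
  have hfix (τ : ℝ) (hτ : hn (k + β) (vhat (b τ)) ≤ ENNReal.ofReal (N τ)) :=
    hc (-1) 1 1 (vhat (u τ)) (vhat (b τ)) (vhat (b τ)) (vhat (u τ)) (vhat (b τ)) M (N τ)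
      (by simp) (by simp) (by simp) hM0 (hN0 τ) (hM τ).1 (hM τ).2 (hM τ).2 (hM τ).1 hτ
  have hD : IntegrableOn (fun τ ↦ c * (M ^ 2 * N τ + N τ ^ 2)) (Icc 0 S) :=
    ((hN1.const_mul _).add hN2).const_mul c
  obtain ⟨hi, he⟩ := energy_identity hF.eqB hq hγ hF.divB (measurable_norm_rpow (2 * a))
    (fun ξ ↦ by positivity)
    (fun t _ ↦ integrable_en ((dn_le_hn ha hak _).trans_lt ((hM t).2.trans_lt ENNReal.ofReal_lt_top)))
    hD (by
      filter_upwards [hN] with τ hτ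
      rw [rhsB_eq]
      exact ⟨(hfix τ hτ).1, (hfix τ hτ).2.2⟩)
  refine ⟨_, hi, ?_, he⟩
  filter_upwards [hN] with τ hτ
  rw [rhsB_eq, (hfix τ hτ).2.1]
  ring

/-- At level 0 the advection form carries a single derivative, which the `H^k` norms with `k > 1`
control at every time. -/
lemma energyU_zero {α β k S : ℝ} (hα : 0 ≤ α) (hk : 1 < k) (hαk : α ≤ k)
    {u b : ℝ → VectorField} (hF : Flow α β k S u b) :
    ∃ f : ℝ → ℝ, IntegrableOn f (Icc 0 S) ∧
      (∀ᵐ τ ∂(volume.restrict (Icc 0 S)), f τ = - advF 0 (vhat (u τ)) (vhat (u τ)) (vhat (u τ))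
        + advF 0 (vhat (b τ)) (vhat (b τ)) (vhat (u τ))
        - nu α * ((2 * Real.pi) ^ (2 * α) * en (0 + α) (vhat (u τ)))) ∧
      ∀ t ∈ Icc 0 S, en 0 (vhat (u t)) = en 0 (vhat (u 0)) + 2 * ∫ τ in (0 : ℝ)..t, f τ := by
  obtain ⟨M, hM0, hM⟩ := hF.bdd
  obtain ⟨c, hc0, hc⟩ := form_dom (k := k) (t := k) (a := 0) (b := α) hk le_rfl hα
    (by linarith) (by linarith)
  set m : ℝ := 4 + 2 * α with hm
  obtain ⟨q, hq⟩ := exists_curlRep_self (m := m) (by linarith) (fun i ↦ hF.contU' hk i)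
  obtain ⟨γ, hγ⟩ := exists_curlRep_rhsU (m := m) (α := α) hα (by linarith) (by linarith)
    (fun i ↦ hF.contU' hk i) (fun i ↦ hF.contB' hk i)
  have hfix (τ : ℝ) := hc (-1) 1 (nu α) (vhat (u τ)) (vhat (u τ)) (vhat (b τ)) (vhat (b τ))
      (vhat (u τ)) M M (by simp) (by simp) (abs_nu_le α) hM0 hM0 (hM τ).1 (hM τ).1 (hM τ).2 (hM τ).2
      (hM τ).1
  have hD : IntegrableOn (fun _ : ℝ ↦ c * (M ^ 2 * M + M ^ 2)) (Icc 0 S) :=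
    integrableOn_const (by simp)
  obtain ⟨hi, he⟩ := energy_identity hF.eqU hq hγ hF.divU (measurable_norm_rpow (2 * 0))
    (fun ξ ↦ by positivity)
    (fun t _ ↦ integrable_en ((dn_le_hn le_rfl (by linarith) _).trans_lt
      ((hM t).1.trans_lt ENNReal.ofReal_lt_top)))
    hD (.of_forall fun τ ↦ by
      rw [rhsU_eq]
      exact ⟨(hfix τ).1, (hfix τ).2.2⟩)
  refine ⟨_, hi, .of_forall fun τ ↦ ?_, he⟩
  rw [rhsU_eq, (hfix τ).2.1]
  ring

/-- Here the self-advection of `u` carries three derivatives, and `k > 1` does not ensure absolute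
convergence. It is removed by `vorticity_energy_le`; only the Lorentz force and the viscosity remain
as a source, which is square integrable in space at almost every time. -/
lemma energyU_one {α β k S : ℝ} (hα : 0 ≤ α) (hβ : 1 ≤ β) (hk : 1 < k) (hαk : 1 + α ≤ k)
    {u b : ℝ → VectorField} (hF : Flow α β k S u b) :
    ∃ f : ℝ → ℝ, IntegrableOn f (Icc 0 S) ∧
      (∀ᵐ τ ∂(volume.restrict (Icc 0 S)), f τ = advF 1 (vhat (b τ)) (vhat (b τ)) (vhat (u τ))
        - nu α * ((2 * Real.pi) ^ (2 * α) * en (1 + α) (vhat (u τ)))) ∧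
      ∀ t ∈ Icc 0 S, en 1 (vhat (u t)) ≤ en 1 (vhat (u 0)) + 2 * ∫ τ in (0 : ℝ)..t, f τ := by
  obtain ⟨M, hM0, hM⟩ := hF.bdd
  obtain ⟨N, hN0, hN1, hN2, hN⟩ := exists_hn_bound hF.sqB
  obtain ⟨N', hN'0, hN'1, -, hN'⟩ := exists_hn_bound hF.sqU
  obtain ⟨c, hc0, hc⟩ := exists_curl_source (α := α) (k := k) (s := k + β) hα hk (by linarith) hαk
  set m : ℝ := 4 + 2 * α with hm
  obtain ⟨q, hq⟩ := exists_curlRep_self (m := m) (by linarith) (fun i ↦ hF.contU' hk i)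
  obtain ⟨γ, hγ⟩ := exists_curlRep_rhsU (m := m) (α := α) hα (by linarith) (by linarith)
    (fun i ↦ hF.contU' hk i) (fun i ↦ hF.contB' hk i)
  set G' : ℝ → Fin 2 → Plane → ℂ := fun τ ↦
    mixG 1 0 (nu α) α (vhat (b τ)) (vhat (b τ)) (vhat (b τ)) (vhat (b τ)) (vhat (u τ)) with hG'
  -- The source is known to be in `L²` only when the bounds `N` and `N'` hold, that is at almost
  -- every time; elsewhere `g` is set to zero.
  have hsrc : ∀ τ, ∃ g : L2C, (hn (k + β) (vhat (b τ)) ≤ ENNReal.ofReal (N τ) →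
      hn (k + α) (vhat (u τ)) ≤ ENNReal.ofReal (N' τ) →
      g =ᵐ[volume] curlHat (G' τ) ∧ ‖g‖ ≤ c * (M * N τ + N' τ)) := by
    intro τ
    by_cases h1 : hn (k + β) (vhat (b τ)) ≤ ENNReal.ofReal (N τ)
    · by_cases h2 : hn (k + α) (vhat (u τ)) ≤ ENNReal.ofReal (N' τ)
      · obtain ⟨g, hg⟩ := hc (nu α) (abs_nu_le α) (vhat (u τ)) (vhat (b τ)) M (N τ) (N' τ) hM0
          (hN0 τ) (hN'0 τ) (hM τ).2 h1 h2
        exact ⟨g, fun _ _ ↦ hg⟩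
      · exact ⟨0, fun _ h ↦ absurd h h2⟩
    · exact ⟨0, fun h ↦ absurd h h1⟩
  choose g hg using hsrc
  have hEU := hF.eqU
  simp only [rhsU_eq_add] at hEU hγ
  -- `δ` is the regularity of `u` beyond one derivative, capped at 1 for the commutator estimate.
  set δ : ℝ := min (k - 1) 1 with hδ
  have hδ0 : 0 < δ := lt_min (by linarith) one_pos
  have hδk : 1 + δ ≤ k := by linarith [min_le_left (k - 1) 1]
  obtain ⟨hi, he⟩ := vorticity_energy_le (G' := G') (g := g) (D := fun τ ↦ c * (M * N τ + N' τ)) hδ0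
    (min_le_right _ _) hEU hq hγ hF.divU hM0
    (fun t j ↦ (n2_ejap_coord_le _ _ j).trans ((hn_mono hδk _).trans (hM t).1))
    (by filter_upwards [hN, hN'] with τ h1 h2; exact (hg τ h1 h2).1)
    (((hN1.const_mul M).add hN'1).const_mul c)
    (by filter_upwards [hN, hN'] with τ h1 h2; exact (hg τ h1 h2).2)
  refine ⟨_, hi, ?_, fun t ht ↦ ?_⟩
  · filter_upwards [hN] with τ hτ
    have hBk := (hM τ).2.trans_lt ENNReal.ofReal_lt_top
    have hUk := (hM τ).1.trans_lt ENNReal.ofReal_lt_top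
    have hBs := hτ.trans_lt ENNReal.ofReal_lt_top
    -- The Lorentz force does converge absolutely, because `b` has `β` spare derivatives: `3 ≤ (k +
    -- β) + k`.
    have ht : tri (mag (vhat (b τ))) (mag (vhat (b τ)))
        (advWeight (fun ξ ↦ ‖ξ‖ ^ (2 * (1 : ℝ))) (vhat (u τ))) < ∞ :=
      tri_advWeight_lt_top (s := k + β) (t := k) hk (by linarith) zero_le_one (by linarith) hBk hBk
        hBs hBs hUk
    have h := (form_mixG (b := α) zero_le_one hα 1 0 (nu α) ht ht
      ((dn_le_hn (by linarith) hαk _).trans_lt hUk)).2.1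
    simp only [mul_one, Real.rpow_two, one_mul, zero_mul, add_zero] at h
    exact h
  · have := he t ht
    simpa only [en, mul_one, Real.rpow_two] using this

lemma one_le_two_pi_rpow {s : ℝ} (hs : 0 ≤ s) : 1 ≤ (2 * Real.pi) ^ (2 * s) :=
  Real.one_le_rpow (by linarith [Real.pi_gt_three]) (by linarith)

/-- Conservation of energy. -/
lemma energy_zero {α β k S : ℝ} (hα : 0 ≤ α) (hβ : 1 ≤ β) (hk : 1 < k) (hαk : 1 + α ≤ k)
    {u b : ℝ → VectorField} (hF : Flow α β k S u b) {t : ℝ} (ht : t ∈ Icc 0 S) :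
    en 0 (vhat (u t)) + en 0 (vhat (b t)) + 2 * ∫ τ in (0 : ℝ)..t, en β (vhat (b τ))
      ≤ en 0 (vhat (u 0)) + en 0 (vhat (b 0)) := by
  obtain ⟨f, hf, hfe, hfi⟩ := hF.energyU_zero hα hk (by linarith)
  obtain ⟨g, hg, hge, hgi⟩ := hF.energyB hβ hk le_rfl (by linarith)
  obtain ⟨M, hM0, hM⟩ := hF.bdd
  have hI := integrableOn_en (a := β) (by linarith) (by linarith : β ≤ k + β) hF.sqB
  have hle : ∫ τ in (0 : ℝ)..t, (f τ + g τ) ≤ ∫ τ in (0 : ℝ)..t, - en β (vhat (b τ)) := by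
    refine intervalIntegral_mono_Icc (hf.add hg) hI.neg ?_ ht
    filter_upwards [hfe, hge] with τ h1 h2
    have hU : hn k (vhat (u τ)) < ∞ := (hM τ).1.trans_lt ENNReal.ofReal_lt_top
    have hB : hn k (vhat (b τ)) < ∞ := (hM τ).2.trans_lt ENNReal.ofReal_lt_top
    have fin {V W Z : Fin 2 → L2C} (hV : hn k V < ∞) (hW : hn k W < ∞) (hZ : hn k Z < ∞) :
        tri (mag V) (mag W) (advWeight (fun ξ ↦ ‖ξ‖ ^ (2 * (0 : ℝ))) Z) < ∞ :=
      tri_advWeight_lt_top (s := k) (t := k) hk (by linarith) le_rfl (by linarith) hV hW hV hW hZ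
    have rU := isRealHat_vhat (u τ)
    have rB := isRealHat_vhat (b τ)
    -- `a1` and `a2` annihilate the transport terms of `u` and `b`; `a3` cancels the Lorentz force
    -- against the stretching of `b`.
    have a1 := advF_zero_antisymm (fin hU hU hU) (fin hU hU hU) (hF.divU τ) rU rU
    have a2 := advF_zero_antisymm (fin hU hB hB) (fin hU hB hB) (hF.divU τ) rB rB
    have a3 := advF_zero_antisymm (fin hB hB hU) (fin hB hU hB) (hF.divB τ) rB rU
    have n1 : 0 ≤ nu α * ((2 * Real.pi) ^ (2 * α) * en (0 + α) (vhat (u τ))) :=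
      mul_nonneg (nu_nonneg α) (mul_nonneg (by positivity) (en_nonneg _ _))
    have n2 : en β (vhat (b τ)) ≤ (2 * Real.pi) ^ (2 * β) * en (0 + β) (vhat (b τ)) := by
      rw [zero_add]
      exact le_mul_of_one_le_left (en_nonneg _ _) (one_le_two_pi_rpow (by linarith))
    rw [h1, h2]
    linarith
  rw [intervalIntegral.integral_add (intervalIntegrable_of_Icc hf ht)
    (intervalIntegrable_of_Icc hg ht), intervalIntegral.integral_neg] at hle
  rw [hfi t ht, hgi t ht]
  linarith

/-- The gradient energy inequality. -/
lemma exists_energy_one {α β k : ℝ} (hα : 0 ≤ α) (hβ : 1 ≤ β) (hk : 1 < k) (hβk : β ≤ k)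
    (hαk : 1 + α ≤ k) : ∃ K : ℝ, 0 ≤ K ∧ ∀ (S : ℝ) (u b : ℝ → VectorField), Flow α β k S u b →
    ∀ t ∈ Icc 0 S, en 1 (vhat (u t)) + en 1 (vhat (b t))
      + ∫ τ in (0 : ℝ)..t, (2 * nu α * en (1 + α) (vhat (u τ)) + en (1 + β) (vhat (b τ)))
      ≤ en 1 (vhat (u 0)) + en 1 (vhat (b 0))
        + ∫ τ in (0 : ℝ)..t, K * ((1 + en 1 (vhat (u τ))) * en 1 (vhat (b τ))) := by
  obtain ⟨K, hK0, hK⟩ := exists_nonlinear_grad_le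
  refine ⟨K, hK0, fun S u b hF t ht ↦ ?_⟩
  obtain ⟨f, hf, hfe, hfi⟩ := hF.energyU_one hα hβ hk hαk
  obtain ⟨g, hg, hge, hgi⟩ := hF.energyB hβ hk zero_le_one (by linarith)
  obtain ⟨M, hM0, hM⟩ := hF.bdd
  obtain ⟨N, hN0, hN1, hN2, hN⟩ := exists_hn_bound hF.sqB
  have c1 := continuous_en (a := 1) zero_le_one (by linarith) hF.contU
  have c2 := continuous_en (a := 1) zero_le_one (by linarith) hF.contB
  have c3 := continuous_en (a := 1 + α) (by linarith) hαk hF.contU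
  have hI1 : IntegrableOn (fun τ ↦ 2 * nu α * en (1 + α) (vhat (u τ)) + en (1 + β) (vhat (b τ)))
      (Icc 0 S) :=
    ((c3.continuousOn.integrableOn_Icc).const_mul _).add
      (integrableOn_en (a := 1 + β) (by linarith) (by linarith : 1 + β ≤ k + β) hF.sqB)
  have hI2 : IntegrableOn (fun τ ↦ K * ((1 + en 1 (vhat (u τ))) * en 1 (vhat (b τ)))) (Icc 0 S) :=
    (by fun_prop : Continuous fun τ ↦
      K * ((1 + en 1 (vhat (u τ))) * en 1 (vhat (b τ)))).continuousOn.integrableOn_Icc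
  have hle : ∫ τ in (0 : ℝ)..t, 2 * (f τ + g τ)
      ≤ ∫ τ in (0 : ℝ)..t, (K * ((1 + en 1 (vhat (u τ))) * en 1 (vhat (b τ)))
        - (2 * nu α * en (1 + α) (vhat (u τ)) + en (1 + β) (vhat (b τ)))) := by
    refine intervalIntegral_mono_Icc ((hf.add hg).const_mul 2) (hI2.sub hI1) ?_ ht
    filter_upwards [hfe, hge, hN] with τ h1 h2 h3
    have hU : hn k (vhat (u τ)) < ∞ := (hM τ).1.trans_lt ENNReal.ofReal_lt_top
    have hB : hn (k + β) (vhat (b τ)) < ∞ := h3.trans_lt ENNReal.ofReal_lt_top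
    have key := hK β k hβ hk hβk _ _ hU hB (hF.divU τ) (hF.divB τ) (isRealHat_vhat _)
      (isRealHat_vhat _)
    have habs := le_abs_self (advF 1 (vhat (b τ)) (vhat (b τ)) (vhat (u τ))
      + advF 1 (vhat (b τ)) (vhat (u τ)) (vhat (b τ)) - advF 1 (vhat (u τ)) (vhat (b τ)) (vhat (b τ)))
    have n1 : nu α * en (1 + α) (vhat (u τ))
        ≤ nu α * ((2 * Real.pi) ^ (2 * α) * en (1 + α) (vhat (u τ))) :=
      mul_le_mul_of_nonneg_left (le_mul_of_one_le_left (en_nonneg _ _) (one_le_two_pi_rpow hα))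
        (nu_nonneg α)
    have n2 : en (1 + β) (vhat (b τ)) ≤ (2 * Real.pi) ^ (2 * β) * en (1 + β) (vhat (b τ)) :=
      le_mul_of_one_le_left (en_nonneg _ _) (one_le_two_pi_rpow (by linarith))
    rw [h1, h2]
    linarith
  rw [intervalIntegral.integral_const_mul, intervalIntegral.integral_add (intervalIntegrable_of_Icc hf ht)
    (intervalIntegrable_of_Icc hg ht), intervalIntegral.integral_sub (intervalIntegrable_of_Icc hI2 ht)
    (intervalIntegrable_of_Icc hI1 ht)] at hle
  have e1 := hfi t ht
  have e2 := hgi t ht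
  linarith

/-- The higher order energy inequality for the magnetic field. -/
lemma exists_energy_high {α β k : ℝ} (hα0 : 0 ≤ α) (hα : α < 1 / 2) (hβ : 1 ≤ β)
    (hr : 1 < α + β) (hk : α + β ≤ k) : ∃ K : ℝ, 0 ≤ K ∧ ∀ (S : ℝ) (u b : ℝ → VectorField),
    Flow α β k S u b → ∀ t ∈ Icc 0 S, en (α + β) (vhat (b t))
      + ∫ τ in (0 : ℝ)..t, en (α + β + β) (vhat (b τ)) ≤ en (α + β) (vhat (b 0))
        + ∫ τ in (0 : ℝ)..t, K * (en (1 + α) (vhat (u τ))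
            * (en 0 (vhat (b τ)) + en (α + β) (vhat (b τ)))
          + (en 0 (vhat (u τ)) + en 1 (vhat (u τ))) * (en 0 (vhat (b τ)) + en (1 + β) (vhat (b τ)))) := by
  obtain ⟨K, hK0, hK⟩ := exists_nonlinear_high_le hα0 hα hβ hr hk
  refine ⟨K, hK0, fun S u b hF t ht ↦ ?_⟩
  have hk1 : 1 < k := by linarith
  obtain ⟨g, hg, hge, hgi⟩ := hF.energyB hβ hk1 (by linarith : 0 ≤ α + β) hk
  obtain ⟨M, hM0, hM⟩ := hF.bdd
  obtain ⟨N, hN0, hN1, hN2, hN⟩ := exists_hn_bound hF.sqB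
  have c0 := continuous_en (a := 0) le_rfl (by linarith) hF.contU
  have c1 := continuous_en (a := 1) zero_le_one (by linarith) hF.contU
  have c2 := continuous_en (a := 0) le_rfl (by linarith) hF.contB
  have c3 := continuous_en (a := 1 + α) (by linarith) (by linarith) hF.contU
  have c4 := continuous_en (a := α + β) (by linarith) hk hF.contB
  have hI1 := integrableOn_en (a := α + β + β) (by linarith) (by linarith : α + β + β ≤ k + β) hF.sqB
  have hIβ := integrableOn_en (a := 1 + β) (by linarith) (by linarith : 1 + β ≤ k + β) hF.sqB
  have hI0 : IntegrableOn (fun τ ↦ en 0 (vhat (b τ)) + en (1 + β) (vhat (b τ))) (Icc 0 S) :=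
    (c2.continuousOn.integrableOn_Icc).add hIβ
  have hI2 : IntegrableOn (fun τ ↦ K * (en (1 + α) (vhat (u τ))
      * (en 0 (vhat (b τ)) + en (α + β) (vhat (b τ)))
      + (en 0 (vhat (u τ)) + en 1 (vhat (u τ))) * (en 0 (vhat (b τ)) + en (1 + β) (vhat (b τ)))))
      (Icc 0 S) := by
    refine Integrable.const_mul (Integrable.add ?_ ?_) K
    · exact (by fun_prop : Continuous fun τ ↦ en (1 + α) (vhat (u τ))
        * (en 0 (vhat (b τ)) + en (α + β) (vhat (b τ)))).continuousOn.integrableOn_Icc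
    · exact hI0.continuousOn_mul (c0.add c1).continuousOn isCompact_Icc
  have hle : ∫ τ in (0 : ℝ)..t, 2 * g τ ≤ ∫ τ in (0 : ℝ)..t, (K * (en (1 + α) (vhat (u τ))
      * (en 0 (vhat (b τ)) + en (α + β) (vhat (b τ)))
      + (en 0 (vhat (u τ)) + en 1 (vhat (u τ))) * (en 0 (vhat (b τ)) + en (1 + β) (vhat (b τ))))
      - en (α + β + β) (vhat (b τ))) := by
    refine intervalIntegral_mono_Icc (hg.const_mul 2) (hI2.sub hI1) ?_ ht
    filter_upwards [hge, hN] with τ h2 h3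
    have hU : hn k (vhat (u τ)) < ∞ := (hM τ).1.trans_lt ENNReal.ofReal_lt_top
    have hB : hn (k + β) (vhat (b τ)) < ∞ := h3.trans_lt ENNReal.ofReal_lt_top
    have key := hK _ _ hU hB
    have habs := le_abs_self (advF (α + β) (vhat (b τ)) (vhat (u τ)) (vhat (b τ))
      - advF (α + β) (vhat (u τ)) (vhat (b τ)) (vhat (b τ)))
    have n2 : en (α + β + β) (vhat (b τ)) ≤ (2 * Real.pi) ^ (2 * β) * en (α + β + β) (vhat (b τ)) :=
      le_mul_of_one_le_left (en_nonneg _ _) (one_le_two_pi_rpow (by linarith))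
    rw [h2]
    linarith
  rw [intervalIntegral.integral_const_mul, intervalIntegral.integral_sub
    (intervalIntegrable_of_Icc hI2 ht) (intervalIntegrable_of_Icc hI1 ht)] at hle
  have e2 := hgi t ht
  linarith

end Flow

/-! ### The a priori bound by two applications of Grönwall's inequality. -/

namespace Flow

lemma intervalIntegral_const_le {f : ℝ → ℝ} {S T Y t : ℝ} (hf : IntegrableOn f (Icc 0 S))
    (hY : 0 ≤ Y) (h : ∀ τ ∈ Icc 0 S, f τ ≤ Y) (ht : t ∈ Icc 0 S) (hT : S ≤ T) :
    ∫ τ in (0 : ℝ)..t, f τ ≤ T * Y := by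
  have h1 := intervalIntegral_mono_Icc (g := fun _ ↦ Y) hf (integrableOn_const (by simp))
    ((ae_restrict_iff' measurableSet_Icc).2 (.of_forall h)) ht
  rw [intervalIntegral.integral_const, smul_eq_mul, sub_zero] at h1
  exact h1.trans (mul_le_mul_of_nonneg_right (ht.2.trans hT) hY)

/-- The a priori bound, depending only on the initial data and the final time. -/
theorem exists_bound {α β k : ℝ} (hα0 : 0 ≤ α) (hα : α < 1 / 2) (hβ : 1 ≤ β)
    (hr : 1 < α + β) (hk : α + β ≤ k) {T e₀ e₁ e₂ : ℝ} (hT : 0 ≤ T) (he₀ : 0 ≤ e₀) (he₁ : 0 ≤ e₁)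
    (he₂ : 0 ≤ e₂) :
    ∃ C : ℝ, ∀ (S : ℝ) (u b : ℝ → VectorField), S ≤ T → Flow α β k S u b →
      en 0 (vhat (u 0)) + en 0 (vhat (b 0)) = e₀ → en 1 (vhat (u 0)) + en 1 (vhat (b 0)) = e₁ →
      en (α + β) (vhat (b 0)) = e₂ → ∀ t ∈ Icc 0 S, en (α + β) (vhat (b t))
        + ∫ τ in (0 : ℝ)..t, en (α + β + β) (vhat (b τ)) ≤ C := by
  have hk1 : 1 < k := by linarith
  obtain ⟨K, hK0, hK⟩ := exists_energy_one (α := α) (β := β) (k := k) hα0 hβ hk1 (by linarith)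
    (by linarith)
  obtain ⟨L, hL0, hL⟩ := exists_energy_high hα0 hα hβ hr hk
  set I₁ : ℝ := T * e₀ + e₀ with hI₁
  set Y : ℝ := (1 + e₁) * Real.exp (K * I₁) with hY
  set D : ℝ := e₁ + K * (Y * I₁) with hD
  set F : ℝ := D + T * Y with hFF
  set A : ℝ := e₂ + L * ((e₀ + Y) * (T * e₀ + D)) with hA
  set W : ℝ := (e₀ + A) * Real.exp (L * F) with hW
  have hI₁0 : 0 ≤ I₁ := by positivity
  have hY0 : 0 ≤ Y := by positivity
  have hD0 : 0 ≤ D := by positivity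
  have hF0 : 0 ≤ F := by positivity
  have hA0 : 0 ≤ A := by positivity
  have hW0 : 0 ≤ W := by positivity
  refine ⟨A + L * (W * F), ?_⟩
  intro S u b hST hF h0 h1 h2
  have c0 := continuous_en (a := 0) le_rfl (by linarith) hF.contU
  have c0b := continuous_en (a := 0) le_rfl (by linarith) hF.contB
  have c1 := continuous_en (a := 1) zero_le_one (by linarith) hF.contU
  have c1b := continuous_en (a := 1) zero_le_one (by linarith) hF.contB
  have cα := continuous_en (a := 1 + α) (by linarith) (by linarith) hF.contU
  have cz := continuous_en (a := α + β) (by linarith) hk hF.contB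
  have iβ := integrableOn_en (a := β) (by linarith) (by linarith : β ≤ k + β) hF.sqB
  have i1β := integrableOn_en (a := 1 + β) (by linarith) (by linarith : 1 + β ≤ k + β) hF.sqB
  have ih := integrableOn_en (a := α + β + β) (by linarith) (by linarith : α + β + β ≤ k + β) hF.sqB
  obtain ⟨N, hN0, hN1, hN2, hN⟩ := exists_hn_bound hF.sqB
  have dB : ∀ᵐ τ ∂(volume.restrict (Icc 0 S)), ∀ s : ℝ, 0 ≤ s → s ≤ k + β →
      dn s (vhat (b τ)) < ∞ := by
    filter_upwards [hN] with τ h s hs0 hs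
    exact (dn_le_hn hs0 hs _).trans_lt (h.trans_lt ENNReal.ofReal_lt_top)
  have nonneg_int {a t : ℝ} (v : ℝ → VectorField) (ht : t ∈ Icc 0 S) :
      0 ≤ ∫ τ in (0 : ℝ)..t, en a (vhat (v τ)) :=
    intervalIntegral.integral_nonneg ht.1 fun _ _ ↦ en_nonneg _ _
  have E0 (t : ℝ) (ht : t ∈ Icc 0 S) : en 0 (vhat (u t)) + en 0 (vhat (b t)) ≤ e₀ := by
    have := hF.energy_zero hα0 hβ hk1 (by linarith) ht
    have := nonneg_int (a := β) b ht
    linarith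
  have E0β (t : ℝ) (ht : t ∈ Icc 0 S) : ∫ τ in (0 : ℝ)..t, en β (vhat (b τ)) ≤ e₀ := by
    have := hF.energy_zero hα0 hβ hk1 (by linarith) ht
    have := nonneg_int (a := β) b ht
    have := en_nonneg 0 (vhat (u t))
    have := en_nonneg 0 (vhat (b t))
    linarith
  have E0b (t : ℝ) (ht : t ∈ Icc 0 S) : ∫ τ in (0 : ℝ)..t, en 0 (vhat (b τ)) ≤ T * e₀ :=
    intervalIntegral_const_le c0b.continuousOn.integrableOn_Icc he₀
      (fun τ hτ ↦ by linarith [E0 τ hτ, en_nonneg 0 (vhat (u τ))]) ht hST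
  have E1b (t : ℝ) (ht : t ∈ Icc 0 S) : ∫ τ in (0 : ℝ)..t, en 1 (vhat (b τ)) ≤ I₁ := by
    have i0b : IntegrableOn (fun τ ↦ en 0 (vhat (b τ))) (Icc 0 S) := c0b.continuousOn.integrableOn_Icc
    have h := intervalIntegral_mono_Icc (g := fun τ ↦ en 0 (vhat (b τ)) + en β (vhat (b τ)))
      (c1b.continuousOn.integrableOn_Icc) (i0b.add iβ) (by
        filter_upwards [dB] with τ hτ
        exact en_le_add le_rfl zero_le_one hβ (hτ 0 le_rfl (by linarith))
          (hτ β (by linarith) (by linarith))) ht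
    rw [intervalIntegral.integral_add (intervalIntegrable_of_Icc i0b ht)
      (intervalIntegrable_of_Icc iβ ht)] at h
    linarith [E0β t ht, E0b t ht]
  have iν : IntegrableOn (fun τ ↦ 2 * nu α * en (1 + α) (vhat (u τ))) (Icc 0 S) :=
    (cα.continuousOn.integrableOn_Icc).const_mul _
  have split (t : ℝ) (ht : t ∈ Icc 0 S) :
      ∫ τ in (0 : ℝ)..t, (2 * nu α * en (1 + α) (vhat (u τ)) + en (1 + β) (vhat (b τ)))
        = 2 * nu α * (∫ τ in (0 : ℝ)..t, en (1 + α) (vhat (u τ)))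
          + ∫ τ in (0 : ℝ)..t, en (1 + β) (vhat (b τ)) := by
    rw [intervalIntegral.integral_add (intervalIntegrable_of_Icc iν ht)
      (intervalIntegrable_of_Icc i1β ht), intervalIntegral.integral_const_mul]
  have hν := nu_nonneg α
  -- Grönwall with the coefficient `K ‖∇b‖²`, whose time integral the basic energy already bounds;
  -- the inequality becomes linear once `1 + en 1 u` is enlarged to the whole gradient energy.
  have EY (t : ℝ) (ht : t ∈ Icc 0 S) : 1 + (en 1 (vhat (u t)) + en 1 (vhat (b t))) ≤ Y := by
    have hg := gronwall_integral (y := fun t ↦ 1 + (en 1 (vhat (u t)) + en 1 (vhat (b t))))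
      (a := fun t ↦ K * en 1 (vhat (b t))) (by fun_prop) (by fun_prop)
      (fun t ↦ mul_nonneg hK0 (en_nonneg _ _)) (A := 1 + e₁) (S := S) (fun t ht ↦ by
        have hE := hK S u b hF t ht
        rw [split t ht] at hE
        have m1 : 0 ≤ 2 * nu α * ∫ τ in (0 : ℝ)..t, en (1 + α) (vhat (u τ)) :=
          mul_nonneg (by positivity) (nonneg_int u ht)
        have m2 := nonneg_int (a := 1 + β) b ht
        have m3 : ∫ τ in (0 : ℝ)..t, K * ((1 + en 1 (vhat (u τ))) * en 1 (vhat (b τ)))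
            ≤ ∫ τ in (0 : ℝ)..t, K * en 1 (vhat (b τ))
              * (1 + (en 1 (vhat (u τ)) + en 1 (vhat (b τ)))) := by
          refine intervalIntegral.integral_mono_on ht.1
            (Continuous.intervalIntegrable (by fun_prop) _ _)
            (Continuous.intervalIntegrable (by fun_prop) _ _) fun τ _ ↦ ?_
          have := mul_nonneg hK0 (mul_nonneg (en_nonneg 1 (vhat (b τ))) (en_nonneg 1 (vhat (b τ))))
          linarith
        linarith) ht
    refine hg.trans ?_
    rw [intervalIntegral.integral_const_mul, hY]
    gcongr
    exact E1b t ht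
  have ED (t : ℝ) (ht : t ∈ Icc 0 S) : 2 * nu α * (∫ τ in (0 : ℝ)..t, en (1 + α) (vhat (u τ)))
      + ∫ τ in (0 : ℝ)..t, en (1 + β) (vhat (b τ)) ≤ D := by
    have hE := hK S u b hF t ht
    rw [split t ht] at hE
    have m3 : ∫ τ in (0 : ℝ)..t, K * ((1 + en 1 (vhat (u τ))) * en 1 (vhat (b τ)))
        ≤ ∫ τ in (0 : ℝ)..t, K * (Y * en 1 (vhat (b τ))) := by
      refine intervalIntegral.integral_mono_on ht.1
        (Continuous.intervalIntegrable (by fun_prop) _ _)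
        (Continuous.intervalIntegrable (by fun_prop) _ _) fun τ hτ ↦ ?_
      have hy := EY τ ⟨hτ.1, hτ.2.trans ht.2⟩
      have := en_nonneg 1 (vhat (b τ))
      gcongr
      linarith
    have m5 : ∫ τ in (0 : ℝ)..t, K * (Y * en 1 (vhat (b τ)))
        = K * (Y * ∫ τ in (0 : ℝ)..t, en 1 (vhat (b τ))) := by
      rw [intervalIntegral.integral_const_mul, intervalIntegral.integral_const_mul]
    have m4 : K * (Y * ∫ τ in (0 : ℝ)..t, en 1 (vhat (b τ))) ≤ K * (Y * I₁) := by
      gcongr; exact E1b t ht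
    linarith [en_nonneg 1 (vhat (u t)), en_nonneg 1 (vhat (b t))]
  have EDβ (t : ℝ) (ht : t ∈ Icc 0 S) : ∫ τ in (0 : ℝ)..t, en (1 + β) (vhat (b τ)) ≤ D := by
    have := ED t ht
    have m1 : 0 ≤ 2 * nu α * ∫ τ in (0 : ℝ)..t, en (1 + α) (vhat (u τ)) :=
      mul_nonneg (by positivity) (nonneg_int u ht)
    linarith
  -- Without viscosity (`α = 0`) the order `1 + α` is 1 and the pointwise bound `Y` is integrated
  -- over time. With `α > 0` the viscous dissipation bounds the integral.
  have EF (t : ℝ) (ht : t ∈ Icc 0 S) : ∫ τ in (0 : ℝ)..t, en (1 + α) (vhat (u τ)) ≤ F := by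
    by_cases h : α = 0
    · have := intervalIntegral_const_le (f := fun τ ↦ en (1 + α) (vhat (u τ))) (Y := Y)
        cα.continuousOn.integrableOn_Icc hY0
        (fun τ hτ ↦ by
          have := EY τ hτ
          have := en_nonneg 1 (vhat (b τ))
          simp only [h, add_zero]
          linarith) ht hST
      linarith
    · have := ED t ht
      have hn1 : nu α = 1 := by simp [nu, h]
      rw [hn1] at this
      have m1 := nonneg_int (a := 1 + α) u ht
      have m2 := nonneg_int (a := 1 + β) b ht
      have : 0 ≤ T * Y := by positivity
      linarith
  have i0β : IntegrableOn (fun τ ↦ en 0 (vhat (b τ)) + en (1 + β) (vhat (b τ))) (Icc 0 S) :=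
    (c0b.continuousOn.integrableOn_Icc).add i1β
  -- The terms containing `en (1 + β)` of `b` integrate to a constant that goes into `A`. The
  -- unknown high energy is multiplied only by `en (1 + α)` of `u`, which is integrable by `EF`.
  have Ehigh (t : ℝ) (ht : t ∈ Icc 0 S) : en (α + β) (vhat (b t))
      + ∫ τ in (0 : ℝ)..t, en (α + β + β) (vhat (b τ))
      ≤ A + ∫ τ in (0 : ℝ)..t, L * en (1 + α) (vhat (u τ)) * (e₀ + en (α + β) (vhat (b τ))) := by
    refine (hL S u b hF t ht).trans ?_
    have m : ∫ τ in (0 : ℝ)..t, L * (en (1 + α) (vhat (u τ))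
            * (en 0 (vhat (b τ)) + en (α + β) (vhat (b τ)))
          + (en 0 (vhat (u τ)) + en 1 (vhat (u τ))) * (en 0 (vhat (b τ)) + en (1 + β) (vhat (b τ))))
        ≤ ∫ τ in (0 : ℝ)..t, (L * en (1 + α) (vhat (u τ)) * (e₀ + en (α + β) (vhat (b τ)))
          + L * ((e₀ + Y) * (en 0 (vhat (b τ)) + en (1 + β) (vhat (b τ))))) := by
      refine intervalIntegral_mono_Icc ?_ ?_ ?_ ht
      · refine Integrable.const_mul (Integrable.add ?_ ?_) L
        · exact (by fun_prop : Continuous fun τ ↦ en (1 + α) (vhat (u τ))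
            * (en 0 (vhat (b τ)) + en (α + β) (vhat (b τ)))).continuousOn.integrableOn_Icc
        · exact i0β.continuousOn_mul (c0.add c1).continuousOn isCompact_Icc
      · refine Integrable.add ?_ ((i0β.const_mul _).const_mul L)
        exact (by fun_prop : Continuous fun τ ↦ L * en (1 + α) (vhat (u τ))
          * (e₀ + en (α + β) (vhat (b τ)))).continuousOn.integrableOn_Icc
      · refine (ae_restrict_iff' measurableSet_Icc).2 (.of_forall fun τ hτ ↦ ?_)
        have p1 := E0 τ hτ
        have p2 := EY τ hτ
        have p3 := en_nonneg 0 (vhat (u τ))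
        have p4 := en_nonneg 0 (vhat (b τ))
        have p5 := en_nonneg 1 (vhat (b τ))
        have p6 := en_nonneg (1 + α) (vhat (u τ))
        have p7 := en_nonneg (1 + β) (vhat (b τ))
        rw [mul_assoc L, ← mul_add]
        gcongr
        · linarith
        · linarith
        · linarith
    have icont : IntervalIntegrable (fun τ ↦ L * en (1 + α) (vhat (u τ))
        * (e₀ + en (α + β) (vhat (b τ)))) volume 0 t :=
      Continuous.intervalIntegrable (by fun_prop) _ _
    rw [intervalIntegral.integral_add icont (intervalIntegrable_of_Icc
        ((i0β.const_mul (e₀ + Y)).const_mul L) ht)] at m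
    have m3 : ∫ τ in (0 : ℝ)..t, L * ((e₀ + Y) * (en 0 (vhat (b τ)) + en (1 + β) (vhat (b τ))))
        = L * ((e₀ + Y) * ((∫ τ in (0 : ℝ)..t, en 0 (vhat (b τ)))
          + ∫ τ in (0 : ℝ)..t, en (1 + β) (vhat (b τ)))) := by
      rw [intervalIntegral.integral_const_mul, intervalIntegral.integral_const_mul,
        intervalIntegral.integral_add (c0b.intervalIntegrable _ _) (intervalIntegrable_of_Icc i1β ht)]
    have m2 : L * ((e₀ + Y) * ((∫ τ in (0 : ℝ)..t, en 0 (vhat (b τ)))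
        + ∫ τ in (0 : ℝ)..t, en (1 + β) (vhat (b τ)))) ≤ L * ((e₀ + Y) * (T * e₀ + D)) := by
      gcongr
      exacts [E0b t ht, EDβ t ht]
    rw [h2]
    linarith
  have EW (t : ℝ) (ht : t ∈ Icc 0 S) : e₀ + en (α + β) (vhat (b t)) ≤ W := by
    have hg := gronwall_integral (y := fun t ↦ e₀ + en (α + β) (vhat (b t)))
      (a := fun t ↦ L * en (1 + α) (vhat (u t))) (by fun_prop) (by fun_prop)
      (fun t ↦ mul_nonneg hL0 (en_nonneg _ _)) (A := e₀ + A) (S := S) (fun t ht ↦ by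
        have := Ehigh t ht
        have := nonneg_int (a := α + β + β) b ht
        linarith) ht
    refine hg.trans ?_
    rw [intervalIntegral.integral_const_mul, hW]
    gcongr
    exact EF t ht
  intro t ht
  refine (Ehigh t ht).trans ?_
  have m : ∫ τ in (0 : ℝ)..t, L * en (1 + α) (vhat (u τ)) * (e₀ + en (α + β) (vhat (b τ)))
      ≤ ∫ τ in (0 : ℝ)..t, L * (W * en (1 + α) (vhat (u τ))) := by
    refine intervalIntegral.integral_mono_on ht.1
      (Continuous.intervalIntegrable (by fun_prop) _ _)
      (Continuous.intervalIntegrable (by fun_prop) _ _) fun τ hτ ↦ ?_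
    have hw := EW τ ⟨hτ.1, hτ.2.trans ht.2⟩
    have := en_nonneg (1 + α) (vhat (u τ))
    rw [mul_assoc, mul_comm W]
    gcongr
  have m3 : ∫ τ in (0 : ℝ)..t, L * (W * en (1 + α) (vhat (u τ)))
      = L * (W * ∫ τ in (0 : ℝ)..t, en (1 + α) (vhat (u τ))) := by
    rw [intervalIntegral.integral_const_mul, intervalIntegral.integral_const_mul]
  have m2 : L * (W * ∫ τ in (0 : ℝ)..t, en (1 + α) (vhat (u τ))) ≤ L * (W * F) := by
    gcongr; exact EF t ht
  linarith

end Flow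

/-! ### From solutions to flows, with time frozen outside `[0, S]`. -/

/-- The retraction of the time axis onto `[0, S]`. -/
def clampTime (S t : ℝ) : ℝ := max 0 (min S t)

lemma continuous_clampTime (S : ℝ) : Continuous (clampTime S) := by unfold clampTime; fun_prop

lemma clampTime_mem {S : ℝ} (hS : 0 ≤ S) (t : ℝ) : clampTime S t ∈ Icc 0 S :=
  ⟨le_max_left _ _, max_le hS (min_le_left _ _)⟩

lemma clampTime_eq {S t : ℝ} (ht : t ∈ Icc 0 S) : clampTime S t = t := by
  rw [clampTime, min_eq_right ht.2, max_eq_right ht.1]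

lemma CurlEq.congr {S : ℝ} {V V' : ℝ → Fin 2 → L2C} {G G' : ℝ → Fin 2 → Plane → ℂ}
    (h : CurlEq S V G) (hV : ∀ t ∈ Icc 0 S, V t = V' t) (hG : ∀ t ∈ Icc 0 S, G t = G' t) :
    CurlEq S V' G' := by
  intro φ t ht
  rw [← hV t ht, ← hV 0 ⟨le_rfl, ht.1.trans ht.2⟩, h φ t ht]
  congr 1
  refine intervalIntegral.integral_congr fun τ hτ ↦ ?_
  rw [uIcc_of_le ht.1] at hτ
  rw [hG τ ⟨hτ.1, hτ.2.trans ht.2⟩]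

lemma continuous_fourier_L2 : Continuous fun f : L2C ↦ (𝓕 f : L2C) :=
  (FourierTransform.fourierCLE ℂ L2C).continuous

lemma exists_cont_hat {k S : ℝ} (hS : 0 ≤ S) {f : ℝ → L2R} (h : ContSobolev k S f) :
    ∃ F : ℝ → L2C, Continuous F ∧
      (∀ t, F t =ᵐ[volume] fun ξ ↦ (jap k ξ : ℂ) * hat (f (clampTime S t)) ξ) ∧
      ∃ M : ℝ, ∀ t, ‖F t‖ ≤ M := by
  obtain ⟨F, hF, hFe⟩ := h
  have hc : Continuous fun t ↦ F (clampTime S t) :=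
    hF.comp_continuous (continuous_clampTime S) (clampTime_mem hS)
  refine ⟨fun t ↦ 𝓕 (F (clampTime S t)), continuous_fourier_L2.comp hc,
    fun t ↦ bessel_hat (hFe _ (clampTime_mem hS t)), ?_⟩
  obtain ⟨M, hM⟩ := isCompact_Icc.exists_bound_of_continuousOn
    (continuous_fourier_L2.comp_continuousOn hF)
  exact ⟨M, fun t ↦ hM _ (clampTime_mem hS t)⟩

lemma exists_sq_hat {s S : ℝ} {f : ℝ → L2R} (h : SqIntSobolev s S f) :
    ∃ F : ℝ → L2C, MemLp F 2 (volume.restrict (Icc 0 S)) ∧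
      ∀ᵐ t ∂(volume.restrict (Icc 0 S)), F t =ᵐ[volume] fun ξ ↦ (jap s ξ : ℂ) * hat (f t) ξ := by
  obtain ⟨F, hF, hFe⟩ := h
  refine ⟨fun t ↦ 𝓕 (F t),
    ((FourierTransform.fourierCLE ℂ L2C : L2C →L[ℂ] L2C)).comp_memLp' hF, ?_⟩
  filter_upwards [hFe] with t ht
  exact bessel_hat ht

/-- Because `2α ≤ k`, the viscous term lies in `L²` at every time of `[0, S]`, so `Lambda` never
takes its default value there. -/
lemma IsSolution.curlEq_u {α β k S : ℝ} (hα : 0 ≤ α) (hαk : 2 * α ≤ k) {u₀ b₀ : VectorField}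
    {u b : ℝ → VectorField} {p : ℝ → 𝓢'(Plane, ℂ)} (h : IsSolution α β k S u₀ b₀ u b p) :
    CurlEq S (fun t ↦ vhat (u t)) (fun t ↦ rhsU α (vhat (u t)) (vhat (b t))) := by
  refine curlEq_of_hasTimeDeriv (q := p) h.eq_u ?_
  refine (ae_restrict_iff' measurableSet_Icc).2 (.of_forall fun t ht i φ ↦ ?_)
  obtain ⟨F, -, hF⟩ := h.cont_u i
  exact rhsU_fourier i (p t) (lambdaMem_of_jap (by linarith) hαk (bessel_hat (hF t ht))) φ

/-- The order `2β` may exceed `k`, so the diffusion term is known to be in `L²` only at the almost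
every time when `b` lies in `H^(k+β)`; the default value of `Lambda` at other times does not affect
the time integral. There is no pressure, hence `q = 0`. -/
lemma IsSolution.curlEq_b {α β k S : ℝ} (hβ : 0 ≤ β) (hβk : β ≤ k) {u₀ b₀ : VectorField}
    {u b : ℝ → VectorField} {p : ℝ → 𝓢'(Plane, ℂ)} (h : IsSolution α β k S u₀ b₀ u b p) :
    CurlEq S (fun t ↦ vhat (b t)) (fun t ↦ rhsB β (vhat (u t)) (vhat (b t))) := by
  refine curlEq_of_hasTimeDeriv (q := fun _ ↦ 0) h.eq_b ?_
  choose F _ hF using h.sqInt_b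
  filter_upwards [hF 0, hF 1] with t h0 h1 i φ
  have hi : besselPotential Plane ℂ (k + β) (dist (b t i)) = (F i t : 𝓢'(Plane, ℂ)) := by
    fin_cases i; exacts [h0, h1]
  have := rhsB_fourier (u := u t) i (lambdaMem_of_jap (a := 2 * β) (by linarith) (by linarith)
    (bessel_hat hi)) φ
  exact ⟨this.1, by rw [this.2]; simp⟩

lemma IsSolution.flow {α β k S : ℝ} (hα : 0 ≤ α) (hαk : 2 * α ≤ k) (hβ : 0 ≤ β) (hβk : β ≤ k)
    (hS : 0 ≤ S) {u₀ b₀ : VectorField} {u b : ℝ → VectorField} {p : ℝ → 𝓢'(Plane, ℂ)}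
    (h : IsSolution α β k S u₀ b₀ u b p) :
    Flow α β k S (fun t ↦ u (clampTime S t)) (fun t ↦ b (clampTime S t)) := by
  choose F hF hFe M hM using fun i ↦ exists_cont_hat hS (h.cont_u i)
  choose F' hF' hFe' M' hM' using fun i ↦ exists_cont_hat hS (h.cont_b i)
  have hclamp : ∀ᵐ t ∂(volume.restrict (Icc 0 S)), clampTime S t = t := by
    filter_upwards [ae_restrict_mem measurableSet_Icc] with t ht using clampTime_eq ht
  refine ⟨fun i ↦ ⟨F i, hF i, hFe i⟩, fun i ↦ ⟨F' i, hF' i, hFe' i⟩, ?_, fun i ↦ ?_, fun i ↦ ?_,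
    fun t ↦ div_hat (h.div_u _ (clampTime_mem hS t)), fun t ↦ div_hat (h.div_b _ (clampTime_mem hS t)),
    ?_, ?_⟩
  · have hM0 (i : Fin 2) : 0 ≤ M i := (norm_nonneg _).trans (hM i 0)
    have hM0' (i : Fin 2) : 0 ≤ M' i := (norm_nonneg _).trans (hM' i 0)
    refine ⟨M 0 + M 1 + (M' 0 + M' 1), by linarith [hM0 0, hM0 1, hM0' 0, hM0' 1], fun t ↦ ⟨?_, ?_⟩⟩
    · refine (hn_le_norm (F := fun i ↦ F i t) fun i ↦ hFe i t).trans (ENNReal.ofReal_le_ofReal ?_)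
      linarith [hM 0 t, hM 1 t, hM0' 0, hM0' 1]
    · refine (hn_le_norm (F := fun i ↦ F' i t) fun i ↦ hFe' i t).trans (ENNReal.ofReal_le_ofReal ?_)
      linarith [hM' 0 t, hM' 1 t, hM0 0, hM0 1]
  · obtain ⟨P, hP, hPe⟩ := exists_sq_hat (h.sqInt_u i)
    refine ⟨P, hP, ?_⟩
    filter_upwards [hPe, hclamp] with t ht hc
    rw [hc]; exact ht
  · obtain ⟨P, hP, hPe⟩ := exists_sq_hat (h.sqInt_b i)
    refine ⟨P, hP, ?_⟩
    filter_upwards [hPe, hclamp] with t ht hc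
    rw [hc]; exact ht
  · exact (h.curlEq_u hα hαk).congr (fun t ht ↦ by rw [clampTime_eq ht])
      (fun t ht ↦ by rw [clampTime_eq ht])
  · exact (h.curlEq_b hβ hβk).congr (fun t ht ↦ by rw [clampTime_eq ht])
      (fun t ht ↦ by rw [clampTime_eq ht])

/-! ### The current and the final bound. -/

lemma memLp_curlHat {V : Fin 2 → L2C} (h : dn 1 V < ∞) :
    MemLp (fun ξ ↦ 2 * Real.pi * Complex.I * curlHat (fun i ↦ V i) ξ) 2 := by
  have h0 := measurable_L2 (V 0)
  have h1 := measurable_L2 (V 1)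
  have hm := measurable_mag V
  have hmeas : Measurable (curlHat fun i ↦ V i) := by unfold curlHat; fun_prop
  refine MemLp.const_mul (memLp_of_n2_le (F := fun ξ ↦ 2 * (ENNReal.ofReal (‖ξ‖ ^ (1 : ℝ)) * mag V ξ))
    hmeas.aestronglyMeasurable (.of_forall fun ξ ↦ ?_) ?_) _
  · refine (enorm_curlHat_le _ ξ).trans ?_
    rw [Real.rpow_one, ofReal_norm]
    calc _ ≤ ‖ξ‖ₑ * (mag V ξ + mag V ξ) := by gcongr <;> exact enorm_le_mag V _ ξ
      _ = _ := by ring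
  · rw [n2_const_mul _ (by fun_prop)]
    exact ENNReal.mul_lt_top (by simp) h

lemma coe_eq_curl {v : VectorField} {j : L2C}
    (hj : (𝓕 j : L2C) =ᵐ[volume] fun ξ ↦ 2 * Real.pi * Complex.I * curlHat (fun i ↦ vhat v i) ξ) :
    (j : 𝓢'(Plane, ℂ)) = curl v := by
  ext ψ
  obtain ⟨φ, rfl⟩ : ∃ φ : 𝓢(Plane, ℂ), ψ = 𝓕 φ := ⟨𝓕⁻ ψ, by simp⟩
  have h1 : (j : 𝓢'(Plane, ℂ)) (𝓕 φ)
      = 2 * Real.pi * Complex.I * ∫ ξ, φ ξ * curlHat (fun i ↦ vhat v i) ξ := by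
    rw [coe_fourier_apply, ← integral_const_mul]
    apply integral_congr_ae
    filter_upwards [hj] with ξ hξ
    rw [hξ]; ring
  have h2 (i l : Fin 2) : partialD i (dist (v l)) (𝓕 φ)
      = 2 * Real.pi * Complex.I * ∫ ξ, mulX i φ ξ * vhat v l ξ := by
    rw [partialD_fourier, dist_fourier, ← integral_const_mul]
    congr 1; ext ξ
    simp only [smul_apply, smul_eq_mul, vhat]
    ring
  have h3 : curl v (𝓕 φ) = - partialD 1 (dist (v 0)) (𝓕 φ) + partialD 0 (dist (v 1)) (𝓕 φ) := rfl
  rw [h1, h3, h2, h2, integral_curlHat (V := fun i ↦ (vhat v i : Plane → ℂ)) φ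
    (schwartz_mul_L2_integrable (mulX 1 φ) (vhat v 0))
    (schwartz_mul_L2_integrable (mulX 0 φ) (vhat v 1))]
  ring

/-- The homogeneous Sobolev norm of the current. -/
lemma lambda_current {s : ℝ} (hs : 0 ≤ s) {V : Fin 2 → L2C} (hdiv : IsDivFree V)
    (h : dn (1 + s) V < ∞) {j : L2C}
    (hj : (𝓕 j : L2C) =ᵐ[volume] fun ξ ↦ 2 * Real.pi * Complex.I * curlHat (fun i ↦ V i) ξ) :
    LambdaMem s j ∧ ‖Lambda s j‖ ^ 2 = (2 * Real.pi) ^ (2 * (1 + s)) * en (1 + s) V := by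
  have hpi := Real.pi_pos
  have hsq : (fun ξ ↦ ‖lambdaSymbol s j ξ‖ ^ 2) =ᵐ[volume]
      fun ξ ↦ (2 * Real.pi) ^ (2 * (1 + s)) * (‖ξ‖ ^ (2 * (1 + s)) * sq (fun i ↦ V i) ξ) := by
    filter_upwards [hj, hdiv] with ξ hξ hd
    have e1 : ‖(2 * Real.pi * Complex.I : ℂ)‖ = 2 * Real.pi := by
      simp [abs_of_pos hpi]
    have e2 : ((2 * Real.pi * ‖ξ‖) ^ s) ^ 2 * (2 * Real.pi * ‖ξ‖) ^ 2
        = (2 * Real.pi) ^ (2 * (1 + s)) * ‖ξ‖ ^ (2 * (1 + s)) := by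
      rw [← Real.mul_rpow (by positivity) (norm_nonneg _), ← mul_pow, mul_comm 2 (1 + s),
        Real.rpow_mul (by positivity), Real.rpow_two,
        Real.rpow_add_of_nonneg (by positivity) zero_le_one hs, Real.rpow_one]
      ring
    rw [lambdaSymbol, hξ, norm_mul, norm_mul, e1, Complex.norm_real, Real.norm_eq_abs,
      abs_of_nonneg (by positivity), mul_pow, mul_pow, norm_curlHat_sq hd]
    linear_combination (sq (fun i ↦ V i) ξ) * e2
  have hmeas : AEStronglyMeasurable (lambdaSymbol s j) volume := by
    have h1 := measurable_L2 (𝓕 j : L2C)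
    unfold lambdaSymbol
    exact (by fun_prop : Measurable _).aestronglyMeasurable
  have hmem : LambdaMem s j := by
    rw [LambdaMem, memLp_two_iff_integrable_sq_norm hmeas]
    exact ((integrable_en h).const_mul _).congr hsq.symm
  refine ⟨hmem, ?_⟩
  rw [Lambda, dif_pos hmem, ← invF_apply, norm_invF, norm_sq_eq_integral]
  have : (fun ξ ↦ ‖(hmem.toLp (lambdaSymbol s j) : L2C) ξ‖ ^ 2) =ᵐ[volume]
      fun ξ ↦ (2 * Real.pi) ^ (2 * (1 + s)) * (‖ξ‖ ^ (2 * (1 + s)) * sq (fun i ↦ V i) ξ) := by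
    filter_upwards [hmem.coeFn_toLp, hsq] with ξ h1 h2
    rw [h1, h2]
  rw [integral_congr_ae this, integral_const_mul, en]

end

end GMHD

theorem lemma2 (α β r k : ℝ) (hα0 : 0 ≤ α) (hα : α < 1 / 2) (hβ : 1 ≤ β)
    (hr : r = α + β - 1) (hr0 : 0 < r) (hk : α + β ≤ k)
    (u₀ b₀ : GMHD.VectorField)
    (hu₀ : ∀ i, TemperedDistribution.MemSobolev k 2 (GMHD.dist (u₀ i)))
    (hb₀ : ∀ i, TemperedDistribution.MemSobolev k 2 (GMHD.dist (b₀ i)))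
    (hdivu₀ : GMHD.divergence u₀ = 0) (hdivb₀ : GMHD.divergence b₀ = 0)
    (T : ℝ) (hT : 0 < T) :
    ∃ C : ℝ, ∀ S : ℝ, 0 < S → S ≤ T →
      ∀ (u b : ℝ → GMHD.VectorField) (p : ℝ → 𝓢'(GMHD.Plane, ℂ)),
        GMHD.IsSolution α β k S u₀ b₀ u b p →
        ∃ j : ℝ → GMHD.L2C,
          (∀ t ∈ Set.Icc 0 S, (j t : 𝓢'(GMHD.Plane, ℂ)) = GMHD.curl (b t)) ∧
          (∀ t ∈ Set.Icc 0 S, GMHD.LambdaMem r (j t)) ∧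
          (∀ᵐ t ∂(MeasureTheory.volume.restrict (Set.Icc 0 S)), GMHD.LambdaMem (β + r) (j t)) ∧
          MeasureTheory.IntegrableOn (fun τ ↦ ‖GMHD.Lambda (β + r) (j τ)‖ ^ 2) (Set.Icc 0 S) ∧
          ∀ t ∈ Set.Icc 0 S,
            ‖GMHD.Lambda r (j t)‖ ^ 2
              + ∫ τ in (0 : ℝ)..t, ‖GMHD.Lambda (β + r) (j τ)‖ ^ 2 ≤ C := by
  open GMHD in
  have hk1 : 1 < k := by linarith
  obtain ⟨C, hC⟩ := Flow.exists_bound hα0 hα hβ (by linarith) hk hT.le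
    (add_nonneg (en_nonneg 0 (vhat u₀)) (en_nonneg 0 (vhat b₀)))
    (add_nonneg (en_nonneg 1 (vhat u₀)) (en_nonneg 1 (vhat b₀))) (en_nonneg (α + β) (vhat b₀))
  -- The two terms of the estimate carry the factors `(2π)^(2(α+β))` and `(2π)^(2(α+2β))`; the
  -- larger one serves for both.
  refine ⟨(2 * Real.pi) ^ (2 * (α + β + β)) * C, fun S hS hST u b p hsol ↦ ?_⟩
  have hF := hsol.flow hα0 (by linarith) (by linarith) (by linarith) hS.le
  have hz : clampTime S 0 = 0 := clampTime_eq ⟨le_rfl, hS.le⟩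
  have hbound := hC S _ _ hST hF (by simp only [hz, hsol.init_u, hsol.init_b])
    (by simp only [hz, hsol.init_u, hsol.init_b]) (by simp only [hz, hsol.init_b])
  set b' : ℝ → VectorField := fun t ↦ b (clampTime S t) with hb'
  obtain ⟨M, -, hM⟩ := hF.bdd
  obtain ⟨N, -, -, -, hN⟩ := exists_hn_bound hF.sqB
  have dB (s t : ℝ) (h0 : 0 ≤ s) (h1 : s ≤ k) : dn s (vhat (b' t)) < ∞ :=
    (dn_le_hn h0 h1 _).trans_lt ((hM t).2.trans_lt ENNReal.ofReal_lt_top)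
  have hmem (t : ℝ) := memLp_curlHat (dB 1 t zero_le_one (by linarith))
  set j : ℝ → L2C := fun t ↦ invF ((hmem t).toLp _) with hj
  have hjF (t : ℝ) : (𝓕 (j t) : L2C) =ᵐ[volume]
      fun ξ ↦ 2 * Real.pi * Complex.I * curlHat (fun i ↦ vhat (b' t) i) ξ := by
    rw [hj]
    simp only [fourier_invF]
    exact (hmem t).coeFn_toLp
  -- The curl raises the order by one: `Λ^r j` corresponds to order `α + β` of `b`, and `Λ^(β+r) j`
  -- to order `α + 2β`.
  have e1 : 1 + r = α + β := by linarith
  have e2 : 1 + (β + r) = α + β + β := by linarith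
  have low (t : ℝ) := lambda_current (s := r) hr0.le (hF.divB t)
    (dB _ t (by linarith) (by linarith)) (hjF t)
  have high : ∀ᵐ t ∂(volume.restrict (Icc 0 S)), LambdaMem (β + r) (j t) ∧
      ‖Lambda (β + r) (j t)‖ ^ 2 = (2 * Real.pi) ^ (2 * (α + β + β)) * en (α + β + β) (vhat (b' t)) := by
    filter_upwards [hN] with t ht
    have := lambda_current (s := β + r) (by linarith) (hF.divB t)
      ((dn_le_hn (by linarith) (by linarith) _).trans_lt (ht.trans_lt ENNReal.ofReal_lt_top)) (hjF t)
    rwa [e2] at this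
  have hI := integrableOn_en (a := α + β + β) (by linarith) (by linarith : α + β + β ≤ k + β) hF.sqB
  have hII : IntegrableOn (fun τ ↦ ‖Lambda (β + r) (j τ)‖ ^ 2) (Icc 0 S) := by
    refine (hI.const_mul ((2 * Real.pi) ^ (2 * (α + β + β)))).congr ?_
    filter_upwards [high] with t ht using ht.2.symm
  refine ⟨j, fun t ht ↦ ?_, fun t _ ↦ (low t).1, high.mono fun t ht ↦ ht.1, hII, fun t ht ↦ ?_⟩
  · rw [coe_eq_curl (hjF t)]
    simp only [hb', clampTime_eq ht]
  · have hle : ∫ τ in (0 : ℝ)..t, ‖Lambda (β + r) (j τ)‖ ^ 2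
        ≤ ∫ τ in (0 : ℝ)..t, (2 * Real.pi) ^ (2 * (α + β + β)) * en (α + β + β) (vhat (b' τ)) :=
      intervalIntegral_mono_Icc hII (hI.const_mul _) (high.mono fun τ hτ ↦ hτ.2.le) ht
    have hp : (2 * Real.pi) ^ (2 * (α + β)) ≤ (2 * Real.pi) ^ (2 * (α + β + β)) :=
      Real.rpow_le_rpow_of_exponent_le (by linarith [Real.pi_gt_three]) (by linarith)
    rw [intervalIntegral.integral_const_mul] at hle
    rw [(low t).2, e1]
    have h1 := mul_le_mul_of_nonneg_right hp (en_nonneg (α + β) (vhat (b' t)))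
    have h2 := mul_le_mul_of_nonneg_left (hbound t ht)
      (by positivity : 0 ≤ (2 * Real.pi) ^ (2 * (α + β + β)))
    linarith
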